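/- Manifolds are finite-dimensional smooth manifolds (of pure dimension, not necessarily Hausdorff), and stacks are stacks over the category of manifolds with the topology of open coverings. An étale atlas of a stack $\mathcal G$ is a representable surjective submersion $X\to\mathcal G$ from a Hausdorff manifold $X$ which is étale. Let $M$ be a Hausdorff second countable manifold. A Weinstein groupoid $\mathcal G\rightrightarrows M$ consists of a stack $\mathcal G$ that admits an étale atlas, surjective submersions $\bar s,\bar t:\mathcal G\to M$, a multiplication $\bar m:\mathcal G\times_{\bar s,\bar t}\mathcal G\to\mathcal G$ with $\bar t\circ\bar m=\bar t\circ pr_1$ and $\bar s\circ\bar m=\bar s\circ pr_2$, an injective immersion $\bar e:M\to\mathcal G$ with $\bar s\bar e=\bar t\bar e=\mathrm{id}$, and an isomorphism $\bar i:\mathcal G\to\mathcal G$ with $\bar s\bar i=\bar t$, $\bar t\bar i=\bar s$, together with 2-isomorphisms expressing the associativity, unit and inverse laws, which restrict to the identity 2-morphisms on the identity section (after identifying $\bar m(\bar e,\bar e)$ and $\bar i\bar e$ with $\bar e$). A local Lie groupoid $N$ over $B$ is a manifold $N$ with source and target submersions $s,t:N\to B$, identity section $e:B\to N$ and inverse $i:N\to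 N$, satisfying the axioms of a Lie groupoid, except that the multiplication is defined (and smooth) only as a map $V\times_B V\to N$ for an open neighbourhood $V=i(V)$ of $e(B)$, associativity being required where both sides are products of elements of $V$. Its Lie algebroid is $e^*\ker Ts$ with anchor $Tt$ and the bracket of right invariant vector fields. If $B\subseteq M$ is open, we say that a local Lie groupoid $N$ over $B$ with a morphism of stacks $j:N\to\mathcal G$ presents $\mathcal G$ over $B$ if $j$ intertwines the structure maps of $N$ with those of $\mathcal G$, up to 2-isomorphisms (for $\bar s$ and $\bar t$: strictly) which restrict to the canonical ones on the identity section. A local isomorphism between two local Lie groupoids presenting $\mathcal G$ over $B$ and $B'$ is a diffeomorphism between open subsets of them, which contain the identities over $B\cap B'$, compatible with all structure maps and, up to a 2-isomorphism which is the canonical one on the identities, with the morphisms to $\mathcal G$. A local Lie groupoid associated with $\mathcal G$ is a local Lie groupoid $N$ over $M$ with an étale morphism $j:N\to\mathcal G$ that presents $\mathcal G$ over $M$. A gluing system for $\mathcal G$ in an étale atlas $X\to\mathcal G$ consists of an open covering $\{M_l\}$ of $M$, local Lie groupoids $U_l$ over $M_l$ whose spaces of arrows are open subsets of $X$ and which,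 with the restriction of $X\to\mathcal G$, present $\mathcal G$ over $M_l$, and local isomorphisms $\tilde\varphi_{lk}$ from $U_k$ to $U_l$ which satisfy the cocycle conditions. A Lie algebroid of $\mathcal G$ is a Lie algebroid over $M$ glued from the Lie algebroids of the $U_l$ by means of the maps $T\tilde\varphi_{lk}$, for some étale atlas and some gluing system in it. Theorem. Let $\mathcal G$ be a Weinstein groupoid over $M$. 1. In every étale atlas of $\mathcal G$ there is a gluing system $(\{M_l\},\{U_l\},\{\tilde\varphi_{lk}\})$ for $\mathcal G$ which glues to a local Lie groupoid $G_{loc}$ associated with $\mathcal G$: there are local isomorphisms $\psi_l$ from $U_l$ to $G_{loc}$, defined on all of $U_l$, whose images cover $G_{loc}$ and such that $\psi_k(g)=\psi_l(h)$ if and only if $\tilde\varphi_{lk}$ is defined at $g$ and $\tilde\varphi_{lk}(g)=h$. Moreover $G_{loc}$ is Hausdorff and second countable. 2. The associated local Lie groupoid is canonical up to isomorphism near the identity section: between any two local Lie groupoids associated with $\mathcal G$ there is a local isomorphism, defined near the whole identity section, and any two such local isomorphisms agree on a neighbourhood of the identity section. 3. $\mathcal G$ has a Lie algebroid, it is unique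 up to isomorphism, and every local Lie groupoid associated with $\mathcal G$ has the same Lie algebroid as $\mathcal G$. -/

import Mathlib

open CategoryTheory TopologicalSpace
open scoped Manifold ContDiff Bundle

universe v₁ v₂ v₃ v₄ u₁ u₂ u₃ u₄ v u

set_option linter.checkUnivs false

noncomputable section

/-! ## The category of manifolds -/

/-- A finite dimensional smooth manifold. Neither the Hausdorff property nor second countability is
part of the definition: they are stated where they are wanted. -/
structure Mfd where
  carrier : Type
  dim : ℕ
  [top : TopologicalSpace carrier]
  [charted : ChartedSpace (EuclideanSpace ℝ (Fin dim)) carrier]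
  [isManifold : IsManifold (𝓡 dim) ∞ carrier]

namespace Mfd

instance : CoeSort Mfd Type := ⟨Mfd.carrier⟩

attribute [instance] Mfd.top Mfd.charted Mfd.isManifold

/-- The model with corners of a manifold (no boundary, no corners). -/
abbrev I (S : Mfd) : ModelWithCorners ℝ (EuclideanSpace ℝ (Fin S.dim))
    (EuclideanSpace ℝ (Fin S.dim)) := 𝓡 S.dim

/-- Morphisms of manifolds are smooth maps. -/
instance : Category Mfd where
  Hom S T := C^∞⟮S.I, S; T.I, T⟯
  id _ := ContMDiffMap.id
  comp f g := ContMDiffMap.comp g f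

instance : ConcreteCategory Mfd (fun S T => C^∞⟮S.I, S; T.I, T⟯) where
  hom f := f
  ofHom f := f

/-- The morphism given by a smooth function. -/
def mk' {S T : Mfd} (f : S → T) (hf : ContMDiff S.I T.I ∞ f) : S ⟶ T :=
  (⟨f, hf⟩ : C^∞⟮S.I, S; T.I, T⟯)

theorem smooth {S T : Mfd} (f : S ⟶ T) : ContMDiff S.I T.I ∞ f :=
  ContMDiffMap.contMDiff (I := S.I) (I' := T.I) (n := ∞) f

@[ext]
theorem hom_ext {S T : Mfd} {f g : S ⟶ T} (h : ∀ x, f x = g x) : f = g :=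
  ContMDiffMap.ext h

@[simp] theorem mk'_apply {S T : Mfd} (f : S → T) (hf : ContMDiff S.I T.I ∞ f) (x : S) :
    mk' f hf x = f x := rfl

/-- An open subset of a manifold, as a manifold. -/
def opn (S : Mfd) (U : Opens S) : Mfd where
  carrier := U
  dim := S.dim

/-- The inclusion of an open subset. -/
def incl (S : Mfd) (U : Opens S) : S.opn U ⟶ S :=
  mk' (S := S.opn U) (fun x : U => (x : S)) (contMDiff_subtype_val (I := S.I))

/-- The inclusion of a smaller open subset into a larger one. -/
def inclLE (S : Mfd) {U V : Opens S} (h : U ≤ V) : S.opn U ⟶ S.opn V :=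
  mk' (S := S.opn U) (T := S.opn V) (Set.inclusion h) (contMDiff_inclusion (I := S.I) h)

/-- `f` is a submersion of manifolds. -/
def IsSubm {S T : Mfd} (f : S ⟶ T) : Prop :=
  ∀ x : S, Function.Surjective (mfderiv S.I T.I f x)

/-- `f` is an immersion of manifolds. -/
def IsImm {S T : Mfd} (f : S ⟶ T) : Prop :=
  ∀ x : S, Function.Injective (mfderiv S.I T.I f x)

/-- `f` is an étale map of manifolds, i.e. a local diffeomorphism. -/
def IsEt {S T : Mfd} (f : S ⟶ T) : Prop :=
  IsLocalDiffeomorph S.I T.I ∞ f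

end Mfd

/-! ## Stacks over the category of manifolds -/

namespace Stk

open BasedFunctor

/-- The stack represented by a manifold `M`: objects over `S` are smooth maps `S ⟶ M`. -/
def rep (M : Mfd) : BasedCategory.{0, 1} Mfd where
  obj := Over M
  p := Over.forget M

/-- The object of `rep M` given by a smooth map. -/
def pt {S M : Mfd} (a : S ⟶ M) : (rep M).obj := Over.mk a

/-- The arrow of `rep M` given by a smooth map over `M`. -/
def ptHom {S T M : Mfd} {a : S ⟶ M} {b : T ⟶ M} (f : S ⟶ T) (h : f ≫ b = a) :
    pt a ⟶ pt b := Over.homMk (U := Over.mk a) (V := Over.mk b) f h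

theorem rep_hom_ext {M : Mfd} {x y : (rep M).obj} {R S : Mfd} (f : R ⟶ S) (a b : x ⟶ y)
    [ha : (rep M).p.IsHomLift f a] [hb : (rep M).p.IsHomLift f b] : a = b := by
  have h1 := IsHomLift.fac' (rep M).p f a
  have h2 := IsHomLift.fac' (rep M).p f b
  exact Over.OverMorphism.ext (U := x) (V := y) (h1.trans h2.symm)

/-- The morphism of stacks given by a smooth map. -/
def uMap {A B : Mfd} (f : A ⟶ B) : rep A ⥤ᵇ rep B where
  toFunctor := Over.map f

section

variable {𝒲 : BasedCategory.{v₁, u₁} Mfd} {M : Mfd}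

/-- A morphism from `𝒲` to a manifold `M` attaches to every object `w` over `S` a smooth
map `S ⟶ M`. -/
def toMap (F : 𝒲 ⥤ᵇ rep M) (w : 𝒲.obj) : 𝒲.p.obj w ⟶ M :=
  eqToHom (F.w_obj w).symm ≫ Over.hom (F.obj w)

/-- Equality of two morphisms from a stack to a manifold. -/
def SameMap (F G : 𝒲 ⥤ᵇ rep M) : Prop := ∀ w, toMap F w = toMap G w

theorem toMap_eq {F G : 𝒲 ⥤ᵇ rep M} (h : SameMap F G) (w : 𝒲.obj) :
    eqToHom ((F.w_obj w).trans (G.w_obj w).symm) ≫ Over.hom (G.obj w) = Over.hom (F.obj w) := by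
  have h' : eqToHom (F.w_obj w).symm ≫ Over.hom (F.obj w) =
      eqToHom (G.w_obj w).symm ≫ Over.hom (G.obj w) := h w
  refine (cancel_epi (eqToHom (F.w_obj w).symm)).1 ?_
  refine Eq.trans ?_ h'.symm
  exact (Category.assoc _ _ _).symm.trans (congrArg (· ≫ Over.hom (G.obj w)) (eqToHom_trans _ _))

/-- Two equal morphisms to a manifold are related by a (unique) 2-isomorphism. -/
def SameMap.app {F G : 𝒲 ⥤ᵇ rep M} (h : SameMap F G) (w : 𝒲.obj) : F.obj w ⟶ G.obj w :=
  Over.homMk (U := F.obj w) (V := G.obj w) (eqToHom ((F.w_obj w).trans (G.w_obj w).symm))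
    (toMap_eq h w)

instance SameMap.isHomLift_app {F G : 𝒲 ⥤ᵇ rep M} (h : SameMap F G) (w : 𝒲.obj) :
    (rep M).p.IsHomLift (𝟙 (𝒲.p.obj w)) (h.app w) := by
  refine IsHomLift.of_fac' _ _ _ (F.w_obj w) (G.w_obj w) ?_
  refine Eq.trans (b := eqToHom ((F.w_obj w).trans (G.w_obj w).symm)) rfl ?_
  rw [Category.id_comp, eqToHom_trans]

/-- The 2-isomorphism between two equal morphisms to a manifold. -/
def SameMap.hom {F G : 𝒲 ⥤ᵇ rep M} (h : SameMap F G) : F ⟶ G where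
  app w := h.app w
  naturality w w' f := by
    have h1 : (rep M).p.IsHomLift (𝒲.p.map f) (F.map f) := inferInstance
    have h2 : (rep M).p.IsHomLift (𝒲.p.map f) (G.map f) := inferInstance
    exact rep_hom_ext (𝒲.p.map f) (F.map f ≫ h.app w') (h.app w ≫ G.map f)
  isHomLift' w := inferInstance

end

section

variable {𝒳 : BasedCategory.{v₁, u₁} Mfd} {𝒴 : BasedCategory.{v₂, u₂} Mfd}
  {𝒵 : BasedCategory.{v₃, u₃} Mfd} {𝒲 : BasedCategory.{v₄, u₄} Mfd}

/-- Objects of the fibre product over `S`: triples `(x, η, y)` with `x` and `y` over `S` and `η` an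
arrow over `𝟙 S` from the image of `x` to the image of `y`. -/
structure FPObj (F : 𝒳 ⥤ᵇ 𝒵) (G : 𝒴 ⥤ᵇ 𝒵) where
  fst : 𝒳.obj
  snd : 𝒴.obj
  η : F.obj fst ⟶ G.obj snd
  lift : 𝒵.p.IsHomLift (𝟙 (𝒳.p.obj fst)) η

theorem FPObj.base {F : 𝒳 ⥤ᵇ 𝒵} {G : 𝒴 ⥤ᵇ 𝒵} (w : FPObj F G) :
    𝒴.p.obj w.snd = 𝒳.p.obj w.fst := by
  have := w.lift
  exact (G.w_obj w.snd).symm.trans (IsHomLift.codomain_eq 𝒵.p (𝟙 (𝒳.p.obj w.fst)) w.η)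

/-- Arrows of the fibre product: compatible pairs of arrows over the same smooth map. -/
@[ext]
structure FPHom {F : 𝒳 ⥤ᵇ 𝒵} {G : 𝒴 ⥤ᵇ 𝒵} (w w' : FPObj F G) where
  fst : w.fst ⟶ w'.fst
  snd : w.snd ⟶ w'.snd
  lift : 𝒴.p.IsHomLift (𝒳.p.map fst) snd
  comm : w.η ≫ G.map snd = F.map fst ≫ w'.η

instance (F : 𝒳 ⥤ᵇ 𝒵) (G : 𝒴 ⥤ᵇ 𝒵) : Category (FPObj F G) where
  Hom := FPHom
  id w := ⟨𝟙 _, 𝟙 _, by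
    rw [𝒳.p.map_id]; exact IsHomLift.id w.base, by simp⟩
  comp f g := ⟨f.fst ≫ g.fst, f.snd ≫ g.snd, by
    have := f.lift
    have := g.lift
    rw [𝒳.p.map_comp]; infer_instance, by
    rw [G.map_comp, F.map_comp, Category.assoc, ← g.comm, ← Category.assoc, f.comm,
      Category.assoc]⟩
  id_comp f := by apply FPHom.ext <;> simp
  comp_id f := by apply FPHom.ext <;> simp
  assoc f g h := by apply FPHom.ext <;> simp

/-- The fibre product of two morphisms of stacks. -/
abbrev fibreProd (F : 𝒳 ⥤ᵇ 𝒵) (G : 𝒴 ⥤ᵇ 𝒵) :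
    BasedCategory.{max v₁ v₂, max u₁ u₂ v₃} Mfd where
  obj := FPObj F G
  p :=
    { obj := fun w => 𝒳.p.obj w.fst
      map := fun {w w'} (f : FPHom w w') => 𝒳.p.map f.fst
      map_id := fun w => 𝒳.p.map_id w.fst
      map_comp := fun {w w' w''} (f : FPHom w w') (g : FPHom w' w'') => 𝒳.p.map_comp f.fst g.fst }

/-- The first projection. -/
def fpFst (F : 𝒳 ⥤ᵇ 𝒵) (G : 𝒴 ⥤ᵇ 𝒵) : fibreProd F G ⥤ᵇ 𝒳 where
  obj w := w.fst
  map {w w'} (f : FPHom w w') := f.fst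
  map_id _ := rfl
  map_comp _ _ := rfl
  w := rfl

/-- The second projection. -/
def fpSnd (F : 𝒳 ⥤ᵇ 𝒵) (G : 𝒴 ⥤ᵇ 𝒵) : fibreProd F G ⥤ᵇ 𝒴 where
  obj w := w.snd
  map {w w'} (f : FPHom w w') := f.snd
  map_id _ := rfl
  map_comp _ _ := rfl
  w := by
    refine CategoryTheory.Functor.ext (fun w => w.base) (fun w w' f => ?_)
    have := f.lift
    exact IsHomLift.fac' 𝒴.p (𝒳.p.map f.fst) f.snd

/-- The morphism into a fibre product given by two morphisms and a 2-morphism. -/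
def fpLift {F : 𝒳 ⥤ᵇ 𝒵} {G : 𝒴 ⥤ᵇ 𝒵} (A : 𝒲 ⥤ᵇ 𝒳) (B : 𝒲 ⥤ᵇ 𝒴) (η : A ⋙ F ⟶ B ⋙ G) :
    𝒲 ⥤ᵇ fibreProd F G where
  obj w := ⟨A.obj w, B.obj w, η.app w, η.isHomLift (A.w_obj w).symm⟩
  map {w w'} f := ⟨A.map f, B.map f, by
    have h : 𝒲.p.IsHomLift (𝒲.p.map f) f := inferInstance
    have hB : 𝒴.p.IsHomLift (𝒲.p.map f) (B.map f) := inferInstance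
    have hA := CategoryTheory.Functor.congr_hom A.w f
    simp only [CategoryTheory.Functor.comp_map] at hA
    rw [hA]
    infer_instance, (η.naturality f).symm⟩
  map_id w := by apply FPHom.ext <;> exact CategoryTheory.Functor.map_id _ _
  map_comp f g := by apply FPHom.ext <;> exact CategoryTheory.Functor.map_comp _ _ _
  w := A.w

/-- An arrow in a fibre product over a manifold `M` is just a pair of arrows over the same
smooth map. -/
def fpHom {M : Mfd} {F : 𝒳 ⥤ᵇ rep M} {G : 𝒴 ⥤ᵇ rep M} {w w' : (fibreProd F G).obj}
    {R S : Mfd} (f : R ⟶ S) (a : w.fst ⟶ w'.fst) (b : w.snd ⟶ w'.snd)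
    (ha : 𝒳.p.IsHomLift f a) (hb : 𝒴.p.IsHomLift f b) :
    w ⟶ w' :=
  ⟨a, b, by
    have e := IsHomLift.fac' 𝒳.p f a
    rw [e]; infer_instance, by
    have h1 := w.lift
    have h2 := w'.lift
    have eR : 𝒳.p.obj w.fst = R := IsHomLift.domain_eq 𝒳.p f a
    have eS : 𝒳.p.obj w'.fst = S := IsHomLift.codomain_eq 𝒳.p f a
    subst eR eS
    have h3 : (rep M).p.IsHomLift f (G.map b) := inferInstance
    have h4 : (rep M).p.IsHomLift f (F.map a) := inferInstance
    have h5 : (rep M).p.IsHomLift f (w.η ≫ G.map b) :=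
      IsHomLift.comp_lift_id_left' _ (𝒳.p.obj w.fst) w.η f (G.map b)
    have h6 : (rep M).p.IsHomLift f (F.map a ≫ w'.η) :=
      IsHomLift.comp_lift_id_right' _ f (F.map a) (𝒳.p.obj w'.fst) w'.η
    exact rep_hom_ext f _ _⟩

end

section

variable {𝒳 : BasedCategory.{v₁, u₁} Mfd} {𝒴 : BasedCategory.{v₂, u₂} Mfd}
  {𝒲 : BasedCategory.{v₄, u₄} Mfd} {M : Mfd}

theorem SameMap.symm {F G : 𝒲 ⥤ᵇ rep M} (h : SameMap F G) : SameMap G F := fun w => (h w).symm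

theorem SameMap.trans {F G H : 𝒲 ⥤ᵇ rep M} (h : SameMap F G) (h' : SameMap G H) : SameMap F H :=
  fun w => (h w).trans (h' w)

theorem toMap_comp (A : 𝒳 ⥤ᵇ 𝒲) (F : 𝒲 ⥤ᵇ rep M) (x : 𝒳.obj) :
    toMap (A ⋙ F) x = eqToHom (A.w_obj x).symm ≫ toMap F (A.obj x) :=
  (congrArg (· ≫ Over.hom (F.obj (A.obj x)))
    (eqToHom_trans (A.w_obj x).symm (F.w_obj (A.obj x)).symm)).symm.trans (Category.assoc _ _ _)

theorem SameMap.precomp (A : 𝒳 ⥤ᵇ 𝒲) {F G : 𝒲 ⥤ᵇ rep M} (h : SameMap F G) :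
    SameMap (A ⋙ F) (A ⋙ G) := fun x => by
  rw [toMap_comp, toMap_comp, h]

theorem fpSame (F : 𝒳 ⥤ᵇ rep M) (G : 𝒴 ⥤ᵇ rep M) :
    SameMap (fpFst F G ⋙ F) (fpSnd F G ⋙ G) := fun w => by
  have := w.lift
  have h1 : 𝒳.p.obj w.fst = 𝒳.p.obj w.fst := rfl
  have h2 := IsHomLift.fac' (rep M).p (𝟙 (𝒳.p.obj w.fst)) w.η
  have h3 : (rep M).p.map w.η ≫ Over.hom (G.obj w.snd) = Over.hom (F.obj w.fst) :=
    Over.w (X := M) (f := F.obj w.fst) (g := G.obj w.snd) w.η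
  rw [h2] at h3
  change eqToHom _ ≫ Over.hom (F.obj w.fst) = eqToHom _ ≫ Over.hom (G.obj w.snd)
  rw [← h3]
  simp only [Category.id_comp, eqToHom_trans]
  exact (Category.assoc _ _ _).symm.trans
    (congrArg (· ≫ Over.hom (G.obj w.snd)) (eqToHom_trans _ _))

end

/-- `𝒳` is fibred in groupoids over the category of manifolds. -/
structure IsFibredInGroupoids (𝒳 : BasedCategory.{v₁, u₁} Mfd) : Prop where
  pullback : ∀ {V : Mfd} (x : 𝒳.obj) (f : V ⟶ 𝒳.p.obj x), ∃ (y : 𝒳.obj) (φ : y ⟶ x),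
    𝒳.p.IsHomLift f φ
  lift : ∀ {x y z : 𝒳.obj} (φ : z ⟶ x) (ψ : y ⟶ x) (g : 𝒳.p.obj z ⟶ 𝒳.p.obj y),
    g ≫ 𝒳.p.map ψ = 𝒳.p.map φ → ∃! χ : z ⟶ y, 𝒳.p.map χ = g ∧ χ ≫ ψ = φ

/-- `𝒳` is a stack for the topology of open coverings. Restrictions are not chosen: an object
together with an arrow over an inclusion of open sets is a restriction. -/
structure IsStack (𝒳 : BasedCategory.{v₁, u₁} Mfd) : Prop where
  fibred : IsFibredInGroupoids 𝒳
  /-- Arrows `x ⟶ y` over `𝟙 S` form a sheaf: arrows `b i : x|U i ⟶ y` that agree on overlaps come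
  from a unique arrow. -/
  isom_sheaf : ∀ (S : Mfd) (ι : Type) (U : ι → Opens S), (∀ s, ∃ i, s ∈ U i) →
    ∀ (x y : 𝒳.obj), 𝒳.p.obj x = S → 𝒳.p.obj y = S →
    ∀ (r : ι → 𝒳.obj) (a : ∀ i, r i ⟶ x) (b : ∀ i, r i ⟶ y),
      (∀ i, 𝒳.p.IsHomLift (S.incl (U i)) (a i)) → (∀ i, 𝒳.p.IsHomLift (S.incl (U i)) (b i)) →
      (∀ i j (z : 𝒳.obj) (c : z ⟶ r i) (d : z ⟶ r j), c ≫ a i = d ≫ a j → c ≫ b i = d ≫ b j) →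
      ∃! β : x ⟶ y, 𝒳.p.IsHomLift (𝟙 S) β ∧ ∀ i, a i ≫ β = b i
  /-- Descent: the gluing isomorphism between `x i` and `x j` on `U i ⊓ U j` is given as an object
  `r i j` with arrows to `x i` and `x j`, i.e. as a common restriction of the two. -/
  descent : ∀ (S : Mfd) (ι : Type) (U : ι → Opens S), (∀ s, ∃ i, s ∈ U i) →
    ∀ (x : ι → 𝒳.obj), (∀ i, 𝒳.p.obj (x i) = S.opn (U i)) →
    ∀ (r : ι → ι → 𝒳.obj) (a : ∀ i j, r i j ⟶ x i) (b : ∀ i j, r i j ⟶ x j),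
      (∀ i j, 𝒳.p.IsHomLift (S.inclLE (inf_le_left : U i ⊓ U j ≤ U i)) (a i j)) →
      (∀ i j, 𝒳.p.IsHomLift (S.inclLE (inf_le_right : U i ⊓ U j ≤ U j)) (b i j)) →
      (∀ i j k (z : 𝒳.obj) (c : z ⟶ r i j) (d : z ⟶ r j k) (e : z ⟶ r i k),
        c ≫ a i j = e ≫ a i k → c ≫ b i j = d ≫ a j k → d ≫ b j k = e ≫ b i k) →
      ∃ (y : 𝒳.obj) (ψ : ∀ i, x i ⟶ y), (∀ i, 𝒳.p.IsHomLift (S.incl (U i)) (ψ i)) ∧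
        ∀ i j, a i j ≫ ψ i = b i j ≫ ψ j

section

variable {𝒳 : BasedCategory.{v₁, u₁} Mfd} {𝒴 : BasedCategory.{v₂, u₂} Mfd}

/-- The smooth map underlying a morphism between two representable stacks. -/
def mapOf {P S : Mfd} (G : rep P ⥤ᵇ rep S) : P ⟶ S := toMap G (pt (𝟙 P))

/-- The fibre product `𝒳 ×_𝒴 S` is (isomorphic to) a manifold `P`, and the projection `P ⟶ S` has
the property `Q`. -/
def ReprWith (Q : ∀ {P S : Mfd}, (P ⟶ S) → Prop) (F : 𝒳 ⥤ᵇ 𝒴) {S : Mfd} (y : rep S ⥤ᵇ 𝒴) :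
    Prop :=
  ∃ (P : Mfd) (E : rep P ⥤ᵇ fibreProd F y), E.toFunctor.IsEquivalence ∧
    Q (mapOf (E ⋙ fpSnd F y))

/-- Representable submersions. -/
def IsReprSubmersion (F : 𝒳 ⥤ᵇ 𝒴) : Prop :=
  ∀ (S : Mfd) (y : rep S ⥤ᵇ 𝒴), ReprWith Mfd.IsSubm F y

/-- Epimorphisms: every object of `𝒴` lies locally in the image. -/
def IsEpim (F : 𝒳 ⥤ᵇ 𝒴) : Prop :=
  ∀ (S : Mfd) (y : 𝒴.obj), 𝒴.p.obj y = S → ∃ (ι : Type) (U : ι → Opens S),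
    (∀ s, ∃ i, s ∈ U i) ∧ ∀ i, ∃ (x : 𝒳.obj) (φ : F.obj x ⟶ y), 𝒴.p.IsHomLift (S.incl (U i)) φ

/-- An atlas of a stack: a representable surjective submersion from a Hausdorff manifold. -/
structure IsAtlas {X : Mfd} (q : rep X ⥤ᵇ 𝒳) : Prop where
  t2 : T2Space X
  subm : IsReprSubmersion q
  epi : IsEpim q

/-- Étale maps of stacks. -/
def IsEtale (F : 𝒳 ⥤ᵇ 𝒴) : Prop :=
  ∀ (S : Mfd) (y : rep S ⥤ᵇ 𝒴), IsReprSubmersion y → ReprWith Mfd.IsEt F y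

/-- Immersions of stacks. -/
def IsImmersion (F : 𝒳 ⥤ᵇ 𝒴) : Prop :=
  ∀ (S : Mfd) (y : rep S ⥤ᵇ 𝒴), IsReprSubmersion y → ReprWith Mfd.IsImm F y

/-- Submersions of differentiable stacks (not necessarily representable). -/
def IsSubmersion (F : 𝒳 ⥤ᵇ 𝒴) : Prop :=
  ∀ (X : Mfd) (q : rep X ⥤ᵇ 𝒳), IsAtlas q → ∀ (S : Mfd) (y : rep S ⥤ᵇ 𝒴), IsAtlas y →
    ReprWith Mfd.IsSubm (q ⋙ F) y

/-- Étale atlases. -/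
structure IsEtaleAtlas {X : Mfd} (q : rep X ⥤ᵇ 𝒳) : Prop extends IsAtlas q where
  etale : IsEtale q

/-- Étale differentiable stacks. -/
structure IsEtaleStack (𝒳 : BasedCategory.{v₁, u₁} Mfd) : Prop where
  stack : IsStack 𝒳
  atlas : ∃ (X : Mfd) (q : rep X ⥤ᵇ 𝒳), IsEtaleAtlas q

end

end Stk

open Stk BasedFunctor

/-! ## Weinstein groupoids -/

/-- The structure maps of a Weinstein groupoid over `M`, with the identities between maps to `M` that
are needed in order to form the compositions in its axioms. -/
structure PreWeinstein (M : Mfd) where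
  stk : BasedCategory.{v, u} Mfd
  src : stk ⥤ᵇ rep M
  tgt : stk ⥤ᵇ rep M
  mul : fibreProd src tgt ⥤ᵇ stk
  unit : rep M ⥤ᵇ stk
  inv : stk ⥤ᵇ stk
  tgt_mul : SameMap (mul ⋙ tgt) (fpFst src tgt ⋙ tgt)
  src_mul : SameMap (mul ⋙ src) (fpSnd src tgt ⋙ src)
  src_unit : SameMap (unit ⋙ src) (𝟭 (rep M))
  tgt_unit : SameMap (unit ⋙ tgt) (𝟭 (rep M))
  src_inv : SameMap (inv ⋙ src) tgt
  tgt_inv : SameMap (inv ⋙ tgt) src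

namespace PreWeinstein

variable {M : Mfd} (G : PreWeinstein.{v, u} M)

/-- The stack of composable pairs. -/
abbrev pair := fibreProd G.src G.tgt

/-- The stack of composable triples. -/
abbrev triple := fibreProd (fpSnd G.src G.tgt ⋙ G.src) G.tgt

/-- `(x, y, z) ↦ (x y) z`. -/
def mulLeft : G.triple ⥤ᵇ G.stk :=
  fpLift (F := G.src) (G := G.tgt) (fpFst _ _ ⋙ G.mul) (fpSnd _ _)
    (((G.src_mul.precomp (fpFst (fpSnd G.src G.tgt ⋙ G.src) G.tgt))).trans (fpSame _ _)).hom ⋙ G.mul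

/-- `(x, y, z) ↦ (y, z)`. -/
def lastTwo : G.triple ⥤ᵇ G.pair :=
  fpLift (F := G.src) (G := G.tgt) (fpFst _ _ ⋙ fpSnd _ _) (fpSnd _ _)
    (fpSame (fpSnd G.src G.tgt ⋙ G.src) G.tgt).hom

theorem mulRight_aux : SameMap ((fpFst (fpSnd G.src G.tgt ⋙ G.src) G.tgt ⋙ fpFst _ _) ⋙ G.src)
    ((G.lastTwo ⋙ G.mul) ⋙ G.tgt) :=
  ((fpSame G.src G.tgt).precomp (fpFst (fpSnd G.src G.tgt ⋙ G.src) G.tgt)).trans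
    (G.tgt_mul.precomp G.lastTwo).symm

/-- `(x, y, z) ↦ x (y z)`. -/
def mulRight : G.triple ⥤ᵇ G.stk :=
  fpLift (F := G.src) (G := G.tgt) (fpFst _ _ ⋙ fpFst _ _) (G.lastTwo ⋙ G.mul)
    G.mulRight_aux.hom ⋙ G.mul

/-- `x ↦ e(t(x)) x`. -/
def unitMul : G.stk ⥤ᵇ G.stk :=
  fpLift (F := G.src) (G := G.tgt) (G.tgt ⋙ G.unit) (𝟭 G.stk) (G.src_unit.precomp G.tgt).hom ⋙ G.mul

/-- `x ↦ x e(s(x))`. -/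
def mulUnit : G.stk ⥤ᵇ G.stk :=
  fpLift (F := G.src) (G := G.tgt) (𝟭 G.stk) (G.src ⋙ G.unit) (G.tgt_unit.precomp G.src).symm.hom ⋙
    G.mul

/-- `x ↦ i(x) x`. -/
def invMul : G.stk ⥤ᵇ G.stk :=
  fpLift (F := G.src) (G := G.tgt) G.inv (𝟭 G.stk) (SameMap.hom (G := 𝟭 G.stk ⋙ G.tgt) G.src_inv) ⋙
    G.mul

/-- `x ↦ x i(x)`. -/
def mulInv : G.stk ⥤ᵇ G.stk :=
  fpLift (F := G.src) (G := G.tgt) (𝟭 G.stk) G.inv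
    (SameMap.hom (F := 𝟭 G.stk ⋙ G.src) G.tgt_inv.symm) ⋙ G.mul

/-- The pair `(e, e)` of identities. -/
def unit₂ : rep M ⥤ᵇ G.pair :=
  fpLift (F := G.src) (G := G.tgt) G.unit G.unit (G.src_unit.trans G.tgt_unit.symm).hom

/-- The triple `(e, e, e)` of identities. -/
def unit₃ : rep M ⥤ᵇ G.triple :=
  fpLift (F := fpSnd G.src G.tgt ⋙ G.src) (G := G.tgt) G.unit₂ G.unit
    (SameMap.hom (F := G.unit₂ ⋙ fpSnd G.src G.tgt ⋙ G.src) (G.src_unit.trans G.tgt_unit.symm))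

/-- The canonical arrow `e(t(e(u))) ⟶ e(u)`. -/
def unitTgt (u : (rep M).obj) : G.unit.obj (G.tgt.obj (G.unit.obj u)) ⟶ G.unit.obj u :=
  G.unit.map (G.tgt_unit.app u)

/-- The canonical arrow `e(s(e(u))) ⟶ e(u)`. -/
def unitSrc (u : (rep M).obj) : G.unit.obj (G.src.obj (G.unit.obj u)) ⟶ G.unit.obj u :=
  G.unit.map (G.src_unit.app u)

theorem unitTgt_lift (u : (rep M).obj) :
    G.stk.p.IsHomLift (𝟙 ((rep M).p.obj u)) (G.unitTgt u) :=
  @BasedFunctor.preserves_isHomLift _ _ _ _ G.unit _ _ _ _ (𝟙 ((rep M).p.obj u)) (G.tgt_unit.app u)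
    (SameMap.isHomLift_app G.tgt_unit u)

theorem unitSrc_lift (u : (rep M).obj) :
    G.stk.p.IsHomLift (𝟙 ((rep M).p.obj u)) (G.unitSrc u) :=
  @BasedFunctor.preserves_isHomLift _ _ _ _ G.unit _ _ _ _ (𝟙 ((rep M).p.obj u)) (G.src_unit.app u)
    (SameMap.isHomLift_app G.src_unit u)

end PreWeinstein

/-- A Weinstein groupoid over `M`. The last fields make precise that the 2-morphisms of the
axioms become identities on the identity section: `unitIso` identifies `e e` with `e`, `invUnitIso`
identifies `i(e)` with `e`, and with these identifications all the 2-morphisms restrict to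
identities. -/
structure WeinsteinGroupoid (M : Mfd) extends PreWeinstein.{v, u} M where
  etale : IsEtaleStack stk
  src_subm : IsSubmersion src
  src_epi : IsEpim src
  tgt_subm : IsSubmersion tgt
  tgt_epi : IsEpim tgt
  assoc : toPreWeinstein.mulLeft ≅ toPreWeinstein.mulRight
  unit_imm : IsImmersion unit
  unit_inj : ∀ {S : Mfd} (a b : S ⟶ M) (φ : unit.obj (pt a) ⟶ unit.obj (pt b)),
    stk.p.IsHomLift (𝟙 S) φ → a = b
  leftUnit : toPreWeinstein.unitMul ≅ 𝟭 stk
  rightUnit : toPreWeinstein.mulUnit ≅ 𝟭 stk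
  inv_equiv : inv.toFunctor.IsEquivalence
  leftInv : toPreWeinstein.invMul ≅ src ⋙ unit
  rightInv : toPreWeinstein.mulInv ≅ tgt ⋙ unit
  unitIso : toPreWeinstein.unit₂ ⋙ mul ≅ unit
  invUnitIso : unit ⋙ inv ≅ unit
  leftUnit_res : ∀ u : (rep M).obj,
    leftUnit.hom.app (unit.obj u) =
      mul.map (fpHom (w' := toPreWeinstein.unit₂.obj u) (𝟙 ((rep M).p.obj u))
        (toPreWeinstein.unitTgt u) (𝟙 (unit.obj u))
        (toPreWeinstein.unitTgt_lift u) (IsHomLift.id (unit.w_obj u))) ≫ unitIso.hom.app u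
  rightUnit_res : ∀ u : (rep M).obj,
    rightUnit.hom.app (unit.obj u) =
      mul.map (fpHom (w' := toPreWeinstein.unit₂.obj u) (𝟙 ((rep M).p.obj u))
        (𝟙 (unit.obj u)) (toPreWeinstein.unitSrc u)
        (IsHomLift.id (unit.w_obj u)) (toPreWeinstein.unitSrc_lift u)) ≫ unitIso.hom.app u
  assoc_res : ∀ u : (rep M).obj,
    assoc.hom.app (toPreWeinstein.unit₃.obj u) ≫
      mul.map (fpHom (w' := toPreWeinstein.unit₂.obj u) (𝟙 ((rep M).p.obj u))
        (𝟙 (unit.obj u)) (unitIso.hom.app u)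
        (IsHomLift.id (unit.w_obj u)) (unitIso.hom.isHomLift' u)) ≫ unitIso.hom.app u =
      mul.map (fpHom (w' := toPreWeinstein.unit₂.obj u) (𝟙 ((rep M).p.obj u))
        (unitIso.hom.app u) (𝟙 (unit.obj u))
        (unitIso.hom.isHomLift' u) (IsHomLift.id (unit.w_obj u))) ≫ unitIso.hom.app u
  leftInv_res : ∀ u : (rep M).obj,
    leftInv.hom.app (unit.obj u) ≫ toPreWeinstein.unitSrc u =
      mul.map (fpHom (w' := toPreWeinstein.unit₂.obj u) (𝟙 ((rep M).p.obj u))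
        (invUnitIso.hom.app u) (𝟙 (unit.obj u))
        (invUnitIso.hom.isHomLift' u) (IsHomLift.id (unit.w_obj u))) ≫ unitIso.hom.app u
  rightInv_res : ∀ u : (rep M).obj,
    rightInv.hom.app (unit.obj u) ≫ toPreWeinstein.unitTgt u =
      mul.map (fpHom (w' := toPreWeinstein.unit₂.obj u) (𝟙 ((rep M).p.obj u))
        (𝟙 (unit.obj u)) (invUnitIso.hom.app u)
        (IsHomLift.id (unit.w_obj u)) (invUnitIso.hom.isHomLift' u)) ≫ unitIso.hom.app u

/-! ## Local Lie groupoids -/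

/-- A local Lie groupoid over `B` with space of arrows `N`: all the structure of a Lie groupoid,
except that the product `mul g h` (for `src g = tgt h`) is defined only for `g` and `h` in an open
neighbourhood `dom` of the identity section. The values of `mul` elsewhere are meaningless. -/
structure LocalLieGroupoid (B N : Mfd) where
  src : N ⟶ B
  tgt : N ⟶ B
  unit : B ⟶ N
  inv : N ⟶ N
  dom : Opens N
  mul : N → N → N
  src_subm : Mfd.IsSubm src
  tgt_subm : Mfd.IsSubm tgt
  src_unit : ∀ b, src (unit b) = b
  tgt_unit : ∀ b, tgt (unit b) = b
  unit_mem : ∀ b, unit b ∈ dom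
  src_inv : ∀ g, src (inv g) = tgt g
  tgt_inv : ∀ g, tgt (inv g) = src g
  inv_inv : ∀ g, inv (inv g) = g
  inv_unit : ∀ b, inv (unit b) = unit b
  inv_mem : ∀ g ∈ dom, inv g ∈ dom
  mul_smooth : ContMDiffOn (N.I.prod N.I) N.I ∞ (fun p : N × N => mul p.1 p.2)
    {p | p.1 ∈ dom ∧ p.2 ∈ dom ∧ src p.1 = tgt p.2}
  src_mul : ∀ g ∈ dom, ∀ h ∈ dom, src g = tgt h → src (mul g h) = src h
  tgt_mul : ∀ g ∈ dom, ∀ h ∈ dom, src g = tgt h → tgt (mul g h) = tgt g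
  unit_mul : ∀ g ∈ dom, mul (unit (tgt g)) g = g
  mul_unit : ∀ g ∈ dom, mul g (unit (src g)) = g
  inv_mul : ∀ g ∈ dom, mul (inv g) g = unit (src g)
  mul_inv : ∀ g ∈ dom, mul g (inv g) = unit (tgt g)
  assoc : ∀ g ∈ dom, ∀ h ∈ dom, ∀ k ∈ dom, src g = tgt h → src h = tgt k →
    mul g h ∈ dom → mul h k ∈ dom → mul (mul g h) k = mul g (mul h k)

namespace LocalLieGroupoid

variable {B N : Mfd} (L : LocalLieGroupoid B N)

/-- Composable pairs of `S`-valued points of a local Lie groupoid. -/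
structure Composable {S : Mfd} (a b : S ⟶ N) : Prop where
  fst_mem : ∀ x, a x ∈ L.dom
  snd_mem : ∀ x, b x ∈ L.dom
  eq : a ≫ L.src = b ≫ L.tgt

variable {L}

/-- The product of two composable `S`-valued points. -/
def Composable.mulMap {S : Mfd} {a b : S ⟶ N} (h : L.Composable a b) : S ⟶ N :=
  Mfd.mk' (fun x => L.mul (a x) (b x))
    (L.mul_smooth.comp_contMDiff ((Mfd.smooth a).prodMk (Mfd.smooth b))
      (fun x => ⟨h.fst_mem x, h.snd_mem x, congrArg (fun f : S ⟶ B => f x) h.eq⟩))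

theorem Composable.precomp {S T : Mfd} {a b : S ⟶ N} (h : L.Composable a b) (f : T ⟶ S) :
    L.Composable (f ≫ a) (f ≫ b) :=
  ⟨fun x => h.fst_mem (f x), fun x => h.snd_mem (f x), by
    rw [Category.assoc, h.eq, Category.assoc]⟩

variable (L) in
theorem composable_unit {S : Mfd} (b : S ⟶ B) : L.Composable (b ≫ L.unit) (b ≫ L.unit) :=
  ⟨fun x => L.unit_mem (b x), fun x => L.unit_mem (b x), by
    ext x
    exact (L.src_unit (b x)).trans (L.tgt_unit (b x)).symm⟩

variable (L) in
theorem mulMap_unit {S : Mfd} (b : S ⟶ B) : (L.composable_unit b).mulMap = b ≫ L.unit := by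
  ext x
  have h := L.unit_mul (L.unit (b x)) (L.unit_mem (b x))
  rw [L.tgt_unit] at h
  exact h

variable (L) in
theorem unit_comp_inv {S : Mfd} (b : S ⟶ B) : (b ≫ L.unit) ≫ L.inv = b ≫ L.unit := by
  ext x
  exact L.inv_unit (b x)

end LocalLieGroupoid

namespace Stk

theorem ptHom_lift {S T M : Mfd} {a : S ⟶ M} {b : T ⟶ M} (f : S ⟶ T) (h : f ≫ b = a) :
    (rep M).p.IsHomLift f (ptHom f h) :=
  @IsHomLift.map _ _ _ _ (Over.forget M) (Over.mk a) (Over.mk b) (ptHom f h)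

/-- The arrow between the images of two points given by a smooth map. -/
def ptMap {N : Mfd} {𝒳 : BasedCategory.{v₁, u₁} Mfd} (j : rep N ⥤ᵇ 𝒳) {S T : Mfd} {a : S ⟶ N}
    {b : T ⟶ N} (f : S ⟶ T) (h : f ≫ b = a) : j.obj (pt a) ⟶ j.obj (pt b) :=
  j.map (ptHom f h)

theorem ptMap_lift {N : Mfd} {𝒳 : BasedCategory.{v₁, u₁} Mfd} (j : rep N ⥤ᵇ 𝒳) {S T : Mfd}
    {a : S ⟶ N} {b : T ⟶ N} (f : S ⟶ T) (h : f ≫ b = a) : 𝒳.p.IsHomLift f (ptMap j f h) :=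
  @BasedFunctor.preserves_isHomLift _ _ _ _ j _ _ _ _ f (ptHom f h) (ptHom_lift f h)

end Stk

/-- For morphisms of stacks `j : N ⟶ 𝒢`, with source and target of `j` given by smooth maps
`s, t : N ⟶ M`, the composable pair `(j a, j b)` attached to two points of `N` with
`s ∘ a = t ∘ b`. -/
def PreWeinstein.ptPair {M N : Mfd} (G : PreWeinstein.{v, u} M) {j : rep N ⥤ᵇ G.stk} {s t : N ⟶ M}
    (hs : SameMap (j ⋙ G.src) (uMap s)) (ht : SameMap (j ⋙ G.tgt) (uMap t)) {S : Mfd}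
    (a b : S ⟶ N) (h : a ≫ s = b ≫ t) : G.pair.obj where
  fst := j.obj (pt a)
  snd := j.obj (pt b)
  η := hs.app (pt a) ≫ ptHom (a := a ≫ s) (b := b ≫ t) (𝟙 S) (by simp [h]) ≫ ht.symm.app (pt b)
  lift := by
    have h1 := hs.isHomLift_app (pt a)
    have h2 := ht.symm.isHomLift_app (pt b)
    have h3 := ptHom_lift (a := a ≫ s) (b := b ≫ t) (𝟙 S) (by simp [h])
    have e : G.stk.p.obj (j.obj (pt a)) = S := j.w_obj (pt a)
    rw [e]
    exact @IsHomLift.comp_of_lift_id _ _ _ _ (rep M).p S _ _ _ _ _ h1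
      (@IsHomLift.comp_of_lift_id _ _ _ _ (rep M).p S _ _ _ _ _ h3 h2)

/-- `L` is a local Lie groupoid over `B` presenting the Weinstein groupoid `𝒢` over `w : B ⟶ M`
(the inclusion of an open subset, or the identity) near the identity section, by means of a
morphism of stacks `j : N ⟶ 𝒢`: the structure maps of `𝒢` are, along `j`, those of `L`, up to
2-isomorphisms which on the identity section are the canonical ones. -/
structure Presents {M B N : Mfd} (𝒢 : WeinsteinGroupoid.{v, u} M) (w : B ⟶ M)
    (L : LocalLieGroupoid B N) (j : rep N ⥤ᵇ 𝒢.stk) where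
  src : SameMap (j ⋙ 𝒢.src) (uMap (L.src ≫ w))
  tgt : SameMap (j ⋙ 𝒢.tgt) (uMap (L.tgt ≫ w))
  unit : ∀ {S : Mfd} (b : S ⟶ B), j.obj (pt (b ≫ L.unit)) ⟶ 𝒢.unit.obj (pt (b ≫ w))
  unit_lift : ∀ {S : Mfd} (b : S ⟶ B), 𝒢.stk.p.IsHomLift (𝟙 S) (unit b)
  unit_nat : ∀ {S T : Mfd} (f : T ⟶ S) (b : S ⟶ B),
    ptMap j f (by simp) ≫ unit b = unit (f ≫ b) ≫ ptMap 𝒢.unit f (by simp)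
  mul : ∀ {S : Mfd} {a b : S ⟶ N} (h : L.Composable a b),
    𝒢.mul.obj (𝒢.ptPair src tgt a b (by simp only [← Category.assoc, h.eq])) ⟶ j.obj (pt h.mulMap)
  mul_lift : ∀ {S : Mfd} {a b : S ⟶ N} (h : L.Composable a b), 𝒢.stk.p.IsHomLift (𝟙 S) (mul h)
  mul_nat : ∀ {S T : Mfd} (f : T ⟶ S) {a b : S ⟶ N} (h : L.Composable a b),
    𝒢.mul.map (fpHom (w := 𝒢.ptPair src tgt (f ≫ a) (f ≫ b) _) (w' := 𝒢.ptPair src tgt a b _) f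
      (ptMap j f rfl) (ptMap j f rfl) (ptMap_lift j f rfl) (ptMap_lift j f rfl)) ≫ mul h =
    mul (h.precomp f) ≫ ptMap j f rfl
  inv : ∀ {S : Mfd} (a : S ⟶ N), 𝒢.inv.obj (j.obj (pt a)) ⟶ j.obj (pt (a ≫ L.inv))
  inv_lift : ∀ {S : Mfd} (a : S ⟶ N), 𝒢.stk.p.IsHomLift (𝟙 S) (inv a)
  inv_nat : ∀ {S T : Mfd} (f : T ⟶ S) (a : S ⟶ N),
    𝒢.inv.map (ptMap j f rfl) ≫ inv a = inv (f ≫ a) ≫ ptMap j f (by simp)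
  mul_unit : ∀ {S : Mfd} (b : S ⟶ B),
    mul (L.composable_unit b) ≫ ptMap j (𝟙 S) (by rw [L.mulMap_unit]; simp) ≫ unit b =
      𝒢.mul.map (fpHom (w' := 𝒢.unit₂.obj (pt (b ≫ w))) (𝟙 S) (unit b) (unit b)
        (unit_lift b) (unit_lift b)) ≫ 𝒢.unitIso.hom.app (pt (b ≫ w))
  inv_unit : ∀ {S : Mfd} (b : S ⟶ B),
    inv (b ≫ L.unit) ≫ ptMap j (𝟙 S) (by rw [L.unit_comp_inv]; simp) ≫ unit b =
      𝒢.inv.map (unit b) ≫ 𝒢.invUnitIso.hom.app (pt (b ≫ w))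

/-- The composition of a point with a map that is smooth on an open set containing it. -/
def Mfd.compOn {S N N' : Mfd} (φ : N → N') {U : Set N} (hφ : ContMDiffOn N.I N'.I ∞ φ U)
    (a : S ⟶ N) (ha : ∀ x, a x ∈ U) : S ⟶ N' :=
  Mfd.mk' (fun x => φ (a x)) (hφ.comp_contMDiff (Mfd.smooth a) ha)

/-- A local isomorphism between two local Lie groupoids presenting `𝒢` over `w : B ⟶ M` and
`w' : B' ⟶ M` (open subsets of `M`): a diffeomorphism between open subsets of `N` and `N'`, defined
near all the identities over the common part of `B` and `B'`, which respects all the structure maps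
and the morphisms to `𝒢`. -/
structure LocalIso {M B N B' N' : Mfd} {𝒢 : WeinsteinGroupoid.{v, u} M} {w : B ⟶ M} {w' : B' ⟶ M}
    {L : LocalLieGroupoid B N} {L' : LocalLieGroupoid B' N'} {j : rep N ⥤ᵇ 𝒢.stk}
    {j' : rep N' ⥤ᵇ 𝒢.stk} (c : Presents 𝒢 w L j) (c' : Presents 𝒢 w' L' j') where
  map : OpenPartialHomeomorph N N'
  smooth : ContMDiffOn N.I N'.I ∞ map map.source
  smooth_symm : ContMDiffOn N'.I N.I ∞ map.symm map.target
  src : ∀ g ∈ map.source, w' (L'.src (map g)) = w (L.src g)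
  tgt : ∀ g ∈ map.source, w' (L'.tgt (map g)) = w (L.tgt g)
  unit_mem : ∀ b b', w b = w' b' → L.unit b ∈ map.source
  unit : ∀ b b', w b = w' b' → map (L.unit b) = L'.unit b'
  inv_mem : ∀ g ∈ map.source, L.inv g ∈ map.source
  inv : ∀ g ∈ map.source, map (L.inv g) = L'.inv (map g)
  mul_mem : ∀ g ∈ map.source, ∀ h ∈ map.source, g ∈ L.dom → h ∈ L.dom → map g ∈ L'.dom →
    map h ∈ L'.dom → L.src g = L.tgt h →
    (L.mul g h ∈ map.source ↔ L'.mul (map g) (map h) ∈ map.target)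
  mul : ∀ g ∈ map.source, ∀ h ∈ map.source, g ∈ L.dom → h ∈ L.dom → map g ∈ L'.dom →
    map h ∈ L'.dom → L.src g = L.tgt h → L.mul g h ∈ map.source →
    map (L.mul g h) = L'.mul (map g) (map h)
  /-- The 2-isomorphism between `j` and `j' ∘ map`. -/
  iso : ∀ {S : Mfd} (a : S ⟶ N) (ha : ∀ x, a x ∈ map.source),
    j.obj (pt a) ⟶ j'.obj (pt (Mfd.compOn map smooth a ha))
  iso_lift : ∀ {S : Mfd} (a : S ⟶ N) (ha : ∀ x, a x ∈ map.source),
    𝒢.stk.p.IsHomLift (𝟙 S) (iso a ha)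
  iso_nat : ∀ {S T : Mfd} (f : T ⟶ S) (a : S ⟶ N) (ha : ∀ x, a x ∈ map.source),
    ptMap j f rfl ≫ iso a ha = iso (f ≫ a) (fun x => ha (f x)) ≫ ptMap j' f rfl
  iso_unit : ∀ {S : Mfd} (b : S ⟶ B) (b' : S ⟶ B') (h : b ≫ w = b' ≫ w')
    (ha : ∀ x, (b ≫ L.unit) x ∈ map.source)
    (he : Mfd.compOn map smooth (b ≫ L.unit) ha = b' ≫ L'.unit),
    iso (b ≫ L.unit) ha ≫ ptMap j' (𝟙 S) (by rw [he]; simp) ≫ c'.unit b' =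
      c.unit b ≫ ptMap 𝒢.unit (𝟙 S) (by rw [h]; simp)

/-- A system of local Lie groupoids presenting `𝒢`, inside the étale atlas `q : X ⟶ 𝒢`: an open
covering `W` of `M`, for each `l` a local Lie groupoid over `W l` whose space of arrows is an open
subset `U l` of the atlas, and gluing isomorphisms satisfying the cocycle conditions. -/
structure GluingSystem {M X : Mfd} (𝒢 : WeinsteinGroupoid.{v, u} M) (q : rep X ⥤ᵇ 𝒢.stk) where
  ι : Type
  W : ι → Opens M
  cover : ∀ x, ∃ l, x ∈ W l
  U : ι → Opens X
  grpd : ∀ l, LocalLieGroupoid (M.opn (W l)) (X.opn (U l))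
  chart : ∀ l, Presents 𝒢 (M.incl (W l)) (grpd l) (uMap (X.incl (U l)) ⋙ q)
  trans : ∀ k l, LocalIso (chart k) (chart l)
  trans_self_source : ∀ l, (trans l l).map.source = Set.univ
  trans_self : ∀ l g, (trans l l).map g = g
  trans_symm_mem : ∀ k l, ∀ g ∈ (trans k l).map.source,
    (trans k l).map g ∈ (trans l k).map.source
  trans_symm : ∀ k l, ∀ g ∈ (trans k l).map.source, (trans l k).map ((trans k l).map g) = g
  cocycle_mem : ∀ k l m, ∀ g ∈ (trans k l).map.source,
    (trans k l).map g ∈ (trans l m).map.source → g ∈ (trans k m).map.source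
  cocycle : ∀ k l m, ∀ g ∈ (trans k l).map.source,
    (trans k l).map g ∈ (trans l m).map.source →
    (trans l m).map ((trans k l).map g) = (trans k m).map g

/-- `L` (with its morphism `j` to `𝒢`) is obtained by gluing the local Lie groupoids of the system
`D` along the gluing isomorphisms. -/
structure IsGluing {M X N : Mfd} {𝒢 : WeinsteinGroupoid.{v, u} M} {q : rep X ⥤ᵇ 𝒢.stk}
    (D : GluingSystem 𝒢 q) {L : LocalLieGroupoid M N} {j : rep N ⥤ᵇ 𝒢.stk}
    (c : Presents 𝒢 (𝟙 M) L j) where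
  map : ∀ l, LocalIso (D.chart l) c
  source : ∀ l, (map l).map.source = Set.univ
  dom : ∀ l, ∀ g ∈ (D.grpd l).dom, (map l).map g ∈ L.dom
  cover : ∀ n : N, ∃ l g, (map l).map g = n
  glue : ∀ k l g h, (map k).map g = (map l).map h ↔
    g ∈ (D.trans k l).map.source ∧ (D.trans k l).map g = h

/-! ## Lie algebroids -/

/-- The derivative of a smooth function in the direction of a tangent vector. -/
def Mfd.dirDeriv {M : Mfd} (f : C^∞⟮M.I, M; 𝓘(ℝ, ℝ), ℝ⟯) (x : M) (v : TangentSpace M.I x) : ℝ :=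
  mfderiv M.I 𝓘(ℝ, ℝ) f x v

/-- A Lie algebroid over `M`: a smooth vector bundle `A` of finite rank, a smooth bundle map
`A ⟶ TM`, and a Lie bracket on smooth sections satisfying the Leibniz rule. -/
structure LieAlgebroid (M : Mfd) where
  rank : ℕ
  A : M → Type
  [topTotal : TopologicalSpace (Bundle.TotalSpace (EuclideanSpace ℝ (Fin rank)) A)]
  [addCommGroup : ∀ x, AddCommGroup (A x)]
  [module : ∀ x, Module ℝ (A x)]
  [topFib : ∀ x, TopologicalSpace (A x)]
  [fiberBundle : FiberBundle (EuclideanSpace ℝ (Fin rank)) A]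
  [vectorBundle : VectorBundle ℝ (EuclideanSpace ℝ (Fin rank)) A]
  [smoothBundle : ContMDiffVectorBundle ∞ (EuclideanSpace ℝ (Fin rank)) A M.I]
  anchor : ∀ x, A x →ₗ[ℝ] TangentSpace M.I x
  anchor_smooth : ContMDiff (M.I.prod 𝓘(ℝ, EuclideanSpace ℝ (Fin rank))) M.I.tangent ∞
    (fun a : Bundle.TotalSpace (EuclideanSpace ℝ (Fin rank)) A =>
      (⟨a.proj, anchor a.proj a.2⟩ : TangentBundle M.I M))
  bracket : Cₛ^∞⟮M.I; EuclideanSpace ℝ (Fin rank), A⟯ → Cₛ^∞⟮M.I; EuclideanSpace ℝ (Fin rank), A⟯ →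
    Cₛ^∞⟮M.I; EuclideanSpace ℝ (Fin rank), A⟯
  bracket_add : ∀ a b c, bracket a (b + c) = bracket a b + bracket a c
  add_bracket : ∀ a b c, bracket (a + b) c = bracket a c + bracket b c
  bracket_self : ∀ a, bracket a a = 0
  jacobi : ∀ a b c, bracket a (bracket b c) = bracket (bracket a b) c + bracket b (bracket a c)
  leibniz : ∀ (f : C^∞⟮M.I, M; 𝓘(ℝ, ℝ), ℝ⟯) (a b fb : Cₛ^∞⟮M.I; EuclideanSpace ℝ (Fin rank), A⟯),
    (∀ x, fb x = f x • b x) → ∀ x, bracket a fb x =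
      f x • bracket a b x + Mfd.dirDeriv f x (anchor x (a x)) • b x

attribute [instance] LieAlgebroid.topTotal LieAlgebroid.addCommGroup LieAlgebroid.module
  LieAlgebroid.topFib LieAlgebroid.fiberBundle LieAlgebroid.vectorBundle LieAlgebroid.smoothBundle

namespace LieAlgebroid

variable {M : Mfd}

/-- The smooth sections of a Lie algebroid. -/
abbrev Sec (A : LieAlgebroid M) : Type :=
  Cₛ^∞⟮M.I; EuclideanSpace ℝ (Fin A.rank), A.A⟯

/-- Isomorphisms of Lie algebroids over `M`. That `onSec` exists says that the fibrewise linear maps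
form a smooth isomorphism of bundles. -/
structure Iso (A A' : LieAlgebroid M) where
  fib : ∀ x, A.A x ≃ₗ[ℝ] A'.A x
  onSec : A.Sec ≃ A'.Sec
  onSec_apply : ∀ a x, onSec a x = fib x (a x)
  anchor : ∀ x v, A'.anchor x (fib x v) = A.anchor x v
  bracket : ∀ a b, onSec (A.bracket a b) = A'.bracket (onSec a) (onSec b)

/-- The right invariant vector field on a local Lie groupoid `L` over `w : B ⟶ M`, given by a
section of `A` and linear maps `θ` from the fibres of `A` to the tangent spaces of the source fibres
of `L` at the identities: at `g` it is the image of `θ(a(t(g)))` under the differential of right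
translation by `g` (a map on the source fibre over `t(g)`). The differential within a submanifold
enters only through its values on tangent vectors of that submanifold, which are well defined. -/
def rightInvariant (A : LieAlgebroid M) {B N : Mfd} (w : B ⟶ M) (L : LocalLieGroupoid B N)
    (θ : ∀ b : B, A.A (w b) →ₗ[ℝ] TangentSpace N.I (L.unit b)) (a : A.Sec) (g : N) :
    TangentSpace N.I g :=
  mfderivWithin N.I N.I (fun h => L.mul h g) {h | h ∈ L.dom ∧ L.src h = L.tgt g}
    (L.unit (L.tgt g)) (θ (L.tgt g) (a (w (L.tgt g))))

/-- An identification of the restriction of `A` along `w : B ⟶ M` (the inclusion of an open subset,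
or the identity) with the Lie algebroid of the local Lie groupoid `L` over `B`: the bundle
`e^* ker Ts`, with anchor given by `Tt` and bracket given by the bracket of right invariant vector
fields. -/
structure Realizes (A : LieAlgebroid M) {B N : Mfd} (w : B ⟶ M) (L : LocalLieGroupoid B N) where
  θ : ∀ b : B, A.A (w b) →ₗ[ℝ] TangentSpace N.I (L.unit b)
  injective : ∀ b, Function.Injective (θ b)
  range : ∀ b (v : TangentSpace N.I (L.unit b)),
    v ∈ Set.range (θ b) ↔ mfderiv N.I B.I L.src (L.unit b) v = 0
  smooth : ∀ a : A.Sec, ContMDiff B.I N.I.tangent ∞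
    (fun b => (⟨L.unit b, θ b (a (w b))⟩ : TangentBundle N.I N))
  anchor : ∀ b v, mfderiv N.I M.I (L.tgt ≫ w) (L.unit b) (θ b v) = A.anchor (w b) v
  bracket : ∀ (a a' : A.Sec) (b : B), θ b (A.bracket a a' (w b)) =
    VectorField.mlieBracket N.I (A.rightInvariant w L θ a) (A.rightInvariant w L θ a') (L.unit b)

end LieAlgebroid

/-- `A` is (isomorphic to) the Lie algebroid of the local Lie groupoid `L`. -/
def LocalLieGroupoid.HasLieAlgebroid {M N : Mfd} (L : LocalLieGroupoid M N) (A : LieAlgebroid M) :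
    Prop :=
  Nonempty (A.Realizes (𝟙 M) L)

/-- `A` is (isomorphic to) the Lie algebroid of the Weinstein groupoid `𝒢`: for some étale atlas `X`
and some system of local Lie groupoids `U l` in `X` presenting `𝒢` over an open covering of `M`, it
is glued from the Lie algebroids `A l` of the `U l` by the differentials of the gluing
isomorphisms. As a vector bundle this is the pull-back of `ker Ts` along the identity section. -/
def WeinsteinGroupoid.HasLieAlgebroid {M : Mfd} (𝒢 : WeinsteinGroupoid.{v, u} M)
    (A : LieAlgebroid M) : Prop :=
  ∃ (X : Mfd) (q : rep X ⥤ᵇ 𝒢.stk) (_ : IsEtaleAtlas q) (D : GluingSystem 𝒢 q)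
    (R : ∀ l, A.Realizes (M.incl (D.W l)) (D.grpd l)),
    ∀ (k l : D.ι) (x : M) (hk : x ∈ D.W k) (hl : x ∈ D.W l) (v : A.A x),
      mfderiv (X.opn (D.U k)).I (X.opn (D.U l)).I (D.trans k l).map ((D.grpd k).unit ⟨x, hk⟩)
        ((R k).θ ⟨x, hk⟩ v) = (R l).θ ⟨x, hl⟩ v

end

open Stk

noncomputable section

open Stk Mfd Category
open BasedFunctor hiding id id_comp comp_id
open ConcreteCategory (congr_hom)
open Function (Injective)
open Filter (inter_mem Eventually Tendsto tendsto_id)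
open Set (range)
open Topology

local notation "𝔼" n:max => EuclideanSpace ℝ (Fin n)

variable {Ξ : BasedCategory.{v₁, u₁} Mfd}

/-- The arrow `φ` of a category over manifolds lies over `f`. -/
abbrev CategoryTheory.BasedCategory.Lifts (Ξ : BasedCategory.{v₁, u₁} Mfd) {S T : Mfd} {x y : Ξ.obj}
    (f : S ⟶ T) (φ : x ⟶ y) : Prop := Ξ.p.IsHomLift f φ

/-! ## Topology near a section -/

namespace NearSection

open Set

variable {Y M : Type*} [TopologicalSpace Y] [TopologicalSpace M]

lemma isOpen_forall_mem {ι : Type*} {p : Y → M} (hp : Continuous p) {C : ι → Set M}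
    (hC : LocallyFinite C) (hCc : ∀ i, IsClosed (C i)) {Q : ι → Set Y} (hQ : ∀ i, IsOpen (Q i)) :
    IsOpen {g | ∀ i, p g ∈ C i → g ∈ Q i} := by
  have h : {g | ∀ i, p g ∈ C i → g ∈ Q i} = (⋃ i, p ⁻¹' C i ∩ (Q i)ᶜ)ᶜ := by
    ext g
    simp
  rw [h, isOpen_compl_iff]
  refine LocallyFinite.isClosed_iUnion ((hC.preimage_continuous hp).subset fun i => inter_subset_left)
    fun i => ((hCc i).preimage hp).inter (hQ i).isClosed_compl

lemma exists_closed_cover [T2Space M] [ParacompactSpace M] {ι : Type*} (u : ι → Set M)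
    (hu : ∀ x, IsOpen (u x)) (hx : ∀ x, ∃ i, x ∈ u i) :
    ∃ C w : ι → Set M, LocallyFinite C ∧ (∀ x, IsClosed (C x)) ∧ (∀ x, C x ⊆ u x) ∧
      (∀ x, IsOpen (w x)) ∧ (∀ x, w x ⊆ C x) ∧ ∀ x, ∃ y, x ∈ w y := by
  obtain ⟨v, vo, vc, vf, vu⟩ := precise_refinement u hu (iUnion_eq_univ_iff.2 hx)
  obtain ⟨w, wc, wo, wv⟩ := exists_iUnion_eq_closure_subset vo vf.point_finite vc
  exact ⟨fun x => closure (w x), w, vf.subset wv, fun x => isClosed_closure,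
    fun x => (wv x).trans (vu x), wo, fun x => subset_closure, iUnion_eq_univ_iff.1 wc⟩

lemma exists_section_extension [T2Space M] [ParacompactSpace M] {P : Type*} [TopologicalSpace P]
    {pr : P → Y} (hpr : IsLocalHomeomorph pr) {p : Y → M} (hp : Continuous p) {e : M → Y}
    (he : ∀ x, p (e x) = x) {l : M → P} (hl : Continuous l) (hle : ∀ x, pr (l x) = e x) :
    ∃ (D : Set Y) (σ : Y → P), IsOpen D ∧ (∀ x, e x ∈ D) ∧ ContinuousOn σ D ∧
      (∀ y ∈ D, pr (σ y) = y) ∧ ∀ x, σ (e x) = l x := by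
  choose φ hφ hφpr using hpr
  obtain ⟨C, w, Cf, Cc, Cu, wo, wC, hw⟩ := exists_closed_cover (M := M)
    (fun x => l ⁻¹' (φ (l x)).source) (fun x => (φ (l x)).open_source.preimage hl)
    (fun x => ⟨x, hφ (l x)⟩)
  have hopen : IsOpenMap pr := (show IsLocalHomeomorph pr from fun x => ⟨φ x, hφ x, hφpr x⟩).isOpenMap
  let Q : M × M → Set Y := fun ij => pr '' ((φ (l ij.1)).source ∩ (φ (l ij.2)).source)
  have hQ : ∀ ij, IsOpen (Q ij) := fun ij =>
    hopen _ ((φ (l ij.1)).open_source.inter (φ (l ij.2)).open_source)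
  let C2 : M × M → Set M := fun ij => C ij.1 ∩ C ij.2
  have hC2 : LocallyFinite C2 := by
    intro x
    obtain ⟨t, ht, hf⟩ := Cf x
    refine ⟨t, ht, (hf.prod hf).subset ?_⟩
    rintro ⟨i, j⟩ ⟨z, ⟨hzi, hzj⟩, hzt⟩
    exact ⟨⟨z, hzi, hzt⟩, ⟨z, hzj, hzt⟩⟩
  let D : Set Y := {g | ∀ ij, p g ∈ C2 ij → g ∈ Q ij}
  have hD : IsOpen D := isOpen_forall_mem hp hC2 (fun ij => (Cc _).inter (Cc _)) hQ
  choose w' hw' using hw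
  let σ : Y → P := fun g => (φ (l (w' (p g)))).symm g
  have hσ : ∀ g ∈ D, ∀ i, p g ∈ C i → σ g ∈ (φ (l i)).source ∧ pr (σ g) = g := by
    intro g hg i hi
    obtain ⟨z, ⟨hz1, hz2⟩, hzg⟩ := hg (w' (p g), i) ⟨wC _ (hw' (p g)), hi⟩
    have : σ g = z := by
      change (φ (l (w' (p g)))).symm g = z
      have h2 := (φ (l (w' (p g)))).left_inv hz1
      rwa [← congrFun (hφpr (l (w' (p g)))) z, hzg] at h2
    rw [this]
    exact ⟨hz2, hzg⟩
  refine ⟨D, σ, hD, ?_, ?_, ?_, ?_⟩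
  · rintro x ⟨i, j⟩ ⟨hi, hj⟩
    rw [he] at hi hj
    exact ⟨l x, ⟨Cu _ hi, Cu _ hj⟩, hle x⟩
  · intro g hg
    refine ContinuousAt.continuousWithinAt ?_
    set i := w' (p g) with hidef
    have hgi := hσ g hg i (wC _ (hw' (p g)))
    have hs : ∀ᶠ g' in 𝓝 g, σ g' = (φ (l i)).symm g' := by
      filter_upwards [hD.mem_nhds hg, hp.continuousAt.preimage_mem_nhds
        ((wo i).mem_nhds (hw' (p g)))] with g' hg' hpg'
      have := hσ g' hg' i (wC _ hpg')
      have h2 : (φ (l i)).symm (pr (σ g')) = σ g' := by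
        rw [hφpr (l i)]; exact (φ (l i)).left_inv this.1
      rw [this.2] at h2
      exact h2.symm
    refine ContinuousAt.congr ?_ (hs.mono fun _ h => h.symm)
    refine (φ (l i)).continuousAt_symm ?_
    rw [← hgi.2]
    rw [hφpr (l i)]
    exact (φ (l i)).map_source hgi.1
  · intro g hg
    exact (hσ g hg _ (wC _ (hw' (p g)))).2
  · intro x
    have hx := hw' (p (e x))
    have h1 : l x ∈ (φ (l (w' (p (e x))))).source := Cu _ (by
      have := wC _ hx
      rwa [he x] at this ⊢)
    change (φ (l (w' (p (e x))))).symm (e x) = l x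
    rw [← hle x] at h1 ⊢
    nth_rewrite 2 [hφpr (l (w' (p (pr (l x)))))]
    exact (φ _).left_inv h1

lemma exists_tube [T2Space M] [ParacompactSpace M] {s t : Y → M} (hs : Continuous s)
    (ht : Continuous t) {e : M → Y} (he : Continuous e) (hse : ∀ x, s (e x) = x)
    (hte : ∀ x, t (e x) = x) {Q : M → Set Y} (hQ : ∀ x, IsOpen (Q x)) (heQ : ∀ x, e x ∈ Q x) :
    ∃ D : Set Y, IsOpen D ∧ (∀ x, e x ∈ D) ∧
      ∀ g ∈ D, ∀ h ∈ D, ∀ k ∈ D, s g = t h → s h = t k → ∃ x, g ∈ Q x ∧ h ∈ Q x ∧ k ∈ Q x := by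
  obtain ⟨C, w, Cf, Cc, Cu, wo, wC, hw⟩ := exists_closed_cover (M := M)
    (fun x => e ⁻¹' (Q x)) (fun x => (hQ x).preimage he) (fun x => ⟨x, heQ x⟩)
  obtain ⟨C', w', Cf', Cc', Cu', wo', wC', hw'⟩ := exists_closed_cover w wo hw
  refine ⟨{g | ∀ i, s g ∈ C i → g ∈ Q i} ∩ {g | ∀ i, t g ∈ C i → g ∈ Q i} ∩
    {g | ∀ i, t g ∈ C' i → g ∈ s ⁻¹' w i}, ?_, ?_, ?_⟩
  · exact ((isOpen_forall_mem hs Cf Cc hQ).inter (isOpen_forall_mem ht Cf Cc hQ)).inter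
      (isOpen_forall_mem ht Cf' Cc' fun i => (wo i).preimage hs)
  · intro x
    refine ⟨⟨fun i hi => Cu i ?_, fun i hi => Cu i ?_⟩, fun i hi => ?_⟩
    · rwa [hse] at hi
    · rwa [hte] at hi
    · rw [hte] at hi
      change s (e x) ∈ w i
      rw [hse]
      exact Cu' i hi
  · rintro g ⟨⟨hg1, hg2⟩, hg3⟩ h ⟨⟨hh1, hh2⟩, hh3⟩ k ⟨⟨hk1, hk2⟩, hk3⟩ hgh hhk
    obtain ⟨i, hi⟩ := hw' (s g)
    have h1 := wC' i hi
    have h2 := wC i (Cu' i h1)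
    refine ⟨i, hg1 i h2, hh2 i (hgh ▸ h2), hk2 i ?_⟩
    rw [← hhk]
    exact wC i (hh3 i (hgh ▸ h1))

end NearSection

/-! ## Manifolds -/

namespace Mfd

open Set

lemma continuous {S T : Mfd} (f : S ⟶ T) : Continuous f := (smooth f).continuous

lemma contMDiffAt_opens_iff {E H E' H' : Type*} [NormedAddCommGroup E] [NormedSpace ℝ E]
    [TopologicalSpace H] {I : ModelWithCorners ℝ E H} [NormedAddCommGroup E'] [NormedSpace ℝ E']
    [TopologicalSpace H'] {I' : ModelWithCorners ℝ E' H'} {A : Type*} [TopologicalSpace A]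
    [ChartedSpace H A] {N : Type*} [TopologicalSpace N] [ChartedSpace H' N] {U : Opens N}
    {f : A → U} {x : A} :
    ContMDiffAt I I' ∞ f x ↔ ContMDiffAt I I' ∞ (fun y => (f y : N)) x := by
  rw [contMDiffAt_iff_target (f := f), contMDiffAt_iff_target (f := fun y => (f y : N))]
  refine and_congr ?_ Iff.rfl
  exact IsInducing.subtypeVal.continuousAt_iff

/-- Restriction of the codomain of a smooth map to an open subset. -/
def codRestrict {S T : Mfd} (f : S ⟶ T) (U : Opens T) (h : ∀ x, f x ∈ U) : S ⟶ T.opn U :=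
  mk' (T := T.opn U) (fun x => (⟨f x, h x⟩ : U))
    (fun x => (contMDiffAt_opens_iff (I := S.I) (I' := T.I)).2 (smooth f x))

@[simp] theorem codRestrict_incl {S T : Mfd} (f : S ⟶ T) (U : Opens T) (h : ∀ x, f x ∈ U) :
    codRestrict f U h ≫ T.incl U = f := rfl

lemma incl_injective {S : Mfd} (U : Opens S) : Injective (S.incl U) :=
  Subtype.val_injective

/-- The one-point manifold. -/
def point : Mfd where
  carrier := 𝔼 0
  dim := 0

/-- A point of a manifold, as a morphism. -/
def pnt {S : Mfd} (x : S) : point ⟶ S := mk' (fun _ => x) contMDiff_const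

instance : Subsingleton point := inferInstanceAs (Subsingleton (𝔼 0))

def pointElt : point := (0 : 𝔼 0)

@[simp] theorem pnt_comp {S T : Mfd} (x : S) (f : S ⟶ T) : pnt x ≫ f = pnt (f x) := rfl

lemma pnt_injective {S : Mfd} : Injective (pnt (S := S)) := fun x y h =>
  congrArg (fun f : point ⟶ S => f pointElt) h

lemma eq_pnt {S : Mfd} (f : point ⟶ S) : f = pnt (f pointElt) := by
  ext x
  rw [Subsingleton.elim x pointElt]
  rfl

end Mfd

/-- Charts `ψ i` from open subsets of a manifold `Y` to a set `T` with smooth transitions. -/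
structure GlueCore (Y : Mfd) (T : Type) where
  ι : Type u
  O : ι → Opens Y
  ψ : ∀ i, O i → T
  inj : ∀ i, Injective (ψ i)
  surj : ∀ t, ∃ i x, ψ i x = t
  trans : ∀ i j (x : O i) (y : O j), ψ i x = ψ j y → ∃ (U : Set Y) (f : Y → Y), IsOpen U ∧
    (x : Y) ∈ U ∧ ContMDiffOn Y.I Y.I ∞ f U ∧
    ∀ x' ∈ U, ∀ hx : x' ∈ O i, ∃ hy : f x' ∈ O j, ψ i ⟨x', hx⟩ = ψ j ⟨f x', hy⟩

namespace GlueCore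

open Set

variable {Y : Mfd} {T : Type} (G : GlueCore.{u} Y T)

instance (i : G.ι) : ChartedSpace (𝔼 Y.dim) (G.O i) := inferInstance

/-- The topology of the glued space. -/
@[reducible] def top : TopologicalSpace T where
  IsOpen U := ∀ i, IsOpen (G.ψ i ⁻¹' U)
  isOpen_univ i := isOpen_univ
  isOpen_inter _ _ h h' i := (h i).inter (h' i)
  isOpen_sUnion s h i := by
    rw [preimage_sUnion]
    exact isOpen_biUnion fun t ht => h t ht i

lemma smooth_trans (i j : G.ι) (x : G.O i) (y : G.O j) (h : G.ψ i x = G.ψ j y) :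
    ∃ g : G.O i → G.O j, ContMDiffAt Y.I Y.I ∞ g x ∧ g x = y ∧
      ∀ᶠ x' in 𝓝 x, G.ψ i x' = G.ψ j (g x') := by
  obtain ⟨U, f, hU, hxU, hf, hψ⟩ := G.trans i j x y h
  classical
  let g : G.O i → G.O j := fun x' => if hx : (x' : Y) ∈ U then
    ⟨f x', (hψ x' hx x'.2).1⟩ else y
  have hgU : ∀ x' : G.O i, (x' : Y) ∈ U → ((g x' : Y) = f x' ∧ G.ψ i x' = G.ψ j (g x')) := by
    intro x' hx
    have : g x' = ⟨f x', (hψ x' hx x'.2).1⟩ := dif_pos hx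
    rw [this]
    exact ⟨rfl, (hψ x' hx x'.2).2⟩
  have hev : ∀ᶠ x' : G.O i in 𝓝 x, (x' : Y) ∈ U :=
    continuous_subtype_val.continuousAt.preimage_mem_nhds (hU.mem_nhds hxU)
  refine ⟨g, ?_, ?_, hev.mono fun x' hx => (hgU x' hx).2⟩
  · rw [Mfd.contMDiffAt_opens_iff]
    have h1 : ContMDiffAt Y.I Y.I ∞ (fun x' : G.O i => f x') x :=
      ContMDiffAt.comp x (hf.contMDiffAt (hU.mem_nhds hxU))
        (contMDiff_subtype_val (I := Y.I)).contMDiffAt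
    exact h1.congr_of_eventuallyEq (hev.mono fun x' hx => (hgU x' hx).1)
  · exact G.inj j ((hgU x hxU).2.symm.trans h)

lemma isOpenEmbedding (i : G.ι) : @IsOpenEmbedding _ _ _ G.top (G.ψ i) := by
  letI := G.top
  refine IsOpenEmbedding.of_continuous_injective_isOpenMap ?_ (G.inj i) ?_
  · exact continuous_def.2 fun U hU => hU i
  · intro V hV j
    rw [isOpen_iff_mem_nhds]
    rintro y ⟨x, hxV, hx⟩
    obtain ⟨g, hg, hgy, hev⟩ := G.smooth_trans j i y x hx.symm
    have := hg.continuousAt.preimage_mem_nhds (hV.mem_nhds (hgy ▸ hxV : g y ∈ V))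
    filter_upwards [this, hev] with y' hy' h'
    exact ⟨g y', hy', h'.symm⟩

/-- The chart of the glued space around a point. -/
def chart (i : G.ι) (x : G.O i) :
    letI := G.top
    OpenPartialHomeomorph T (𝔼 Y.dim) :=
  letI := G.top
  have : Nonempty (G.O i) := ⟨x⟩
  ((G.isOpenEmbedding i).toOpenPartialHomeomorph).symm ≫ₕ chartAt (𝔼 Y.dim) x

lemma embedding_symm_apply (i : G.ι) [Nonempty (G.O i)] (x : G.O i) (t : T) (h : G.ψ i x = t) :
    letI := G.top
    ((G.isOpenEmbedding i).toOpenPartialHomeomorph).symm t = x := by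
  letI := G.top
  subst h
  exact ((G.isOpenEmbedding _).toOpenPartialHomeomorph).left_inv (mem_univ _)

/-- The charted space structure of the glued space. -/
@[reducible] def charted :
    letI := G.top
    ChartedSpace (𝔼 Y.dim) T :=
  letI := G.top
  { atlas := {c | ∃ i x, c = G.chart i x}
    chartAt := fun t => G.chart (G.surj t).choose (G.surj t).choose_spec.choose
    mem_chart_source := fun t => by
      have h := (G.surj t).choose_spec.choose_spec
      refine ⟨⟨_, mem_univ _, h⟩, ?_⟩
      have : Nonempty (G.O (G.surj t).choose) := ⟨(G.surj t).choose_spec.choose⟩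
      have h2 := G.embedding_symm_apply _ _ t h
      rw [Set.mem_preimage]
      erw [h2]
      exact mem_chart_source _ _
    chart_mem_atlas := fun t => ⟨_, _, rfl⟩ }

lemma contMDiffAt_symm_comp (i j : G.ι) [Nonempty (G.O j)] (x : G.O i) (y : G.O j)
    (h : G.ψ i x = G.ψ j y) :
    letI := G.top
    ContMDiffAt Y.I Y.I ∞
      (fun x' => ((G.isOpenEmbedding j).toOpenPartialHomeomorph).symm (G.ψ i x')) x := by
  letI := G.top
  obtain ⟨g, hg, -, hev⟩ := G.smooth_trans i j x y h
  refine hg.congr_of_eventuallyEq (hev.mono fun x' hx' => ?_)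
  exact G.embedding_symm_apply j (g x') _ hx'.symm

lemma isManifold :
    letI := G.top
    letI := G.charted
    IsManifold Y.I ∞ T := by
  letI := G.top
  letI := G.charted
  refine isManifold_of_contDiffOn _ _ _ ?_
  rintro _ _ ⟨i, x, rfl⟩ ⟨j, y, rfl⟩
  have : Nonempty (G.O i) := ⟨x⟩
  have : Nonempty (G.O j) := ⟨y⟩
  rw [← contMDiffOn_iff_contDiffOn]
  rintro z ⟨hz, -⟩
  refine ContMDiffAt.contMDiffWithinAt ?_
  set c := chartAt (𝔼 Y.dim) x with hc
  set c' := chartAt (𝔼 Y.dim) y with hc'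
  obtain ⟨⟨hz1, -⟩, ⟨y', -, hy'⟩, hz3⟩ := hz
  have h1 : ContMDiffAt 𝓘(ℝ, 𝔼 Y.dim) Y.I ∞ c.symm z :=
    (contMDiffOn_chart_symm (I := Y.I)).contMDiffAt (c.open_target.mem_nhds hz1)
  have h2 := G.contMDiffAt_symm_comp i j (c.symm z) y' hy'.symm
  have h3 : ContMDiffAt Y.I 𝓘(ℝ, 𝔼 Y.dim) ∞ c'
      (((G.isOpenEmbedding j).toOpenPartialHomeomorph).symm (G.ψ i (c.symm z))) :=
    (contMDiffOn_chart (I := Y.I)).contMDiffAt (c'.open_source.mem_nhds hz3)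
  have h4 := ContMDiffAt.comp z h2 h1
  have h5 := ContMDiffAt.comp (g := c') z h3 h4
  exact h5

/-- The glued manifold. -/
def mfd : Mfd :=
  letI := G.top
  letI := G.charted
  have := G.isManifold
  { carrier := T, dim := Y.dim }

lemma contMDiffAt_chart_comp (i j : G.ι) (x : G.O i) (y : G.O j) (h : G.ψ j y = G.ψ i x) :
    letI := G.top
    ContMDiffAt Y.I 𝓘(ℝ, 𝔼 Y.dim) ∞ (fun x' => G.chart j y (G.ψ i x')) x := by
  letI := G.top
  have : Nonempty (G.O j) := ⟨y⟩
  have h3 : ContMDiffAt Y.I 𝓘(ℝ, 𝔼 Y.dim) ∞ (chartAt (𝔼 Y.dim) y)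
      (((G.isOpenEmbedding j).toOpenPartialHomeomorph).symm (G.ψ i x)) := by
    rw [G.embedding_symm_apply j y _ h]
    exact (contMDiffOn_chart (I := Y.I)).contMDiffAt
      ((chartAt _ y).open_source.mem_nhds (mem_chart_source _ y))
  have h2 := G.contMDiffAt_symm_comp i j x y h.symm
  have h4 := ContMDiffAt.comp (g := chartAt (𝔼 Y.dim) y) x h3 h2
  exact h4

lemma contMDiff_ψ (i : G.ι) : ContMDiff (Y.opn (G.O i)).I G.mfd.I ∞
    (fun x : Y.opn (G.O i) => (show G.mfd from G.ψ i x)) := by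
  letI := G.top
  intro x
  rw [contMDiffAt_iff_target]
  exact ⟨(G.isOpenEmbedding i).continuous.continuousAt, G.contMDiffAt_chart_comp i _ x _
    (G.surj (G.ψ i x)).choose_spec.choose_spec⟩

lemma contMDiffAt_ψ_symm (i : G.ι) (x : G.O i) [Nonempty (G.O i)] :
    letI := G.top
    ContMDiffAt G.mfd.I (Y.opn (G.O i)).I ∞ (fun t : G.mfd =>
      (show Y.opn (G.O i) from ((G.isOpenEmbedding i).toOpenPartialHomeomorph).symm t))
      (show G.mfd from G.ψ i x) := by
  letI := G.top
  rw [contMDiffAt_iff_source, ModelWithCorners.range_eq_univ, contMDiffWithinAt_univ]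
  have h := (G.surj (G.ψ i x)).choose_spec.choose_spec
  set j := (G.surj (G.ψ i x)).choose
  set y := (G.surj (G.ψ i x)).choose_spec.choose
  have : Nonempty (G.O j) := ⟨y⟩
  have h2 := G.contMDiffAt_symm_comp j i y x h
  set c := chartAt (𝔼 Y.dim) y with hc
  have hz : extChartAt G.mfd.I (show G.mfd from G.ψ i x) (show G.mfd from G.ψ i x) = c y := by
    change c (((G.isOpenEmbedding j).toOpenPartialHomeomorph).symm (G.ψ i x)) = c y
    rw [G.embedding_symm_apply j y _ h]
  rw [hz]
  have hcy : c.symm (c y) = y := c.left_inv (mem_chart_source _ _)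
  have h1 : ContMDiffAt 𝓘(ℝ, 𝔼 Y.dim) Y.I ∞ c.symm (c y) :=
    (contMDiffOn_chart_symm (I := Y.I)).contMDiffAt
      (c.open_target.mem_nhds (c.map_source (mem_chart_source _ _)))
  rw [← hcy] at h2
  have h3 := ContMDiffAt.comp (f := c.symm) (c y) h2 h1
  exact h3

/-- The charts as morphisms. -/
def map (i : G.ι) : Y.opn (G.O i) ⟶ G.mfd := Mfd.mk' (S := Y.opn (G.O i)) (G.ψ i) (G.contMDiff_ψ i)

lemma isEt_map (i : G.ι) : Mfd.IsEt (G.map i) := by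
  letI := G.top
  intro x
  have : Nonempty (G.O i) := ⟨x⟩
  let φ := (G.isOpenEmbedding i).toOpenPartialHomeomorph
  refine ⟨{ toPartialEquiv := φ.toPartialEquiv, open_source := φ.open_source
            open_target := φ.open_target
            contMDiffOn_toFun := (G.contMDiff_ψ i).contMDiffOn
            contMDiffOn_invFun := ?_ }, mem_univ _, fun _ _ => rfl⟩
  rintro _ ⟨x', -, rfl⟩
  exact (G.contMDiffAt_ψ_symm i x').contMDiffWithinAt

lemma map_injective (i : G.ι) : Injective (G.map i) := G.inj i

lemma exists_map_eq (t : G.mfd) : ∃ i x, G.map i x = t := G.surj t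

end GlueCore

namespace Mfd

open Set

lemma exists_submersion_chart {N M : Mfd} (t : N ⟶ M) (ht : IsSubm t) (n₀ : N) :
    ∃ Φ : OpenPartialHomeomorph N (M × 𝔼 (N.dim - M.dim)),
      n₀ ∈ Φ.source ∧ (∀ n ∈ Φ.source, (Φ n).1 = t n) ∧
      ContMDiffOn N.I (M.I.prod 𝓘(ℝ, 𝔼 (N.dim - M.dim))) ∞ Φ Φ.source ∧
      ContMDiffOn (M.I.prod 𝓘(ℝ, 𝔼 (N.dim - M.dim))) N.I ∞ Φ.symm Φ.target := by
  let En := 𝔼 N.dim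
  let Em := 𝔼 M.dim
  let c₀ := chartAt En n₀
  let d := chartAt Em (t n₀)
  let c := c₀.restrOpen (t ⁻¹' d.source) (d.open_source.preimage (continuous t))
  have hn₀ : n₀ ∈ c.source := ⟨mem_chart_source _ _, mem_chart_source _ _⟩
  let f : En → Em := fun z => d (t (c₀.symm z))
  have hct : ∀ z ∈ c.target, z ∈ c₀.target ∧ t (c₀.symm z) ∈ d.source := fun z hz => by
    have h1 := c.map_target hz
    have h2 := c.right_inv hz
    refine ⟨?_, h1.2⟩
    rw [← h2]
    exact c₀.map_source h1.1
  have hf : ContMDiffOn 𝓘(ℝ, En) 𝓘(ℝ, Em) ∞ f c.target := by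
    intro z hz
    obtain ⟨h1, h2⟩ := hct z hz
    have k1 : ContMDiffAt 𝓘(ℝ, En) N.I ∞ c₀.symm z :=
      (contMDiffOn_chart_symm (I := N.I)).contMDiffAt (c₀.open_target.mem_nhds h1)
    have k2 : ContMDiffAt M.I 𝓘(ℝ, Em) ∞ d (t (c₀.symm z)) :=
      (contMDiffOn_chart (I := M.I)).contMDiffAt (d.open_source.mem_nhds h2)
    have k3 := ContMDiffAt.comp z (smooth t (c₀.symm z)) k1
    exact (ContMDiffAt.comp (g := d) z k2 k3).contMDiffWithinAt
  rw [contMDiffOn_iff_contDiffOn] at hf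
  let z₀ := c₀ n₀
  have hz₀ : z₀ ∈ c.target := c.map_source hn₀
  have hfat : ∀ z ∈ c.target, ContDiffAt ℝ ∞ f z := fun z hz =>
    hf.contDiffAt (c.open_target.mem_nhds hz)
  have hder : fderiv ℝ f z₀ = mfderiv N.I M.I t n₀ := by
    have h := ((smooth t).mdifferentiableAt (x := n₀) (by simp)).hasMFDerivAt.2
    rw [ModelWithCorners.range_eq_univ] at h
    have h' : HasFDerivAt f (mfderiv N.I M.I t n₀ : En →L[ℝ] Em) z₀ := hasFDerivWithinAt_univ.1 h
    exact HasFDerivAt.fderiv (E := 𝔼 N.dim) (F := 𝔼 M.dim) h'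
  let f' : En →L[ℝ] Em := fderiv ℝ f z₀
  have hsurj : Function.Surjective f' := by
    have := ht n₀
    rwa [← hder] at this
  obtain ⟨hk, hle⟩ : Module.finrank ℝ (f' : En →ₗ[ℝ] Em).ker = N.dim - M.dim ∧ M.dim ≤ N.dim := by
    have h1 := LinearMap.finrank_range_add_finrank_ker (f' : En →ₗ[ℝ] Em)
    rw [LinearMap.range_eq_top.2 hsurj, finrank_top, finrank_euclideanSpace_fin,
      finrank_euclideanSpace_fin] at h1
    omega
  let Ek := 𝔼 (N.dim - M.dim)
  let κ : (f' : En →ₗ[ℝ] Em).ker ≃L[ℝ] Ek := ContinuousLinearEquiv.ofFinrankEq (by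
    rw [hk, finrank_euclideanSpace_fin])
  obtain ⟨pr₀, hpr₀⟩ := LinearMap.exists_leftInverse_of_injective
    ((f' : En →ₗ[ℝ] Em).ker.subtype) (Submodule.ker_subtype _)
  let pr : En →L[ℝ] Ek := κ.toContinuousLinearMap.comp (LinearMap.toContinuousLinearMap pr₀)
  have hprod : Injective (f'.prod pr) := by
    rw [injective_iff_map_eq_zero]
    intro v hv
    have h1 : pr₀ v = 0 := κ.injective (by simpa [pr] using congrArg Prod.snd hv)
    have h2 := LinearMap.congr_fun hpr₀ ⟨v, congrArg Prod.fst hv⟩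
    simp only [LinearMap.comp_apply, Submodule.subtype_apply, LinearMap.id_apply] at h2
    rw [h1] at h2
    exact (congrArg Subtype.val h2).symm
  have hbij : Function.Bijective (f'.prod pr) := by
    refine ⟨hprod, ?_⟩
    have hfr : Module.finrank ℝ En = Module.finrank ℝ (Em × Ek) := by
      rw [Module.finrank_prod, finrank_euclideanSpace_fin, finrank_euclideanSpace_fin,
        finrank_euclideanSpace_fin]
      omega
    exact (LinearMap.injective_iff_surjective_of_finrank_eq_finrank
      (f := ((f'.prod pr : En →L[ℝ] Em × Ek) : En →ₗ[ℝ] Em × Ek)) hfr).1 hprod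
  let F : En → Em × Ek := fun z => (f z, pr z)
  have hFat : ∀ z ∈ c.target, ContDiffAt ℝ ∞ F z := fun z hz =>
    (hfat z hz).prodMk pr.contDiff.contDiffAt
  let F' : En ≃L[ℝ] Em × Ek := ContinuousLinearEquiv.ofBijective (f'.prod pr)
    (LinearMap.ker_eq_bot.2 hbij.1) (LinearMap.range_eq_top.2 hbij.2)
  have hF' : HasFDerivAt F (F' : En →L[ℝ] Em × Ek) z₀ := by
    have h1 : HasFDerivAt f f' z₀ := ((hfat z₀ hz₀).differentiableAt (by simp)).hasFDerivAt
    have h2 : HasFDerivAt F (f'.prod pr) z₀ := h1.prodMk pr.hasFDerivAt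
    have h3 : (F' : En →L[ℝ] Em × Ek) = f'.prod pr := ContinuousLinearEquiv.coe_ofBijective _ _ _
    rwa [h3]
  let Ψ₀ := (hFat z₀ hz₀).toOpenPartialHomeomorph F hF' (by simp)
  have hinv : IsOpen (c.target ∩ (fderiv ℝ F) ⁻¹' (range ((↑) : (En ≃L[ℝ] Em × Ek) → _))) := by
    have hcont : ContinuousOn (fderiv ℝ F) c.target :=
      ContDiffOn.continuousOn_fderiv_of_isOpen (n := ∞) (fun z hz => (hFat z hz).contDiffWithinAt)
        c.open_target (by simp)
    exact hcont.isOpen_inter_preimage c.open_target (ContinuousLinearEquiv.isOpen)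
  let Ψ := Ψ₀.restrOpen _ hinv
  have hΨsymm : ContMDiffOn 𝓘(ℝ, Em × Ek) 𝓘(ℝ, En) ∞ Ψ.symm Ψ.target := by
    rw [contMDiffOn_iff_contDiffOn]
    intro a ha
    obtain ⟨h1, h2, F₁, hF₁⟩ := Ψ.map_target ha
    refine (Ψ.contDiffAt_symm (f₀' := F₁) ha ?_ (hFat _ h2)).contDiffWithinAt
    rw [hF₁]
    exact ((hFat _ h2).differentiableAt (by simp)).hasFDerivAt
  let δ : OpenPartialHomeomorph (Em × Ek) (M × Ek) := d.symm.prod (OpenPartialHomeomorph.refl Ek)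
  let Φ := (c.trans Ψ).trans δ
  have hΦ : ∀ n ∈ Φ.source, Φ n = (t n, pr (c₀ n)) := by
    intro n hn
    have h1 : n ∈ c.source := hn.1.1
    refine Prod.ext ?_ rfl
    change d.symm (d (t (c₀.symm (c₀ n)))) = t n
    rw [c₀.left_inv h1.1, d.left_inv h1.2]
  refine ⟨Φ, ?_, fun n hn => by rw [hΦ n hn], ?_, ?_⟩
  · refine ⟨⟨hn₀, ?_, hz₀, ⟨F', hF'.fderiv.symm⟩⟩, ?_, mem_univ _⟩
    · exact (hFat z₀ hz₀).mem_toOpenPartialHomeomorph_source hF' (by simp)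
    · change d (t (c₀.symm (c₀ n₀))) ∈ d.target
      rw [c₀.left_inv (mem_chart_source _ _)]
      exact d.map_source (mem_chart_source _ _)
  · refine ContMDiffOn.congr ?_ hΦ
    refine ((smooth t).contMDiffOn).prodMk ?_
    refine pr.contMDiff.comp_contMDiffOn ?_
    exact (contMDiffOn_chart (I := N.I)).mono fun n hn => hn.1.1.1
  · have h1 : ContMDiffOn (M.I.prod 𝓘(ℝ, Ek)) 𝓘(ℝ, Em × Ek) ∞ δ.symm Φ.target := by
      have k1 : ContMDiffOn (M.I.prod 𝓘(ℝ, Ek)) 𝓘(ℝ, Em) ∞ (fun q : M × Ek => d q.1) Φ.target :=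
        ContMDiffOn.comp (contMDiffOn_chart (I := M.I)) contMDiffOn_fst (fun q hq => hq.1.1)
      exact k1.prodMk_space contMDiffOn_snd
    have h2 := hΨsymm.comp h1 (fun q hq => hq.2.1)
    have h3 : ContMDiffOn 𝓘(ℝ, En) N.I ∞ c.symm c.target :=
      (contMDiffOn_chart_symm (I := N.I)).mono fun z hz => (hct z hz).1
    exact h3.comp h2 (fun q hq => hq.2.2)

/-- Euclidean space as a manifold. -/
abbrev euc (n : ℕ) : Mfd where
  carrier := 𝔼 n
  dim := n

/-- A point of an open subset. -/
def opnMk {S : Mfd} {U : Opens S} (x : S) (h : x ∈ U) : S.opn U := (⟨x, h⟩ : U)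

lemma contMDiffAt_of_comp_isEt {S T Z : Mfd} {f : S → T} {g : T → Z} {x : S}
    (hf : IsLocalDiffeomorphAt S.I T.I ∞ f x)
    (hg : ContMDiffAt S.I Z.I ∞ (fun y => g (f y)) x) : ContMDiffAt T.I Z.I ∞ g (f x) := by
  obtain ⟨Φ, hx, hΦ⟩ := hf
  have hfx : f x = Φ x := hΦ hx
  have hmem : f x ∈ Φ.target := hfx ▸ Φ.map_source hx
  have hinv : Φ.symm (f x) = x := by
    rw [hfx]
    exact Φ.left_inv hx
  have h1 : ContMDiffAt T.I S.I ∞ Φ.symm (f x) :=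
    Φ.contMDiffOn_invFun.contMDiffAt (Φ.open_target.mem_nhds hmem)
  rw [← hinv] at hg
  refine (ContMDiffAt.comp (f x) hg h1).congr_of_eventuallyEq ?_
  filter_upwards [Φ.open_target.mem_nhds hmem] with y hy
  have h2 : f (Φ.symm y) = y := (hΦ (Φ.map_target hy)).trans (Φ.right_inv hy)
  exact congrArg g h2.symm

section Pull

variable {S N M : Mfd} (f : S ⟶ M) (t : N ⟶ M) (ht : IsSubm t)

/-- The points of the fibre product of two smooth maps. -/
abbrev PullPts : Type := {p : S × N // f p.1 = t p.2}

/-- A chart of `N` around a point in which the submersion `t` is a projection. -/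
def sChart (n : N) : OpenPartialHomeomorph N (M × 𝔼 (N.dim - M.dim)) :=
  (exists_submersion_chart t ht n).choose

lemma mem_sChart (n : N) : n ∈ (sChart t ht n).source :=
  (exists_submersion_chart t ht n).choose_spec.1

lemma sChart_fst (n n' : N) (h : n' ∈ (sChart t ht n).source) : (sChart t ht n n').1 = t n' :=
  (exists_submersion_chart t ht n).choose_spec.2.1 n' h

lemma sChart_smooth (n : N) : ContMDiffOn N.I (M.I.prod 𝓘(ℝ, 𝔼 (N.dim - M.dim))) ∞ (sChart t ht n)
      (sChart t ht n).source :=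
  (exists_submersion_chart t ht n).choose_spec.2.2.1

lemma sChart_symm_smooth (n : N) :
    ContMDiffOn (M.I.prod 𝓘(ℝ, 𝔼 (N.dim - M.dim))) N.I ∞ (sChart t ht n).symm
      (sChart t ht n).target :=
  (exists_submersion_chart t ht n).choose_spec.2.2.2

lemma sChart_symm_tgt (n : N) (q) (h : q ∈ (sChart t ht n).target) :
    t ((sChart t ht n).symm q) = q.1 := by
  rw [← sChart_fst t ht n _ ((sChart t ht n).map_target h), (sChart t ht n).right_inv h]

/-- The dimension of a fibre product. -/
abbrev pullDim (S N M : Mfd) : ℕ := S.dim + (N.dim - M.dim)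

/-- Splitting of coordinates on a fibre product. -/
abbrev pullSplit (S N M : Mfd) : 𝔼 (pullDim S N M) ≃L[ℝ] 𝔼 S.dim × 𝔼 (N.dim - M.dim) :=
  EuclideanSpace.finAddEquivProd

/-- The parametrization of the pairs near `p`, on its domain `pullDom`. -/
def pullPar (p : PullPts f t) (y : 𝔼 (pullDim S N M)) : S × N :=
  ((chartAt (𝔼 S.dim) p.1.1).symm (pullSplit S N M y).1, (sChart t ht p.1.2).symm
      (f ((chartAt (𝔼 S.dim) p.1.1).symm (pullSplit S N M y).1), (pullSplit S N M y).2))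

def pullDomSet (p : PullPts f t) : Set (euc (pullDim S N M)) :=
  {y | (pullSplit S N M y).1 ∈ (chartAt (𝔼 S.dim) p.1.1).target ∧
    (f ((chartAt (𝔼 S.dim) p.1.1).symm (pullSplit S N M y).1),
        (pullSplit S N M y).2) ∈ (sChart t ht p.1.2).target}

lemma smoothOn_pullPar_fst (p : PullPts f t) : ContMDiffOn (euc (pullDim S N M)).I S.I ∞
      (fun y => (chartAt (𝔼 S.dim) p.1.1).symm (pullSplit S N M y).1)
      {y | (pullSplit S N M y).1 ∈ (chartAt (𝔼 S.dim) p.1.1).target} := by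
  have h1 : ContMDiff (euc (pullDim S N M)).I 𝓘(ℝ, 𝔼 S.dim) ∞
      (fun y : euc (pullDim S N M) => (pullSplit S N M y).1) :=
    ((ContinuousLinearMap.fst ℝ _ _).comp (pullSplit S N M).toContinuousLinearMap).contMDiff
  exact ContMDiffOn.comp (contMDiffOn_chart_symm (I := S.I)) h1.contMDiffOn fun y hy => hy

lemma isOpen_pullFstSet (p : PullPts f t) : IsOpen {y : euc (pullDim S N M) |
    (pullSplit S N M y).1 ∈ (chartAt (𝔼 S.dim) p.1.1).target} :=
  (chartAt (𝔼 S.dim) p.1.1).open_target.preimage (continuous_fst.comp (pullSplit S N M).continuous)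

lemma smoothOn_pullPar_mid (p : PullPts f t) : ContMDiffOn (euc (pullDim S N M)).I
      (M.I.prod 𝓘(ℝ, 𝔼 (N.dim - M.dim))) ∞
      (fun y => (f ((chartAt (𝔼 S.dim) p.1.1).symm (pullSplit S N M y).1), (pullSplit S N M y).2))
      {y | (pullSplit S N M y).1 ∈ (chartAt (𝔼 S.dim) p.1.1).target} := by
  have h2 : ContMDiff (euc (pullDim S N M)).I 𝓘(ℝ, 𝔼 (N.dim - M.dim)) ∞
      (fun y : euc (pullDim S N M) => (pullSplit S N M y).2) :=
    ((ContinuousLinearMap.snd ℝ _ _).comp (pullSplit S N M).toContinuousLinearMap).contMDiff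
  exact ((smooth f).comp_contMDiffOn (smoothOn_pullPar_fst f t p)).prodMk h2.contMDiffOn

lemma isOpen_pullDomSet (p : PullPts f t) : IsOpen (pullDomSet f t ht p) :=
  (smoothOn_pullPar_mid f t p).continuousOn.isOpen_inter_preimage (isOpen_pullFstSet f t p)
    (sChart t ht p.1.2).open_target

def pullDom (p : PullPts f t) : Opens (euc (pullDim S N M)) :=
  ⟨pullDomSet f t ht p, isOpen_pullDomSet f t ht p⟩

lemma smoothOn_pullPar_snd (p : PullPts f t) :
    ContMDiffOn (euc (pullDim S N M)).I N.I ∞ (fun y => (pullPar f t ht p y).2)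
      (pullDomSet f t ht p) :=
  (sChart_symm_smooth t ht p.1.2).comp ((smoothOn_pullPar_mid f t p).mono fun _ hy => hy.1)
    fun _ hy => hy.2

lemma pullPar_mem (p : PullPts f t) (y : pullDom f t ht p) :
    f (pullPar f t ht p y).1 = t (pullPar f t ht p y).2 :=
  (sChart_symm_tgt t ht p.1.2 _ y.2.2).symm

/-- The inverse of `pullPar`, as a function on `S × N`. -/
def pullRet (p : PullPts f t) (q : S × N) : euc (pullDim S N M) :=
  (pullSplit S N M).symm (chartAt (𝔼 S.dim) p.1.1 q.1, (sChart t ht p.1.2 q.2).2)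

def pullRetSet (p : PullPts f t) : Set (S × N) := {q | q.1 ∈ (chartAt (𝔼 S.dim) p.1.1).source ∧
    q.2 ∈ (sChart t ht p.1.2).source}

lemma isOpen_pullRetSet (p : PullPts f t) : IsOpen (pullRetSet f t ht p) :=
  ((chartAt (𝔼 S.dim) p.1.1).open_source.preimage continuous_fst).inter
    ((sChart t ht p.1.2).open_source.preimage continuous_snd)

lemma smoothOn_pullRet (p : PullPts f t) :
    ContMDiffOn (S.I.prod N.I) (euc (pullDim S N M)).I ∞ (pullRet f t ht p)
      (pullRetSet f t ht p) := by
  have h1 : ContMDiffOn (S.I.prod N.I) 𝓘(ℝ, 𝔼 S.dim) ∞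
      (fun q : S × N => chartAt (𝔼 S.dim) p.1.1 q.1) (pullRetSet f t ht p) :=
    ContMDiffOn.comp (contMDiffOn_chart (I := S.I)) contMDiffOn_fst fun q hq => hq.1
  have h2 : ContMDiffOn (S.I.prod N.I) 𝓘(ℝ, 𝔼 (N.dim - M.dim)) ∞
      (fun q : S × N => (sChart t ht p.1.2 q.2).2) (pullRetSet f t ht p) :=
    contMDiff_snd.comp_contMDiffOn
      (ContMDiffOn.comp (sChart_smooth t ht p.1.2) contMDiffOn_snd fun q hq => hq.2)
  exact ((pullSplit S N M).symm.toContinuousLinearMap.contMDiff).comp_contMDiffOn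
    (h1.prodMk_space h2)

lemma pullRet_mem (p : PullPts f t) (q : PullPts f t) (hq : q.1 ∈ pullRetSet f t ht p) :
    pullRet f t ht p q.1 ∈ pullDom f t ht p ∧ pullPar f t ht p (pullRet f t ht p q.1) = q.1 := by
  have h1 : (chartAt (𝔼 S.dim) p.1.1).symm (pullSplit S N M (pullRet f t ht p q.1)).1 = q.1.1 := by
    rw [pullRet, ContinuousLinearEquiv.apply_symm_apply]
    exact (chartAt _ _).left_inv hq.1
  have h2 : (f ((chartAt (𝔼 S.dim) p.1.1).symm
      (pullSplit S N M (pullRet f t ht p q.1)).1), (pullSplit S N M (pullRet f t ht p q.1)).2) =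
      sChart t ht p.1.2 q.1.2 := by
    rw [h1, q.2, ← sChart_fst t ht _ _ hq.2, pullRet, ContinuousLinearEquiv.apply_symm_apply]
  refine ⟨⟨?_, ?_⟩, ?_⟩
  · rw [pullRet, ContinuousLinearEquiv.apply_symm_apply]
    exact (chartAt _ _).map_source hq.1
  · rw [h2]
    exact (sChart t ht p.1.2).map_source hq.2
  · rw [pullPar, h2, h1, (sChart t ht p.1.2).left_inv hq.2]

lemma pullPar_memRet (p : PullPts f t) (y : pullDom f t ht p) :
    pullPar f t ht p y ∈ pullRetSet f t ht p ∧ pullRet f t ht p (pullPar f t ht p y) = y := by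
  refine ⟨⟨(chartAt _ _).map_target y.2.1, (sChart t ht p.1.2).map_target y.2.2⟩, ?_⟩
  rw [pullRet, pullPar]
  rw [(chartAt (𝔼 S.dim) p.1.1).right_inv y.2.1, (sChart t ht p.1.2).right_inv y.2.2]
  exact ContinuousLinearEquiv.symm_apply_apply _ _

lemma self_mem_pullRetSet (p : PullPts f t) : p.1 ∈ pullRetSet f t ht p :=
  ⟨mem_chart_source _ _, mem_sChart t ht _⟩

lemma continuousOn_pullPar (p : PullPts f t) :
    ContinuousOn (pullPar f t ht p) (pullDomSet f t ht p) :=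
  ((smoothOn_pullPar_fst f t p).continuousOn.mono fun _ hy => hy.1).prodMk
    (smoothOn_pullPar_snd f t ht p).continuousOn

/-- The charts of the fibre product. -/
def pullCore : GlueCore.{0} (euc (pullDim S N M)) (PullPts f t) where
  ι := PullPts f t
  O := pullDom f t ht
  ψ p y := ⟨pullPar f t ht p y, pullPar_mem f t ht p y⟩
  inj p y y' h := Subtype.ext (by
    have h' : pullPar f t ht p y = pullPar f t ht p y' := congrArg Subtype.val h
    rw [← (pullPar_memRet f t ht p y).2, ← (pullPar_memRet f t ht p y').2, h'])
  surj p := ⟨p, ⟨_, (pullRet_mem f t ht p p (self_mem_pullRetSet f t ht p)).1⟩,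
    Subtype.ext (pullRet_mem f t ht p p (self_mem_pullRetSet f t ht p)).2⟩
  trans p p' y y' h := by
    have h' : pullPar f t ht p y = pullPar f t ht p' y' := congrArg Subtype.val h
    refine ⟨pullDomSet f t ht p ∩ pullPar f t ht p ⁻¹' pullRetSet f t ht p',
      fun z => pullRet f t ht p' (pullPar f t ht p z),
      (continuousOn_pullPar f t ht p).isOpen_inter_preimage (isOpen_pullDomSet f t ht p)
        (isOpen_pullRetSet f t ht p'), ⟨y.2, ?_⟩, ?_, ?_⟩
    · change pullPar f t ht p y ∈ pullRetSet f t ht p'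
      rw [h']
      exact (pullPar_memRet f t ht p' y').1
    · refine (smoothOn_pullRet f t ht p').comp ?_ fun z hz => hz.2
      exact ((smoothOn_pullPar_fst f t p).mono fun _ hy => hy.1.1).prodMk
        ((smoothOn_pullPar_snd f t ht p).mono fun _ hy => hy.1)
    · intro z hz hzO
      have := pullRet_mem f t ht p' ⟨pullPar f t ht p z, pullPar_mem f t ht p ⟨z, hzO⟩⟩ hz.2
      exact ⟨this.1, Subtype.ext this.2.symm⟩

/-- The fibre product of a smooth map and a submersion. -/
def pull : Mfd := (pullCore f t ht).mfd

/-- A pair of points as a point of the fibre product. -/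
def pullMk (a : S) (b : N) (h : f a = t b) : pull f t ht := (⟨(a, b), h⟩ : PullPts f t)

/-- The pair of points underlying a point of the fibre product. -/
def pullVal (p : pull f t ht) : PullPts f t := p

/-- The parametrizations of the fibre product. -/
def pullMap (p : PullPts f t) : (euc (pullDim S N M)).opn (pullDom f t ht p) ⟶ pull f t ht :=
  (pullCore f t ht).map p

lemma contMDiff_of_pull {Z : Mfd} (g : pull f t ht → Z)
    (h : ∀ p : PullPts f t, ContMDiff ((euc (pullDim S N M)).opn (pullDom f t ht p)).I Z.I ∞
      (fun y => g (pullMap f t ht p y))) :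
    ContMDiff (pull f t ht).I Z.I ∞ g := by
  intro p
  obtain ⟨i, y, rfl⟩ := (pullCore f t ht).exists_map_eq p
  exact contMDiffAt_of_comp_isEt ((pullCore f t ht).isEt_map i y) (h i y)

lemma contMDiff_opn_of_contMDiffOn {Y Z : Mfd} {U : Opens Y} {g : Y → Z}
    (h : ContMDiffOn Y.I Z.I ∞ g U) : ContMDiff (Y.opn U).I Z.I ∞ (fun y => g (Y.incl U y)) :=
  ContMDiffOn.comp_contMDiff h (smooth (Y.incl U)) fun y : U => y.2

/-- The first projection of a fibre product. -/
def pullFst : pull f t ht ⟶ S := mk' (fun p => (pullVal f t ht p).1.1)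
  (contMDiff_of_pull f t ht _ fun p => contMDiff_opn_of_contMDiffOn (U := pullDom f t ht p)
    (g := fun y => (pullPar f t ht p y).1) ((smoothOn_pullPar_fst f t p).mono fun _ hy => hy.1))

/-- The second projection of a fibre product. -/
def pullSnd : pull f t ht ⟶ N := mk' (fun p => (pullVal f t ht p).1.2)
  (contMDiff_of_pull f t ht _ fun p => contMDiff_opn_of_contMDiffOn (U := pullDom f t ht p)
    (g := fun y => (pullPar f t ht p y).2) (smoothOn_pullPar_snd f t ht p))

lemma pull_comm : pullFst f t ht ≫ f = pullSnd f t ht ≫ t :=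
  Mfd.hom_ext fun p => (pullVal f t ht p).2

lemma pull_ext {p p' : pull f t ht} (h : pullFst f t ht p = pullFst f t ht p')
    (h' : pullSnd f t ht p = pullSnd f t ht p') : p = p' :=
  Subtype.ext (Prod.ext h h')

lemma contMDiffOn_of_pull {Z : Mfd} (D : Set (pull f t ht)) (hD : IsOpen D)
    (g : pull f t ht → Z) (hg : ContMDiffOn (pull f t ht).I Z.I ∞ g D) (G : S × N → Z)
    (hG : ∀ p ∈ D, G (pullVal f t ht p).1 = g p) :
    ContMDiffOn (S.I.prod N.I) Z.I ∞ G {q | ∃ h : f q.1 = t q.2, pullMk f t ht q.1 q.2 h ∈ D} := by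
  rintro q ⟨hq, hqD⟩
  let p : PullPts f t := ⟨q, hq⟩
  have hr := pullRet_mem f t ht p p (self_mem_pullRetSet f t ht p)
  let y : (euc (pullDim S N M)).opn (pullDom f t ht p) := opnMk (pullRet f t ht p q) hr.1
  have hy : pullMap f t ht p y = p := Subtype.ext hr.2
  -- `g` in the chart, extended by `pullRet`
  have h1 : ContMDiffAt ((euc (pullDim S N M)).opn (pullDom f t ht p)).I Z.I ∞
      (fun y => g (pullMap f t ht p y)) y := by
    have : ContMDiffAt (pull f t ht).I Z.I ∞ g (pullMap f t ht p y) := by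
      rw [hy]
      exact hg.contMDiffAt (hD.mem_nhds hqD)
    exact ContMDiffAt.comp (g := g) y this (smooth (pullMap f t ht p) y)
  classical
  let g' : 𝔼 (pullDim S N M) → Z := fun z =>
    if hz : z ∈ pullDom f t ht p then g (pullMap f t ht p (⟨z, hz⟩ : pullDom f t ht p))
    else g p
  have h2 : ContMDiffAt (euc (pullDim S N M)).I Z.I ∞ g' (pullRet f t ht p q) := by
    refine (contMDiffAt_subtype_iff (I := (euc (pullDim S N M)).I) (I' := Z.I)
      (U := pullDom f t ht p) (x := y)).1 ?_
    refine ContMDiffAt.congr_of_eventuallyEq h1 (Eventually.of_forall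
      fun z : pullDom f t ht p => ?_)
    exact dif_pos z.2
  have h3 : ContMDiffAt (S.I.prod N.I) (euc (pullDim S N M)).I ∞ (pullRet f t ht p) q :=
    (smoothOn_pullRet f t ht p).contMDiffAt
      ((isOpen_pullRetSet f t ht p).mem_nhds (self_mem_pullRetSet f t ht p))
  refine ((ContMDiffAt.comp q h2 h3).contMDiffWithinAt).congr_of_eventuallyEq_of_mem ?_
    (⟨hq, hqD⟩ : q ∈ {q : S × N | ∃ h : f q.1 = t q.2, pullMk f t ht q.1 q.2 h ∈ D})
  filter_upwards [mem_nhdsWithin_of_mem_nhds ((isOpen_pullRetSet f t ht p).mem_nhds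
    (self_mem_pullRetSet f t ht p)), self_mem_nhdsWithin] with q' hq' hqD'
  obtain ⟨hc, hd⟩ := hqD'
  have hr' := pullRet_mem f t ht p ⟨q', hc⟩ hq'
  have : g' (pullRet f t ht p q') = g (pullMk f t ht q'.1 q'.2 hc) := by
    refine (dif_pos hr'.1).trans (congrArg g ?_)
    exact Subtype.ext hr'.2
  exact (hG _ hd).trans this.symm

/-- A smooth map to the fibre product. -/
def pullLift {Z : Mfd} (a : Z ⟶ S) (b : Z ⟶ N) (h : a ≫ f = b ≫ t) : Z ⟶ pull f t ht :=
  mk' (fun z => pullMk f t ht (a z) (b z) (congrArg (fun k : Z ⟶ M => k z) h)) (by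
    intro z
    let p : PullPts f t := ⟨(a z, b z), congrArg (fun k : Z ⟶ M => k z) h⟩
    have hev : ∀ᶠ z' in 𝓝 z, (a z', b z') ∈ pullRetSet f t ht p :=
      ((continuous a).prodMk (continuous b)).continuousAt.preimage_mem_nhds
        ((isOpen_pullRetSet f t ht p).mem_nhds (self_mem_pullRetSet f t ht p))
    have h3 : ContMDiffAt Z.I (euc (pullDim S N M)).I ∞ (fun z' => pullRet f t ht p (a z', b z')) z :=
      ContMDiffAt.comp (g := pullRet f t ht p) z ((smoothOn_pullRet f t ht p).contMDiffAt
        ((isOpen_pullRetSet f t ht p).mem_nhds (self_mem_pullRetSet f t ht p)))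
        ((smooth a z).prodMk (smooth b z))
    have hmem : ∀ z', (a z', b z') ∈ pullRetSet f t ht p →
        pullRet f t ht p (a z', b z') ∈ pullDom f t ht p ∧
          pullPar f t ht p (pullRet f t ht p (a z', b z')) = (a z', b z') := fun z' hz' =>
      pullRet_mem f t ht p ⟨(a z', b z'), congrArg (fun k : Z ⟶ M => k z') h⟩ hz'
    have hz := hmem z (self_mem_pullRetSet f t ht p)
    classical
    let r : Z → (euc (pullDim S N M)).opn (pullDom f t ht p) := fun z' =>
      if hz' : (a z', b z') ∈ pullRetSet f t ht p then opnMk _ (hmem z' hz').1 else opnMk _ hz.1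
    have h4 : ContMDiffAt Z.I ((euc (pullDim S N M)).opn (pullDom f t ht p)).I ∞ r z := by
      refine (contMDiffAt_opens_iff (I := Z.I) (I' := (euc (pullDim S N M)).I)
        (U := pullDom f t ht p) (f := r)).2 ?_
      refine h3.congr_of_eventuallyEq (hev.mono fun z' hz' => ?_)
      exact congrArg Subtype.val (dif_pos hz')
    have h5 := ContMDiffAt.comp z (smooth (pullMap f t ht p) (r z)) h4
    refine h5.congr_of_eventuallyEq (hev.mono fun z' hz' => ?_)
    have : r z' = opnMk _ (hmem z' hz').1 := dif_pos hz'
    refine Subtype.ext (Eq.trans (hmem z' hz').2.symm ?_)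
    change _ = (pullVal f t ht (pullMap f t ht p (r z'))).1
    rw [this]
    rfl)

lemma isInducing_pullVal : IsInducing (fun p => ((pullVal f t ht p).1 : S × N)) := by
  rw [isInducing_iff_nhds]
  intro p
  refine le_antisymm ?_ ?_
  · exact (((continuous (pullFst f t ht)).prodMk (continuous (pullSnd f t ht))).tendsto p).le_comap
  · intro V hV
    have hr := pullRet_mem f t ht p p (self_mem_pullRetSet f t ht p)
    let y : pullDom f t ht p := ⟨pullRet f t ht p (pullVal f t ht p).1, hr.1⟩
    have hy : pullMap f t ht p y = p := Subtype.ext hr.2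
    have h1 : pullMap f t ht p ⁻¹' V ∈ 𝓝 y := by
      refine (continuous (pullMap f t ht p)).continuousAt.preimage_mem_nhds ?_
      rw [hy]
      exact hV
    obtain ⟨W, hW, hWV⟩ := mem_nhds_subtype _ y _ |>.1 h1
    have h3 : ContinuousAt (pullRet f t ht p) (pullVal f t ht p).1 :=
      ((smoothOn_pullRet f t ht p).continuousOn).continuousAt
        ((isOpen_pullRetSet f t ht p).mem_nhds (self_mem_pullRetSet f t ht p))
    refine ⟨_, inter_mem (h3.preimage_mem_nhds hW)
      ((isOpen_pullRetSet f t ht p).mem_nhds (self_mem_pullRetSet f t ht p)), ?_⟩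
    rintro p' ⟨hp', hp''⟩
    have hr' := pullRet_mem f t ht p p' hp''
    have := hWV (show (⟨_, hr'.1⟩ : pullDom f t ht p) ∈ Subtype.val ⁻¹' W from hp')
    have he : pullMap f t ht p (⟨_, hr'.1⟩ : pullDom f t ht p) = p' := Subtype.ext hr'.2
    change pullMap f t ht p (⟨_, hr'.1⟩ : pullDom f t ht p) ∈ V at this
    rwa [he] at this

end Pull

end Mfd

namespace Stk

/-- The universal object of a chart. -/
abbrev uObj {N : Mfd} (j : rep N ⥤ᵇ Ξ) : Ξ.obj := j.obj (pt (𝟙 N))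

lemma IsFibredInGroupoids.hom_ext (hΞ : IsFibredInGroupoids Ξ) {x y z : Ξ.obj} {R S : Mfd}
    (g : R ⟶ S) {φ φ' : z ⟶ y} (ψ : y ⟶ x) (hφ : Ξ.Lifts g φ) (hφ' : Ξ.Lifts g φ')
    (h : φ ≫ ψ = φ' ≫ ψ) : φ = φ' := by
  have e : Ξ.p.map φ = Ξ.p.map φ' := (IsHomLift.fac' Ξ.p g φ).trans (IsHomLift.fac' Ξ.p g φ').symm
  exact (hΞ.lift (φ ≫ ψ) ψ (Ξ.p.map φ) (Ξ.p.map_comp φ ψ).symm).unique ⟨rfl, rfl⟩ ⟨e.symm, h.symm⟩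

lemma IsFibredInGroupoids.exists_lift (hΞ : IsFibredInGroupoids Ξ) {x y z : Ξ.obj}
    {Z Y X : Mfd} (g : Z ⟶ Y) (f : Y ⟶ X) (φ : z ⟶ x) (ψ : y ⟶ x)
    (hφ : Ξ.Lifts (g ≫ f) φ) (hψ : Ξ.Lifts f ψ) :
    ∃ χ : z ⟶ y, Ξ.Lifts g χ ∧ χ ≫ ψ = φ := by
  have h1 : Ξ.p.obj z = Z := IsHomLift.domain_eq Ξ.p (g ≫ f) φ
  have h2 : Ξ.p.obj y = Y := IsHomLift.domain_eq Ξ.p f ψ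
  have h3 : Ξ.p.obj x = X := IsHomLift.codomain_eq Ξ.p f ψ
  subst h1 h2 h3
  have e1 := IsHomLift.eq_of_isHomLift Ξ.p (g ≫ f) φ
  have e2 := IsHomLift.eq_of_isHomLift Ξ.p f ψ
  obtain ⟨χ, ⟨hχ, hχ'⟩, -⟩ := hΞ.lift φ ψ g (by rw [← e2, ← e1])
  exact ⟨χ, hχ ▸ IsHomLift.map Ξ.p χ, hχ'⟩

/-- The arrow `z ⟶ y` over `g` induced by an arrow `z ⟶ x` over `g ≫ f`. -/
def IsFibredInGroupoids.factor (hΞ : IsFibredInGroupoids Ξ) {x y z : Ξ.obj}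
    {Z Y X : Mfd} (g : Z ⟶ Y) (f : Y ⟶ X) (φ : z ⟶ x) (ψ : y ⟶ x)
    (hφ : Ξ.Lifts (g ≫ f) φ) (hψ : Ξ.Lifts f ψ) : z ⟶ y :=
  (hΞ.exists_lift g f φ ψ hφ hψ).choose

lemma IsFibredInGroupoids.factor_lift (hΞ : IsFibredInGroupoids Ξ) {x y z : Ξ.obj}
    {Z Y X : Mfd} (g : Z ⟶ Y) (f : Y ⟶ X) (φ : z ⟶ x) (ψ : y ⟶ x)
    (hφ : Ξ.Lifts (g ≫ f) φ) (hψ : Ξ.Lifts f ψ) :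
    Ξ.Lifts g (hΞ.factor g f φ ψ hφ hψ) :=
  (hΞ.exists_lift g f φ ψ hφ hψ).choose_spec.1

lemma IsFibredInGroupoids.factor_fac (hΞ : IsFibredInGroupoids Ξ) {x y z : Ξ.obj}
    {Z Y X : Mfd} (g : Z ⟶ Y) (f : Y ⟶ X) (φ : z ⟶ x) (ψ : y ⟶ x)
    (hφ : Ξ.Lifts (g ≫ f) φ) (hψ : Ξ.Lifts f ψ) :
    hΞ.factor g f φ ψ hφ hψ ≫ ψ = φ :=
  (hΞ.exists_lift g f φ ψ hφ hψ).choose_spec.2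

lemma IsFibredInGroupoids.isIso (hΞ : IsFibredInGroupoids Ξ) {x y : Ξ.obj} {S : Mfd}
    (φ : x ⟶ y) (hφ : Ξ.Lifts (𝟙 S) φ) : IsIso φ := by
  have hy : Ξ.p.obj y = S := IsHomLift.codomain_eq Ξ.p (𝟙 S) φ
  obtain ⟨χ, hχ, hχφ⟩ := hΞ.exists_lift (𝟙 S) (𝟙 S) (𝟙 y) φ
    (by rw [id_comp]; exact IsHomLift.id hy) hφ
  refine ⟨χ, ?_, hχφ⟩
  have hx : Ξ.p.obj x = S := IsHomLift.domain_eq Ξ.p (𝟙 S) φ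
  refine hΞ.hom_ext (𝟙 S) φ (IsHomLift.comp_of_lift_id Ξ.p S φ χ) (IsHomLift.id hx) ?_
  rw [assoc, hχφ, comp_id, id_comp]

lemma lift_comp {x y z : Ξ.obj} {R S T : Mfd} {f : R ⟶ S} {g : S ⟶ T} {φ : x ⟶ y} {ψ : y ⟶ z}
    (hφ : Ξ.Lifts f φ) (hψ : Ξ.Lifts g ψ) : Ξ.Lifts (f ≫ g) (φ ≫ ψ) :=
  IsHomLift.comp Ξ.p f g φ ψ

/-! ### Points -/

section

variable {N : Mfd} (j : rep N ⥤ᵇ Ξ)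

lemma ptMap_comp {R S T : Mfd} {a : R ⟶ N} {b : S ⟶ N} {c : T ⟶ N} (f : R ⟶ S) (g : S ⟶ T)
    (h : f ≫ b = a) (h' : g ≫ c = b) :
    ptMap j f h ≫ ptMap j g h' = ptMap j (f ≫ g) (by rw [assoc, h', h]) :=
  (j.map_comp (ptHom f h) (ptHom g h')).symm

lemma ptMap_comp_assoc {R S T : Mfd} {a : R ⟶ N} {b : S ⟶ N} {c : T ⟶ N} (f : R ⟶ S) (g : S ⟶ T)
    (h : f ≫ b = a) (h' : g ≫ c = b) {z : Ξ.obj} (k : j.obj (pt c) ⟶ z) :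
    ptMap j f h ≫ ptMap j g h' ≫ k = ptMap j (f ≫ g) (by rw [assoc, h', h]) ≫ k := by
  rw [← assoc, ptMap_comp]

lemma ptMap_id {S : Mfd} (a : S ⟶ N) (h : 𝟙 S ≫ a = a) : ptMap j (𝟙 S) h = 𝟙 (j.obj (pt a)) :=
  j.map_id (pt a)

end

/-! ### 2-morphisms -/

section

variable {Y : Mfd} {F G : rep Y ⥤ᵇ Ξ}

/-- The 2-morphism given by a natural family of arrows. -/
def natMk (φ : ∀ {S : Mfd} (a : S ⟶ Y), F.obj (pt a) ⟶ G.obj (pt a))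
    (hφ : ∀ {S : Mfd} (a : S ⟶ Y), Ξ.Lifts (𝟙 S) (φ a))
    (nat : ∀ {S T : Mfd} (f : T ⟶ S) (a : S ⟶ Y),
      ptMap F f rfl ≫ φ a = φ (f ≫ a) ≫ ptMap G f rfl) : F ⟶ G where
  app x := φ (S := x.left) (Over.hom (X := Y) x)
  naturality x y f := by
    have key : ∀ {S T : Mfd} (a : S ⟶ Y) (b : T ⟶ Y) (f : T ⟶ S) (h : f ≫ a = b),
        ptMap F f h ≫ φ a = φ b ≫ ptMap G f h := fun a b f h => by subst h; exact nat f a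
    exact key (Over.hom (X := Y) y) (Over.hom (X := Y) x) (CommaMorphism.left f) (Over.w (X := Y) f)
  isHomLift' x := hφ _

lemma app_lift (α : F ⟶ G) {S : Mfd} (a : S ⟶ Y) : Ξ.Lifts (𝟙 S) (α.app (pt a)) :=
  α.isHomLift' (pt a)

/-- The arrow from the image of a point to the image of the universal point. -/
def univ (F : rep Y ⥤ᵇ Ξ) {S : Mfd} (a : S ⟶ Y) : F.obj (pt a) ⟶ uObj F :=
  ptMap F (a := a) (b := 𝟙 Y) a rfl

lemma univ_lift (F : rep Y ⥤ᵇ Ξ) {S : Mfd} (a : S ⟶ Y) : Ξ.Lifts a (univ F a) :=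
  ptMap_lift F (a := a) (b := 𝟙 Y) a rfl

lemma ptMap_univ (F : rep Y ⥤ᵇ Ξ) {S T : Mfd} {a : S ⟶ Y} {b : T ⟶ Y} (f : S ⟶ T)
    (h : f ≫ b = a) : ptMap F f h ≫ univ F b = univ F a := by
  subst h
  exact ptMap_comp F (a := f ≫ b) (b := b) (c := 𝟙 Y) f b rfl rfl

lemma natOfArrow_aux {S : Mfd} (a : S ⟶ Y) {x : Ξ.obj} {η : uObj F ⟶ x}
    (hη : Ξ.Lifts (𝟙 Y) η) : Ξ.Lifts (𝟙 S ≫ a) (univ F a ≫ η) :=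
  lift_comp (f := a) (g := 𝟙 Y) (univ_lift F a) hη

/-- The 2-morphism given by an arrow at the universal point. -/
def natOfArrow (hΞ : IsFibredInGroupoids Ξ) (η : uObj F ⟶ uObj G) (hη : Ξ.Lifts (𝟙 Y) η) : F ⟶ G :=
  natMk (fun {S} a => hΞ.factor (𝟙 S) a (univ F a ≫ η) (univ G a) (natOfArrow_aux a hη)
      (univ_lift G a))
    (fun {S} a => hΞ.factor_lift (𝟙 S) a (univ F a ≫ η) (univ G a) (natOfArrow_aux a hη)
      (univ_lift G a))
    (fun {S T} f a => by
      have e1 := hΞ.factor_fac (𝟙 S) a (univ F a ≫ η) (univ G a) (natOfArrow_aux a hη)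
        (univ_lift G a)
      have e2 := hΞ.factor_fac (𝟙 T) (f ≫ a) (univ F (f ≫ a) ≫ η) (univ G (f ≫ a))
        (natOfArrow_aux (f ≫ a) hη) (univ_lift G (f ≫ a))
      refine hΞ.hom_ext f (univ G a)
        (lift_comp (g := 𝟙 S) (ptMap_lift F f rfl) (hΞ.factor_lift _ _ _ _ _ _))
        (lift_comp (f := 𝟙 T) (hΞ.factor_lift _ _ _ _ _ _) (ptMap_lift G f rfl)) ?_
      rw [assoc, e1, assoc, ptMap_univ, e2, ← assoc, ptMap_univ])

lemma natOfArrow_app (hΞ : IsFibredInGroupoids Ξ) (η : uObj F ⟶ uObj G)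
    (hη : Ξ.Lifts (𝟙 Y) η) {S : Mfd} (a : S ⟶ Y) :
    (natOfArrow hΞ η hη).app (pt a) ≫ univ G a = univ F a ≫ η :=
  hΞ.factor_fac (𝟙 S) a (univ F a ≫ η) (univ G a) (natOfArrow_aux a hη) (univ_lift G a)

end

/-! ### Base maps of arrows -/

lemma lift_unique {x y : Ξ.obj} {S T : Mfd} {f g : S ⟶ T} {α : x ⟶ y} (hf : Ξ.Lifts f α)
    (hg : Ξ.Lifts g α) : f = g :=
  (IsHomLift.fac Ξ.p f α).trans (IsHomLift.fac Ξ.p g α).symm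

/-- The smooth map underlying an arrow. -/
def bm {x y : Ξ.obj} {S T : Mfd} (hx : Ξ.p.obj x = S) (hy : Ξ.p.obj y = T) (α : x ⟶ y) : S ⟶ T :=
  eqToHom hx.symm ≫ Ξ.p.map α ≫ eqToHom hy

lemma bm_lift {x y : Ξ.obj} {S T : Mfd} (hx : Ξ.p.obj x = S) (hy : Ξ.p.obj y = T) (α : x ⟶ y) :
    Ξ.Lifts (bm hx hy α) α := by
  subst hx hy
  simp only [bm, eqToHom_refl, id_comp, comp_id]
  infer_instance

lemma bm_eq {x y : Ξ.obj} {S T : Mfd} {hx : Ξ.p.obj x = S} {hy : Ξ.p.obj y = T} {α : x ⟶ y}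
    {f : S ⟶ T} (h : Ξ.Lifts f α) : bm hx hy α = f := lift_unique (bm_lift hx hy α) h

lemma bm_comp {x y z : Ξ.obj} {S T R : Mfd} {hx : Ξ.p.obj x = S} {hy : Ξ.p.obj y = T}
    {hz : Ξ.p.obj z = R} (α : x ⟶ y) (β : y ⟶ z) :
    bm hx hz (α ≫ β) = bm hx hy α ≫ bm hy hz β :=
  bm_eq (lift_comp (bm_lift hx hy α) (bm_lift hy hz β))

lemma lift_base {x y : Ξ.obj} {S T : Mfd} {f : S ⟶ T} {α : x ⟶ y} (h : Ξ.Lifts f α) :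
    Ξ.p.obj x = S ∧ Ξ.p.obj y = T :=
  ⟨IsHomLift.domain_eq Ξ.p f α, IsHomLift.codomain_eq Ξ.p f α⟩

lemma map_lift {𝒴 : BasedCategory.{v₂, u₂} Mfd} (F : Ξ ⥤ᵇ 𝒴) {x y : Ξ.obj} {S T : Mfd} {f : S ⟶ T}
    {α : x ⟶ y} (h : Ξ.Lifts f α) : 𝒴.Lifts f (F.map α) :=
  @BasedFunctor.preserves_isHomLift _ _ _ _ F _ _ _ _ f α h

lemma rep_fibred (N : Mfd) : IsFibredInGroupoids (rep N) where
  pullback {V} x f := ⟨pt (f ≫ Over.hom (X := N) x), Over.homMk (U := Over.mk _) (V := x) f rfl,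
    @IsHomLift.map _ _ _ _ (Over.forget N) _ _ (Over.homMk (U := Over.mk (f ≫ Over.hom (X := N) x))
      (V := x) f rfl)⟩
  lift {x y z} φ ψ g h := by
    refine ⟨Over.homMk (U := z) (V := y) g ?_, ⟨rfl, Over.OverMorphism.ext (U := z) (V := x) h⟩,
      fun χ hχ => Over.OverMorphism.ext (U := z) (V := y) hχ.1⟩
    have h1 := Over.w (X := N) (f := y) (g := x) ψ
    have h2 := Over.w (X := N) (f := z) (g := x) φ
    rw [← h1, ← h2]
    exact (h =≫ Over.hom (X := N) x)

/-- The arrow from a point to the universal point. -/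
def term {N : Mfd} (x : (rep N).obj) : x ⟶ pt (𝟙 N) :=
  Over.homMk (U := x) (V := Over.mk (𝟙 N)) (Over.hom (X := N) x) (comp_id _)

lemma toMap_lift {M : Mfd} (G : Ξ ⥤ᵇ rep M) (z : Ξ.obj) :
    (rep M).Lifts (toMap G z) (term (G.obj z)) := by
  have e : toMap G z = bm (G.w_obj z) rfl (term (G.obj z)) := by
    change eqToHom _ ≫ Over.hom (X := M) _ = eqToHom _ ≫ Over.hom (X := M) _ ≫ 𝟙 _
    rw [comp_id]
  exact e ▸ bm_lift _ _ _

lemma comp_term {N : Mfd} {x y : (rep N).obj} (f : x ⟶ y) : f ≫ term y = term x :=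
  Over.OverMorphism.ext (U := x) (V := Over.mk (𝟙 N)) (Over.w (X := N) (f := x) (g := y) f)

lemma term_unique {N : Mfd} {x : (rep N).obj} (f : x ⟶ pt (𝟙 N)) : f = term x :=
  Over.OverMorphism.ext (U := x) (V := Over.mk (𝟙 N))
    ((comp_id _).symm.trans (Over.w (X := N) (f := x) (g := Over.mk (𝟙 N)) f))

/-- The product of two objects of a stack: this is how fibre products of charts appear. -/
structure IsProd {J Q K : Ξ.obj} (k₁ : K ⟶ J) (k₂ : K ⟶ Q) : Prop where
  ex : ∀ {x : Ξ.obj} (α : x ⟶ J) (γ : x ⟶ Q), ∃ β : x ⟶ K, β ≫ k₁ = α ∧ β ≫ k₂ = γ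
  uniq : ∀ {x : Ξ.obj} (β β' : x ⟶ K), β ≫ k₁ = β' ≫ k₁ → β ≫ k₂ = β' ≫ k₂ → β = β'

lemma exists_vert (hΞ : IsFibredInGroupoids Ξ) {N S : Mfd} (j : rep N ⥤ᵇ Ξ) {x : Ξ.obj}
    {f : S ⟶ N} {α : x ⟶ uObj j} (h : Ξ.Lifts f α) :
    ∃ φ : x ⟶ j.obj (pt f), Ξ.Lifts (𝟙 S) φ ∧ φ ≫ univ j f = α :=
  hΞ.exists_lift (𝟙 S) f α (univ j f) h (univ_lift j f)

lemma fp_isIso {𝒵 : BasedCategory.{v₂, u₂} Mfd} {𝒴 : BasedCategory.{v₃, u₃} Mfd} {F : Ξ ⥤ᵇ 𝒵}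
    {G : 𝒴 ⥤ᵇ 𝒵} {w w' : (fibreProd F G).obj} (f : w ⟶ w') (h₁ : IsIso (FPHom.fst f))
    (h₂ : IsIso (FPHom.snd f)) : IsIso f := by
  have hl := FPHom.lift f
  have hi : IsIso (Ξ.p.map (FPHom.fst f)) := inferInstance
  refine ⟨⟨inv (FPHom.fst f), inv (FPHom.snd f), ?_, ?_⟩, FPHom.ext (IsIso.hom_inv_id _)
    (IsIso.hom_inv_id _), FPHom.ext (IsIso.inv_hom_id _) (IsIso.inv_hom_id _)⟩
  · rw [Functor.map_inv]
    infer_instance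
  · rw [Functor.map_inv, Functor.map_inv, IsIso.comp_inv_eq, assoc, IsIso.eq_inv_comp]
    exact (FPHom.comm f).symm

lemma exists_isProd_of_reprWith (hΞ : IsFibredInGroupoids Ξ)
    {Pr : ∀ {P S : Mfd}, (P ⟶ S) → Prop} {N X : Mfd} {j : rep N ⥤ᵇ Ξ} {q : rep X ⥤ᵇ Ξ}
    (H : ReprWith Pr j q) : ∃ (P : Mfd) (K : Ξ.obj) (π₂ : P ⟶ X) (k₁ : K ⟶ uObj j)
      (k₂ : K ⟶ uObj q), Ξ.Lifts π₂ k₂ ∧ IsProd k₁ k₂ ∧ Pr π₂ := by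
  obtain ⟨P, E, hE, hPr⟩ := H
  let w := uObj E
  have hw : (rep N).p.obj w.fst = P := E.w_obj (pt (𝟙 P))
  have hη : Ξ.Lifts (𝟙 P) w.η := by
    have := w.lift
    rwa [hw] at this
  have hterm : (rep X).Lifts (mapOf (E ⋙ fpSnd j q)) (term w.snd) := toMap_lift (E ⋙ fpSnd j q) _
  have hk₂ : Ξ.Lifts (mapOf (E ⋙ fpSnd j q)) (w.η ≫ q.map (term w.snd)) :=
    lift_comp (f := 𝟙 P) hη (map_lift q hterm)
  refine ⟨P, j.obj w.fst, mapOf (E ⋙ fpSnd j q), j.map (term w.fst), w.η ≫ q.map (term w.snd), hk₂,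
    ⟨?_, ?_⟩, hPr⟩
  · intro x α γ
    have hJ : Ξ.p.obj (uObj j) = N := j.w_obj _
    have hQ : Ξ.p.obj (uObj q) = X := q.w_obj _
    obtain ⟨a, ha, haα⟩ := exists_vert hΞ j (bm_lift rfl hJ α)
    obtain ⟨c, hc, hcγ⟩ := exists_vert hΞ q (bm_lift rfl hQ γ)
    have := hΞ.isIso a ha
    have hac : Ξ.Lifts (𝟙 (Ξ.p.obj x)) (inv a ≫ c) := lift_comp (f := 𝟙 _) inferInstance hc
    let w' : (fibreProd j q).obj := ⟨pt (bm rfl hJ α), pt (bm rfl hQ γ), inv a ≫ c, hac⟩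
    let z := E.toFunctor.objPreimage w'
    let i : E.obj z ≅ w' := E.toFunctor.objObjPreimageIso w'
    let k : w' ⟶ w := i.inv ≫ E.map (term z)
    have hk := FPHom.comm k
    refine ⟨a ≫ j.map (FPHom.fst k), ?_, ?_⟩
    · rw [assoc, ← Functor.map_comp, comp_term]
      exact haα
    · rw [assoc, ← reassoc_of% hk, ← Functor.map_comp, comp_term]
      change a ≫ (inv a ≫ c) ≫ univ q _ = γ
      rw [assoc, IsIso.hom_inv_id_assoc, hcγ]
  · intro x β β' h₁ h₂
    have hj : Ξ.p.obj (j.obj w.fst) = P := (j.w_obj _).trans hw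
    have hβ := bm_lift rfl hj β
    have hβ' := bm_lift rfl hj β'
    suffices h : bm rfl hj β = bm rfl hj β' by
      rw [← h] at hβ'
      exact hΞ.hom_ext _ _ hβ hβ' h₂
    set g := bm rfl hj β
    set g' := bm rfl hj β'
    let A : E.obj (pt g) ⟶ w := E.map (term (pt g))
    have hEg : (rep N).p.obj (FPObj.fst (E.obj (pt g))) = Ξ.p.obj x := E.w_obj (pt g)
    have hA : (rep N).Lifts g (FPHom.fst A) :=
      map_lift (E ⋙ fpFst j q) (ptHom_lift (a := g) (b := 𝟙 P) g rfl)
    have hA' : (rep X).Lifts g (FPHom.snd A) :=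
      map_lift (E ⋙ fpSnd j q) (ptHom_lift (a := g) (b := 𝟙 P) g rfl)
    have hηg : Ξ.Lifts (𝟙 (Ξ.p.obj x)) (FPObj.η (E.obj (pt g))) := by
      have := FPObj.lift (E.obj (pt g))
      rwa [hEg] at this
    -- the comparison between `β` and the pullback along `g`
    have hjA : Ξ.Lifts g (j.map (FPHom.fst A)) := inferInstance
    obtain ⟨κ, hκ, hκβ⟩ := hΞ.exists_lift (𝟙 _) g β (j.map (FPHom.fst A)) hβ hjA
    have hκi := hΞ.isIso κ hκ
    -- `β'` as an arrow from the pullback along `g`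
    have hinv : Ξ.Lifts g' (inv κ ≫ β') := lift_comp (f := 𝟙 _) inferInstance hβ'
    have e₁ : g ≫ bm hw rfl (term w.fst) = g' ≫ bm hw rfl (term w.fst) := by
      have ht := map_lift j (bm_lift hw rfl (term w.fst))
      refine lift_unique (lift_comp hβ ht) ?_
      rw [h₁]
      exact lift_comp hβ' ht
    have e₂ : g ≫ mapOf (E ⋙ fpSnd j q) = g' ≫ mapOf (E ⋙ fpSnd j q) := by
      refine lift_unique (lift_comp hβ hk₂) ?_
      rw [h₂]
      exact lift_comp hβ' hk₂
    obtain ⟨b₁, hb₁, hb₁'⟩ := (rep_fibred N).exists_lift g' (bm hw rfl (term w.fst))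
      (term (FPObj.fst (E.obj (pt g)))) (term w.fst) (by
        rw [← e₁, ← comp_term (FPHom.fst A)]
        exact lift_comp hA (bm_lift hw rfl (term w.fst))) (bm_lift hw rfl (term w.fst))
    obtain ⟨b₂, hb₂, hb₂'⟩ := (rep_fibred X).exists_lift g' (mapOf (E ⋙ fpSnd j q))
      (term (FPObj.snd (E.obj (pt g)))) (term w.snd) (by
        rw [← e₂, ← comp_term (FPHom.snd A)]
        exact lift_comp hA' hterm) hterm
    have hjb₁ : Ξ.Lifts g' (j.map b₁) := inferInstance
    have hqb₂ : Ξ.Lifts g' (q.map b₂) := inferInstance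
    have hb : j.map b₁ = inv κ ≫ β' := by
      refine hΞ.hom_ext g' (j.map (term w.fst)) hjb₁ hinv ?_
      rw [← Functor.map_comp, hb₁', assoc, ← h₁, ← hκβ, assoc,
        IsIso.inv_hom_id_assoc, ← Functor.map_comp, comp_term]
    have hcomm : FPObj.η (E.obj (pt g)) ≫ q.map b₂ = j.map b₁ ≫ w.η := by
      refine hΞ.hom_ext g' (q.map (term w.snd)) (lift_comp (f := 𝟙 _) hηg hqb₂)
        (lift_comp (g := 𝟙 P) hjb₁ hη) ?_
      rw [assoc, ← Functor.map_comp, hb₂', assoc, hb, assoc, ← h₂, ← hκβ,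
        assoc, IsIso.inv_hom_id_assoc, ← reassoc_of% (FPHom.comm A), ← Functor.map_comp,
        comp_term]
    have hl : (rep X).Lifts ((rep N).p.map b₁) b₂ := by
      rw [IsHomLift.fac' (rep N).p g' b₁]
      infer_instance
    let A' : E.obj (pt g) ⟶ w := (⟨b₁, b₂, hl, hcomm⟩ : FPHom (E.obj (pt g)) w)
    have hA'' : A' = A := by
      have h1 : E.map (E.toFunctor.preimage A') = A' := E.toFunctor.map_preimage A'
      rw [← h1, term_unique (E.toFunctor.preimage A')]
    have : b₁ = FPHom.fst A := congrArg FPHom.fst hA''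
    rw [this] at hb₁
    exact lift_unique hA hb₁

end Stk

namespace Mfd

lemma IsEt.exists_section {P X : Mfd} {f : P ⟶ X} (hf : IsEt f) (p : P) :
    ∃ (V : Opens X) (hp : f p ∈ V) (σ : X.opn V ⟶ P), σ ≫ f = X.incl V ∧ σ (opnMk (f p) hp) = p := by
  obtain ⟨Φ, hp, hΦ⟩ := hf p
  have hfp : f p ∈ Φ.target := by
    rw [hΦ hp]; exact Φ.map_source hp
  let V : Opens X := ⟨Φ.target, Φ.open_target⟩
  have hs : ContMDiff (X.opn V).I P.I ∞ (fun x : X.opn V => Φ.symm (X.incl V x)) :=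
    contMDiff_opn_of_contMDiffOn (U := V) Φ.contMDiffOn_invFun
  refine ⟨V, hfp, mk' _ hs, ?_, ?_⟩
  · ext x
    have hx : X.incl V x ∈ Φ.target := x.2
    change f (Φ.symm (X.incl V x)) = X.incl V x
    exact (hΦ (Φ.map_target hx)).trans (Φ.right_inv hx)
  · change Φ.symm (f p) = p
    rw [hΦ hp]
    exact Φ.left_inv hp

lemma _root_.IsLocalDiffeomorphAt.exists_injOn {N N' : Mfd} {φ : N → N'} {n : N}
    (h : IsLocalDiffeomorphAt N.I N'.I ∞ φ n) : ∃ U : Set N, IsOpen U ∧ n ∈ U ∧ Set.InjOn φ U := by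
  obtain ⟨Φ, hn, hΦ⟩ := h
  exact ⟨Φ.source, Φ.open_source, hn, fun x hx y hy e => Φ.injOn hx hy (by rw [← hΦ hx, e, hΦ hy])⟩

lemma pnt_opnMk {S : Mfd} {U : Opens S} {x : S} (h : x ∈ U) : pnt (opnMk x h) ≫ S.incl U = pnt x :=
  rfl

end Mfd

namespace Stk

lemma reprWith_of_isProd (hΞ : IsFibredInGroupoids Ξ)
    {Pr : ∀ {P S : Mfd}, (P ⟶ S) → Prop} {N X P : Mfd} {j : rep N ⥤ᵇ Ξ} {q : rep X ⥤ᵇ Ξ}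
    {K : Ξ.obj} {π₁ : P ⟶ N} {π₂ : P ⟶ X} {k₁ : K ⟶ uObj j} {k₂ : K ⟶ uObj q}
    (hk₁ : Ξ.Lifts π₁ k₁) (hk₂ : Ξ.Lifts π₂ k₂) (H : IsProd k₁ k₂) (hPr : Pr π₂) :
    ReprWith Pr j q := by
  obtain ⟨a, ha, hak⟩ := exists_vert hΞ j hk₁
  obtain ⟨c, hc, hck⟩ := exists_vert hΞ q hk₂
  have hai := hΞ.isIso a ha
  let η₀ : j.obj (pt π₁) ⟶ q.obj (pt π₂) := inv a ≫ c
  have hac : Ξ.Lifts (𝟙 P) η₀ := lift_comp (f := 𝟙 _) inferInstance hc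
  let H' : uMap π₁ ⋙ j ⟶ uMap π₂ ⋙ q := natOfArrow (F := uMap π₁ ⋙ j) (G := uMap π₂ ⋙ q) hΞ η₀ hac
  let E := fpLift (uMap π₁) (uMap π₂) H'
  obtain ⟨η, hηE, hη⟩ : ∃ η : ∀ {S : Mfd} (g : S ⟶ P), j.obj (pt (g ≫ π₁)) ⟶ q.obj (pt (g ≫ π₂)),
      (∀ {S : Mfd} (g : S ⟶ P), η g = H'.app (pt g)) ∧
      ∀ {S : Mfd} (g : S ⟶ P), Ξ.Lifts (𝟙 S) (η g) :=
    ⟨fun g => H'.app (pt g), fun _ => rfl, fun g => app_lift H' g⟩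
  obtain ⟨κ, hκ, hκ₁, hκ₂⟩ : ∃ κ : ∀ {S : Mfd} (g : S ⟶ P), j.obj (pt (g ≫ π₁)) ⟶ K,
      (∀ {S : Mfd} (g : S ⟶ P), Ξ.Lifts g (κ g)) ∧
      (∀ {S : Mfd} (g : S ⟶ P), κ g ≫ k₁ = univ j (g ≫ π₁)) ∧
      ∀ {S : Mfd} (g : S ⟶ P), κ g ≫ k₂ = η g ≫ univ q (g ≫ π₂) := by
    refine ⟨fun g => ptMap j (a := g ≫ π₁) (b := π₁) g rfl ≫ inv a, fun g =>
      lift_comp (g := 𝟙 P) (ptMap_lift j _ _) inferInstance, fun {S} g => ?_, fun {S} g => ?_⟩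
    · rw [← hak, ← ptMap_univ j (a := g ≫ π₁) (b := π₁) g rfl]
      simp
    · have e : η g ≫ ptMap q (a := g ≫ π₂) (b := π₂) g rfl =
          ptMap j (a := g ≫ π₁) (b := π₁) g rfl ≫ inv a ≫ c := by
        rw [hηE]
        exact natOfArrow_app (F := uMap π₁ ⋙ j) (G := uMap π₂ ⋙ q) hΞ η₀ hac g
      rw [← hck, ← ptMap_univ q (a := g ≫ π₂) (b := π₂) g rfl, reassoc_of% e]
      simp
  have hfull : ∀ {S T : Mfd} (g : S ⟶ P) (g' : T ⟶ P) (k : E.obj (pt g) ⟶ E.obj (pt g')),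
      (rep N).p.map (FPHom.fst k) ≫ g' = g := by
    intro S T g g' k
    have hl : (rep N).Lifts ((rep N).p.map (FPHom.fst k)) (FPHom.fst k) := inferInstance
    let jk : j.obj (pt (g ≫ π₁)) ⟶ j.obj (pt (g' ≫ π₁)) := j.map (FPHom.fst k)
    let qk : q.obj (pt (g ≫ π₂)) ⟶ q.obj (pt (g' ≫ π₂)) := q.map (FPHom.snd k)
    have hl' : Ξ.Lifts ((rep N).p.map (FPHom.fst k)) jk :=
      map_lift j hl
    have hcomm : η g ≫ qk = jk ≫ η g' := by
      rw [hηE, hηE]; exact FPHom.comm k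
    have h1 : jk ≫ univ j (g' ≫ π₁) = univ j (g ≫ π₁) :=
      (j.map_comp _ _).symm.trans (congrArg j.map (comp_term (FPHom.fst k)))
    have h2 : qk ≫ univ q (g' ≫ π₂) = univ q (g ≫ π₂) :=
      (q.map_comp _ _).symm.trans (congrArg q.map (comp_term (FPHom.snd k)))
    have h3 : κ g = jk ≫ κ g' := by
      refine H.uniq _ _ ?_ ?_
      · rw [assoc, hκ₁, hκ₁, h1]
      · rw [assoc, hκ₂, hκ₂, ← h2, reassoc_of% hcomm]
    refine lift_unique (lift_comp hl' (hκ g')) ?_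
    rw [← h3]
    exact hκ g
  refine ⟨P, E, { faithful := ?_, full := ?_, essSurj := ?_ }, ?_⟩
  · refine ⟨fun {x y f g} h => ?_⟩
    have := congrArg (fun k => CommaMorphism.left (FPHom.fst k)) h
    exact Over.OverMorphism.ext (U := x) (V := y) this
  · refine ⟨fun {x y} k => ?_⟩
    refine ⟨Over.homMk (U := x) (V := y) ((rep N).p.map (FPHom.fst k))
      (hfull (Over.hom (X := P) x) (Over.hom (X := P) y) k), ?_⟩
    refine FPHom.ext ?_ ?_
    · exact Over.OverMorphism.ext (U := (E.obj x).fst) (V := (E.obj y).fst) rfl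
    · have h2 := FPHom.lift k
      have h1 : (rep X).Lifts ((rep N).p.map (FPHom.fst k))
        ((uMap π₂).map (Over.homMk (U := x) (V := y) ((rep N).p.map (FPHom.fst k))
          (hfull (Over.hom (X := P) x) (Over.hom (X := P) y) k))) :=
        @IsHomLift.map _ _ _ _ (Over.forget X) ((uMap π₂).obj x) ((uMap π₂).obj y)
          ((uMap π₂).map (Over.homMk (U := x) (V := y) ((rep N).p.map (FPHom.fst k))
          (hfull (Over.hom (X := P) x) (Over.hom (X := P) y) k)))
      exact @rep_hom_ext X _ _ _ _ ((rep N).p.map (FPHom.fst k)) _ _ h1 h2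
  · refine ⟨fun w => ?_⟩
    have hw := FPObj.lift w
    obtain ⟨β, hβ₁, hβ₂⟩ := H.ex (j.map (term w.fst)) (w.η ≫ q.map (term w.snd))
    have hjw : Ξ.p.obj (j.obj w.fst) = (rep N).p.obj w.fst := j.w_obj _
    have hg := bm_lift hjw (lift_base hk₁).1 β
    set g := bm hjw (lift_base hk₁).1 β
    have ht₁ : (rep N).Lifts (Over.hom (X := N) w.fst) (term w.fst) :=
      @IsHomLift.map _ _ _ _ (Over.forget N) _ _ (term w.fst)
    have ht₂ := bm_lift w.base (rfl : (rep X).p.obj (pt (𝟙 X)) = X) (term w.snd)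
    have e₁ : g ≫ π₁ = Over.hom (X := N) w.fst := by
      refine lift_unique (lift_comp hg hk₁) ?_
      rw [hβ₁]
      exact map_lift j ht₁
    have e₂ : g ≫ π₂ = bm w.base (rfl : (rep X).p.obj (pt (𝟙 X)) = X) (term w.snd) := by
      refine lift_unique (lift_comp hg hk₂) ?_
      rw [hβ₂]
      exact lift_comp (f := 𝟙 _) hw (map_lift q ht₂)
    obtain ⟨b₁, hb₁, hb₁'⟩ := (rep_fibred N).exists_lift (𝟙 _) (Over.hom (X := N) w.fst)
      (term (pt (g ≫ π₁))) (term w.fst) (by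
        rw [id_comp, ← e₁]
        exact ptHom_lift (a := g ≫ π₁) (b := 𝟙 N) (g ≫ π₁) rfl) ht₁
    obtain ⟨b₂, hb₂, hb₂'⟩ := (rep_fibred X).exists_lift (𝟙 _) _
      (term (pt (g ≫ π₂))) (term w.snd) (by
        rw [id_comp, ← e₂]
        exact ptHom_lift (a := g ≫ π₂) (b := 𝟙 X) (g ≫ π₂) rfl) ht₂
    have hjb₁ := map_lift j hb₁
    have hqb₂ := map_lift q hb₂
    have h3 : κ g = j.map b₁ ≫ β := by
      refine hΞ.hom_ext g k₁ (hκ g) (lift_comp (f := 𝟙 _) hjb₁ hg) ?_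
      rw [hκ₁, assoc, hβ₁, ← Functor.map_comp, hb₁']
      rfl
    have hcomm : η g ≫ q.map b₂ = j.map b₁ ≫ w.η := by
      refine hΞ.hom_ext (𝟙 _) (q.map (term w.snd)) (lift_comp (f := 𝟙 _) (g := 𝟙 _) (hη g) hqb₂)
        (lift_comp (f := 𝟙 _) (g := 𝟙 _) hjb₁ hw) ?_
      rw [assoc, ← Functor.map_comp, hb₂', assoc, ← hβ₂, ← assoc, ← h3]
      exact (hκ₂ g).symm
    have hl : (rep X).Lifts ((rep N).p.map b₁) b₂ := by
      have e : (rep N).p.map b₁ = 𝟙 ((rep N).p.obj w.fst) :=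
        lift_unique (IsHomLift.map (rep N).p b₁) hb₁
      exact e ▸ hb₂
    let A : E.obj (pt g) ⟶ w := (⟨b₁, b₂, hl, ((hηE g) =≫ q.map b₂).symm.trans hcomm⟩ : FPHom (E.obj (pt g)) w)
    have := fp_isIso A ((rep_fibred N).isIso b₁ hb₁) ((rep_fibred X).isIso b₂ hb₂)
    exact ⟨pt g, ⟨asIso A⟩⟩
  · exact hPr

/-! ### Étale charts -/

/-- The properties of an étale morphism `j : N ⟶ Ξ` that are used below: 2-morphisms at a point
into `j` extend uniquely to a neighbourhood. A lift of an object to `N` is an arrow to the image of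
the universal point of `N`. -/
structure IsEtChart {N : Mfd} (j : rep N ⥤ᵇ Ξ) : Prop where
  small : ∀ {Y : Mfd} (F : rep Y ⥤ᵇ Ξ) (y : Y), Small.{0} (F.obj (pt (pnt y)) ⟶ uObj j)
  lift : ∀ {Y : Mfd} (F : rep Y ⥤ᵇ Ξ) (y : Y) (β : F.obj (pt (pnt y)) ⟶ uObj j),
    ∃ (O : Opens Y) (hy : y ∈ O) (α : F.obj (pt (Y.incl O)) ⟶ uObj j),
      ptMap F (a := pnt y) (b := Y.incl O) (pnt (opnMk y hy)) (pnt_opnMk hy) ≫ α = β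
  rigid : ∀ {Y : Mfd} (F : rep Y ⥤ᵇ Ξ) (y : Y) (α α' : uObj F ⟶ uObj j),
    univ F (pnt y) ≫ α = univ F (pnt y) ≫ α' →
      ∃ O : Opens Y, y ∈ O ∧ univ F (Y.incl O) ≫ α = univ F (Y.incl O) ≫ α'

lemma IsEpim.exists_arrow (hΞ : IsFibredInGroupoids Ξ) {X : Mfd} {q : rep X ⥤ᵇ Ξ} (hq : IsEpim q)
    {Y : Mfd} (F : rep Y ⥤ᵇ Ξ) (y : Y) :
    ∃ O : Opens Y, y ∈ O ∧ Nonempty (F.obj (pt (Y.incl O)) ⟶ uObj q) := by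
  obtain ⟨ι, U, hU, h⟩ := hq Y (uObj F) (F.w_obj _)
  obtain ⟨i, hi⟩ := hU y
  obtain ⟨x, φ, hφ⟩ := h i
  obtain ⟨χ, -, -⟩ := hΞ.exists_lift (𝟙 _) (Y.incl (U i)) (univ F (Y.incl (U i))) φ
    (univ_lift F _) hφ
  exact ⟨U i, hi, ⟨χ ≫ q.map (term x)⟩⟩

lemma isEtChart_of_isProd (hΞ : IsFibredInGroupoids Ξ) {X N P : Mfd} {q : rep X ⥤ᵇ Ξ}
    (hq : IsEpim q) {j : rep N ⥤ᵇ Ξ} {K : Ξ.obj} {π₂ : P ⟶ X} {k₁ : K ⟶ uObj j}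
    {k₂ : K ⟶ uObj q} (hk₂ : Ξ.Lifts π₂ k₂) (H : IsProd k₁ k₂) (hπ : IsEt π₂) :
    IsEtChart j := by
  have hK := (lift_base hk₂).1
  have hQ := (lift_base hk₂).2
  refine ⟨fun {Y} F y => ?_, fun {Y} F y β => ?_, fun {Y} F y α α' h => ?_⟩
  · obtain ⟨O, hy, ⟨γ⟩⟩ := hq.exists_arrow hΞ F y
    choose e he₁ he₂ using fun β : F.obj (pt (pnt y)) ⟶ uObj j =>
      H.ex β (ptMap F (a := pnt y) (b := Y.incl O) (pnt (opnMk y hy)) (pnt_opnMk hy) ≫ γ)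
    have hF : Ξ.p.obj (F.obj (pt (pnt y))) = point := F.w_obj _
    refine small_of_injective (β := P) (f := fun β => bm hF hK (e β) pointElt) fun β β' hββ => ?_
    have h1 : bm hF hK (e β) = bm hF hK (e β') := by
      rw [eq_pnt (bm hF hK (e β)), eq_pnt (bm hF hK (e β'))]
      exact congrArg pnt hββ
    have h2 := bm_lift hF hK (e β)
    rw [h1] at h2
    rw [← he₁ β, ← he₁ β', hΞ.hom_ext _ k₂ h2 (bm_lift hF hK (e β')) ((he₂ β).trans (he₂ β').symm)]
  · obtain ⟨O, hy, ⟨γ⟩⟩ := hq.exists_arrow hΞ F y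
    have hF : Ξ.p.obj (F.obj (pt (pnt y))) = point := F.w_obj _
    have hFO : Ξ.p.obj (F.obj (pt (Y.incl O))) = Y.opn O := F.w_obj _
    have hγ := bm_lift hFO hQ γ
    set c := bm hFO hQ γ
    have hγy : Ξ.Lifts (pnt (opnMk y hy) ≫ c)
        (ptMap F (a := pnt y) (b := Y.incl O) (pnt (opnMk y hy)) (pnt_opnMk hy) ≫ γ) :=
      lift_comp (ptMap_lift F _ _) hγ
    obtain ⟨β', hβ₁, hβ₂⟩ := H.ex β (ptMap F (a := pnt y) (b := Y.incl O) (pnt (opnMk y hy)) (pnt_opnMk hy) ≫ γ)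
    have hβ' := bm_lift hF hK β'
    rw [eq_pnt (bm hF hK β')] at hβ'
    set p₀ := bm hF hK β' pointElt
    have hp : π₂ p₀ = c (opnMk y hy) := by
      have := lift_comp hβ' hk₂
      rw [hβ₂] at this
      exact pnt_injective (lift_unique this hγy)
    obtain ⟨V, hpV, σ, hσ, hσp⟩ := hπ.exists_section p₀
    let O' : Opens Y := ⟨(fun z : Y.opn O => Y.incl O z) '' (c ⁻¹' V),
      (O.isOpenEmbedding'.isOpenMap) _ (V.isOpen.preimage (continuous c))⟩
    have hO' : ∀ z : Y.opn O', Y.incl O' z ∈ O := by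
      rintro ⟨_, z, -, rfl⟩; exact z.2
    have hy' : y ∈ O' := ⟨opnMk y hy, show c (opnMk y hy) ∈ V from hp ▸ hpV, rfl⟩
    let i : Y.opn O' ⟶ Y.opn O := codRestrict (Y.incl O') O hO'
    have hiV : ∀ z, (i ≫ c) z ∈ V := by
      rintro ⟨_, z, hz, rfl⟩; exact hz
    let c' : Y.opn O' ⟶ X.opn V := codRestrict (i ≫ c) V hiV
    have hc' : c' (opnMk y hy') = opnMk (π₂ p₀) hpV := Subtype.ext hp.symm
    let γ' : F.obj (pt (Y.incl O')) ⟶ _ := ptMap F (a := Y.incl O') (b := Y.incl O) i (codRestrict_incl _ _ hO') ≫ γ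
    have hγ' : Ξ.Lifts ((c' ≫ σ) ≫ π₂) γ' := by
      have e : (c' ≫ σ) ≫ π₂ = i ≫ c := by
        rw [assoc, hσ]; rfl
      rw [e]
      exact lift_comp (ptMap_lift F _ _) hγ
    obtain ⟨α, hα, hαk⟩ := hΞ.exists_lift (c' ≫ σ) π₂ γ' k₂ hγ' hk₂
    refine ⟨O', hy', α ≫ k₁, ?_⟩
    have key : ptMap F (a := pnt y) (b := Y.incl O') (pnt (opnMk y hy')) (pnt_opnMk hy') ≫ α = β' := by
      have hl := lift_comp (ptMap_lift F (a := pnt y) (b := Y.incl O') (pnt (opnMk y hy')) (pnt_opnMk hy')) hα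
      have e : pnt (opnMk y hy') ≫ c' ≫ σ = pnt p₀ := by
        refine congrArg pnt (a₁ := σ (c' (opnMk y hy'))) ?_
        rw [hc', hσp]
      rw [e] at hl
      refine hΞ.hom_ext _ k₂ hl hβ' ?_
      rw [hβ₂, assoc, hαk]
      exact ptMap_comp_assoc F _ _ _ _ _
    rw [← hβ₁, ← key, assoc]
  · obtain ⟨O, hy, ⟨γ⟩⟩ := hq.exists_arrow hΞ F y
    have hFO : Ξ.p.obj (F.obj (pt (Y.incl O))) = Y.opn O := F.w_obj _
    obtain ⟨β, hβ₁, hβ₂⟩ := H.ex (univ F (Y.incl O) ≫ α) γ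
    obtain ⟨β', hβ₁', hβ₂'⟩ := H.ex (univ F (Y.incl O) ≫ α') γ
    have hβ := bm_lift hFO hK β
    have hβ' := bm_lift hFO hK β'
    set g := bm hFO hK β
    set g' := bm hFO hK β'
    have hry := ptMap_lift F (a := pnt y) (b := Y.incl O) (pnt (opnMk y hy)) (pnt_opnMk hy)
    have hpt : ptMap F (a := pnt y) (b := Y.incl O) (pnt (opnMk y hy)) (pnt_opnMk hy) ≫ β =
        ptMap F (a := pnt y) (b := Y.incl O) (pnt (opnMk y hy)) (pnt_opnMk hy) ≫ β' := by
      refine H.uniq _ _ ?_ ?_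
      · rw [assoc, hβ₁, assoc, hβ₁', ← assoc, ← assoc, ptMap_univ]
        exact h
      · rw [assoc, hβ₂, assoc, hβ₂']
    have hgy : g (opnMk y hy) = g' (opnMk y hy) := by
      have h1 := lift_comp hry hβ
      rw [hpt] at h1
      exact pnt_injective (lift_unique h1 (lift_comp hry hβ'))
    have hgg : g ≫ π₂ = g' ≫ π₂ := by
      refine lift_unique (lift_comp hβ hk₂) ?_
      rw [hβ₂, ← hβ₂']
      exact lift_comp hβ' hk₂
    obtain ⟨V, hVo, hpV, hV⟩ := (hπ (g (opnMk y hy))).exists_injOn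
    let O' : Opens Y := ⟨(fun z : Y.opn O => Y.incl O z) '' (g ⁻¹' V ∩ g' ⁻¹' V),
      (O.isOpenEmbedding'.isOpenMap) _ ((hVo.preimage (continuous g)).inter
        (hVo.preimage (continuous g')))⟩
    have hO' : ∀ z : Y.opn O', Y.incl O' z ∈ O := by
      rintro ⟨_, z, -, rfl⟩; exact z.2
    let i : Y.opn O' ⟶ Y.opn O := codRestrict (Y.incl O') O hO'
    have hi : i ≫ g = i ≫ g' := by
      ext z
      obtain ⟨_, z, ⟨hz1, hz2⟩, rfl⟩ := z
      exact hV hz1 hz2 (congr_hom hgg z)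
    refine ⟨O', ⟨opnMk y hy, ⟨hpV, show g' _ ∈ V from hgy ▸ hpV⟩, rfl⟩, ?_⟩
    have hr := ptMap_lift F (a := Y.incl O') (b := Y.incl O) i (codRestrict_incl _ _ hO')
    have h1 := lift_comp hr hβ
    rw [hi] at h1
    have h2 := hΞ.hom_ext _ k₂ h1 (lift_comp hr hβ') (by
      rw [assoc, hβ₂, assoc, hβ₂'])
    rw [← ptMap_univ F (a := Y.incl O') (b := Y.incl O) i (codRestrict_incl _ _ hO'), assoc, ← hβ₁, assoc,
      ← hβ₁', ← assoc, h2, assoc]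

lemma IsEtale.isEtChart (hΞ : IsFibredInGroupoids Ξ) {X N : Mfd} {q : rep X ⥤ᵇ Ξ}
    (hq : IsEtaleAtlas q) {j : rep N ⥤ᵇ Ξ} (hj : IsEtale j) : IsEtChart j := by
  obtain ⟨P, K, π₂, k₁, k₂, hk₂, H, hπ⟩ := exists_isProd_of_reprWith hΞ (hj X q hq.subm)
  exact isEtChart_of_isProd hΞ hq.epi hk₂ H hπ

end Stk

namespace Mfd

lemma isEt_incl {S : Mfd} (U : Opens S) : IsEt (S.incl U) := by
  intro x
  have : Nonempty U := ⟨x⟩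
  let φ := U.isOpenEmbedding'.toOpenPartialHomeomorph
  refine ⟨{ toPartialEquiv := φ.toPartialEquiv, open_source := φ.open_source
            open_target := φ.open_target
            contMDiffOn_toFun := (smooth (S.incl U)).contMDiffOn
            contMDiffOn_invFun := ?_ }, Set.mem_univ _, fun _ _ => rfl⟩
  rintro _ ⟨z, -, rfl⟩
  refine ContMDiffAt.contMDiffWithinAt ?_
  refine (contMDiffAt_opens_iff (I := S.I) (I' := S.I) (U := U)).2 ?_
  refine contMDiffAt_id.congr_of_eventuallyEq ?_
  filter_upwards [U.isOpen.mem_nhds z.2] with y hy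
  exact φ.right_inv ⟨⟨y, hy⟩, Set.mem_univ _, rfl⟩

lemma contMDiffAt_of_opn {Y Z : Mfd} {O : Opens Y} {v : Y → Z} {y : Y} (hy : y ∈ O)
    (h : ContMDiffAt (Y.opn O).I Z.I ∞ (fun z => v (Y.incl O z)) (opnMk y hy)) :
    ContMDiffAt Y.I Z.I ∞ v y :=
  contMDiffAt_of_comp_isEt (isEt_incl O (opnMk y hy)) h

lemma contMDiff_of_local {Y Z : Mfd} {v : Y → Z} (h : ∀ y, ∃ (O : Opens Y) (_ : y ∈ O)
    (f : Y.opn O ⟶ Z), ∀ z, f z = v (Y.incl O z)) : ContMDiff Y.I Z.I ∞ v := by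
  intro y
  obtain ⟨O, hy, f, hf⟩ := h y
  refine contMDiffAt_of_opn hy ?_
  exact ((smooth f) (opnMk y hy)).congr_of_eventuallyEq
    (Eventually.of_forall fun z => (hf z).symm)

lemma inclLE_incl {S : Mfd} {U V : Opens S} (h : U ≤ V) : S.inclLE h ≫ S.incl V = S.incl U := rfl

lemma IsEt.of_comp {S T Z : Mfd} {f : S ⟶ T} {g : T ⟶ Z} {x : S}
    (hf : IsEt f) (hfg : IsEt (f ≫ g)) : IsLocalDiffeomorphAt T.I Z.I ∞ g (f x) := by
  obtain ⟨Φ, hx, hΦ⟩ := hf x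
  have hmem : f x ∈ Φ.target := hΦ hx ▸ Φ.map_source hx
  have hinv : Φ.symm (f x) = x := by
    rw [hΦ hx]
    exact Φ.left_inv hx
  have h1 : IsLocalDiffeomorphAt T.I S.I ∞ Φ.symm (f x) := ⟨Φ.symm, hmem, fun _ _ => rfl⟩
  have h2 : IsLocalDiffeomorphAt T.I Z.I ∞ ((f ≫ g) ∘ Φ.symm) (f x) :=
    IsLocalDiffeomorphAt.comp (K := Z.I) (P := Z) h1
      (show IsLocalDiffeomorphAt S.I Z.I ∞ (f ≫ g) (Φ.symm (f x)) by rw [hinv]; exact hfg x)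
  obtain ⟨Ψ, hΨ, hΨe⟩ := h2
  refine ⟨{ toPartialEquiv := Ψ.toPartialEquiv.restr Φ.target
            open_source := Ψ.open_source.inter Φ.open_target
            open_target := ?_
            contMDiffOn_toFun := Ψ.contMDiffOn_toFun.mono Set.inter_subset_left
            contMDiffOn_invFun := Ψ.contMDiffOn_invFun.mono Set.inter_subset_left },
    ⟨hΨ, hmem⟩, ?_⟩
  · exact Ψ.contMDiffOn_invFun.continuousOn.isOpen_inter_preimage Ψ.open_target Φ.open_target
  · rintro y ⟨hy1, hy2⟩
    have e : f (Φ.symm y) = y := (hΦ (Φ.map_target hy2)).trans (Φ.right_inv hy2)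
    have := hΨe hy1
    change g (f (Φ.symm y)) = _ at this
    rwa [e] at this

end Mfd

namespace Stk

/-! ### Gluing of arrows -/

section

variable {Y : Mfd} (F : rep Y ⥤ᵇ Ξ)

/-- Restriction to a point. -/
def resP {O : Opens Y} {y : Y} (hy : y ∈ O) : F.obj (pt (pnt y)) ⟶ F.obj (pt (Y.incl O)) :=
  ptMap F (a := pnt y) (b := Y.incl O) (pnt (opnMk y hy)) (pnt_opnMk hy)

/-- Restriction to a smaller open set. -/
def resO {O V : Opens Y} (h : V ≤ O) : F.obj (pt (Y.incl V)) ⟶ F.obj (pt (Y.incl O)) :=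
  ptMap F (a := Y.incl V) (b := Y.incl O) (Y.inclLE h) (inclLE_incl h)

lemma resP_resO {O V : Opens Y} (h : V ≤ O) {y : Y} (hy : y ∈ V) :
    resP F hy ≫ resO F h = resP F (h hy) := ptMap_comp F _ _ _ _

lemma resP_univ {O : Opens Y} {y : Y} (hy : y ∈ O) :
    resP F hy ≫ univ F (Y.incl O) = univ F (pnt y) := ptMap_univ F _ _

lemma resO_univ {O V : Opens Y} (h : V ≤ O) :
    resO F h ≫ univ F (Y.incl O) = univ F (Y.incl V) := ptMap_univ F _ _

lemma ptMap_resP {O : Opens Y} {S : Mfd} {a : S ⟶ Y} (c : S ⟶ Y.opn O) (hc : c ≫ Y.incl O = a)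
    (s : S) (hs : a s ∈ O) : ptMap F (a := pnt (a s)) (b := a) (pnt s) rfl ≫
      ptMap F c hc = resP F hs := by
  subst hc
  exact ptMap_comp F _ _ _ _

end

variable {Y N : Mfd} {F : rep Y ⥤ᵇ Ξ} {j : rep N ⥤ᵇ Ξ}

lemma IsStack.arrow_ext (hΞ : IsStack Ξ) {α α' : uObj F ⟶ uObj j}
    (h : ∀ y, ∃ O : Opens Y, y ∈ O ∧ univ F (Y.incl O) ≫ α = univ F (Y.incl O) ≫ α') : α = α' := by
  choose O hO hα using h
  have hF : Ξ.p.obj (uObj F) = Y := F.w_obj _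
  have hJ : Ξ.p.obj (uObj j) = N := j.w_obj _
  have hl := bm_lift hF hJ α
  have hl' := bm_lift hF hJ α'
  have e : bm hF hJ α = bm hF hJ α' := by
    ext y
    have h1 := lift_comp (univ_lift F (Y.incl (O y))) hl
    rw [hα] at h1
    exact congrArg (fun f : Y.opn (O y) ⟶ N => f (opnMk y (hO y)))
      (lift_unique h1 (lift_comp (univ_lift F (Y.incl (O y))) hl'))
  rw [← e] at hl'
  obtain ⟨φ, hφ, hφα⟩ := exists_vert hΞ.fibred j hl
  obtain ⟨φ', hφ', hφα'⟩ := exists_vert hΞ.fibred j hl'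
  have key := hΞ.isom_sheaf Y Y O (fun y => ⟨y, hO y⟩) (uObj F) (j.obj (pt (bm hF hJ α)))
    hF (j.w_obj _) (fun y => F.obj (pt (Y.incl (O y)))) (fun y => univ F _)
    (fun y => univ F _ ≫ φ) (fun y => univ_lift F _)
    (fun y => lift_comp (g := 𝟙 Y) (univ_lift F (Y.incl (O y))) hφ)
    (fun i i' z c d hcd => by rw [reassoc_of% hcd])
  have : φ = φ' := by
    refine key.unique ⟨hφ, fun i => rfl⟩ ⟨hφ', fun i => ?_⟩
    refine hΞ.fibred.hom_ext (Y.incl (O i)) (univ j _)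
      (lift_comp (g := 𝟙 Y) (univ_lift F (Y.incl (O i))) hφ')
      (lift_comp (g := 𝟙 Y) (univ_lift F (Y.incl (O i))) hφ) ?_
    rw [assoc, hφα', assoc, hφα, hα]
  rw [← hφα, ← hφα', this]

lemma IsEtChart.ext (hΞ : IsStack Ξ) (hj : IsEtChart j) {α α' : uObj F ⟶ uObj j}
    (h : ∀ y, univ F (pnt y) ≫ α = univ F (pnt y) ≫ α') : α = α' :=
  hΞ.arrow_ext fun y => hj.rigid F y α α' (h y)

lemma IsEtChart.ext_pt (hΞ : IsStack Ξ) (hj : IsEtChart j) {S : Mfd} {a : S ⟶ Y}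
    {α α' : F.obj (pt a) ⟶ uObj j}
    (h : ∀ s, ptMap F (a := pnt (a s)) (b := a) (pnt s) rfl ≫ α =
      ptMap F (a := pnt (a s)) (b := a) (pnt s) rfl ≫ α') : α = α' :=
  IsEtChart.ext (F := uMap a ⋙ F) hΞ hj h

lemma IsEtChart.rigid_pt (hj : IsEtChart j) {S : Mfd} {a : S ⟶ Y} (s : S)
    {α α' : F.obj (pt a) ⟶ uObj j}
    (h : ptMap F (a := pnt (a s)) (b := a) (pnt s) rfl ≫ α =
      ptMap F (a := pnt (a s)) (b := a) (pnt s) rfl ≫ α') :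
    ∃ O : Opens S, s ∈ O ∧ ∀ s' ∈ O, ptMap F (a := pnt (a s')) (b := a) (pnt s') rfl ≫ α =
      ptMap F (a := pnt (a s')) (b := a) (pnt s') rfl ≫ α' := by
  obtain ⟨O, hs, hO⟩ := hj.rigid (uMap a ⋙ F) s α α' h
  refine ⟨O, hs, fun s' hs' => ?_⟩
  have e : ptMap F (a := pnt (a s')) (b := a) (pnt s') rfl = resP (uMap a ⋙ F) hs' ≫
    univ (uMap a ⋙ F) (S.incl O) := (resP_univ (uMap a ⋙ F) hs').symm
  rw [e]
  exact (assoc _ _ _).trans ((resP (uMap a ⋙ F) hs' ≫= hO).trans (assoc _ _ _).symm)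

lemma IsEtChart.exists_glue (hΞ : IsStack Ξ) (hj : IsEtChart j)
    (v : ∀ y, F.obj (pt (pnt y)) ⟶ uObj j)
    (hv : ∀ y, ∃ (O : Opens Y) (_ : y ∈ O) (α : F.obj (pt (Y.incl O)) ⟶ uObj j),
      ∀ z (hz : z ∈ O), resP F hz ≫ α = v z) :
    ∃ α : uObj F ⟶ uObj j, ∀ y, univ F (pnt y) ≫ α = v y := by
  have hfib := hΞ.fibred
  have hJ : Ξ.p.obj (uObj j) = N := j.w_obj _
  have hFy : ∀ y : Y, Ξ.p.obj (F.obj (pt (pnt y))) = point := fun y => F.w_obj _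
  choose O hO α hα using hv
  have hFO : ∀ y, Ξ.p.obj (F.obj (pt (Y.incl (O y)))) = Y.opn (O y) := fun y => F.w_obj _
  have hbm : ∀ y (z : Y.opn (O y)), bm (hFO y) hJ (α y) z =
      bm (hFy (Y.incl _ z)) hJ (v (Y.incl _ z)) pointElt := by
    intro y z
    have h1 := lift_comp (ptMap_lift F (a := pnt (Y.incl (O y) z)) (b := Y.incl (O y)) (pnt z) rfl)
      (bm_lift (hFO y) hJ (α y))
    have h2 := hα y (Y.incl _ z) z.2
    change ptMap F (a := pnt (Y.incl (O y) z)) (b := Y.incl (O y)) (pnt z) rfl ≫ _ = _ at h2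
    rw [h2] at h1
    rw [bm_eq h1]
    rfl
  let f : Y ⟶ N := mk' (fun y => bm (hFy y) hJ (v y) pointElt)
    (contMDiff_of_local fun y => ⟨O y, hO y, bm (hFO y) hJ (α y), hbm y⟩)
  have hαf : ∀ y, Ξ.Lifts (Y.incl (O y) ≫ f) (α y) := fun y => by
    have : bm (hFO y) hJ (α y) = Y.incl (O y) ≫ f := by
      ext z; exact hbm y z
    rw [← this]; exact bm_lift _ _ _
  choose b hb hbα using fun y => hfib.exists_lift (Y.incl (O y)) f (α y) (univ j f) (hαf y)
    (univ_lift j f)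
  have key := hΞ.isom_sheaf Y Y O (fun y => ⟨y, hO y⟩) (uObj F) (j.obj (pt f))
    (F.w_obj _) (j.w_obj _) (fun y => F.obj (pt (Y.incl (O y)))) (fun y => univ F _) b
    (fun y => univ_lift F _) hb (by
      intro i i' z c d hcd
      have hc := bm_lift (rfl : Ξ.p.obj z = _) (hFO i) c
      have hd := bm_lift (rfl : Ξ.p.obj z = _) (hFO i') d
      set c₀ := bm (rfl : Ξ.p.obj z = _) (hFO i) c
      set d₀ := bm (rfl : Ξ.p.obj z = _) (hFO i') d
      have hc' := lift_comp hc (univ_lift F (Y.incl (O i)))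
      have hd' := lift_comp hd (univ_lift F (Y.incl (O i')))
      rw [← hcd] at hd'
      have he : c₀ ≫ Y.incl (O i) = d₀ ≫ Y.incl (O i') := lift_unique hc' hd'
      obtain ⟨m, hm⟩ : ∃ m, c₀ ≫ Y.incl (O i) = m := ⟨_, rfl⟩
      rw [hm] at he hc'
      obtain ⟨κ, hκ, hκc⟩ := hfib.exists_lift (𝟙 _) m _ (univ F m) hc' (univ_lift F m)
      have e1 : c = κ ≫ ptMap F (a := m) c₀ hm :=
        hfib.hom_ext c₀ (univ F _) hc (lift_comp (f := 𝟙 _) hκ (ptMap_lift F _ _)) (by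
          rw [assoc, ptMap_univ, hκc])
      have e2 : d = κ ≫ ptMap F (a := m) d₀ he.symm :=
        hfib.hom_ext d₀ (univ F _) hd (lift_comp (f := 𝟙 _) hκ (ptMap_lift F _ _)) (by
          rw [assoc, ptMap_univ, hκc, hcd])
      have e3 : ptMap F (a := m) c₀ hm ≫ α i = ptMap F (a := m) d₀ he.symm ≫ α i' := by
        refine hj.ext_pt hΞ fun s => ?_
        have hmi : m s ∈ O i := by rw [← hm]; exact (c₀ s).2
        have hmi' : m s ∈ O i' := by rw [he]; exact (d₀ s).2
        rw [← assoc, ptMap_resP F c₀ hm s hmi, ← assoc, ptMap_resP F d₀ he.symm s hmi', hα, hα]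
      refine hfib.hom_ext (c₀ ≫ Y.incl (O i)) (univ j f) (lift_comp hc (hb i))
        (by rw [hm, he]; exact lift_comp hd (hb i')) ?_
      rw [assoc, hbα, assoc, hbα, e1, e2, assoc, e3, assoc])
  obtain ⟨β, ⟨hβ, hβa⟩, -⟩ := key
  refine ⟨β ≫ univ j f, fun y => ?_⟩
  rw [← hα y y (hO y), ← hbα, ← hβa, ← assoc, ← assoc, ← assoc, resP_univ]

/-! ### The space of lifts -/

section

variable {Y N : Mfd} (F : rep Y ⥤ᵇ Ξ) {j : rep N ⥤ᵇ Ξ} (hj : IsEtChart j)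

/-- The points of the fibre product of `F : Y ⟶ Ξ` and an étale chart. -/
abbrev LiftPts : Type := Σ y : Y, @Shrink.{0} (F.obj (pt (pnt y)) ⟶ uObj j) (hj.small F y)

/-- The point given by an arrow. -/
def liftMk (y : Y) (φ : F.obj (pt (pnt y)) ⟶ uObj j) : LiftPts F hj :=
  ⟨y, @equivShrink _ (hj.small F y) φ⟩

/-- The arrow given by a point. -/
def liftVal (t : LiftPts F hj) : F.obj (pt (pnt t.1)) ⟶ uObj j :=
  (@equivShrink _ (hj.small F t.1)).symm t.2

@[simp] theorem liftVal_mk (y : Y) (φ : F.obj (pt (pnt y)) ⟶ uObj j) :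
    liftVal F hj (liftMk F hj y φ) = φ := (@equivShrink _ (hj.small F y)).symm_apply_apply φ

lemma liftMk_val (t : LiftPts F hj) : liftMk F hj t.1 (liftVal F hj t) = t := by
  obtain ⟨y, φ⟩ := t
  exact congrArg (Sigma.mk y) ((@equivShrink _ (hj.small F y)).apply_symm_apply φ)

lemma liftMk_injective {y : Y} {φ φ' : F.obj (pt (pnt y)) ⟶ uObj j}
    (h : liftMk F hj y φ = liftMk F hj y φ') : φ = φ' :=
  (@equivShrink _ (hj.small F y)).injective (eq_of_heq (Sigma.mk.inj_iff.1 h).2)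

/-- The points of the fibre product, as a glued space: the charts are the lifts over open sets. -/
def liftCore : GlueCore.{v₁} Y (LiftPts F hj) where
  ι := Σ O : Opens Y, (F.obj (pt (Y.incl O)) ⟶ uObj j)
  O i := i.1
  ψ i z := liftMk F hj z (resP F z.2 ≫ i.2)
  inj i z z' h := Subtype.ext (congrArg Sigma.fst h)
  surj t := by
    obtain ⟨O, hy, α, hα⟩ := hj.lift F t.1 (liftVal F hj t)
    exact ⟨⟨O, α⟩, ⟨t.1, hy⟩, (congrArg (liftMk F hj t.1) hα).trans (liftMk_val F hj t)⟩
  trans := by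
    rintro ⟨O, α⟩ ⟨O', α'⟩ ⟨y, hy⟩ ⟨y', hy'⟩ h
    obtain rfl : y = y' := congrArg Sigma.fst h
    have hα := liftMk_injective F hj h
    have hyO : y ∈ O ⊓ O' := ⟨hy, hy'⟩
    have e : ∀ z (hz : z ∈ O ⊓ O') (V : Opens Y) (hV : O ⊓ O' ≤ V)
        (γ : F.obj (pt (Y.incl V)) ⟶ uObj j),
        ptMap F (a := pnt z) (b := Y.incl (O ⊓ O')) (pnt (opnMk z hz)) rfl ≫ resO F hV ≫ γ =
          resP F (hV hz) ≫ γ := fun z hz V hV γ =>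
      (assoc _ _ _).symm.trans ((resP_resO F hV hz) =≫ γ)
    obtain ⟨V, hV, hVα⟩ := hj.rigid_pt (F := F) (a := Y.incl (O ⊓ O')) (opnMk y hyO)
      (α := resO F inf_le_left ≫ α) (α' := resO F inf_le_right ≫ α')
      ((e y hyO O inf_le_left α).trans (hα.trans (e y hyO O' inf_le_right α').symm))
    refine ⟨(fun z : Y.opn (O ⊓ O') => Y.incl _ z) '' V, id,
      ((O ⊓ O').isOpenEmbedding'.isOpenMap) _ V.isOpen, ⟨opnMk y hyO, hV, rfl⟩, contMDiffOn_id, ?_⟩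
    rintro _ ⟨⟨z, hz⟩, hzV, rfl⟩ hzO
    refine ⟨hz.2, congrArg (liftMk F hj z) ?_⟩
    exact (e z hz O inf_le_left α).symm.trans ((hVα _ hzV).trans (e z hz O' inf_le_right α'))

/-- The fibre product of `F : Y ⟶ Ξ` and an étale chart. -/
def liftSpace : Mfd := (liftCore F hj).mfd

/-- A point of the fibre product, as a pair. -/
def liftPt (t : liftSpace F hj) : LiftPts F hj := t

/-- The projection of the fibre product. -/
def liftPr : liftSpace F hj ⟶ Y := mk' (fun t => (liftPt F hj t).1) (by
  intro t
  obtain ⟨i, x, rfl⟩ := (liftCore F hj).exists_map_eq t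
  exact contMDiffAt_of_comp_isEt ((liftCore F hj).isEt_map i x) (smooth (Y.incl i.1) x))

lemma isEt_liftPr : IsEt (liftPr F hj) := by
  intro t
  obtain ⟨i, x, rfl⟩ := (liftCore F hj).exists_map_eq t
  exact IsEt.of_comp ((liftCore F hj).isEt_map i) (isEt_incl i.1)

/-- The open subset of the fibre product given by a lift over an open set. -/
def liftOpen (O : Opens Y) (α : F.obj (pt (Y.incl O)) ⟶ uObj j) : Opens (liftSpace F hj) :=
  ⟨range ((liftCore F hj).map ⟨O, α⟩), ((liftCore F hj).isEt_map ⟨O, α⟩).isOpen_range⟩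

lemma mem_liftOpen {O : Opens Y} {α : F.obj (pt (Y.incl O)) ⟶ uObj j}
    {t : liftSpace F hj} (h : t ∈ liftOpen F hj O α) : ∃ hO : liftPr F hj t ∈ O,
      liftVal F hj t = resP F hO ≫ α := by
  obtain ⟨x, rfl⟩ := h
  exact ⟨x.2, liftVal_mk F hj _ _⟩

lemma exists_liftArrow (hΞ : IsStack Ξ) :
    ∃ k : F.obj (pt (liftPr F hj)) ⟶ uObj j, ∀ t : liftSpace F hj,
      ptMap F (a := pnt (liftPr F hj t)) (b := liftPr F hj) (pnt t) rfl ≫ k = liftVal F hj t := by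
  refine IsEtChart.exists_glue (F := uMap (liftPr F hj) ⋙ F) hΞ hj (fun t => liftVal F hj t) ?_
  intro t
  obtain ⟨⟨O, α⟩, x, hx⟩ := (liftCore F hj).exists_map_eq t
  have ht : t ∈ liftOpen F hj O α := ⟨x, hx⟩
  let c : (liftSpace F hj).opn (liftOpen F hj O α) ⟶ Y.opn O :=
    codRestrict ((liftSpace F hj).incl _ ≫ liftPr F hj) O fun z => (mem_liftOpen F hj z.2).1
  refine ⟨liftOpen F hj O α, ht, ptMap F (a := (liftSpace F hj).incl (liftOpen F hj O α) ≫ liftPr F hj)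
    (b := Y.incl O) c rfl ≫ α, fun z hz => ?_⟩
  obtain ⟨hO, hv⟩ := mem_liftOpen F hj hz
  rw [hv]
  exact (assoc _ _ _).symm.trans ((ptMap_resP F c rfl (opnMk z hz) hO) =≫ α)

lemma contMDiff_liftMk {S : Mfd} (g : S ⟶ Y) (α : F.obj (pt g) ⟶ uObj j) :
    ContMDiff S.I (liftSpace F hj).I ∞ (fun s => (show liftSpace F hj from liftMk F hj (g s)
      (ptMap F (a := pnt (g s)) (b := g) (pnt s) rfl ≫ α))) := by
  refine contMDiff_of_local fun s => ?_
  obtain ⟨O, hO, γ, hγ⟩ := hj.lift F (g s) (ptMap F (a := pnt (g s)) (b := g) (pnt s) rfl ≫ α)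
  let U : Opens S := ⟨g ⁻¹' O, O.isOpen.preimage (continuous g)⟩
  let c : S.opn U ⟶ Y.opn O := codRestrict (S.incl U ≫ g) O fun z => z.2
  let α₁ : F.obj (pt (S.incl U ≫ g)) ⟶ uObj j :=
    ptMap F (a := S.incl U ≫ g) (b := g) (S.incl U) rfl ≫ α
  let α₂ : F.obj (pt (S.incl U ≫ g)) ⟶ uObj j :=
    ptMap F (a := S.incl U ≫ g) (b := Y.incl O) c rfl ≫ γ
  have h₁ : ∀ z : S.opn U, ptMap F (a := pnt ((S.incl U ≫ g) z)) (b := S.incl U ≫ g) (pnt z) rfl ≫ α₁ =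
      ptMap F (a := pnt (g (S.incl U z))) (b := g) (pnt (S.incl U z)) rfl ≫ α := fun z =>
    ptMap_comp_assoc F _ _ _ _ _
  have h₂ : ∀ z : S.opn U, ptMap F (a := pnt ((S.incl U ≫ g) z)) (b := S.incl U ≫ g) (pnt z) rfl ≫ α₂ =
      resP F (O := O) (y := g (S.incl U z)) z.2 ≫ γ := fun z =>
    (assoc _ _ _).symm.trans ((ptMap_resP F c rfl z z.2) =≫ γ)
  obtain ⟨V, hV, hVe⟩ := hj.rigid_pt (F := F) (a := S.incl U ≫ g) (opnMk s hO) (α := α₁) (α' := α₂)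
    ((h₁ (opnMk s hO)).trans (hγ.symm.trans (h₂ (opnMk s hO)).symm))
  let V' : Opens S := ⟨(fun z : S.opn U => S.incl U z) '' V,
    (U.isOpenEmbedding'.isOpenMap) _ V.isOpen⟩
  have hV' : ∀ z : S.opn V', S.incl V' z ∈ U := by
    rintro ⟨_, z, -, rfl⟩; exact z.2
  refine ⟨V', ⟨_, hV, rfl⟩, codRestrict (S.incl V') U hV' ≫ c ≫ (liftCore F hj).map ⟨O, γ⟩, ?_⟩
  rintro ⟨_, z, hz, rfl⟩
  exact congrArg (liftMk F hj (g (S.incl U z))) ((h₂ z).symm.trans ((hVe z hz).symm.trans (h₁ z)))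

lemma IsEtChart.isEtale {N : Mfd} {j : rep N ⥤ᵇ Ξ} (hΞ : IsStack Ξ) (hj : IsEtChart j) :
    IsEtale j := by
  intro Y F _
  have hfib := hΞ.fibred
  obtain ⟨k, hk⟩ := exists_liftArrow F hj hΞ
  have hK : Ξ.p.obj (F.obj (pt (liftPr F hj))) = liftSpace F hj := F.w_obj _
  have hF : Ξ.p.obj (uObj F) = Y := F.w_obj _
  have hJ : Ξ.p.obj (uObj j) = N := j.w_obj _
  refine reprWith_of_isProd hfib (bm_lift hK hJ k) (univ_lift F (liftPr F hj)) ⟨?_, ?_⟩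
    (isEt_liftPr F hj)
  · intro w α γ
    have hγ := bm_lift (rfl : Ξ.p.obj w = _) hF γ
    set g := bm (rfl : Ξ.p.obj w = _) hF γ
    obtain ⟨a, ha, haγ⟩ := exists_vert hfib F hγ
    have hai := hfib.isIso a ha
    let l : Ξ.p.obj w ⟶ liftSpace F hj := mk' _ (contMDiff_liftMk F hj g (inv a ≫ α))
    have hl : l ≫ liftPr F hj = g := rfl
    refine ⟨a ≫ ptMap F l hl, ?_, ?_⟩
    · rw [assoc, ← IsIso.eq_inv_comp]
      refine hj.ext_pt hΞ fun s => ?_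
      have e := hk (l s)
      have e' : liftVal F hj (l s) = ptMap F (a := pnt (g s)) (b := g) (pnt s) rfl ≫ inv a ≫ α :=
        liftVal_mk F hj _ _
      rw [e'] at e
      exact (ptMap_comp_assoc F _ _ _ _ _).trans e
    · rw [assoc, ptMap_univ, haγ]
  · intro w β β' h₁ h₂
    have hβ := bm_lift rfl hK β
    have hβ' := bm_lift rfl hK β'
    suffices h : bm rfl hK β = bm rfl hK β' by
      rw [← h] at hβ'
      exact hfib.hom_ext _ _ hβ hβ' h₂
    set l := bm rfl hK β
    set l' := bm rfl hK β'
    obtain ⟨g, hg⟩ : ∃ g, l ≫ liftPr F hj = g := ⟨_, rfl⟩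
    have hgl := lift_comp hβ (univ_lift F (liftPr F hj))
    have hg' : l' ≫ liftPr F hj = g := by
      rw [h₂] at hgl
      rw [← hg]
      exact lift_unique (lift_comp hβ' (univ_lift F (liftPr F hj))) hgl
    rw [hg] at hgl
    obtain ⟨a, ha, haγ⟩ := exists_vert hfib F hgl
    have hai := hfib.isIso a ha
    have e1 : β = a ≫ ptMap F l hg := hfib.hom_ext l (univ F _) hβ
      (lift_comp (f := 𝟙 _) ha (ptMap_lift F _ _)) (by rw [assoc, ptMap_univ, haγ])
    have e2 : β' = a ≫ ptMap F l' hg' := hfib.hom_ext l' (univ F _) hβ'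
      (lift_comp (f := 𝟙 _) ha (ptMap_lift F _ _)) (by rw [assoc, ptMap_univ, haγ, h₂])
    rw [e1, e2, assoc, assoc, cancel_epi] at h₁
    ext s
    have key : ∀ (t : liftSpace F hj) (y : Y) (hy : liftPr F hj t = y),
        t = liftMk F hj y (ptMap F (a := pnt y) (b := liftPr F hj) (pnt t) (congrArg pnt hy) ≫ k) := by
      intro t y hy
      subst hy
      rw [hk]
      exact (liftMk_val F hj t).symm
    have h3 : l s = liftMk F hj (g s) _ := key (l s) (g s) (congr_hom hg s)
    have h4 : l' s = liftMk F hj (g s) _ := key (l' s) (g s) (congr_hom hg' s)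
    rw [h3, h4]
    refine congrArg (liftMk F hj (g s)) ?_
    have h5 := (ptMap F (a := pnt (g s)) (b := g) (pnt s) rfl ≫= h₁)
    exact (ptMap_comp_assoc F _ _ _ hg k).symm.trans (h5.trans (ptMap_comp_assoc F _ _ _ hg' k))

lemma IsEtChart.exists_extension (hΞ : IsStack Ξ) {M Y N : Mfd} [T2Space M] [ParacompactSpace M]
    {F : rep Y ⥤ᵇ Ξ} {j : rep N ⥤ᵇ Ξ} (hj : IsEtChart j) (e : M ⟶ Y) {p : Y → M}
    (hp : Continuous p) (hpe : ∀ x, p (e x) = x) (β : F.obj (pt e) ⟶ uObj j) :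
    ∃ (D : Opens Y) (hD : ∀ x, e x ∈ D) (α : F.obj (pt (Y.incl D)) ⟶ uObj j),
      ptMap F (codRestrict e D hD) (codRestrict_incl e D hD) ≫ α = β := by
  have hl : Continuous (fun x : M => (show liftSpace F hj from liftMk F hj (e x)
      (ptMap F (a := pnt (e x)) (b := e) (pnt x) rfl ≫ β))) := (contMDiff_liftMk F hj e β).continuous
  obtain ⟨D, σ, hDo, hD, hσ, hσp, hσe⟩ := NearSection.exists_section_extension
    (isEt_liftPr F hj).isLocalHomeomorph hp hpe hl (fun _ => rfl)
  let D' : Opens Y := ⟨D, hDo⟩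
  have key : ∀ (t : liftSpace F hj) (y : Y) (hy : liftPr F hj t = y),
      ∃ φ : F.obj (pt (pnt y)) ⟶ uObj j, t = liftMk F hj y φ := by
    intro t y hy
    subst hy
    exact ⟨_, (liftMk_val F hj t).symm⟩
  choose φ hφ using fun (y : Y) (hy : y ∈ D) => key (σ y) y (hσp y hy)
  obtain ⟨α, hα⟩ := IsEtChart.exists_glue (F := uMap (Y.incl D') ⋙ F) hΞ hj
    (fun y : Y.opn D' => φ (Y.incl D' y) y.2) (by
      rintro ⟨y, hy⟩
      obtain ⟨⟨O, γ⟩, x, hx⟩ := (liftCore F hj).exists_map_eq (σ y)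
      have hmem : σ y ∈ liftOpen F hj O γ := ⟨x, hx⟩
      let U : Opens (Y.opn D') := ⟨(fun z : Y.opn D' => σ (Y.incl D' z)) ⁻¹' liftOpen F hj O γ,
        (liftOpen F hj O γ).isOpen.preimage (continuousOn_iff_continuous_restrict.1 hσ)⟩
      have hU : ∀ z : Y.opn D', z ∈ U → ∃ hO : Y.incl D' z ∈ O,
          φ (Y.incl D' z) z.2 = resP F hO ≫ γ := by
        intro z hz
        obtain ⟨hO, hv⟩ := mem_liftOpen F hj hz
        have h1 := hφ (Y.incl D' z) z.2
        have h2 : liftPr F hj (σ (Y.incl D' z)) = Y.incl D' z := hσp _ z.2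
        rw [h2] at hO
        refine ⟨hO, ?_⟩
        obtain ⟨⟨x', hx'O⟩, hx'⟩ := hz
        have h3 : σ (Y.incl D' z) = liftMk F hj x' (resP F hx'O ≫ γ) := hx'.symm
        have h4 : x' = Y.incl D' z := (congrArg (liftPr F hj) h3).symm.trans h2
        subst h4
        exact liftMk_injective F hj (h1.symm.trans h3)
      let c : (Y.opn D').opn U ⟶ Y.opn O :=
        codRestrict ((Y.opn D').incl U ≫ Y.incl D') O fun z => (hU _ z.2).1
      refine ⟨U, hmem, ptMap F (a := (Y.opn D').incl U ≫ Y.incl D') (b := Y.incl O) c rfl ≫ γ,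
        fun z hz => ?_⟩
      obtain ⟨hO, hv⟩ := hU z hz
      rw [hv]
      exact (assoc _ _ _).symm.trans ((ptMap_resP F c rfl (opnMk z hz) hO) =≫ γ))
  refine ⟨D', hD, α, hj.ext_pt hΞ fun x => ?_⟩
  have h1 := hφ (e x) (hD x)
  rw [hσe] at h1
  have h2 := liftMk_injective F hj h1
  rw [h2]
  exact (ptMap_comp_assoc F _ _ _ _ _).trans (hα (opnMk (e x) (hD x)))

end

end Stk

namespace Mfd

lemma IsEt.exists_factor {S T Z : Mfd} {ψ : T ⟶ Z} (hψ : IsEt ψ) (hi : Injective ψ)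
    (f : S ⟶ Z) (h : ∀ s, f s ∈ range ψ) : ∃ g : S ⟶ T, g ≫ ψ = f := by
  choose g hg using h
  refine ⟨mk' g fun s => ?_, by ext s; exact hg s⟩
  obtain ⟨Φ, hx, hΦ⟩ := hψ (g s)
  have hfs : f s ∈ Φ.target := by
    rw [← hg s, hΦ hx]; exact Φ.map_source hx
  have h1 : ContMDiffAt Z.I T.I ∞ Φ.symm (f s) :=
    Φ.contMDiffOn_invFun.contMDiffAt (Φ.open_target.mem_nhds hfs)
  refine (ContMDiffAt.comp s h1 (smooth f s)).congr_of_eventuallyEq ?_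
  filter_upwards [(continuous f).continuousAt.preimage_mem_nhds
    (Φ.open_target.mem_nhds hfs)] with s' hs'
  apply hi
  rw [hg]
  exact ((hΦ (Φ.map_target hs')).trans (Φ.right_inv hs')).symm

end Mfd

namespace Stk

/-! ### The morphism given by an object -/

lemma IsFibredInGroupoids.exists_pullback (hΞ : IsFibredInGroupoids Ξ) {N S : Mfd} {x : Ξ.obj}
    (hx : Ξ.p.obj x = N) (a : S ⟶ N) : ∃ (y : Ξ.obj) (φ : y ⟶ x), Ξ.Lifts a φ := by
  subst hx
  exact hΞ.pullback x a

lemma exists_functor (hΞ : IsFibredInGroupoids Ξ) {N : Mfd} {x : Ξ.obj} (hx : Ξ.p.obj x = N) :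
    ∃ (j : rep N ⥤ᵇ Ξ) (φ : uObj j ⟶ x), Ξ.Lifts (𝟙 N) φ := by
  choose o φ hφ using fun a : (rep N).obj => hΞ.exists_pullback hx (Over.hom (X := N) a)
  have hm : ∀ {a b : (rep N).obj} (f : a ⟶ b), ∃ χ : o a ⟶ o b,
      Ξ.Lifts (CommaMorphism.left f) χ ∧ χ ≫ φ b = φ a := fun {a b} f =>
    hΞ.exists_lift (CommaMorphism.left f) (Over.hom (X := N) b) (φ a) (φ b) (by
      rw [Over.w (X := N) (f := a) (g := b) f]; exact hφ a) (hφ b)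
  choose m hml hmφ using @hm
  have ho : ∀ a, Ξ.p.obj (o a) = Comma.left a := fun a => (lift_base (hφ a)).1
  let j : rep N ⥤ᵇ Ξ := {
      obj := o, map := fun {a b} f => m f
      map_id := fun a => hΞ.hom_ext (𝟙 _) (φ a) (hml (𝟙 a)) (IsHomLift.id (ho a)) (by
        rw [hmφ, id_comp])
      map_comp := fun {a b c} f g => hΞ.hom_ext (CommaMorphism.left (f ≫ g)) (φ c) (hml (f ≫ g))
        (lift_comp (hml f) (hml g)) (by rw [assoc, hmφ, hmφ, hmφ])
      w := CategoryTheory.Functor.ext ho fun a b f => by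
        have := hml f
        exact IsHomLift.fac' Ξ.p (CommaMorphism.left f) (m f) }
  exact ⟨j, φ (pt (𝟙 N)), hφ (pt (𝟙 N))⟩

/-! ### Maps to a manifold -/

section

variable {M N : Mfd}

lemma toMap_pt (G : rep N ⥤ᵇ rep M) {S : Mfd} (a : S ⟶ N) : toMap G (pt a) = a ≫ mapOf G := by
  refine lift_unique (toMap_lift G (pt a)) ?_
  rw [← comp_term (ptMap G (a := a) (b := 𝟙 N) a rfl)]
  exact lift_comp (ptMap_lift G _ _) (toMap_lift G (pt (𝟙 N)))

lemma sameMap_iff {G G' : rep N ⥤ᵇ rep M} : SameMap G G' ↔ mapOf G = mapOf G' := by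
  refine ⟨fun h => h _, fun h x => ?_⟩
  have h1 := toMap_pt G (Over.hom (X := N) x)
  rwa [h, ← toMap_pt G'] at h1

lemma sameMap_mapOf (G : rep N ⥤ᵇ rep M) : SameMap G (uMap (mapOf G)) := sameMap_iff.2 rfl

lemma toMap_arrow (G : Ξ ⥤ᵇ rep M) {x y : Ξ.obj} {α : x ⟶ y} {S T : Mfd} {f : S ⟶ T}
    (hα : Ξ.Lifts f α) : eqToHom (lift_base hα).1.symm ≫ toMap G x =
      f ≫ eqToHom (lift_base hα).2.symm ≫ toMap G y := by
  have hx : Ξ.p.obj x = S := (lift_base hα).1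
  have hy : Ξ.p.obj y = T := (lift_base hα).2
  subst hx hy
  simp only [eqToHom_refl, id_comp]
  refine lift_unique (toMap_lift G x) ?_
  rw [← comp_term (G.map α)]
  exact lift_comp (map_lift G hα) (toMap_lift G y)

lemma mapOf_arrow {Y : Mfd} (G : Ξ ⥤ᵇ rep M) {F : rep Y ⥤ᵇ Ξ} {j : rep N ⥤ᵇ Ξ} {S T : Mfd}
    {a : S ⟶ Y} {b : T ⟶ N} {f : S ⟶ T} {α : F.obj (pt a) ⟶ j.obj (pt b)}
    (hα : Ξ.Lifts f α) : a ≫ mapOf (F ⋙ G) = f ≫ b ≫ mapOf (j ⋙ G) := by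
  have h := toMap_arrow G hα
  rw [← toMap_pt, ← toMap_pt, toMap_comp, toMap_comp]
  exact h

end

/-! ### Étale charts are local -/

lemma isEtChart_of_local (hΞ : IsFibredInGroupoids Ξ) {X N : Mfd} {q : rep X ⥤ᵇ Ξ}
    (hq : IsEtChart q) {j : rep N ⥤ᵇ Ξ} (h : ∀ n : N, ∃ (U : Opens X) (ψ : X.opn U ⟶ N)
      (κ : q.obj (pt (X.incl U)) ⟶ uObj j), IsEt ψ ∧ Injective ψ ∧
      n ∈ range ψ ∧ Ξ.Lifts ψ κ) : IsEtChart j := by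
  have hJ : Ξ.p.obj (uObj j) = N := j.w_obj _
  have hQ : Ξ.p.obj (uObj q) = X := q.w_obj _
  choose U ψ κ hψ hinj hmem hκ using h
  choose g hg using hmem
  -- factorization of arrows through the charts
  have fac : ∀ (n : N) {Y S : Mfd} (F : rep Y ⥤ᵇ Ξ) (a : S ⟶ Y) {f : S ⟶ N}
      (α : F.obj (pt a) ⟶ uObj j), Ξ.Lifts f α → (∀ s, f s ∈ range (ψ n)) →
      ∃ (f' : S ⟶ X.opn (U n)) (α' : F.obj (pt a) ⟶ q.obj (pt (X.incl (U n)))),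
        f' ≫ ψ n = f ∧ Ξ.Lifts f' α' ∧ α' ≫ κ n = α := by
    intro n Y S F a f α hα hf
    obtain ⟨f', hf'⟩ := (hψ n).exists_factor (hinj n) f hf
    obtain ⟨α', h1, h2⟩ := hΞ.exists_lift f' (ψ n) α (κ n) (by rwa [hf']) (hκ n)
    exact ⟨f', α', hf', h1, h2⟩
  have cancel : ∀ (n : N) {Y S : Mfd} (F : rep Y ⥤ᵇ Ξ) (a : S ⟶ Y) {f f' : S ⟶ X.opn (U n)}
      {α α' : F.obj (pt a) ⟶ q.obj (pt (X.incl (U n)))}, Ξ.Lifts f α → Ξ.Lifts f' α' →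
      α ≫ univ q _ = α' ≫ univ q _ → α = α' := by
    intro n Y S F a f f' α α' h1 h2 h3
    have h4 := lift_comp h1 (univ_lift q (X.incl (U n)))
    rw [h3] at h4
    have h5 := lift_unique h4 (lift_comp h2 (univ_lift q (X.incl (U n))))
    have h6 : f = f' := by
      ext s
      exact incl_injective _ (congrArg (fun k : S ⟶ X => k s) h5)
    subst h6
    exact hΞ.hom_ext f _ h1 h2 h3
  refine ⟨fun {Y} F y => ?_, fun {Y} F y β => ?_, fun {Y} F y α α' hαα => ?_⟩
  · have hF : Ξ.p.obj (F.obj (pt (pnt y))) = point := F.w_obj _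
    have := hq.small F y
    choose f' α' h1 h2 h3 using fun β : F.obj (pt (pnt y)) ⟶ uObj j =>
      fac (bm hF hJ β pointElt) F (pnt y) β (bm_lift hF hJ β) (fun s => by
        rw [Subsingleton.elim s pointElt]; exact ⟨_, hg _⟩)
    refine small_of_injective (β := N × (F.obj (pt (pnt y)) ⟶ uObj q))
      (f := fun β => (bm hF hJ β pointElt, α' β ≫ univ q _)) fun β β' hββ => ?_
    rw [Prod.mk.injEq] at hββ
    obtain ⟨e1, e2⟩ := hββ
    have key : ∀ (n n' : N) (_ : n = n') (f : point ⟶ X.opn (U n)) (f' : point ⟶ X.opn (U n'))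
        (α : F.obj (pt (pnt y)) ⟶ q.obj (pt (X.incl (U n))))
        (α' : F.obj (pt (pnt y)) ⟶ q.obj (pt (X.incl (U n')))), Ξ.Lifts f α →
        Ξ.Lifts f' α' → α ≫ univ q _ = α' ≫ univ q _ → α ≫ κ n = α' ≫ κ n' := by
      intro n n' hn f f' α α' hf hf' hh
      subst hn
      rw [cancel n F _ hf hf' hh]
    rw [← h3 β, ← h3 β']
    exact key _ _ e1 _ _ _ _ (h2 β) (h2 β') e2
  · have hF : Ξ.p.obj (F.obj (pt (pnt y))) = point := F.w_obj _
    set n := bm hF hJ β pointElt with hn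
    obtain ⟨f, β', hf, hβ', hβκ⟩ := fac n F (pnt y) β (bm_lift hF hJ β) (fun s => by
        rw [Subsingleton.elim s pointElt]; exact ⟨_, hg _⟩)
    obtain ⟨O, hy, γ, hγ⟩ := hq.lift F y (β' ≫ univ q _)
    have hFO : Ξ.p.obj (F.obj (pt (Y.incl O))) = Y.opn O := F.w_obj _
    have hγl := bm_lift hFO hQ γ
    set c := bm hFO hQ γ
    have hcy : c (opnMk y hy) = X.incl (U n) (f pointElt) := by
      have h1 := lift_comp (ptMap_lift F (a := pnt y) (b := Y.incl O) (pnt (opnMk y hy))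
        (pnt_opnMk hy)) hγl
      rw [hγ] at h1
      exact congrArg (fun k : point ⟶ X => k pointElt)
        (lift_unique h1 (lift_comp hβ' (univ_lift q _)))
    let O' : Opens Y := ⟨(fun z : Y.opn O => Y.incl O z) '' (c ⁻¹' U n),
      (O.isOpenEmbedding'.isOpenMap) _ ((U n).isOpen.preimage (continuous c))⟩
    have hO'O : O' ≤ O := by
      rintro _ ⟨z, -, rfl⟩; exact z.2
    have hy' : y ∈ O' := ⟨opnMk y hy, show c (opnMk y hy) ∈ U n by rw [hcy]; exact (f pointElt).2, rfl⟩
    have hiV : ∀ z, (Y.inclLE hO'O ≫ c) z ∈ U n := by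
      rintro ⟨_, z, hz, rfl⟩; exact hz
    let c' := codRestrict (Y.inclLE hO'O ≫ c) (U n) hiV
    have hγl' : Ξ.Lifts (Y.inclLE hO'O ≫ c) (resO F hO'O ≫ γ) := lift_comp (ptMap_lift F _ _) hγl
    obtain ⟨γ', hγ', hγγ⟩ := hΞ.exists_lift c' (X.incl (U n)) (resO F hO'O ≫ γ) (univ q _)
      hγl' (univ_lift q _)
    refine ⟨O', hy', γ' ≫ κ n, ?_⟩
    change resP F hy' ≫ γ' ≫ κ n = β
    rw [← hβκ, ← assoc]
    refine (?_ =≫ κ n)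
    refine cancel n F _ (lift_comp (ptMap_lift F _ _) hγ') hβ' ?_
    have e := resP_resO F hO'O hy'
    change _ = β' ≫ _
    rw [assoc, hγγ, reassoc_of% e]
    exact hγ
  · have hF : Ξ.p.obj (uObj F) = Y := F.w_obj _
    have hα := bm_lift hF hJ α
    have hα' := bm_lift hF hJ α'
    set f := bm hF hJ α
    set f' := bm hF hJ α'
    have hfy : f y = f' y := by
      have h1 := lift_comp (univ_lift F (pnt y)) hα
      rw [hαα] at h1
      exact pnt_injective (lift_unique h1 (lift_comp (univ_lift F (pnt y)) hα'))
    set n := f y with hn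
    have hro : IsOpen (range (ψ n)) := (hψ n).isOpen_range
    let O : Opens Y := ⟨f ⁻¹' range (ψ n) ∩ f' ⁻¹' range (ψ n),
      (hro.preimage (continuous f)).inter (hro.preimage (continuous f'))⟩
    have hyO : y ∈ O := ⟨⟨_, hg n⟩, ⟨g n, (hg n).trans hfy⟩⟩
    obtain ⟨f₁, α₁, hf₁, hα₁, hακ₁⟩ := fac n F (Y.incl O) (univ F (Y.incl O) ≫ α)
      (lift_comp (univ_lift F _) hα) (fun z => z.2.1)
    obtain ⟨f₂, α₂, hf₂, hα₂, hακ₂⟩ := fac n F (Y.incl O) (univ F (Y.incl O) ≫ α')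
      (lift_comp (univ_lift F _) hα') (fun z => z.2.2)
    have hl : Ξ.Lifts (pnt (opnMk y hyO)) (resP F hyO) := ptMap_lift F _ _
    have h12 : resP F hyO ≫ α₁ = resP F hyO ≫ α₂ := by
      have h1 := lift_comp hl hα₁
      have h2 := lift_comp hl hα₂
      have e : pnt (opnMk y hyO) ≫ f₁ = pnt (opnMk y hyO) ≫ f₂ := by
        refine congrArg pnt (a₁ := f₁ (opnMk y hyO)) (a₂ := f₂ (opnMk y hyO)) (hinj n ?_)
        have e1 := congrArg (fun k : Y.opn O ⟶ N => k (opnMk y hyO)) hf₁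
        have e2 := congrArg (fun k : Y.opn O ⟶ N => k (opnMk y hyO)) hf₂
        exact e1.trans (hfy.trans e2.symm)
      rw [e] at h1
      refine hΞ.hom_ext _ (κ n) h1 h2 ?_
      rw [assoc, hακ₁, assoc, hακ₂, ← assoc, resP_univ, ← assoc, resP_univ]
      exact hαα
    obtain ⟨V, hyV, hV⟩ := hq.rigid (uMap (Y.incl O) ⋙ F) (opnMk y hyO) (α₁ ≫ univ q _)
      (α₂ ≫ univ q _) (by
        have := (h12 =≫ univ q (X.incl (U n)))
        simp only [assoc] at this
        exact this)
    let V' : Opens Y := ⟨(fun z : Y.opn O => Y.incl O z) '' V, (O.isOpenEmbedding'.isOpenMap) _ V.isOpen⟩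
    have hV'O : V' ≤ O := by
      rintro _ ⟨z, -, rfl⟩; exact z.2
    refine ⟨V', ⟨_, hyV, rfl⟩, ?_⟩
    let i : Y.opn V' ⟶ (Y.opn O).opn V := codRestrict (Y.inclLE hV'O) V (by
      rintro ⟨_, z, hz, rfl⟩; exact hz)
    have hres : resO F hV'O = ptMap F (a := Y.incl V') (b := (Y.opn O).incl V ≫ Y.incl O) i rfl ≫
      ptMap F (a := (Y.opn O).incl V ≫ Y.incl O) (b := Y.incl O) ((Y.opn O).incl V) rfl :=
      (ptMap_comp F i ((Y.opn O).incl V) _ _).symm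
    have h34 : resO F hV'O ≫ α₁ = resO F hV'O ≫ α₂ := by
      have hl := ptMap_lift F (a := Y.incl V') (b := Y.incl O) (Y.inclLE hV'O) (inclLE_incl hV'O)
      refine cancel n F _ (lift_comp hl hα₁) (lift_comp hl hα₂) ?_
      rw [assoc, assoc, hres, assoc, assoc]
      exact congrArg _ hV
    rw [← resO_univ F hV'O, assoc, ← hακ₁, reassoc_of% h34, hακ₂, assoc]

/-! ### Submersions onto a manifold -/

lemma isAtlas_id (M : Mfd) [T2Space M] : IsAtlas (𝟭 (rep M)) where
  t2 := inferInstance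
  subm S y := by
    have hy : (rep M).p.obj (uObj y) = S := y.w_obj _
    refine reprWith_of_isProd (rep_fibred M) (j := 𝟭 (rep M)) (π₂ := 𝟙 S) (k₂ := 𝟙 _)
      (bm_lift hy rfl (term (uObj y))) (IsHomLift.id hy) ⟨?_, ?_⟩ ?_
    · intro x α γ
      exact ⟨γ, (term_unique _).trans (term_unique _).symm, comp_id γ⟩
    · intro x β β' _ h
      rwa [comp_id, comp_id] at h
    · intro x
      change Function.Surjective (mfderiv S.I S.I id x)
      rw [mfderiv_id]
      exact Function.surjective_id
  epi S y hy := ⟨Unit, fun _ => ⊤, fun s => ⟨(), trivial⟩, fun _ => by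
    obtain ⟨z, φ, hφ⟩ := (rep_fibred M).exists_pullback hy (S.incl ⊤)
    exact ⟨z, φ, hφ⟩⟩

lemma isSubm_mapOf {Ξ : BasedCategory.{v₁, u₁} Mfd} {M X : Mfd} [T2Space M] {G : Ξ ⥤ᵇ rep M}
    (hG : IsSubmersion G) {q : rep X ⥤ᵇ Ξ} (hq : IsAtlas q) : IsSubm (mapOf (q ⋙ G)) := by
  obtain ⟨P, K, π₂, k₁, k₂, hk₂, H, hπ⟩ :=
    exists_isProd_of_reprWith (rep_fibred M) (hG X q hq M (𝟭 (rep M)) (isAtlas_id M))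
  have hA : (rep M).p.obj ((q ⋙ G).obj (pt (𝟙 X))) = X := (q ⋙ G).w_obj _
  have hK := (lift_base hk₂).1
  obtain ⟨σ, hσ₁, hσ₂⟩ := H.ex (𝟙 _) (term _)
  have e1 : k₁ ≫ σ = 𝟙 K := H.uniq _ _ (by rw [assoc, hσ₁, id_comp, comp_id])
    ((term_unique _).trans (term_unique _).symm)
  have h1 : bm hA hK σ ≫ bm hK hA k₁ = 𝟙 X := by
    rw [← bm_comp, hσ₁]; exact bm_eq (IsHomLift.id hA)
  have h2 : bm hK hA k₁ ≫ bm hA hK σ = 𝟙 P := by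
    rw [← bm_comp, e1]; exact bm_eq (IsHomLift.id hK)
  have h3 : mapOf (q ⋙ G) = bm hA hK σ ≫ π₂ := by
    refine lift_unique (toMap_lift (q ⋙ G) (pt (𝟙 X))) ?_
    rw [← hσ₂]
    exact lift_comp (bm_lift hA hK σ) hk₂
  rw [h3]
  set a := bm hA hK σ
  set b := bm hK hA k₁
  have hmd : ∀ {S T : Mfd} (f : S ⟶ T) (x : S), MDifferentiableAt S.I T.I f x := fun f x =>
    (smooth f x).mdifferentiableAt (by simp)
  intro x
  have hs : Function.Surjective (mfderiv X.I P.I a x) := by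
    have hbx : b (a x) = x := congr_hom h1 x
    have hc := mfderiv_comp (I := P.I) (I' := X.I) (I'' := P.I) (a x) (hmd a (b (a x))) (hmd b (a x))
    have hid : (a ∘ b : P → P) = id := funext fun p => congr_hom h2 p
    rw [hid, mfderiv_id, hbx] at hc
    intro v
    exact ⟨mfderiv P.I X.I b (a x) v, (congrArg (fun L : TangentSpace P.I (a x) →L[ℝ] _ => L v) hc).symm⟩
  have hc := mfderiv_comp (I := X.I) (I' := P.I) (I'' := M.I) x (hmd π₂ (a x)) (hmd a x)
  have hc' : mfderiv X.I M.I (a ≫ π₂) x = (mfderiv P.I M.I π₂ (a x)).comp (mfderiv X.I P.I a x) := hc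
  rw [hc']
  exact (hπ (a x)).comp hs

/-! ### Partially defined maps of charts -/

/-- The arrow `f'` is the image of the arrow `f` under the partially defined map `α` of charts. -/
def Tr {X : Mfd} {q : rep X ⥤ᵇ Ξ} {D : Opens X} {J : Ξ.obj} (α : q.obj (pt (X.incl D)) ⟶ J)
    {z : Ξ.obj} (f : z ⟶ uObj q) (f' : z ⟶ J) : Prop :=
  ∃ k : z ⟶ q.obj (pt (X.incl D)), k ≫ univ q (X.incl D) = f ∧ k ≫ α = f'

section

variable {X : Mfd} {q : rep X ⥤ᵇ Ξ} {D : Opens X} {J : Ξ.obj} {α : q.obj (pt (X.incl D)) ⟶ J}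
  {z : Ξ.obj} {f : z ⟶ uObj q} {f' f'' : z ⟶ J}

lemma Tr.pre (h : Tr α f f') {y : Ξ.obj} (r : y ⟶ z) : Tr α (r ≫ f) (r ≫ f') := by
  obtain ⟨k, rfl, rfl⟩ := h
  exact ⟨r ≫ k, assoc _ _ _, assoc _ _ _⟩

lemma incl_cancel (hΞ : IsFibredInGroupoids Ξ) {k k' : z ⟶ q.obj (pt (X.incl D))}
    (h : k ≫ univ q (X.incl D) = k' ≫ univ q (X.incl D)) : k = k' := by
  have hQ : Ξ.p.obj (q.obj (pt (X.incl D))) = X.opn D := q.w_obj _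
  have hk := bm_lift (rfl : Ξ.p.obj z = _) hQ k
  have hk' := bm_lift (rfl : Ξ.p.obj z = _) hQ k'
  have h4 := lift_comp hk (univ_lift q (X.incl D))
  rw [h] at h4
  have h5 := lift_unique h4 (lift_comp hk' (univ_lift q (X.incl D)))
  have h6 : bm (rfl : Ξ.p.obj z = _) hQ k = bm (rfl : Ξ.p.obj z = _) hQ k' := by
    ext s
    exact incl_injective _ (congrArg (fun k : _ ⟶ X => k s) h5)
  rw [h6] at hk
  exact hΞ.hom_ext _ _ hk hk' h

lemma Tr.unique (hΞ : IsFibredInGroupoids Ξ) (h : Tr α f f') (h' : Tr α f f'') : f' = f'' := by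
  obtain ⟨k, rfl, rfl⟩ := h
  obtain ⟨k', e, rfl⟩ := h'
  rw [incl_cancel hΞ e]

lemma Tr.exists (hΞ : IsFibredInGroupoids Ξ) (α : q.obj (pt (X.incl D)) ⟶ J)
    (f : z ⟶ uObj q) {S : Mfd} {g : S ⟶ X}
    (hf : Ξ.Lifts g f) (hg : ∀ s, g s ∈ D) : ∃ f', Tr α f f' := by
  obtain ⟨k, -, hk⟩ := hΞ.exists_lift (codRestrict g D hg) (X.incl D) f (univ q (X.incl D)) hf
    (univ_lift q _)
  exact ⟨k ≫ α, k, hk, rfl⟩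

lemma Tr.mem (h : Tr α f f') {S : Mfd} {g : S ⟶ X} (hf : Ξ.Lifts g f) (s : S) : g s ∈ D := by
  obtain ⟨k, rfl, -⟩ := h
  have hQ : Ξ.p.obj (q.obj (pt (X.incl D))) = X.opn D := q.w_obj _
  have hz := (lift_base hf).1
  rw [lift_unique hf (lift_comp (bm_lift hz hQ k) (univ_lift q (X.incl D)))]
  exact (bm hz hQ k s).2

lemma Tr.base (h : Tr α f f') {S N : Mfd} {g : S ⟶ X} (hf : Ξ.Lifts g f)
    {φ : X.opn D ⟶ N} (hφ : Ξ.Lifts φ α) :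
    Ξ.Lifts (codRestrict g D (h.mem hf) ≫ φ) f' := by
  have hm := h.mem hf
  obtain ⟨k, rfl, rfl⟩ := h
  have hQ : Ξ.p.obj (q.obj (pt (X.incl D))) = X.opn D := q.w_obj _
  have hz := (lift_base hf).1
  have e := lift_unique hf (lift_comp (bm_lift hz hQ k) (univ_lift q (X.incl D)))
  have e' : codRestrict g D hm = bm hz hQ k := by
    ext s
    exact incl_injective D (congrArg (fun k : _ ⟶ X => k s) e)
  rw [e']
  exact lift_comp (bm_lift hz hQ k) hφ

end

lemma IsEtChart.exists_extension_opn (hΞ : IsStack Ξ) {M X N : Mfd} {W : Opens M}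
    [T2Space W] [ParacompactSpace W] {F : rep X ⥤ᵇ Ξ} {j : rep N ⥤ᵇ Ξ} (hj : IsEtChart j)
    (e : M.opn W ⟶ X) (s : X ⟶ M) (hse : e ≫ s = M.incl W)
    (β : F.obj (pt e) ⟶ uObj j) :
    ∃ (D : Opens X) (hD : ∀ x, e x ∈ D) (α : F.obj (pt (X.incl D)) ⟶ uObj j),
      ∀ x, resP F (hD x) ≫ α = ptMap F (a := pnt (e x)) (b := e) (pnt x) rfl ≫ β := by
  have hse' : ∀ x, s (e x) = M.incl W x := fun x => congr_hom hse x
  let Y : Opens X := ⟨s ⁻¹' W, W.isOpen.preimage (continuous s)⟩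
  let e' : M.opn W ⟶ X.opn Y := codRestrict e Y fun x => show s (e x) ∈ W by
    rw [hse']; exact x.2
  let p := codRestrict (X.incl Y ≫ s) W fun x => x.2
  have : T2Space (M.opn W) := inferInstanceAs (T2Space W)
  have : ParacompactSpace (M.opn W) := inferInstanceAs (ParacompactSpace W)
  obtain ⟨D, hD, α, hα⟩ := IsEtChart.exists_extension (F := uMap (X.incl Y) ⋙ F) hΞ hj e'
    (p := p) (continuous p) (fun x => Subtype.ext (hse' x)) β
  let D' : Opens X := ⟨(fun z : X.opn Y => X.incl Y z) '' D, (Y.isOpenEmbedding'.isOpenMap) _ D.isOpen⟩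
  have hD'Y : D' ≤ Y := by
    rintro _ ⟨z, -, rfl⟩; exact z.2
  let i : X.opn D' ⟶ (X.opn Y).opn D := codRestrict (X.inclLE hD'Y) D (by
    rintro ⟨_, z, hz, rfl⟩; exact hz)
  refine ⟨D', fun x => ⟨e' x, hD x, rfl⟩, ptMap F (a := X.incl D')
    (b := (X.opn Y).incl D ≫ X.incl Y) i rfl ≫ α, fun x => ?_⟩
  have h1 := (ptMap F (a := pnt (e x)) (b := e) (pnt x) rfl ≫= hα)
  refine Eq.trans ?_ h1
  exact (ptMap_comp_assoc F (a := pnt (e x)) (b := X.incl D') (c := (X.opn Y).incl D ≫ X.incl Y) _ i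
    _ _ α).trans (ptMap_comp_assoc F (a := pnt (e x)) (b := e) (c := (X.opn Y).incl D ≫ X.incl Y)
      (pnt x) (codRestrict e' D hD) rfl rfl α).symm

/-! ### Gluing a chart near a section -/

/-- Local lifts of a morphism `e : M ⟶ Ξ` to a chart `q`, with transition maps. -/
structure SectionCover {M X : Mfd} (e : rep M ⥤ᵇ Ξ) (q : rep X ⥤ᵇ Ξ) (G : Ξ ⥤ᵇ rep M) where
  chart : IsEtChart q
  stack : IsStack Ξ
  sec : mapOf (e ⋙ G) = 𝟙 M
  u : M → Opens M
  a : ∀ x, e.obj (pt (M.incl (u x))) ⟶ uObj q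
  C : M → Set M
  w : M → Set M
  locFin : LocallyFinite C
  closed : ∀ x, IsClosed (C x)
  subset : ∀ x, C x ⊆ u x
  isOpen : ∀ x, IsOpen (w x)
  w_sub : ∀ x, w x ⊆ C x
  cover : ∀ m, ∃ x, m ∈ w x
  D : M → M → Opens X
  α : ∀ x y, q.obj (pt (X.incl (D x y))) ⟶ uObj q
  tr : ∀ x y m (hx : m ∈ u x) (hy : m ∈ u y), Tr (α x y) (resP e hx ≫ a x) (resP e hy ≫ a y)

lemma exists_sectionCover {M X : Mfd} [T2Space M] [SecondCountableTopology M] {e : rep M ⥤ᵇ Ξ}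
    {q : rep X ⥤ᵇ Ξ} {G : Ξ ⥤ᵇ rep M} (hΞ : IsStack Ξ) (hq : IsEtChart q) (hepi : IsEpim q)
    (sec : mapOf (e ⋙ G) = 𝟙 M) : Nonempty (SectionCover e q G) := by
  have hfib := hΞ.fibred
  have : LocallyCompactSpace M := Manifold.locallyCompact_of_finiteDimensional M.I
  choose u hu a using fun x : M => hepi.exists_arrow hfib e x
  replace a := fun x => (a x).some
  obtain ⟨C, w, h1, h2, h3, h4, h5, h6⟩ := NearSection.exists_closed_cover (fun x => (u x : Set M))
    (fun x => (u x).isOpen) (fun x => ⟨x, hu x⟩)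
  have hQ : Ξ.p.obj (uObj q) = X := q.w_obj _
  have key : ∀ x y, ∃ (D : Opens X) (α : q.obj (pt (X.incl D)) ⟶ uObj q),
      ∀ m (hx : m ∈ u x) (hy : m ∈ u y), Tr α (resP e hx ≫ a x) (resP e hy ≫ a y) := by
    intro x y
    let W : Opens M := u x ⊓ u y
    have : LocallyCompactSpace W := W.isOpen.locallyCompactSpace
    have hW : Ξ.p.obj (e.obj (pt (M.incl W))) = M.opn W := e.w_obj _
    let f := resO e (inf_le_left : W ≤ u x) ≫ a x
    have hf := bm_lift hW hQ f
    set b := bm hW hQ f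
    obtain ⟨v, hv, hvf⟩ := exists_vert hfib q hf
    have hvi := hfib.isIso v hv
    have hbs : b ≫ mapOf (q ⋙ G) = M.incl W := by
      have := mapOf_arrow G hf
      rw [sec, comp_id, id_comp] at this
      exact this.symm
    obtain ⟨D, hD, α, hα⟩ := IsEtChart.exists_extension_opn (F := q) hΞ hq b (mapOf (q ⋙ G)) hbs
      (inv v ≫ resO e (inf_le_right : W ≤ u y) ≫ a y)
    refine ⟨D, α, fun m hx hy => ?_⟩
    have hm : m ∈ W := ⟨hx, hy⟩
    obtain ⟨v', hv', hvv'⟩ := hfib.exists_lift (𝟙 point) (pnt (opnMk m hm)) (resP e hm ≫ v)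
      (ptMap q (a := pnt (b (opnMk m hm))) (b := b) (pnt (opnMk m hm)) rfl)
      (lift_comp (f := pnt (opnMk m hm)) (g := 𝟙 _) (ptMap_lift e _ _) hv) (ptMap_lift q _ _)
    have e1 := resP_resO e (inf_le_left : W ≤ u x) hm
    have e2 := resP_resO e (inf_le_right : W ≤ u y) hm
    refine ⟨v' ≫ resP q (hD (opnMk m hm)), ?_, ?_⟩
    · rw [assoc, resP_univ, ← e1, assoc]
      change _ = resP e hm ≫ f
      rw [← hvf, ← assoc, ← hvv', assoc]
      exact (v' ≫= (ptMap_univ q _ _).symm)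
    · rw [assoc, hα, reassoc_of% hvv', IsIso.hom_inv_id_assoc, reassoc_of% e2]
  choose D α hα using key
  exact ⟨⟨hq, hΞ, sec, u, a, C, w, h1, h2, h3, h4, h5, h6, D, α, hα⟩⟩

namespace SectionCover

variable {M X : Mfd} {e : rep M ⥤ᵇ Ξ} {q : rep X ⥤ᵇ Ξ} {G : Ξ ⥤ᵇ rep M} (K : SectionCover e q G)

lemma objQ : Ξ.p.obj (uObj q) = X := q.w_obj _

/-- The source map of the chart. -/
abbrev s (_ : SectionCover e q G) : X ⟶ M := mapOf (q ⋙ G)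

/-- The local lift of `e`. -/
def lft (x : M) : M.opn (K.u x) ⟶ X := bm (e.w_obj _) objQ (K.a x)

lemma lft_lift (x : M) : Ξ.Lifts (K.lft x) (K.a x) := bm_lift _ _ _

lemma resP_a_lift {x m : M} (hx : m ∈ K.u x) :
    Ξ.Lifts (pnt (K.lft x (opnMk m hx))) (resP e hx ≫ K.a x) :=
  lift_comp (f := pnt (opnMk m hx)) (g := K.lft x) (ptMap_lift e _ _) (K.lft_lift x)

lemma s_lft {x m : M} (hx : m ∈ K.u x) : K.s (K.lft x (opnMk m hx)) = m := by
  have h := mapOf_arrow G (K.lft_lift x)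
  rw [K.sec, comp_id, id_comp] at h
  exact (congr_hom h (opnMk m hx)).symm

lemma s_eq {g h : X} {f : q.obj (pt (pnt g)) ⟶ uObj q} (hf : Ξ.Lifts (pnt h) f) :
    K.s g = K.s h := pnt_injective (mapOf_arrow G hf)

/-- The points at which the cocycle condition holds. -/
def cocycleSet (x y z : M) : Set X := {g | ∃ f' f'', Tr (K.α x y) (univ q (pnt g)) f' ∧
  Tr (K.α y z) f' f'' ∧ Tr (K.α x z) (univ q (pnt g)) f''}

/-- The points at which a transition map from a lift to itself is the identity. -/
def idSet (x : M) : Set X := {g | Tr (K.α x x) (univ q (pnt g)) (univ q (pnt g))}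

lemma exists_frame {x m : M} (hx : m ∈ K.u x) :
    ∃ v : e.obj (pt (pnt m)) ⟶ q.obj (pt (pnt (K.lft x (opnMk m hx)))), IsIso v ∧
      v ≫ univ q _ = resP e hx ≫ K.a x := by
  obtain ⟨v, hv, hv'⟩ := exists_vert K.stack.fibred q (K.resP_a_lift hx)
  exact ⟨v, K.stack.fibred.isIso v hv, hv'⟩

lemma mem_interior_of {U : Opens X} {A : Set X} {g : X} (hg : g ∈ U) (V : Opens (X.opn U))
    (hV : opnMk g hg ∈ V) (h : ∀ z ∈ V, X.incl U z ∈ A) : g ∈ interior A := by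
  refine mem_interior.2 ⟨(fun z : X.opn U => X.incl U z) '' V, ?_,
    (U.isOpenEmbedding'.isOpenMap) _ V.isOpen, ⟨_, hV, rfl⟩⟩
  rintro _ ⟨z, hz, rfl⟩
  exact h z hz

lemma lft_mem_cocycleSet {x y z m : M} (hx : m ∈ K.u x) (hy : m ∈ K.u y) (hz : m ∈ K.u z) :
    K.lft x (opnMk m hx) ∈ interior (K.cocycleSet x y z) := by
  have hfib := K.stack.fibred
  obtain ⟨v, hv, hvu⟩ := K.exists_frame hx
  generalize K.lft x (opnMk m hx) = g at v hv hvu ⊢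
  have e0 : inv v ≫ resP e hx ≫ K.a x = univ q (pnt g) := by rw [← hvu, IsIso.inv_hom_id_assoc]
  have t1 := (K.tr x y m hx hy).pre (inv v)
  have t2 := (K.tr y z m hy hz).pre (inv v)
  have t3 := (K.tr x z m hx hz).pre (inv v)
  rw [e0] at t1 t3
  have hg1 : g ∈ K.D x y := t1.mem (univ_lift q (pnt g)) pointElt
  have hg3 : g ∈ K.D x z := t3.mem (univ_lift q (pnt g)) pointElt
  have hα := bm_lift (q.w_obj (pt (X.incl (K.D x y)))) objQ (K.α x y)
  set φ := bm (q.w_obj (pt (X.incl (K.D x y)))) objQ (K.α x y)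
  have hφg : φ (opnMk g hg1) ∈ K.D y z := t2.mem (t1.base (univ_lift q (pnt g)) hα) pointElt
  let U : Opens X := ⟨(fun z : X.opn (K.D x y) => X.incl _ z) '' (φ ⁻¹' K.D y z),
    ((K.D x y).isOpenEmbedding'.isOpenMap) _ ((K.D y z).isOpen.preimage (continuous φ))⟩ ⊓ K.D x z
  have hgU : g ∈ U := ⟨⟨opnMk g hg1, hφg, rfl⟩, hg3⟩
  have hU1 : ∀ z, X.incl U z ∈ K.D x y := by
    rintro ⟨_, ⟨z, -, rfl⟩, -⟩; exact z.2
  have hU2 : ∀ z' : X.opn U, (codRestrict (X.incl U) (K.D x y) hU1 ≫ φ) z' ∈ K.D y z := by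
    rintro ⟨_, ⟨z, hz, rfl⟩, -⟩; exact hz
  obtain ⟨f', hf'⟩ := Tr.exists hfib (K.α x y) (univ q (X.incl U)) (univ_lift q _) hU1
  have hf'b := hf'.base (univ_lift q _) hα
  obtain ⟨f'', hf''⟩ := Tr.exists hfib (K.α y z) f' hf'b hU2
  obtain ⟨f₃, hf₃⟩ := Tr.exists hfib (K.α x z) (univ q (X.incl U)) (univ_lift q _) fun z => z.2.2
  have hat : resP q hgU ≫ f'' = resP q hgU ≫ f₃ := by
    have s1 := hf'.pre (resP q hgU)
    have s2 := hf''.pre (resP q hgU)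
    have s3 := hf₃.pre (resP q hgU)
    rw [resP_univ] at s1 s3
    rw [s1.unique hfib t1] at s2
    rw [s2.unique hfib t2, s3.unique hfib t3]
  obtain ⟨V, hV, hVe⟩ := K.chart.rigid_pt (F := q) (a := X.incl U) (opnMk g hgU) hat
  refine mem_interior_of hgU V hV fun z hz => ?_
  have s1 := hf'.pre (resP q z.2)
  have s2 := hf''.pre (resP q z.2)
  have s3 := hf₃.pre (resP q z.2)
  rw [resP_univ] at s1 s3
  refine ⟨_, _, s1, s2, ?_⟩
  have e3 : resP q z.2 ≫ f'' = resP q z.2 ≫ f₃ := hVe z hz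
  rw [e3]
  exact s3

lemma lft_mem_idSet {x m : M} (hx : m ∈ K.u x) : K.lft x (opnMk m hx) ∈ interior (K.idSet x) := by
  have hfib := K.stack.fibred
  obtain ⟨v, hv, hvu⟩ := K.exists_frame hx
  generalize K.lft x (opnMk m hx) = g at v hv hvu ⊢
  have e0 : inv v ≫ resP e hx ≫ K.a x = univ q (pnt g) := by rw [← hvu, IsIso.inv_hom_id_assoc]
  have t1 := (K.tr x x m hx hx).pre (inv v)
  rw [e0] at t1
  have hg1 : g ∈ K.D x x := t1.mem (univ_lift q (pnt g)) pointElt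
  have t : Tr (K.α x x) (univ q (X.incl (K.D x x))) (K.α x x) := ⟨𝟙 _, id_comp _, id_comp _⟩
  have hat : resP q hg1 ≫ K.α x x = resP q hg1 ≫ univ q (X.incl (K.D x x)) := by
    have s1 := t.pre (resP q hg1)
    rw [resP_univ] at s1 ⊢
    exact s1.unique hfib t1
  obtain ⟨V, hV, hVe⟩ := K.chart.rigid_pt (F := q) (a := X.incl (K.D x x)) (opnMk g hg1) hat
  refine mem_interior_of hg1 V hV fun z hz => ?_
  have s1 := t.pre (resP q z.2)
  have e3 : resP q z.2 ≫ K.α x x = resP q z.2 ≫ univ q (X.incl (K.D x x)) := hVe z hz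
  rwa [e3, resP_univ] at s1

lemma locFin₂ : LocallyFinite fun yz : M × M => K.C yz.1 ∩ K.C yz.2 := by
  intro x
  obtain ⟨t, ht, hf⟩ := K.locFin x
  refine ⟨t, ht, (hf.prod hf).subset ?_⟩
  rintro ⟨i, j⟩ ⟨z, ⟨hzi, hzj⟩, hzt⟩
  exact ⟨⟨z, hzi, hzt⟩, ⟨z, hzj, hzt⟩⟩

/-- The piece of the chart with index `x`. -/
def O (x : M) : Opens X := ⟨K.s ⁻¹' K.w x ∩ interior (K.idSet x) ∩
    {g | ∀ yz : M × M, K.s g ∈ K.C yz.1 ∩ K.C yz.2 → g ∈ interior (K.cocycleSet x yz.1 yz.2)},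
  ((((K.isOpen x).preimage (continuous K.s)).inter isOpen_interior).inter
    (NearSection.isOpen_forall_mem (continuous K.s) K.locFin₂
      (fun _ => (K.closed _).inter (K.closed _)) fun _ => isOpen_interior))⟩

lemma s_mem {x : M} {g : X} (hg : g ∈ K.O x) : K.s g ∈ K.w x := hg.1.1

lemma tr_id {x : M} {g : X} (hg : g ∈ K.O x) : Tr (K.α x x) (univ q (pnt g)) (univ q (pnt g)) := by
  have h : g ∈ K.idSet x := interior_subset hg.1.2
  exact h

lemma cocycle {x y z : M} {g : X} (hg : g ∈ K.O x) (hy : K.s g ∈ K.C y) (hz : K.s g ∈ K.C z) :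
    g ∈ K.cocycleSet x y z := interior_subset (hg.2 (y, z) ⟨hy, hz⟩)

lemma lft_mem {x m : M} (hx : m ∈ K.u x) (hw : m ∈ K.w x) : K.lft x (opnMk m hx) ∈ K.O x := by
  refine ⟨⟨?_, K.lft_mem_idSet hx⟩, ?_⟩
  · change K.s (K.lft x (opnMk m hx)) ∈ K.w x
    rwa [K.s_lft]
  · rintro ⟨y, z⟩ ⟨hy, hz⟩
    rw [K.s_lft] at hy hz
    exact K.lft_mem_cocycleSet hx (K.subset y hy) (K.subset z hz)

/-- The relation given by the transition maps. -/
def Rel (x y : M) (g h : X) : Prop :=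
  ∃ f' : q.obj (pt (pnt g)) ⟶ uObj q, Tr (K.α x y) (univ q (pnt g)) f' ∧ Ξ.Lifts (pnt h) f'

variable {K}

lemma Rel.s_eq {x y : M} {g h : X} (r : K.Rel x y g h) : K.s g = K.s h := by
  obtain ⟨f', -, hf'⟩ := r
  exact K.s_eq hf'

lemma Rel.unique {x y : M} {g h h' : X} (r : K.Rel x y g h) (r' : K.Rel x y g h') : h = h' := by
  obtain ⟨f, hf, hfh⟩ := r
  obtain ⟨f', hf', hfh'⟩ := r'
  rw [hf.unique K.stack.fibred hf'] at hfh
  exact pnt_injective (lift_unique hfh hfh')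

lemma Rel.refl {x : M} {g : X} (hg : g ∈ K.O x) : K.Rel x x g g :=
  ⟨_, K.tr_id hg, univ_lift q (pnt g)⟩

lemma Rel.trans {x y z : M} {g h k : X} (hg : g ∈ K.O x) (hk : k ∈ K.O z) (hh : h ∈ K.O y)
    (r : K.Rel x y g h) (r' : K.Rel y z h k) : K.Rel x z g k := by
  have hfib := K.stack.fibred
  have hy : K.s g ∈ K.C y := by rw [r.s_eq]; exact K.w_sub _ (K.s_mem hh)
  have hz : K.s g ∈ K.C z := by rw [r.s_eq, r'.s_eq]; exact K.w_sub _ (K.s_mem hk)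
  obtain ⟨f', f'', h1, h2, h3⟩ := K.cocycle hg hy hz
  obtain ⟨f, hf, hfh⟩ := r
  obtain ⟨k', hk', hkk⟩ := r'
  rw [h1.unique hfib hf] at h2
  obtain ⟨v, hv, hvf⟩ := exists_vert hfib q hfh
  have h4 := hk'.pre v
  rw [hvf] at h4
  rw [h2.unique hfib h4] at h3
  exact ⟨_, h3, lift_comp (f := 𝟙 point) hv hkk⟩

lemma Rel.symm {x y : M} {g h : X} (hg : g ∈ K.O x) (hh : h ∈ K.O y)
    (r : K.Rel x y g h) : K.Rel y x h g := by
  have hfib := K.stack.fibred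
  have hy : K.s g ∈ K.C y := by rw [r.s_eq]; exact K.w_sub _ (K.s_mem hh)
  obtain ⟨f', f'', h1, h2, h3⟩ := K.cocycle hg hy (K.w_sub _ (K.s_mem hg))
  obtain ⟨f, hf, hfh⟩ := r
  rw [h1.unique hfib hf, h3.unique hfib (K.tr_id hg)] at h2
  obtain ⟨v, hv, hvf⟩ := exists_vert hfib q hfh
  have hvi := hfib.isIso v hv
  have h4 := h2.pre (inv v)
  rw [← hvf, IsIso.inv_hom_id_assoc] at h4
  exact ⟨_, h4, lift_comp (f := 𝟙 point) inferInstance (univ_lift q (pnt g))⟩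

variable (K)

/-- The equivalence relation that defines the glued space. -/
def setoid : Setoid (Σ x : M, K.O x) where
  r p p' := K.Rel p.1 p'.1 p.2 p'.2
  iseqv := ⟨fun p => Rel.refl p.2.2, fun {p p'} h => h.symm p.2.2 p'.2.2,
    fun {p p' p''} h h' => h.trans p.2.2 p''.2.2 p'.2.2 h'⟩

lemma mk_eq_iff {x y : M} (g : K.O x) (h : K.O y) :
    Quotient.mk K.setoid ⟨x, g⟩ = Quotient.mk K.setoid ⟨y, h⟩ ↔ K.Rel x y g h :=
  ⟨fun e => Quotient.exact e, fun e => Quotient.sound e⟩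

/-- The transition map. -/
def φ (x y : M) : X.opn (K.D x y) ⟶ X := bm (q.w_obj _) objQ (K.α x y)

lemma φ_lift (x y : M) : Ξ.Lifts (K.φ x y) (K.α x y) := bm_lift _ _ _

lemma rel_φ {x y : M} {g : X} (hg : g ∈ K.D x y) : K.Rel x y g (K.φ x y (opnMk g hg)) := by
  have t : Tr (K.α x y) (univ q (X.incl (K.D x y))) (K.α x y) := ⟨𝟙 _, id_comp _, id_comp _⟩
  have s1 := t.pre (resP q hg)
  rw [resP_univ] at s1
  exact ⟨_, s1, lift_comp (f := pnt (opnMk g hg)) (g := K.φ x y) (ptMap_lift q _ _) (K.φ_lift x y)⟩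

lemma Rel.mem {x y : M} {g h : X} (r : K.Rel x y g h) : g ∈ K.D x y := by
  obtain ⟨f, hf, -⟩ := r
  exact hf.mem (univ_lift q (pnt g)) pointElt

lemma exists_trans (x y : M) : ∃ f : X → X, ContMDiffOn X.I X.I ∞ f (K.D x y) ∧
    ∀ g (hg : g ∈ K.D x y), f g = K.φ x y (opnMk g hg) := by
  classical
  refine ⟨fun g => if hg : g ∈ K.D x y then K.φ x y (opnMk g hg) else g, ?_, fun g hg => dif_pos hg⟩
  intro g hg
  refine ContMDiffAt.contMDiffWithinAt (contMDiffAt_of_opn hg ?_)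
  refine (smooth (K.φ x y) (opnMk g hg)).congr_of_eventuallyEq (Eventually.of_forall ?_)
  intro z
  exact dif_pos (show X.incl _ z ∈ K.D x y from z.2)

/-- The glued space. -/
def core : GlueCore.{0} X (Quotient K.setoid) where
  ι := M
  O := K.O
  ψ x g := Quotient.mk K.setoid ⟨x, g⟩
  inj x g h e := Subtype.ext (((K.mk_eq_iff g h).1 e).unique (Rel.refl g.2)).symm
  surj t := by
    induction t using Quotient.inductionOn with
    | h p => exact ⟨p.1, p.2, rfl⟩
  trans x y g h e := by
    have r := (K.mk_eq_iff g h).1 e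
    obtain ⟨f, hf, hfφ⟩ := K.exists_trans x y
    have hgh : f g = h := by
      rw [hfφ g r.mem]
      exact (K.rel_φ r.mem).unique r
    refine ⟨K.D x y ∩ f ⁻¹' K.O y, f, hf.continuousOn.isOpen_inter_preimage (K.D x y).isOpen
      (K.O y).isOpen, ⟨r.mem, show f g ∈ K.O y by rw [hgh]; exact h.2⟩,
      hf.mono Set.inter_subset_left, ?_⟩
    rintro g' ⟨hg', hg''⟩ hgx
    refine ⟨hg'', (K.mk_eq_iff _ _).2 ?_⟩
    change K.Rel x y g' (f g')
    rw [hfφ g' hg']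
    exact K.rel_φ hg'

/-- The glued chart domain. -/
def N : Mfd := K.core.mfd

/-- The charts of the glued space. -/
def map (x : M) : X.opn (K.O x) ⟶ K.N := K.core.map x

lemma isEt_map (x : M) : IsEt (K.map x) := K.core.isEt_map x

lemma map_injective (x : M) : Injective (K.map x) := K.core.map_injective x

lemma exists_map_eq (n : K.N) : ∃ x g, K.map x g = n := K.core.exists_map_eq n

lemma map_eq_iff {x y : M} (g : X.opn (K.O x)) (h : X.opn (K.O y)) :
    K.map x g = K.map y h ↔ K.Rel x y (X.incl _ g) (X.incl _ h) := K.mk_eq_iff g h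

lemma t2 [T2Space M] [T2Space X] : T2Space K.N := by
  refine ⟨fun n n' hn => ?_⟩
  obtain ⟨x, g, rfl⟩ := K.exists_map_eq n
  obtain ⟨y, h, rfl⟩ := K.exists_map_eq n'
  have sep : ∀ A B : Set X, IsOpen A → IsOpen B → X.incl _ g ∈ A → X.incl _ h ∈ B →
      (∀ g' ∈ A, ∀ h' ∈ B, g' ∈ K.O x → h' ∈ K.O y → ¬ K.Rel x y g' h') →
      ∃ U V : Set K.N, IsOpen U ∧ IsOpen V ∧ K.map x g ∈ U ∧ K.map y h ∈ V ∧ Disjoint U V := by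
    intro A B hA hB hgA hhB hd
    refine ⟨K.map x '' (X.incl _ ⁻¹' A), K.map y '' (X.incl _ ⁻¹' B),
      (K.isEt_map x).isOpenMap _ (hA.preimage (continuous _)),
      (K.isEt_map y).isOpenMap _ (hB.preimage (continuous _)), ⟨g, hgA, rfl⟩, ⟨h, hhB, rfl⟩, ?_⟩
    rw [Set.disjoint_left]
    rintro _ ⟨g', hg', rfl⟩ ⟨h', hh', e⟩
    exact hd _ hg' _ hh' g'.2 h'.2 ((K.map_eq_iff g' h').1 e.symm)
  by_cases hs : K.s (X.incl _ g) = K.s (X.incl _ h)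
  · have hy : K.s (X.incl _ g) ∈ K.C y := by rw [hs]; exact K.w_sub _ (K.s_mem h.2)
    obtain ⟨f', f'', h1, -⟩ := K.cocycle g.2 hy hy
    have hgD : X.incl _ g ∈ K.D x y := h1.mem (univ_lift q (pnt _)) pointElt
    have hne : K.φ x y (opnMk _ hgD) ≠ X.incl _ h := fun e => hn ((K.map_eq_iff g h).2 (by
      rw [← e]; exact K.rel_φ hgD))
    obtain ⟨A, B, hA, hB, hgA, hhB, hAB⟩ := t2_separation hne
    obtain ⟨f, hf, hfφ⟩ := K.exists_trans x y
    refine sep (K.D x y ∩ f ⁻¹' A) B (hf.continuousOn.isOpen_inter_preimage (K.D x y).isOpen hA) hB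
      ⟨hgD, show f _ ∈ A by rw [hfφ _ hgD]; exact hgA⟩ hhB ?_
    rintro g' ⟨hg1, hg2⟩ h' hh' - - r
    have : f g' = h' := by rw [hfφ g' hg1]; exact (K.rel_φ hg1).unique r
    change f g' ∈ A at hg2
    rw [this] at hg2
    exact Set.disjoint_left.1 hAB hg2 hh'
  · obtain ⟨A, B, hA, hB, hgA, hhB, hAB⟩ := t2_separation hs
    refine sep (K.s ⁻¹' A) (K.s ⁻¹' B) (hA.preimage (continuous _)) (hB.preimage (continuous _))
      hgA hhB ?_
    intro g' hg' h' hh' _ _ r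
    change K.s g' ∈ A at hg'
    rw [r.s_eq] at hg'
    exact Set.disjoint_left.1 hAB hg' hh'

end SectionCover

lemma univ_cancel (hΞ : IsFibredInGroupoids Ξ) {X S : Mfd} {q : rep X ⥤ᵇ Ξ} {g : S ⟶ X}
    (hg : Injective g) {z : Ξ.obj} {k k' : z ⟶ q.obj (pt g)}
    (h : k ≫ univ q g = k' ≫ univ q g) : k = k' := by
  have hQ : Ξ.p.obj (q.obj (pt g)) = S := q.w_obj _
  have hk := bm_lift (rfl : Ξ.p.obj z = _) hQ k
  have hk' := bm_lift (rfl : Ξ.p.obj z = _) hQ k'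
  have h4 := lift_comp hk (univ_lift q g)
  rw [h] at h4
  have h5 := lift_unique h4 (lift_comp hk' (univ_lift q g))
  have h6 : bm (rfl : Ξ.p.obj z = _) hQ k = bm (rfl : Ξ.p.obj z = _) hQ k' := by
    ext s
    exact hg (congrArg (fun k : _ ⟶ X => k s) h5)
  rw [h6] at hk
  exact hΞ.hom_ext _ _ hk hk' h

lemma IsEtChart.ext_obj (hΞ : IsStack Ξ) {N S : Mfd} {j : rep N ⥤ᵇ Ξ} (hj : IsEtChart j)
    {z : Ξ.obj} (hz : Ξ.p.obj z = S) {α α' : z ⟶ uObj j}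
    (h : ∀ (s : S) (y : Ξ.obj) (c : y ⟶ z), Ξ.Lifts (pnt s) c → c ≫ α = c ≫ α') : α = α' := by
  obtain ⟨F, φ, hφ⟩ := exists_functor hΞ.fibred hz
  have hi := hΞ.fibred.isIso φ hφ
  rw [← cancel_epi φ]
  refine hj.ext hΞ (F := F) fun s => ?_
  rw [← assoc, ← assoc]
  exact h s _ _ (lift_comp (f := pnt s) (g := 𝟙 _) (univ_lift F _) hφ)

namespace SectionCover

variable {M X : Mfd} {e : rep M ⥤ᵇ Ξ} {q : rep X ⥤ᵇ Ξ} {G : Ξ ⥤ᵇ rep M} (K : SectionCover e q G)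

/-- The open subsets of the glued space that come from the chart. -/
def rng (x : M) : Opens K.N := ⟨range (K.map x), (K.isEt_map x).isOpenMap.isOpen_range⟩

lemma exists_inverse (x : M) : ∃ g : K.N.opn (K.rng x) ⟶ X.opn (K.O x),
    g ≫ K.map x = K.N.incl (K.rng x) :=
  (K.isEt_map x).exists_factor (K.map_injective x) _ fun s => s.2

/-- The inverse of a chart of the glued space. -/
def imap (x : M) : K.N.opn (K.rng x) ⟶ X := (K.exists_inverse x).choose ≫ X.incl _

lemma imap_mem {x : M} (n : K.N.opn (K.rng x)) : K.imap x n ∈ K.O x :=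
  ((K.exists_inverse x).choose n).2

lemma map_imap {x : M} (n : K.N.opn (K.rng x)) : K.map x (opnMk _ (K.imap_mem n)) = K.N.incl _ n :=
  congr_hom (K.exists_inverse x).choose_spec n

lemma imap_injective (x : M) : Injective (K.imap x) := by
  intro n n' h
  refine incl_injective _ ?_
  rw [← K.map_imap n, ← K.map_imap n']
  congr 1
  exact Subtype.ext h

lemma imap_map {x : M} (g : X.opn (K.O x)) (h : K.map x g ∈ K.rng x) :
    K.imap x (opnMk _ h) = X.incl _ g := by
  have h1 := K.map_imap (opnMk _ h)
  exact congrArg Subtype.val (K.map_injective x h1)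

lemma rel_imap {x y : M} (n : K.N.opn (K.rng x)) (n' : K.N.opn (K.rng y))
    (h : K.N.incl _ n = K.N.incl _ n') : K.Rel x y (K.imap x n) (K.imap y n') := by
  rw [← K.map_imap n, ← K.map_imap n'] at h
  exact (K.map_eq_iff _ _).1 h

lemma exists_overlap (x y : M) :
    ∃ b : q.obj (pt (K.N.inclLE (inf_le_left : K.rng x ⊓ K.rng y ≤ K.rng x) ≫ K.imap x)) ⟶
      q.obj (pt (K.imap y)),
      Ξ.Lifts (K.N.inclLE (inf_le_right : K.rng x ⊓ K.rng y ≤ K.rng y)) b ∧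
      Tr (K.α x y) (univ q _) (b ≫ univ q (K.imap y)) := by
  have hfib := K.stack.fibred
  set β := K.N.inclLE (inf_le_left : K.rng x ⊓ K.rng y ≤ K.rng x) ≫ K.imap x with hβ
  have hrel : ∀ n : K.N.opn (K.rng x ⊓ K.rng y), K.Rel x y (β n)
      (K.imap y (K.N.inclLE (inf_le_right : K.rng x ⊓ K.rng y ≤ K.rng y) n)) := fun n =>
    K.rel_imap (K.N.inclLE inf_le_left n) (K.N.inclLE inf_le_right n) rfl
  obtain ⟨f', hf'⟩ := Tr.exists hfib (K.α x y) (univ q β) (univ_lift q β) fun n => (hrel n).mem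
  have hb := hf'.base (univ_lift q β) (K.φ_lift x y)
  have he : codRestrict β _ (hf'.mem (univ_lift q β)) ≫ K.φ x y =
      K.N.inclLE (inf_le_right : K.rng x ⊓ K.rng y ≤ K.rng y) ≫ K.imap y := by
    ext n
    exact (K.rel_φ (hrel n).mem).unique (hrel n)
  rw [he] at hb
  obtain ⟨b, hb', hbu⟩ := hfib.exists_lift _ (K.imap y) f' (univ q (K.imap y)) hb (univ_lift q _)
  exact ⟨b, hb', by rw [hbu]; exact hf'⟩

lemma tr_cocycle {x y z : M} {w : Ξ.obj} {S : Mfd} {g g' g'' : S ⟶ X} {f f' f'' f₃ : w ⟶ uObj q}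
    (hf : Ξ.Lifts g f) (hf' : Ξ.Lifts g' f') (hf'' : Ξ.Lifts g'' f'')
    (hg : ∀ s, g s ∈ K.O x) (hg' : ∀ s, g' s ∈ K.O y) (hg'' : ∀ s, g'' s ∈ K.O z)
    (h₁ : Tr (K.α x y) f f') (h₂ : Tr (K.α y z) f' f'') (h₃ : Tr (K.α x z) f f₃) : f'' = f₃ := by
  have hfib := K.stack.fibred
  refine K.chart.ext_obj K.stack (lift_base hf).1 fun s y' c hc => ?_
  have hcf := lift_comp hc hf
  have hcf' := lift_comp hc hf'
  have hcf'' := lift_comp hc hf''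
  rw [pnt_comp] at hcf hcf' hcf''
  obtain ⟨v, hv, hvf⟩ := exists_vert hfib q hcf
  obtain ⟨v', hv', hvf'⟩ := exists_vert hfib q hcf'
  have hvi := hfib.isIso v hv
  have hvi' := hfib.isIso v' hv'
  have s1 : K.s (g s) = K.s (g' s) := K.s_eq (f := inv v ≫ c ≫ f')
    (lift_comp (f := 𝟙 point) inferInstance hcf')
  have s2 : K.s (g' s) = K.s (g'' s) := K.s_eq (f := inv v' ≫ c ≫ f'')
    (lift_comp (f := 𝟙 point) inferInstance hcf'')
  obtain ⟨k', k'', r1, r2, r3⟩ := K.cocycle (hg s) (y := y) (z := z)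
    (by rw [s1]; exact K.w_sub _ (K.s_mem (hg' s))) (by rw [s1, s2]; exact K.w_sub _ (K.s_mem (hg'' s)))
  replace r1 := r1.pre v
  replace r2 := r2.pre v
  replace r3 := r3.pre v
  rw [hvf] at r1 r3
  rw [r1.unique hfib (h₁.pre c)] at r2
  rw [← r2.unique hfib (h₂.pre c), r3.unique hfib (h₃.pre c)]

lemma exists_chart : ∃ (j : rep K.N ⥤ᵇ Ξ) (κ : ∀ x, q.obj (pt (X.incl (K.O x))) ⟶ uObj j),
    (∀ x, Ξ.Lifts (K.map x) (κ x)) ∧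
    ∀ {x y : M} {w : Ξ.obj} {f f' : w ⟶ uObj q} {k k' : w ⟶ uObj j},
      Tr (K.α x y) f f' → Tr (κ x) f k → Tr (κ y) f' k' → k = k' := by
  have hfib := K.stack.fibred
  choose b hb hbT using K.exists_overlap
  obtain ⟨J₀, ψ₀, hψ₀, hψe₀⟩ := K.stack.descent K.N M K.rng
    (fun n => by obtain ⟨x, g, rfl⟩ := K.exists_map_eq n; exact ⟨x, g, rfl⟩)
    (fun x => q.obj (pt (K.imap x))) (fun x => q.w_obj _)
    (fun x y => q.obj (pt (K.N.inclLE (inf_le_left : K.rng x ⊓ K.rng y ≤ K.rng x) ≫ K.imap x)))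
    (fun x y => ptMap q _ rfl) b (fun x y => ptMap_lift q _ _) hb (by
      intro x y z w c d e h1 h2
      refine univ_cancel hfib (K.imap_injective z) ?_
      rw [assoc, assoc]
      have t1 := (hbT x y).pre c
      have t2 := (hbT y z).pre d
      have t3 := (hbT x z).pre e
      have e1 : c ≫ univ q _ = e ≫ univ q _ := by
        rw [← ptMap_univ q (b := K.imap x) (K.N.inclLE (inf_le_left : K.rng x ⊓ K.rng y ≤ K.rng x)) rfl,
          ← ptMap_univ q (b := K.imap x) (K.N.inclLE (inf_le_left : K.rng x ⊓ K.rng z ≤ K.rng x)) rfl,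
          ← assoc, h1, assoc]
      have e2 : c ≫ b x y ≫ univ q _ = d ≫ univ q _ := by
        rw [← ptMap_univ q (b := K.imap y) (K.N.inclLE (inf_le_left : K.rng y ⊓ K.rng z ≤ K.rng y)) rfl,
          ← assoc, h2, assoc]
      rw [e1] at t1
      rw [← e2] at t2
      have hw : Ξ.p.obj w = Ξ.p.obj w := rfl
      have le := bm_lift hw (q.w_obj _) e
      have lc := bm_lift hw (q.w_obj _) c
      have ld := bm_lift hw (q.w_obj _) d
      refine K.tr_cocycle (lift_comp le (univ_lift q _)) (lift_comp lc (lift_comp (hb x y) (univ_lift q _)))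
        (lift_comp ld (lift_comp (hb y z) (univ_lift q _))) ?_ ?_ ?_ t1 t2 t3
      · exact fun s => K.imap_mem _
      · exact fun s => K.imap_mem _
      · exact fun s => K.imap_mem _)
  obtain ⟨J, ψ, hJ, hψ, hψe⟩ : ∃ (J : Ξ.obj) (ψ : ∀ x, q.obj (pt (K.imap x)) ⟶ J),
      Ξ.p.obj J = K.N ∧ (∀ x, Ξ.Lifts (K.N.incl (K.rng x)) (ψ x)) ∧
      ∀ x y, ptMap q _ rfl ≫ ψ x = b x y ≫ ψ y := by
    by_cases hM : Nonempty M
    · obtain ⟨x⟩ := hM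
      exact ⟨J₀, ψ₀, (lift_base (hψ₀ x)).2, hψ₀, hψe₀⟩
    · have hM' : M → False := fun x => hM ⟨x⟩
      have hN : K.N → False := fun n => hM' (K.exists_map_eq n).choose
      exact ⟨e.obj (pt (mk' (fun n => (hN n).elim) fun n => (hN n).elim)), fun x => (hM' x).elim,
        e.w_obj _, fun x => (hM' x).elim, fun x => (hM' x).elim⟩
  obtain ⟨j, φ, hφ⟩ := exists_functor hfib hJ
  have hφi := hfib.isIso φ hφ
  have hφ' : Ξ.Lifts (𝟙 K.N) (inv φ) := inferInstance
  let cm (x : M) : X.opn (K.O x) ⟶ K.N.opn (K.rng x) := codRestrict (K.map x) _ fun g => ⟨g, rfl⟩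
  have hcm : ∀ x, cm x ≫ K.imap x = X.incl (K.O x) := fun x => by
    ext g; exact K.imap_map g ⟨g, rfl⟩
  refine ⟨j, fun x => ptMap q (cm x) (hcm x) ≫ ψ x ≫ inv φ, fun x => ?_, ?_⟩
  · exact lift_comp (ptMap_lift q (cm x) (hcm x)) (lift_comp (g := 𝟙 _) (hψ x) hφ')
  · rintro x y w f f' _ _ ht ⟨c, rfl, rfl⟩ ⟨d, rfl, rfl⟩
    have hw : Ξ.p.obj w = Ξ.p.obj w := rfl
    have lc := bm_lift hw (q.w_obj (pt (X.incl (K.O x)))) c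
    have ld := bm_lift hw (q.w_obj (pt (X.incl (K.O y)))) d
    set γ := bm hw (q.w_obj (pt (X.incl (K.O x)))) c
    set δ := bm hw (q.w_obj (pt (X.incl (K.O y)))) d
    have lcu := lift_comp lc (univ_lift q _)
    have ldu := lift_comp ld (univ_lift q _)
    have hmem := ht.mem lcu
    have hbase := lift_unique (ht.base lcu (K.φ_lift x y)) ldu
    have hrel : ∀ s, K.map x (γ s) = K.map y (δ s) := fun s => by
      refine (K.map_eq_iff _ _).2 ?_
      have h1 : K.φ x y (opnMk _ (hmem s)) = X.incl _ (δ s) := congr_hom hbase s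
      rw [← h1]
      exact K.rel_φ (hmem s)
    obtain ⟨c', hc', hcc⟩ := hfib.exists_lift
      (codRestrict (γ ≫ K.map x) (K.rng x ⊓ K.rng y) fun s => ⟨⟨γ s, rfl⟩, δ s, (hrel s).symm⟩)
      (K.N.inclLE (inf_le_left : K.rng x ⊓ K.rng y ≤ K.rng x)) (c ≫ ptMap q (cm x) (hcm x))
      (ptMap q (b := K.imap x) _ rfl) (lift_comp (f := γ) (g := cm x) lc (ptMap_lift q _ _))
      (ptMap_lift q _ _)
    have hcu : c' ≫ univ q _ = c ≫ univ q (X.incl (K.O x)) := by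
      rw [← ptMap_univ q (b := K.imap x) (K.N.inclLE (inf_le_left : K.rng x ⊓ K.rng y ≤ K.rng x)) rfl,
        ← assoc, hcc, assoc, ptMap_univ]
    have t := (hbT x y).pre c'
    rw [hcu] at t
    have hbd : c' ≫ b x y = d ≫ ptMap q (cm y) (hcm y) := by
      refine univ_cancel hfib (K.imap_injective y) ?_
      rw [assoc, assoc, ptMap_univ]
      exact t.unique hfib ht
    rw [← assoc, ← hcc, assoc, reassoc_of% (hψe x y), reassoc_of% hbd]

end SectionCover

lemma exists_chart_of_section {M X : Mfd} [T2Space M] [SecondCountableTopology M] {e : rep M ⥤ᵇ Ξ}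
    {q : rep X ⥤ᵇ Ξ} {G : Ξ ⥤ᵇ rep M} [T2Space X] (hΞ : IsStack Ξ) (hq : IsEtChart q)
    (hepi : IsEpim q) (sec : mapOf (e ⋙ G) = 𝟙 M) :
    ∃ (N : Mfd) (j : rep N ⥤ᵇ Ξ), T2Space N ∧ IsEtChart j ∧ Nonempty (uObj e ⟶ uObj j) ∧
      ∀ n : N, ∃ (U : Opens X) (ψ : X.opn U ⟶ N)
        (κ : q.obj (pt (X.incl U)) ⟶ uObj j), IsEt ψ ∧ Injective ψ ∧
        n ∈ range ψ ∧ Ξ.Lifts ψ κ := by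
  obtain ⟨K⟩ := exists_sectionCover hΞ hq hepi sec
  obtain ⟨j, κ, hκ, hκe⟩ := K.exists_chart
  have hfib := hΞ.fibred
  have hloc : ∀ n : K.N, ∃ (U : Opens X) (ψ : X.opn U ⟶ K.N)
        (κ : q.obj (pt (X.incl U)) ⟶ uObj j), IsEt ψ ∧ Injective ψ ∧
        n ∈ range ψ ∧ Ξ.Lifts ψ κ := fun n => by
    obtain ⟨x, g, rfl⟩ := K.exists_map_eq n
    exact ⟨_, K.map x, κ x, K.isEt_map x, K.map_injective x, ⟨g, rfl⟩, hκ x⟩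
  have hj := isEtChart_of_local hfib hq hloc
  refine ⟨K.N, j, K.t2, hj, ?_, hloc⟩
  let w' (x : M) : Opens M := ⟨K.w x, K.isOpen x⟩
  have hwu : ∀ x, w' x ≤ K.u x := fun x => (K.w_sub x).trans (K.subset x)
  have hex : ∀ x, ∃ β, Tr (κ x) (resO e (hwu x) ≫ K.a x) β := fun x =>
    Tr.exists hfib (κ x) _ (lift_comp (ptMap_lift e _ _) (K.lft_lift x)) fun s =>
      K.lft_mem (hwu x s.2) s.2
  choose β hβ using hex
  choose x hx using K.cover
  obtain ⟨α, -⟩ := hj.exists_glue hΞ (F := e) (fun m => resP e (O := w' (x m)) (hx m) ≫ β (x m))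
    fun m => ⟨w' (x m), hx m, β (x m), fun z hz => by
      have t1 := (hβ (x m)).pre (resP e (O := w' (x m)) hz)
      have t2 := (hβ (x z)).pre (resP e (O := w' (x z)) (hx z))
      rw [← assoc, resP_resO] at t1 t2
      exact hκe (K.tr _ _ z (hwu _ hz) (hwu _ (hx z))) t1 t2⟩
  exact ⟨α⟩

section

variable {𝒴 : BasedCategory.{v₂, u₂} Mfd}

lemma obj_univ {N : Mfd} (j : rep N ⥤ᵇ Ξ) : Ξ.p.obj (uObj j) = N := j.w_obj _

lemma lift_comp_id {x y z : Ξ.obj} {R S : Mfd} {f : R ⟶ S} {φ : x ⟶ y} {ψ : y ⟶ z}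
    (hφ : Ξ.Lifts f φ) (hψ : Ξ.Lifts (𝟙 S) ψ) : Ξ.Lifts f (φ ≫ ψ) :=
  lift_comp (g := 𝟙 S) hφ hψ

lemma lift_id_comp {x y z : Ξ.obj} {R S : Mfd} {f : R ⟶ S} {φ : x ⟶ y} {ψ : y ⟶ z}
    (hφ : Ξ.Lifts (𝟙 R) φ) (hψ : Ξ.Lifts f ψ) : Ξ.Lifts f (φ ≫ ψ) :=
  lift_comp (f := 𝟙 R) hφ hψ

/-! ### The map to a manifold attached to an object -/

/-- The smooth map `S ⟶ M` attached to an object over `S`. -/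
def atMap {M S : Mfd} (G : Ξ ⥤ᵇ rep M) {x : Ξ.obj} (hx : Ξ.p.obj x = S) : S ⟶ M :=
  eqToHom hx.symm ≫ toMap G x

lemma atMap_lift {M S T : Mfd} (G : Ξ ⥤ᵇ rep M) {x y : Ξ.obj} {f : S ⟶ T} {α : x ⟶ y}
    (h : Ξ.Lifts f α) (hx : Ξ.p.obj x = S) (hy : Ξ.p.obj y = T) :
    atMap G hx = f ≫ atMap G hy := toMap_arrow G h

lemma atMap_univ {M N : Mfd} (G : Ξ ⥤ᵇ rep M) (j : rep N ⥤ᵇ Ξ)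
    (h : Ξ.p.obj (uObj j) = N) : atMap G h = mapOf (j ⋙ G) :=
  (toMap_comp j G (pt (𝟙 N))).symm

lemma atMap_chart {M N S : Mfd} (G : Ξ ⥤ᵇ rep M) {j : rep N ⥤ᵇ Ξ} {x : Ξ.obj} {a₀ : S ⟶ N}
    {a : x ⟶ uObj j} (h : Ξ.Lifts a₀ a) (hx : Ξ.p.obj x = S) :
    atMap G hx = a₀ ≫ mapOf (j ⋙ G) := by
  rw [atMap_lift G h hx (obj_univ j), atMap_univ]

lemma atMap_same {M S : Mfd} {A : 𝒴 ⥤ᵇ Ξ} {G : Ξ ⥤ᵇ rep M} {H : 𝒴 ⥤ᵇ rep M}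
    (h : SameMap (A ⋙ G) H) {y : 𝒴.obj} (hy : 𝒴.p.obj y = S) (hx : Ξ.p.obj (A.obj y) = S) :
    atMap G hx = atMap H hy := by
  subst hy
  have h1 := h y
  rw [toMap_comp] at h1
  rw [atMap, atMap, ← h1]
  simp

lemma atMap_pair {𝒵 : BasedCategory.{v₃, u₃} Mfd} {M S : Mfd} {F : Ξ ⥤ᵇ rep M} {G : 𝒵 ⥤ᵇ rep M}
    (z : FPObj F G) (h₁ : Ξ.p.obj z.fst = S) (h₂ : 𝒵.p.obj z.snd = S) :
    atMap F h₁ = atMap G h₂ := by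
  subst h₁
  have h := fpSame F G z
  rw [toMap_comp, toMap_comp] at h
  rw [atMap]
  refine Eq.trans ?_ h
  rfl

/-! ### Objects and arrows -/

lemma IsFibredInGroupoids.lift_inv (hΞ : IsFibredInGroupoids Ξ) {x y : Ξ.obj} {S : Mfd} {φ : x ⟶ y}
    (hφ : Ξ.Lifts (𝟙 S) φ) : ∃ ψ : y ⟶ x, Ξ.Lifts (𝟙 S) ψ ∧ φ ≫ ψ = 𝟙 x ∧ ψ ≫ φ = 𝟙 y := by
  have := hΞ.isIso φ hφ
  exact ⟨inv φ, inferInstance, IsIso.hom_inv_id φ, IsIso.inv_hom_id φ⟩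

lemma IsEtChart.eventually_base_eq (hΞ : IsFibredInGroupoids Ξ) {N S : Mfd} {j : rep N ⥤ᵇ Ξ}
    (hj : IsEtChart j) {z y : Ξ.obj} {a₀ a₀' : S ⟶ N} {α α' : z ⟶ uObj j}
    (hα : Ξ.Lifts a₀ α) (hα' : Ξ.Lifts a₀' α') {s : S} {c : y ⟶ z}
    (hc : Ξ.Lifts (pnt s) c) (h : c ≫ α = c ≫ α') : ∀ᶠ s' in 𝓝 s, a₀ s' = a₀' s' := by
  obtain ⟨F, φ, hφ⟩ := exists_functor hΞ (lift_base hα).1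
  obtain ⟨ψ, hψ, hφψ, hψφ⟩ := hΞ.lift_inv hφ
  obtain ⟨v, hv, hvc⟩ := exists_vert hΞ F (lift_comp_id hc hψ)
  obtain ⟨v', hv', -, hvv⟩ := hΞ.lift_inv hv
  have e1 : univ F (pnt s) ≫ φ ≫ α = univ F (pnt s) ≫ φ ≫ α' := by
    have : univ F (pnt s) ≫ φ = v' ≫ c := by
      have h2 := congrArg (v' ≫ · ≫ φ) hvc
      simpa only [assoc, reassoc_of% hvv, hψφ, comp_id] using h2
    rw [← assoc, this, assoc, h, ← assoc, ← this, assoc]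
  obtain ⟨O, hO, hOe⟩ := hj.rigid F s _ _ e1
  refine Filter.eventually_of_mem (O.isOpen.mem_nhds hO) fun s' hs' => ?_
  have l1 := lift_comp (univ_lift F (S.incl O)) (lift_comp (f := 𝟙 S) hφ hα)
  have l2 := lift_comp (univ_lift F (S.incl O)) (lift_comp (f := 𝟙 S) hφ hα')
  rw [hOe] at l1
  exact congr_hom (lift_unique l1 l2) (opnMk s' hs')

lemma IsEtChart.exists_extension_obj (hΞ : IsStack Ξ) {M Y N : Mfd} [T2Space M]
    [ParacompactSpace M] {j : rep N ⥤ᵇ Ξ} (hj : IsEtChart j) (e : M ⟶ Y) {p : Y → M}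
    (hp : Continuous p) (hpe : ∀ x, p (e x) = x) {z y : Ξ.obj} {c : y ⟶ z} (hc : Ξ.Lifts e c)
    (β : y ⟶ uObj j) :
    ∃ (D : Opens Y) (z' : Ξ.obj) (r : z' ⟶ z) (α : z' ⟶ uObj j),
      (∀ x, e x ∈ D) ∧ Ξ.Lifts (Y.incl D) r ∧
      ∀ {w : Ξ.obj} (k : w ⟶ z') (l : w ⟶ y), k ≫ r = l ≫ c → k ≫ α = l ≫ β := by
  have hfib := hΞ.fibred
  obtain ⟨F, φ, hφ⟩ := exists_functor hfib (lift_base hc).2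
  obtain ⟨ψ, hψ, hφψ, hψφ⟩ := hfib.lift_inv hφ
  obtain ⟨v, hv, hvc⟩ := exists_vert hfib F (lift_comp_id hc hψ)
  obtain ⟨v', hv', hvv', hvv⟩ := hfib.lift_inv hv
  obtain ⟨D, hD, α, hα⟩ := IsEtChart.exists_extension (F := F) hΞ hj e hp hpe (v' ≫ β)
  have hr : Ξ.Lifts (Y.incl D) (univ F (Y.incl D) ≫ φ) :=
    lift_comp (g := 𝟙 Y) (univ_lift F (Y.incl D)) hφ
  refine ⟨D, F.obj (pt (Y.incl D)), univ F (Y.incl D) ≫ φ, α, hD, hr, fun {w} k l h => ?_⟩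
  have hk : k = l ≫ v ≫ ptMap F (codRestrict e D hD) (codRestrict_incl e D hD) := by
    refine univ_cancel hfib (incl_injective D) ?_
    rw [assoc, assoc, ptMap_univ]
    rw [hvc, ← assoc l, ← h]
    simp only [assoc, hφψ, comp_id]
  rw [hk, assoc, assoc, hα, reassoc_of% hvv']

end

section

variable {𝒴 : BasedCategory.{v₂, u₂} Mfd}
  {𝒵 : BasedCategory.{v₃, u₃} Mfd}

lemma fp_lift {F : Ξ ⥤ᵇ 𝒵} {G : 𝒴 ⥤ᵇ 𝒵} {w w' : (fibreProd F G).obj} {k : w ⟶ w'} {S T : Mfd}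
    {f : S ⟶ T} (h : Ξ.Lifts f (FPHom.fst k)) : (fibreProd F G).Lifts f k :=
  IsHomLift.of_fac' (fibreProd F G).p f k (lift_base h).1 (lift_base h).2
    (IsHomLift.fac' Ξ.p f (FPHom.fst k))

lemma IsFibredInGroupoids.cancel_inj (hΞ : IsFibredInGroupoids Ξ) {S T : Mfd} {g : S ⟶ T}
    (hg : Injective g) {x y z : Ξ.obj} {r : y ⟶ x} (hr : Ξ.Lifts g r) {k k' : z ⟶ y}
    (h : k ≫ r = k' ≫ r) : k = k' := by
  have hk := bm_lift (rfl : Ξ.p.obj z = _) (lift_base hr).1 k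
  have hk' := bm_lift (rfl : Ξ.p.obj z = _) (lift_base hr).1 k'
  have h4 := lift_comp hk hr
  rw [h] at h4
  have h5 := lift_unique h4 (lift_comp hk' hr)
  have h6 : bm (rfl : Ξ.p.obj z = _) (lift_base hr).1 k = bm (rfl : Ξ.p.obj z = _) (lift_base hr).1 k' := by
    ext s
    exact hg (congrArg (fun k : _ ⟶ T => k s) h5)
  rw [h6] at hk
  exact hΞ.hom_ext _ _ hk hk' h

/-- The values of the arrow `a` into a chart lie in `D`. -/
def InD {N : Mfd} {j : rep N ⥤ᵇ Ξ} (D : Set N) {x : Ξ.obj} (a : x ⟶ uObj j) : Prop :=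
  ∃ (S : Mfd) (a₀ : S ⟶ N), Ξ.Lifts a₀ a ∧ ∀ s, a₀ s ∈ D

/-- The values of the arrows `a` and `b` into a chart lie in `D`. -/
def InD₂ {N : Mfd} {j : rep N ⥤ᵇ Ξ} (D : Set (N × N)) {x y : Ξ.obj} (a : x ⟶ uObj j)
    (b : y ⟶ uObj j) : Prop :=
  ∃ (S : Mfd) (a₀ b₀ : S ⟶ N), Ξ.Lifts a₀ a ∧ Ξ.Lifts b₀ b ∧ ∀ s, (a₀ s, b₀ s) ∈ D

lemma InD.mem {N : Mfd} {j : rep N ⥤ᵇ Ξ} {D : Set N} {x : Ξ.obj} {a : x ⟶ uObj j} (h : InD D a)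
    {S : Mfd} {a₀ : S ⟶ N} (ha : Ξ.Lifts a₀ a) (s : S) : a₀ s ∈ D := by
  obtain ⟨S', a', h', hm⟩ := h
  have e : S' = S := (lift_base h').1.symm.trans (lift_base ha).1
  subst e
  rw [lift_unique ha h']
  exact hm s

lemma InD.pre {N : Mfd} {j : rep N ⥤ᵇ Ξ} {D : Set N} {x y : Ξ.obj} {a : x ⟶ uObj j} (h : InD D a)
    (k : y ⟶ x) : InD D (k ≫ a) := by
  obtain ⟨S, a₀, ha, hm⟩ := h
  exact ⟨_, _, lift_comp (bm_lift rfl (lift_base ha).1 k) ha, fun s => hm _⟩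

end

end Stk

namespace PreWeinstein

variable {M N : Mfd} (G : PreWeinstein.{v, u} M)

lemma pair_lift_fst {z z' : G.pair.obj} {k : z ⟶ z'} {S T : Mfd} {f : S ⟶ T}
    (h : G.pair.Lifts f k) : G.stk.Lifts f (FPHom.fst k) := by
  have h1 : G.stk.p.obj z.fst = S := (lift_base h).1
  have h2 : G.stk.p.obj z'.fst = T := (lift_base h).2
  exact IsHomLift.of_fac' _ _ _ h1 h2 (IsHomLift.fac' G.pair.p f k)

lemma pair_lift_snd {z z' : G.pair.obj} {k : z ⟶ z'} {S T : Mfd} {f : S ⟶ T}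
    (h : G.pair.Lifts f k) : G.stk.Lifts f (FPHom.snd k) := by
  have h1 : G.stk.p.obj z.fst = S := (lift_base h).1
  have h2 : G.stk.p.obj z'.fst = T := (lift_base h).2
  have h3 : G.stk.p.map (FPHom.fst k) = _ := IsHomLift.fac' G.pair.p f k
  have h4 := FPHom.lift k
  subst h1 h2
  rw [h3] at h4
  simpa using h4

variable {G} {j : rep N ⥤ᵇ G.stk}

lemma pair_comp {z : G.pair.obj} {a : z.fst ⟶ uObj j} {b : z.snd ⟶ uObj j} {S : Mfd}
    {a₀ b₀ : S ⟶ N} (ha : G.stk.Lifts a₀ a) (hb : G.stk.Lifts b₀ b) :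
    a₀ ≫ mapOf (j ⋙ G.src) = b₀ ≫ mapOf (j ⋙ G.tgt) := by
  rw [← atMap_chart G.src ha (lift_base ha).1, ← atMap_chart G.tgt hb (lift_base hb).1]
  exact atMap_pair z _ _

lemma exists_pairHom (hG : IsFibredInGroupoids G.stk) {z z' : G.pair.obj} {S T : Mfd} {f : S ⟶ T}
    {x y : G.stk.obj} {X Y : Mfd} {a : z.fst ⟶ x} {b : z.snd ⟶ y} {a' : z'.fst ⟶ x} {b' : z'.snd ⟶ y}
    {a₀ : T ⟶ X} {b₀ : T ⟶ Y}
    (ha : G.stk.Lifts (f ≫ a₀) a) (hb : G.stk.Lifts (f ≫ b₀) b)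
    (ha' : G.stk.Lifts a₀ a') (hb' : G.stk.Lifts b₀ b') :
    ∃ k : z ⟶ z', G.pair.Lifts f k ∧ FPHom.fst k ≫ a' = a ∧ FPHom.snd k ≫ b' = b := by
  obtain ⟨k₁, h₁, e₁⟩ := hG.exists_lift f a₀ a a' ha ha'
  obtain ⟨k₂, h₂, e₂⟩ := hG.exists_lift f b₀ b b' hb hb'
  exact ⟨fpHom f k₁ k₂ h₁ h₂, fp_lift h₁, e₁, e₂⟩

lemma exists_pairHom_pnt (hG : IsFibredInGroupoids G.stk) {z : G.pair.obj} {S : Mfd}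
    {a : z.fst ⟶ uObj j} {b : z.snd ⟶ uObj j} {a₀ b₀ : S ⟶ N} (ha : G.stk.Lifts a₀ a)
    (hb : G.stk.Lifts b₀ b) (s : S) : ∃ (z' : G.pair.obj) (k : z' ⟶ z),
      G.pair.Lifts (pnt s) k ∧ G.stk.Lifts (pnt (a₀ s)) (FPHom.fst k ≫ a) ∧
      G.stk.Lifts (pnt (b₀ s)) (FPHom.snd k ≫ b) := by
  have h : pnt (a₀ s) ≫ mapOf (j ⋙ G.src) = pnt (b₀ s) ≫ mapOf (j ⋙ G.tgt) := by
    rw [← pnt_comp, ← pnt_comp, assoc, assoc, pair_comp ha hb]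
  obtain ⟨k, hk, e₁, e₂⟩ := exists_pairHom hG (f := pnt s)
    (z := G.ptPair (sameMap_mapOf _) (sameMap_mapOf _) (pnt (a₀ s)) (pnt (b₀ s)) h)
    (z' := z) (univ_lift j (pnt (a₀ s))) (univ_lift j (pnt (b₀ s))) ha hb
  refine ⟨_, k, hk, ?_, ?_⟩
  · rw [e₁]; exact univ_lift j _
  · rw [e₂]; exact univ_lift j _

variable (G j) in
/-- A partially defined multiplication of arrows into a chart. -/
structure MulArr (D : Set (N × N)) where
  m : ∀ {z : G.pair.obj} (a : z.fst ⟶ uObj j) (b : z.snd ⟶ uObj j), InD₂ D a b →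
    (G.mul.obj z ⟶ uObj j)
  nat : ∀ {z z' : G.pair.obj} (k : z' ⟶ z) (a : z.fst ⟶ uObj j) (b : z.snd ⟶ uObj j)
    (h : InD₂ D a b) (h' : InD₂ D (FPHom.fst k ≫ a) (FPHom.snd k ≫ b)),
    G.mul.map k ≫ m a b h = m (FPHom.fst k ≫ a) (FPHom.snd k ≫ b) h'

variable (G j) in
/-- A partially defined inversion of arrows into a chart. -/
structure InvArr (D : Set N) where
  i : ∀ {x : G.stk.obj} (a : x ⟶ uObj j), InD D a → (G.inv.obj x ⟶ uObj j)
  nat : ∀ {x y : G.stk.obj} (k : y ⟶ x) (a : x ⟶ uObj j) (h : InD D a),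
    G.inv.map k ≫ i a h = i (k ≫ a) (h.pre k)

lemma inD₂_pre {D : Set (N × N)} {z z' : G.pair.obj} (k : z' ⟶ z) {a : z.fst ⟶ uObj j}
    {b : z.snd ⟶ uObj j} (h : InD₂ D a b) : InD₂ D (FPHom.fst k ≫ a) (FPHom.snd k ≫ b) := by
  obtain ⟨S, a₀, b₀, ha, hb, hm⟩ := h
  have hk := bm_lift (rfl : G.pair.p.obj z' = _) (show G.pair.p.obj z = S from (lift_base ha).1) k
  exact ⟨_, _, _, lift_comp (G.pair_lift_fst hk) ha, lift_comp (G.pair_lift_snd hk) hb, fun s => hm _⟩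

namespace MulArr

variable {D : Set (N × N)} (μ : MulArr G j D)

/-- The product of two points of the chart. -/
def val (g h : N) : N := @Classical.epsilon N ⟨g⟩ fun n =>
  ∃ (z : G.pair.obj) (a : z.fst ⟶ uObj j) (b : z.snd ⟶ uObj j) (hab : InD₂ D a b),
    G.stk.Lifts (pnt g) a ∧ G.stk.Lifts (pnt h) b ∧ G.stk.Lifts (pnt n) (μ.m a b hab)

lemma m_congr {z : G.pair.obj} {a a' : z.fst ⟶ uObj j} {b b' : z.snd ⟶ uObj j} (h : InD₂ D a b)
    (ha : a = a') (hb : b = b') : μ.m a b h = μ.m a' b' (ha ▸ hb ▸ h) := by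
  subst ha hb; rfl

lemma val_pnt (hG : IsFibredInGroupoids G.stk) {z : G.pair.obj} {a : z.fst ⟶ uObj j}
    {b : z.snd ⟶ uObj j} (hab : InD₂ D a b) {g h n : N} (ha : G.stk.Lifts (pnt g) a)
    (hb : G.stk.Lifts (pnt h) b) (hc : G.stk.Lifts (pnt n) (μ.m a b hab)) :
    n = μ.val g h := by
  have H : ∃ n, ∃ (z : G.pair.obj) (a : z.fst ⟶ uObj j) (b : z.snd ⟶ uObj j) (hab : InD₂ D a b),
    G.stk.Lifts (pnt g) a ∧ G.stk.Lifts (pnt h) b ∧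
      G.stk.Lifts (pnt n) (μ.m a b hab) := ⟨n, z, a, b, hab, ha, hb, hc⟩
  obtain ⟨z', a', b', hab', ha', hb', hc'⟩ := Classical.epsilon_spec_aux ⟨g⟩ _ H
  obtain ⟨k, hk, e₁, e₂⟩ := exists_pairHom hG (z := z) (z' := z') (f := 𝟙 point)
    (a₀ := pnt g) (b₀ := pnt h) ha hb ha' hb'
  have hn := μ.nat k a' b' hab' (inD₂_pre k hab')
  rw [μ.m_congr _ e₁ e₂] at hn
  have h5 := lift_id_comp (map_lift G.mul hk) hc'
  rw [hn] at h5
  exact pnt_injective (lift_unique hc h5)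

lemma val_eq (hG : IsFibredInGroupoids G.stk) {z : G.pair.obj} {a : z.fst ⟶ uObj j}
    {b : z.snd ⟶ uObj j} (hab : InD₂ D a b) {S : Mfd} {a₀ b₀ c₀ : S ⟶ N}
    (ha : G.stk.Lifts a₀ a) (hb : G.stk.Lifts b₀ b)
    (hc : G.stk.Lifts c₀ (μ.m a b hab)) (s : S) : c₀ s = μ.val (a₀ s) (b₀ s) := by
  obtain ⟨z', k, hk, h1, h2⟩ := exists_pairHom_pnt hG ha hb s
  refine μ.val_pnt hG (inD₂_pre k hab) h1 h2 ?_
  rw [← μ.nat k a b hab, ← pnt_comp]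
  exact lift_comp (map_lift G.mul hk) hc

lemma exists_base {z : G.pair.obj} {a : z.fst ⟶ uObj j}
    {b : z.snd ⟶ uObj j} (hab : InD₂ D a b) {S : Mfd} {a₀ : S ⟶ N}
    (ha : G.stk.Lifts a₀ a) : ∃ c₀ : S ⟶ N, G.stk.Lifts c₀ (μ.m a b hab) :=
  ⟨_, bm_lift ((G.mul.w_obj z).trans (lift_base ha).1) (obj_univ j) _⟩

end MulArr

namespace InvArr

variable {D : Set N} (ι : InvArr G j D)

/-- The inverse of a point of the chart. -/
def val (g : N) : N := @Classical.epsilon N ⟨g⟩ fun n =>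
  ∃ (x : G.stk.obj) (a : x ⟶ uObj j) (ha : InD D a),
    G.stk.Lifts (pnt g) a ∧ G.stk.Lifts (pnt n) (ι.i a ha)

lemma i_congr {x : G.stk.obj} {a a' : x ⟶ uObj j} (h : InD D a) (e : a = a') :
    ι.i a h = ι.i a' (e ▸ h) := by
  subst e; rfl

lemma val_pnt (hG : IsFibredInGroupoids G.stk) {x : G.stk.obj} {a : x ⟶ uObj j} (h : InD D a)
    {g n : N} (ha : G.stk.Lifts (pnt g) a) (hc : G.stk.Lifts (pnt n) (ι.i a h)) :
    n = ι.val g := by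
  have H : ∃ n, ∃ (x : G.stk.obj) (a : x ⟶ uObj j) (ha : InD D a),
    G.stk.Lifts (pnt g) a ∧ G.stk.Lifts (pnt n) (ι.i a ha) := ⟨n, x, a, h, ha, hc⟩
  obtain ⟨x', a', h', ha', hc'⟩ := Classical.epsilon_spec_aux ⟨g⟩ _ H
  obtain ⟨k, hk, e⟩ := hG.exists_lift (𝟙 point) (pnt g) a a' ha ha'
  have hn := ι.nat k a' h'
  rw [ι.i_congr _ e] at hn
  have h5 := lift_id_comp (map_lift G.inv hk) hc'
  rw [hn] at h5
  exact pnt_injective (lift_unique hc h5)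

lemma val_eq (hG : IsFibredInGroupoids G.stk) {x : G.stk.obj} {a : x ⟶ uObj j} (h : InD D a)
    {S : Mfd} {a₀ c₀ : S ⟶ N} (ha : G.stk.Lifts a₀ a) (hc : G.stk.Lifts c₀ (ι.i a h))
    (s : S) : c₀ s = ι.val (a₀ s) := by
  obtain ⟨y, k, hk⟩ := hG.exists_pullback (lift_base ha).1 (pnt s)
  refine ι.val_pnt hG (h.pre k) (g := a₀ s) (a := k ≫ a) ?_ ?_
  · rw [← pnt_comp]; exact lift_comp hk ha
  · rw [← ι.nat k a h, ← pnt_comp]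
    exact lift_comp (map_lift G.inv hk) hc

lemma exists_base {x : G.stk.obj} {a : x ⟶ uObj j} (h : InD D a) {S : Mfd} {a₀ : S ⟶ N}
    (ha : G.stk.Lifts a₀ a) : ∃ c₀ : S ⟶ N, G.stk.Lifts c₀ (ι.i a h) :=
  ⟨_, bm_lift ((G.inv.w_obj x).trans (lift_base ha).1) (obj_univ j) _⟩

end InvArr

end PreWeinstein

namespace WeinsteinGroupoid

variable {M N : Mfd} {Γ : WeinsteinGroupoid.{v, u} M} {j : rep N ⥤ᵇ Γ.stk}

lemma fibred (Γ : WeinsteinGroupoid.{v, u} M) : IsFibredInGroupoids Γ.stk := Γ.etale.stack.fibred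

/-- The source map of a chart. -/
abbrev cs (Γ : WeinsteinGroupoid.{v, u} M) (j : rep N ⥤ᵇ Γ.stk) : N ⟶ M := mapOf (j ⋙ Γ.src)

/-- The target map of a chart. -/
abbrev ct (Γ : WeinsteinGroupoid.{v, u} M) (j : rep N ⥤ᵇ Γ.stk) : N ⟶ M := mapOf (j ⋙ Γ.tgt)

lemma cs_val {D : Set (N × N)} (μ : Γ.MulArr j D)
    {z : Γ.pair.obj} {a : z.fst ⟶ uObj j} {b : z.snd ⟶ uObj j} (hab : InD₂ D a b) {S : Mfd}
    {b₀ c₀ : S ⟶ N} (hb : Γ.stk.Lifts b₀ b)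
    (hc : Γ.stk.Lifts c₀ (μ.m a b hab)) : c₀ ≫ Γ.cs j = b₀ ≫ Γ.cs j := by
  rw [← atMap_chart Γ.src hc (lift_base hc).1, ← atMap_chart Γ.src hb (lift_base hb).1]
  have hz : Γ.pair.p.obj z = S := (Γ.mul.w_obj z).symm.trans (lift_base hc).1
  rw [atMap_same Γ.src_mul hz]
  exact (atMap_same (A := fpSnd Γ.src Γ.tgt) (G := Γ.src) (y := z) (fun w => rfl) hz
    (lift_base hb).1).symm

lemma ct_val {D : Set (N × N)} (μ : Γ.MulArr j D)
    {z : Γ.pair.obj} {a : z.fst ⟶ uObj j} {b : z.snd ⟶ uObj j} (hab : InD₂ D a b) {S : Mfd}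
    {a₀ c₀ : S ⟶ N} (ha : Γ.stk.Lifts a₀ a)
    (hc : Γ.stk.Lifts c₀ (μ.m a b hab)) : c₀ ≫ Γ.ct j = a₀ ≫ Γ.ct j := by
  rw [← atMap_chart Γ.tgt hc (lift_base hc).1, ← atMap_chart Γ.tgt ha (lift_base ha).1]
  have hz : Γ.pair.p.obj z = S := (Γ.mul.w_obj z).symm.trans (lift_base hc).1
  rw [atMap_same Γ.tgt_mul hz]
  exact (atMap_same (A := fpFst Γ.src Γ.tgt) (G := Γ.tgt) (y := z) (fun w => rfl) hz
    (lift_base ha).1).symm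

lemma cs_inv {D : Set N} (ι : Γ.InvArr j D) {x : Γ.stk.obj} {a : x ⟶ uObj j} (h : InD D a) {S : Mfd}
    {a₀ c₀ : S ⟶ N} (ha : Γ.stk.Lifts a₀ a)
    (hc : Γ.stk.Lifts c₀ (ι.i a h)) : c₀ ≫ Γ.cs j = a₀ ≫ Γ.ct j := by
  rw [← atMap_chart Γ.src hc (lift_base hc).1, ← atMap_chart Γ.tgt ha (lift_base ha).1]
  exact atMap_same Γ.src_inv _ _

lemma ct_inv {D : Set N} (ι : Γ.InvArr j D) {x : Γ.stk.obj} {a : x ⟶ uObj j} (h : InD D a) {S : Mfd}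
    {a₀ c₀ : S ⟶ N} (ha : Γ.stk.Lifts a₀ a)
    (hc : Γ.stk.Lifts c₀ (ι.i a h)) : c₀ ≫ Γ.ct j = a₀ ≫ Γ.cs j := by
  rw [← atMap_chart Γ.tgt hc (lift_base hc).1, ← atMap_chart Γ.src ha (lift_base ha).1]
  exact atMap_same Γ.tgt_inv _ _

lemma unit_cs {S : Mfd} {b : S ⟶ M} {ε : Γ.unit.obj (pt b) ⟶ uObj j} {e : S ⟶ N}
    (hε : Γ.stk.Lifts e ε) : e ≫ Γ.cs j = b := by
  rw [← atMap_chart Γ.src hε (lift_base hε).1]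
  rw [atMap_same Γ.src_unit (y := pt b) (S := S) rfl]
  exact toMap_pt (𝟭 (rep M)) b

lemma unit_ct {S : Mfd} {b : S ⟶ M} {ε : Γ.unit.obj (pt b) ⟶ uObj j} {e : S ⟶ N}
    (hε : Γ.stk.Lifts e ε) : e ≫ Γ.ct j = b := by
  rw [← atMap_chart Γ.tgt hε (lift_base hε).1]
  rw [atMap_same Γ.tgt_unit (y := pt b) (S := S) rfl]
  exact toMap_pt (𝟭 (rep M)) b

lemma exists_mulArr [T2Space M] [ParacompactSpace M] (hj : IsEtChart j) (ht : IsSubm (Γ.ct j))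
    {ε : Γ.unit.obj (pt (𝟙 M)) ⟶ uObj j} {e : M ⟶ N} (hε : Γ.stk.Lifts e ε) :
    ∃ (D : Set (N × N)) (μ : Γ.MulArr j D), IsOpen D ∧
      (∀ x, (e x, e x) ∈ D) ∧ ∀ h, μ.m (z := Γ.unit₂.obj (pt (𝟙 M))) ε ε h =
        Γ.unitIso.hom.app (pt (𝟙 M)) ≫ ε := by
  have hfib := Γ.fibred
  let N₂ := pull (Γ.cs j) (Γ.ct j) ht
  let p₁ : N₂ ⟶ N := pullFst _ _ ht
  let p₂ : N₂ ⟶ N := pullSnd _ _ ht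
  have hp : p₁ ≫ Γ.cs j = p₂ ≫ Γ.ct j := pull_comm _ _ ht
  obtain ⟨P, u₁, u₂, hu₁, hu₂⟩ : ∃ (P : Γ.pair.obj) (u₁ : P.fst ⟶ uObj j) (u₂ : P.snd ⟶ uObj j),
      Γ.stk.Lifts p₁ u₁ ∧ Γ.stk.Lifts p₂ u₂ :=
    ⟨Γ.ptPair (sameMap_mapOf _) (sameMap_mapOf _) p₁ p₂ hp, univ j p₁, univ j p₂, univ_lift j _,
      univ_lift j _⟩
  have hee : e ≫ Γ.cs j = e ≫ Γ.ct j := by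
    rw [unit_cs hε, unit_ct hε]
  let e₂ : M ⟶ N₂ := pullLift _ _ ht e e hee
  have he₁ : e₂ ≫ p₁ = e := rfl
  have he₂ : e₂ ≫ p₂ = e := rfl
  obtain ⟨c, hc, hc₁, hc₂⟩ := PreWeinstein.exists_pairHom hfib (f := e₂)
    (z := Γ.unit₂.obj (pt (𝟙 M))) (z' := P) (a := ε) (b := ε) (by rw [he₁]; exact hε)
    (by rw [he₂]; exact hε) hu₁ hu₂
  obtain ⟨D₂, z', r, α, hD₂, hr, hα⟩ := IsEtChart.exists_extension_obj Γ.etale.stack hj e₂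
    (p := fun p => Γ.cs j (p₁ p)) (continuous (p₁ ≫ Γ.cs j))
    (fun x => congr_hom (unit_cs hε) x) (map_lift Γ.mul hc)
    (Γ.unitIso.hom.app (pt (𝟙 M)) ≫ ε)
  obtain ⟨D, hD, hDD⟩ := (isInducing_pullVal (Γ.cs j) (Γ.ct j) ht).isOpen_iff.1 D₂.isOpen
  have hDm : ∀ p : N₂, p ∈ D₂ ↔ (p₁ p, p₂ p) ∈ D := fun p => by
    change p ∈ (D₂ : Set N₂) ↔ _
    rw [← hDD]; rfl
  have key : ∀ {z : Γ.pair.obj} (a : z.fst ⟶ uObj j) (b : z.snd ⟶ uObj j), InD₂ D a b →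
      ∃ m : Γ.mul.obj z ⟶ uObj j, ∀ (k : z ⟶ P), FPHom.fst k ≫ u₁ = a → FPHom.snd k ≫ u₂ = b →
        ∃ l : Γ.mul.obj z ⟶ z', l ≫ r = Γ.mul.map k ∧ m = l ≫ α := by
    intro z a b hab
    obtain ⟨S, a₀, b₀, ha, hb, hm⟩ := id hab
    let c₀ : S ⟶ N₂ := pullLift _ _ ht a₀ b₀ (PreWeinstein.pair_comp ha hb)
    have ex : ∀ k : z ⟶ P, FPHom.fst k ≫ u₁ = a → FPHom.snd k ≫ u₂ = b → Γ.pair.Lifts c₀ k := by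
      intro k h1 h2
      have hz : Γ.pair.p.obj z = S := (lift_base ha).1
      have hP : Γ.pair.p.obj P = N₂ := (lift_base hu₁).1
      have hk := bm_lift hz hP k
      have e : bm hz hP k = c₀ := by
        have e1 := lift_unique ha (by rw [← h1]; exact lift_comp (Γ.pair_lift_fst hk) hu₁)
        have e2 := lift_unique hb (by rw [← h2]; exact lift_comp (Γ.pair_lift_snd hk) hu₂)
        ext s
        exact pull_ext _ _ ht (congr_hom e1 s).symm (congr_hom e2 s).symm
      rwa [e] at hk
    obtain ⟨k, hk, e₁, e₂⟩ := PreWeinstein.exists_pairHom hfib (f := c₀) (a₀ := p₁) (b₀ := p₂) (z := z) (z' := P)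
      (a := a) (b := b) ha hb hu₁ hu₂
    obtain ⟨l, hl, hlr⟩ := hfib.exists_lift
      (codRestrict c₀ D₂ fun s => (hDm _).2 (hm s)) (N₂.incl D₂) (Γ.mul.map k) r
      (map_lift Γ.mul hk) hr
    refine ⟨l ≫ α, fun k' h1 h2 => ⟨l, ?_, rfl⟩⟩
    rw [hlr]
    congr 1
    have hk' := ex k' h1 h2
    apply FPHom.ext
    · exact hfib.hom_ext c₀ u₁ (Γ.pair_lift_fst hk) (Γ.pair_lift_fst hk') (e₁.trans h1.symm)
    · exact hfib.hom_ext c₀ u₂ (Γ.pair_lift_snd hk) (Γ.pair_lift_snd hk') (e₂.trans h2.symm)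
  choose m hm using @key
  refine ⟨D, ⟨fun a b h => m a b h, fun {z z'} k a b h h' => ?_⟩, hD, fun x => (hDm _).1 (hD₂ x),
    fun h => ?_⟩
  · obtain ⟨S, a₀, b₀, ha, hb, -⟩ := id h
    obtain ⟨q, hq, e₁, e₂⟩ := PreWeinstein.exists_pairHom hfib
      (f := pullLift _ _ ht a₀ b₀ (PreWeinstein.pair_comp ha hb)) (a₀ := p₁) (b₀ := p₂) (z := z) (z' := P)
      (a := a) (b := b) ha hb hu₁ hu₂
    obtain ⟨l, hl, hlm⟩ := hm a b h q e₁ e₂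
    obtain ⟨l', hl', hlm'⟩ := hm _ _ h' (k ≫ q) ((Category.assoc _ _ _).trans (FPHom.fst k ≫= e₁))
      ((Category.assoc _ _ _).trans (FPHom.snd k ≫= e₂))
    rw [hlm, hlm', ← Category.assoc]
    congr 1
    refine hfib.cancel_inj (incl_injective D₂) hr ?_
    rw [Category.assoc, hl, hl', Γ.mul.map_comp]
  · obtain ⟨l, hl, hlm⟩ := hm _ _ h c hc₁ hc₂
    change m _ _ h = _
    rw [hlm, hα l (𝟙 _) (by rw [hl, id_comp]), id_comp]
    rfl

lemma exists_invArr [T2Space M] [ParacompactSpace M] (hj : IsEtChart j)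
    {ε : Γ.unit.obj (pt (𝟙 M)) ⟶ uObj j} {e : M ⟶ N} (hε : Γ.stk.Lifts e ε) :
    ∃ (D : Set N) (ι : Γ.InvArr j D), IsOpen D ∧
      (∀ x, e x ∈ D) ∧ ∀ h, ι.i ε h = Γ.invUnitIso.hom.app (pt (𝟙 M)) ≫ ε := by
  have hfib := Γ.fibred
  obtain ⟨D₂, z', r, α, hD₂, hr, hα⟩ := IsEtChart.exists_extension_obj Γ.etale.stack hj e
    (p := Γ.cs j) (continuous _)
    (fun x => congr_hom (unit_cs hε) x) (map_lift Γ.inv hε)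
    (Γ.invUnitIso.hom.app (pt (𝟙 M)) ≫ ε)
  have key : ∀ {x : Γ.stk.obj} (a : x ⟶ uObj j), InD (D₂ : Set N) a →
      ∃ l : Γ.inv.obj x ⟶ z', l ≫ r = Γ.inv.map a := by
    rintro x a ⟨S, a₀, ha, hm⟩
    obtain ⟨l, hl, hlr⟩ := hfib.exists_lift (codRestrict a₀ D₂ hm) (N.incl D₂) (Γ.inv.map a) r
      (map_lift Γ.inv ha) hr
    exact ⟨l, hlr⟩
  choose l hl using @key
  refine ⟨D₂, ⟨fun a h => l a h ≫ α, fun {x y} k a h => ?_⟩, D₂.isOpen, hD₂, fun h => ?_⟩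
  · rw [← Category.assoc]
    congr 1
    refine hfib.cancel_inj (incl_injective D₂) hr ?_
    rw [Category.assoc, hl, hl, Γ.inv.map_comp]
  · change l _ h ≫ α = _
    rw [hα (l _ h) (𝟙 _) (by rw [hl, id_comp]), id_comp]
    rfl

end WeinsteinGroupoid

lemma Mfd.eventually_of_opn {N : Mfd} {O : Opens N} {x : N} (hx : x ∈ O) {P : N → Prop}
    (h : ∀ᶠ z in 𝓝 (opnMk x hx), P (N.incl O z)) : ∀ᶠ y in 𝓝 x, P y := by
  have h1 := O.isOpenEmbedding'.map_nhds_eq ⟨x, hx⟩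
  change Filter.map _ _ = 𝓝 x at h1
  rw [← h1]
  exact h

namespace Stk

variable {𝒴 : BasedCategory.{v₂, u₂} Mfd}

lemma term_lift {M S : Mfd} (G : Ξ ⥤ᵇ rep M) {x : Ξ.obj} (hx : Ξ.p.obj x = S) :
    (rep M).Lifts (atMap G hx) (term (G.obj x)) := by
  subst hx
  have e : atMap G rfl = bm (G.w_obj x) rfl (term (G.obj x)) := by
    change 𝟙 _ ≫ eqToHom _ ≫ Over.hom (X := M) _ = eqToHom _ ≫ Over.hom (X := M) _ ≫ 𝟙 _
    rw [comp_id, id_comp]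
  rw [e]
  exact bm_lift _ _ _

lemma exists_fp {M S : Mfd} (F : Ξ ⥤ᵇ rep M) (G : 𝒴 ⥤ᵇ rep M) {x : Ξ.obj} {y : 𝒴.obj}
    (hx : Ξ.p.obj x = S) (hy : 𝒴.p.obj y = S) (h : atMap F hx = atMap G hy) :
    ∃ η : F.obj x ⟶ G.obj y, (rep M).Lifts (𝟙 (Ξ.p.obj x)) η := by
  subst hx
  have h1 := term_lift F (x := x) rfl
  rw [h] at h1
  obtain ⟨η, hη, -⟩ := (rep_fibred M).exists_lift (𝟙 _) (atMap G hy) (term (F.obj x)) (term (G.obj y)) h1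
    (term_lift G hy)
  exact ⟨η, hη⟩

end Stk

/-- The structure maps of a Weinstein groupoid near the identities of a chart, over `w : B ⟶ M`. -/
structure OpGerm {M B N : Mfd} (Γ : WeinsteinGroupoid.{v, u} M) (w : B ⟶ M) (j : rep N ⥤ᵇ Γ.stk) where
  chart : IsEtChart j
  src_subm : IsSubm (Γ.cs j)
  tgt_subm : IsSubm (Γ.ct j)
  e : B ⟶ N
  ε : Γ.unit.obj (pt w) ⟶ uObj j
  ε_lift : Γ.stk.Lifts e ε
  D : Set (N × N)
  isOpen_D : IsOpen D
  D_unit : ∀ b, (e b, e b) ∈ D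
  μ : Γ.MulArr j D
  μ_unit : ∀ h, μ.m (z := Γ.unit₂.obj (pt w)) ε ε h = Γ.unitIso.hom.app (pt w) ≫ ε
  E : Set N
  isOpen_E : IsOpen E
  E_unit : ∀ b, e b ∈ E
  ι : Γ.InvArr j E
  ι_unit : ∀ h, ι.i ε h = Γ.invUnitIso.hom.app (pt w) ≫ ε

namespace OpGerm

variable {M B N : Mfd} {Γ : WeinsteinGroupoid.{v, u} M} {j : rep N ⥤ᵇ Γ.stk}

section

variable {w : B ⟶ M} (K : OpGerm Γ w j)

lemma s_e (b : B) : Γ.cs j (K.e b) = w b := congr_hom (WeinsteinGroupoid.unit_cs K.ε_lift) b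

lemma t_e (b : B) : Γ.ct j (K.e b) = w b := congr_hom (WeinsteinGroupoid.unit_ct K.ε_lift) b

lemma inD₂_ε : InD₂ K.D K.ε K.ε := ⟨_, _, _, K.ε_lift, K.ε_lift, K.D_unit⟩

lemma inD_ε : InD K.E K.ε := ⟨_, _, K.ε_lift, K.E_unit⟩

lemma val_e (b : B) : K.μ.val (K.e b) (K.e b) = K.e b := by
  refine (K.μ.val_eq Γ.fibred (z := Γ.unit₂.obj (pt w)) (a := K.ε) (b := K.ε) K.inD₂_ε K.ε_lift
    K.ε_lift (c₀ := K.e) ?_ b).symm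
  exact (congrArg (fun f => Γ.stk.Lifts K.e f) (K.μ_unit K.inD₂_ε)).mpr
    (lift_id_comp (app_lift Γ.unitIso.hom w) K.ε_lift)

lemma inv_e (b : B) : K.ι.val (K.e b) = K.e b := by
  refine (K.ι.val_eq Γ.fibred K.inD_ε K.ε_lift (c₀ := K.e) ?_ b).symm
  rw [K.ι_unit]
  exact lift_id_comp (app_lift Γ.invUnitIso.hom w) K.ε_lift

lemma exists_pair {S : Mfd} {a₀ b₀ : S ⟶ N} (h : a₀ ≫ Γ.cs j = b₀ ≫ Γ.ct j) :
    ∃ (z : Γ.pair.obj) (a : z.fst ⟶ uObj j) (b : z.snd ⟶ uObj j),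
      Γ.stk.Lifts a₀ a ∧ Γ.stk.Lifts b₀ b :=
  ⟨Γ.ptPair (sameMap_mapOf _) (sameMap_mapOf _) a₀ b₀ h, univ j a₀, univ j b₀, univ_lift j _,
    univ_lift j _⟩

lemma exists_mul {S : Mfd} {a₀ b₀ : S ⟶ N} (h : a₀ ≫ Γ.cs j = b₀ ≫ Γ.ct j)
    (hD : ∀ s, (a₀ s, b₀ s) ∈ K.D) : ∃ c₀ : S ⟶ N, (∀ s, c₀ s = K.μ.val (a₀ s) (b₀ s)) ∧
      c₀ ≫ Γ.cs j = b₀ ≫ Γ.cs j ∧ c₀ ≫ Γ.ct j = a₀ ≫ Γ.ct j := by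
  obtain ⟨z, a, b, ha, hb⟩ := exists_pair h
  have hab : InD₂ K.D a b := ⟨_, _, _, ha, hb, hD⟩
  obtain ⟨c₀, hc⟩ := K.μ.exists_base hab ha
  exact ⟨c₀, K.μ.val_eq Γ.fibred hab ha hb hc, WeinsteinGroupoid.cs_val K.μ hab hb hc,
    WeinsteinGroupoid.ct_val K.μ hab ha hc⟩

lemma exists_inv {S : Mfd} {a₀ : S ⟶ N} (hE : ∀ s, a₀ s ∈ K.E) :
    ∃ c₀ : S ⟶ N, (∀ s, c₀ s = K.ι.val (a₀ s)) ∧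
      c₀ ≫ Γ.cs j = a₀ ≫ Γ.ct j ∧ c₀ ≫ Γ.ct j = a₀ ≫ Γ.cs j := by
  have ha := univ_lift j a₀
  have h : InD K.E (univ j a₀) := ⟨_, _, ha, hE⟩
  obtain ⟨c₀, hc⟩ := K.ι.exists_base h ha
  exact ⟨c₀, K.ι.val_eq Γ.fibred h ha hc, WeinsteinGroupoid.cs_inv K.ι h ha hc,
    WeinsteinGroupoid.ct_inv K.ι h ha hc⟩

lemma s_val {g h : N} (hD : (g, h) ∈ K.D) (hgh : Γ.cs j g = Γ.ct j h) :
    Γ.cs j (K.μ.val g h) = Γ.cs j h ∧ Γ.ct j (K.μ.val g h) = Γ.ct j g := by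
  obtain ⟨c₀, hc, h1, h2⟩ := K.exists_mul (a₀ := pnt g) (b₀ := pnt h)
    (by rw [pnt_comp, pnt_comp, hgh]) fun _ => hD
  have h3 : c₀ pointElt = K.μ.val g h := hc pointElt
  rw [← h3]
  exact ⟨congr_hom h1 pointElt, congr_hom h2 pointElt⟩

lemma s_inv {g : N} (hE : g ∈ K.E) :
    Γ.cs j (K.ι.val g) = Γ.ct j g ∧ Γ.ct j (K.ι.val g) = Γ.cs j g := by
  obtain ⟨c₀, hc, h1, h2⟩ := K.exists_inv (a₀ := pnt g) fun _ => hE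
  have h3 : c₀ pointElt = K.ι.val g := hc pointElt
  rw [← h3]
  exact ⟨congr_hom h1 pointElt, congr_hom h2 pointElt⟩

lemma inv_smooth : ContMDiffOn N.I N.I ∞ K.ι.val K.E := by
  let O : Opens N := ⟨K.E, K.isOpen_E⟩
  obtain ⟨c₀, hc, -⟩ := K.exists_inv (a₀ := N.incl O) fun s => s.2
  intro g hg
  refine ContMDiffAt.contMDiffWithinAt (contMDiffAt_of_opn (O := O) hg ?_)
  exact (smooth c₀ _).congr_of_eventuallyEq (Eventually.of_forall fun z => (hc z).symm)

lemma mul_smooth : ContMDiffOn (N.I.prod N.I) N.I ∞ (fun p : N × N => K.μ.val p.1 p.2)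
    {p | p ∈ K.D ∧ Γ.cs j p.1 = Γ.ct j p.2} := by
  let N₂ := pull (Γ.cs j) (Γ.ct j) K.tgt_subm
  let p₁ : N₂ ⟶ N := pullFst _ _ _
  let p₂ : N₂ ⟶ N := pullSnd _ _ _
  have hp : p₁ ≫ Γ.cs j = p₂ ≫ Γ.ct j := pull_comm _ _ _
  let O : Opens N₂ := ⟨{p | (p₁ p, p₂ p) ∈ K.D}, K.isOpen_D.preimage
    ((continuous p₁).prodMk (continuous p₂))⟩
  obtain ⟨c₀, hc, -⟩ := K.exists_mul (a₀ := N₂.incl O ≫ p₁) (b₀ := N₂.incl O ≫ p₂)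
    (by rw [assoc, hp, assoc]) fun s => s.2
  have h1 : ContMDiffOn N₂.I N.I ∞ (fun p => K.μ.val (p₁ p) (p₂ p)) (O : Set N₂) := by
    intro p hp
    refine ContMDiffAt.contMDiffWithinAt (contMDiffAt_of_opn (O := O) hp ?_)
    exact (smooth c₀ _).congr_of_eventuallyEq (Eventually.of_forall fun z => (hc z).symm)
  refine (contMDiffOn_of_pull _ _ K.tgt_subm (O : Set N₂) O.isOpen _ h1
    (fun p => K.μ.val p.1 p.2) fun _ _ => rfl).mono ?_
  rintro ⟨g, h⟩ ⟨hD, hgh⟩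
  exact ⟨hgh, hD⟩

end

end OpGerm

namespace OpGerm

variable {M N : Mfd} {Γ : WeinsteinGroupoid.{v, u} M} {j : rep N ⥤ᵇ Γ.stk} (K : OpGerm Γ (𝟙 M) j)

/-- The identities as an arrow into the chart. -/
def εu (u : (rep M).obj) : Γ.unit.obj u ⟶ uObj j := Γ.unit.map (term u) ≫ K.ε

lemma map_εu {u u' : (rep M).obj} (f : u ⟶ u') : Γ.unit.map f ≫ K.εu u' = K.εu u := by
  rw [εu, ← assoc, ← Γ.unit.map_comp, comp_term, εu]

lemma εu_lift {Ξ : BasedCategory.{v₁, u₁} Mfd} (G : Ξ ⥤ᵇ rep M) {x : Ξ.obj} {S : Mfd}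
    (hx : Ξ.p.obj x = S) : Γ.stk.Lifts (atMap G hx ≫ K.e) (K.εu (G.obj x)) :=
  lift_comp (map_lift Γ.unit (term_lift G hx)) K.ε_lift

lemma εu_pt_lift {S : Mfd} (b : S ⟶ M) : Γ.stk.Lifts (b ≫ K.e) (K.εu (pt b)) := by
  have h := K.εu_lift (𝟭 (rep M)) (x := pt b) (S := S) rfl
  have e : atMap (𝟭 (rep M)) (rfl : (rep M).p.obj (pt b) = S) = b := toMap_pt (𝟭 (rep M)) b
  exact (congrArg (fun f : S ⟶ M => Γ.stk.Lifts (f ≫ K.e) (K.εu (pt b))) e).mp h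

lemma inD₂_εu (u : (rep M).obj) : InD₂ K.D (K.εu u) (K.εu u) := K.inD₂_ε |> fun h => by
  obtain ⟨S, a₀, b₀, ha, hb, hm⟩ := h
  have hk := bm_lift rfl (lift_base ha).1 (Γ.unit.map (term u))
  exact ⟨_, _, _, lift_comp hk ha, lift_comp hk hb, fun s => hm _⟩

lemma inD_εu (u : (rep M).obj) : InD K.E (K.εu u) := K.inD_ε.pre _

lemma m_εu (u : (rep M).obj) : K.μ.m (z := Γ.unit₂.obj u) (K.εu u) (K.εu u) (K.inD₂_εu u) =
    Γ.unitIso.hom.app u ≫ K.εu u := by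
  have h := K.μ.nat (Γ.unit₂.map (term u)) K.ε K.ε K.inD₂_ε (K.inD₂_εu u)
  refine h.symm.trans ((Γ.mul.map (Γ.unit₂.map (term u)) ≫= (K.μ_unit _)).trans ?_)
  exact Γ.unitIso.hom.naturality_assoc (term u) K.ε

lemma i_εu (u : (rep M).obj) : K.ι.i (K.εu u) (K.inD_εu u) = Γ.invUnitIso.hom.app u ≫ K.εu u := by
  have h := K.ι.nat (Γ.unit.map (term u)) K.ε K.inD_ε
  rw [K.ι_unit] at h
  refine h.symm.trans ?_
  exact Γ.invUnitIso.hom.naturality_assoc (term u) K.ε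

lemma m_unit {z : Γ.pair.obj} {u : (rep M).obj} {S : Mfd} {k₁ : z.fst ⟶ Γ.unit.obj u}
    {k₂ : z.snd ⟶ Γ.unit.obj u} (h₁ : Γ.stk.Lifts (𝟙 S) k₁) (h₂ : Γ.stk.Lifts (𝟙 S) k₂)
    {a : z.fst ⟶ uObj j} {b : z.snd ⟶ uObj j} (h : InD₂ K.D a b) (ha : k₁ ≫ K.εu u = a)
    (hb : k₂ ≫ K.εu u = b) : K.μ.m a b h =
      Γ.mul.map (fpHom (w' := Γ.unit₂.obj u) (𝟙 S) k₁ k₂ h₁ h₂) ≫ Γ.unitIso.hom.app u ≫ K.εu u := by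
  subst ha hb
  exact (K.μ.nat (fpHom (w' := Γ.unit₂.obj u) (𝟙 S) k₁ k₂ h₁ h₂) (K.εu u) (K.εu u) (K.inD₂_εu u)
    h).symm.trans (Γ.mul.map _ ≫= (K.m_εu u))

lemma exists_at (O : Opens N) {x : M} (hx : K.e x ∈ O) :
    ∃ (z : Γ.stk.obj) (a : z ⟶ uObj j) (c : Γ.unit.obj (pt (pnt x)) ⟶ z),
      Γ.stk.p.obj z = N.opn O ∧ Γ.stk.Lifts (N.incl O) a ∧
      Γ.stk.Lifts (pnt (opnMk (K.e x) hx)) c ∧ c ≫ a = K.εu (pt (pnt x)) := by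
  obtain ⟨c, hc, hca⟩ := Γ.fibred.exists_lift (pnt (opnMk (K.e x) hx)) (N.incl O) _ _
    (K.εu_pt_lift (pnt x)) (univ_lift j _)
  exact ⟨_, _, c, j.w_obj _, univ_lift j _, hc, hca⟩

lemma eventually_law {O : Opens N} {x : M} {hx : K.e x ∈ O} {z : Γ.stk.obj}
    (hz : Γ.stk.p.obj z = N.opn O) {c : Γ.unit.obj (pt (pnt x)) ⟶ z}
    (hc : Γ.stk.Lifts (pnt (opnMk (K.e x) hx)) c) {A : Γ.stk ⥤ᵇ Γ.pair} {B : Γ.stk ⥤ᵇ Γ.stk}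
    (l : A ⋙ Γ.mul ≅ B) {a : (A.obj z).fst ⟶ uObj j} {b : (A.obj z).snd ⟶ uObj j}
    {r : B.obj z ⟶ uObj j} {p₁ p₂ p₃ : N.opn O ⟶ N} (ha : Γ.stk.Lifts p₁ a) (hb : Γ.stk.Lifts p₂ b)
    (hr : Γ.stk.Lifts p₃ r) (hD : ∀ s, (p₁ s, p₂ s) ∈ K.D)
    {k₁ : (A.obj (Γ.unit.obj (pt (pnt x)))).fst ⟶ Γ.unit.obj (pt (pnt x))}
    {k₂ : (A.obj (Γ.unit.obj (pt (pnt x)))).snd ⟶ Γ.unit.obj (pt (pnt x))}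
    {k₃ : B.obj (Γ.unit.obj (pt (pnt x))) ⟶ Γ.unit.obj (pt (pnt x))}
    {h₁ : Γ.stk.Lifts (𝟙 point) k₁} {h₂ : Γ.stk.Lifts (𝟙 point) k₂}
    (e : l.hom.app (Γ.unit.obj (pt (pnt x))) ≫ k₃ =
      Γ.mul.map (fpHom (w' := Γ.unit₂.obj (pt (pnt x))) (𝟙 _) k₁ k₂ h₁ h₂) ≫ Γ.unitIso.hom.app _)
    (e₁ : k₁ ≫ K.εu (pt (pnt x)) = FPHom.fst (A.map c) ≫ a)
    (e₂ : k₂ ≫ K.εu (pt (pnt x)) = FPHom.snd (A.map c) ≫ b)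
    (e₃ : k₃ ≫ K.εu (pt (pnt x)) = B.map c ≫ r) :
    ∀ᶠ g in 𝓝 (opnMk (K.e x) hx), K.μ.val (p₁ g) (p₂ g) = p₃ g := by
  have hab : InD₂ K.D a b := ⟨_, _, _, ha, hb, hD⟩
  obtain ⟨c₀, hc₀⟩ := K.μ.exists_base hab ha
  have hv := K.μ.val_eq Γ.fibred hab ha hb hc₀
  simp only [← hv]
  refine K.chart.eventually_base_eq Γ.fibred hc₀ (lift_id_comp (l.hom.isHomLift hz) hr)
    (map_lift (A ⋙ Γ.mul) hc) ?_
  refine (K.μ.nat (A.map c) a b hab (PreWeinstein.inD₂_pre _ hab)).trans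
    ((K.m_unit h₁ h₂ _ e₁ e₂).trans (Eq.trans ?_ (l.hom.naturality_assoc c r).symm))
  exact (assoc _ _ _).symm.trans ((e.symm =≫ _).trans ((assoc _ _ _).trans (_ ≫= e₃)))

lemma eventually_unit_mul (x : M) : ∀ᶠ g in 𝓝 (K.e x), K.μ.val (K.e (Γ.ct j g)) g = g := by
  let O : Opens N := ⟨{g | (K.e (Γ.ct j g), g) ∈ K.D}, K.isOpen_D.preimage
    ((continuous (Γ.ct j ≫ K.e)).prodMk continuous_id)⟩
  have hx : K.e x ∈ O := by
    change (K.e (Γ.ct j (K.e x)), K.e x) ∈ K.D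
    rw [K.t_e]; exact K.D_unit x
  obtain ⟨z, a, c, hz, ha, hc, hca⟩ := K.exists_at O hx
  have hb := K.εu_lift Γ.tgt hz
  rw [atMap_chart Γ.tgt ha] at hb
  exact eventually_of_opn hx (K.eventually_law hz hc Γ.leftUnit hb ha ha (fun s => s.2)
    ((comp_id _).trans (Γ.leftUnit_res _)) ((K.map_εu _).trans (K.map_εu _).symm)
    ((id_comp _).trans hca.symm) ((id_comp _).trans hca.symm))

lemma eventually_mul_unit (x : M) : ∀ᶠ g in 𝓝 (K.e x), K.μ.val g (K.e (Γ.cs j g)) = g := by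
  let O : Opens N := ⟨{g | (g, K.e (Γ.cs j g)) ∈ K.D}, K.isOpen_D.preimage
    (continuous_id.prodMk (continuous (Γ.cs j ≫ K.e)))⟩
  have hx : K.e x ∈ O := by
    change (K.e x, K.e (Γ.cs j (K.e x))) ∈ K.D
    rw [K.s_e]; exact K.D_unit x
  obtain ⟨z, a, c, hz, ha, hc, hca⟩ := K.exists_at O hx
  have hb := K.εu_lift Γ.src hz
  rw [atMap_chart Γ.src ha] at hb
  exact eventually_of_opn hx (K.eventually_law hz hc Γ.rightUnit ha hb ha (fun s => s.2)
    ((comp_id _).trans (Γ.rightUnit_res _)) ((id_comp _).trans hca.symm)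
    ((K.map_εu _).trans (K.map_εu _).symm) ((id_comp _).trans hca.symm))

lemma tendsto_inv (x : M) : Tendsto K.ι.val (𝓝 (K.e x)) (𝓝 (K.e x)) := by
  have h := (K.inv_smooth.continuousOn.continuousAt (K.isOpen_E.mem_nhds (K.E_unit x))).tendsto
  rwa [K.inv_e] at h

lemma exists_at_inv {D : Set N} {x : M} (hD : D ∈ 𝓝 (K.e x)) :
    ∃ (O : Opens N) (hx : K.e x ∈ O) (z : Γ.stk.obj) (a : z ⟶ uObj j)
      (c : Γ.unit.obj (pt (pnt x)) ⟶ z) (hE : InD K.E a) (i₀ : N.opn O ⟶ N),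
      Γ.stk.p.obj z = N.opn O ∧ Γ.stk.Lifts (N.incl O) a ∧
      Γ.stk.Lifts (pnt (opnMk (K.e x) hx)) c ∧ c ≫ a = K.εu (pt (pnt x)) ∧
      Γ.stk.Lifts i₀ (K.ι.i a hE) ∧ (∀ s, i₀ s = K.ι.val (N.incl O s)) ∧ (∀ s ∈ O, s ∈ D) ∧
      Γ.invUnitIso.hom.app (pt (pnt x)) ≫ K.εu (pt (pnt x)) = Γ.inv.map c ≫ K.ι.i a hE := by
  let O : Opens N := ⟨interior (K.E ∩ D), isOpen_interior⟩
  have hx : K.e x ∈ O := mem_interior_iff_mem_nhds.2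
    (inter_mem (K.isOpen_E.mem_nhds (K.E_unit x)) hD)
  have hO : ∀ g ∈ O, g ∈ K.E ∩ D := fun g hg => interior_subset hg
  obtain ⟨z, a, c, hz, ha, hc, hca⟩ := K.exists_at O hx
  have hE : InD K.E a := ⟨_, _, ha, fun s => (hO _ s.2).1⟩
  obtain ⟨i₀, hi₀⟩ := K.ι.exists_base hE ha
  exact ⟨O, hx, z, a, c, hE, i₀, hz, ha, hc, hca, hi₀, K.ι.val_eq Γ.fibred hE ha hi₀,
    fun s hs => (hO s hs).2, ((K.ι.nat c a hE).trans ((K.ι.i_congr _ hca).trans (K.i_εu _))).symm⟩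

lemma eventually_inv_mul (x : M) : ∀ᶠ g in 𝓝 (K.e x), K.μ.val (K.ι.val g) g = K.e (Γ.cs j g) := by
  obtain ⟨O, hx, z, a, c, hE, i₀, hz, ha, hc, hca, hi₀, hv, hD, e0⟩ := K.exists_at_inv
    (((K.tendsto_inv x).prodMk_nhds tendsto_id).eventually
      (K.isOpen_D.mem_nhds (K.D_unit x)))
  have hb := K.εu_lift Γ.src hz
  rw [atMap_chart Γ.src ha] at hb
  refine eventually_of_opn hx ((K.eventually_law hz hc Γ.leftInv hi₀ ha hb
    (fun s => (hv s).symm ▸ hD _ s.2) (Γ.leftInv_res _) e0 ((id_comp _).trans hca.symm)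
    ((K.map_εu _).trans (K.map_εu _).symm)).mono fun g hg => ?_)
  rwa [hv] at hg

lemma eventually_mul_inv (x : M) : ∀ᶠ g in 𝓝 (K.e x), K.μ.val g (K.ι.val g) = K.e (Γ.ct j g) := by
  obtain ⟨O, hx, z, a, c, hE, i₀, hz, ha, hc, hca, hi₀, hv, hD, e0⟩ := K.exists_at_inv
    ((tendsto_id.prodMk_nhds (K.tendsto_inv x)).eventually
      (K.isOpen_D.mem_nhds (K.D_unit x)))
  have hb := K.εu_lift Γ.tgt hz
  rw [atMap_chart Γ.tgt ha] at hb
  refine eventually_of_opn hx ((K.eventually_law hz hc Γ.rightInv ha hi₀ hb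
    (fun s => (hv s).symm ▸ hD _ s.2) (Γ.rightInv_res _) ((id_comp _).trans hca.symm) e0
    ((K.map_εu _).trans (K.map_εu _).symm)).mono fun g hg => ?_)
  rwa [hv] at hg

end OpGerm

namespace OpGerm

variable {M B N : Mfd} {Γ : WeinsteinGroupoid.{v, u} M} {j : rep N ⥤ᵇ Γ.stk}

lemma continuousAt_mul {w : B ⟶ M} (K : OpGerm Γ w j) {T : Type*} [TopologicalSpace T]
    {a b : T → N} {x : T} (ha : ContinuousAt a x) (hb : ContinuousAt b x)
    (h : ∀ y, Γ.cs j (a y) = Γ.ct j (b y)) (hD : (a x, b x) ∈ K.D) :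
    ContinuousAt (fun y => K.μ.val (a y) (b y)) x := by
  have h1 := K.mul_smooth.continuousOn (a x, b x) ⟨hD, h x⟩
  have h2 : Tendsto (fun y => (a y, b y)) (𝓝 x)
      (𝓝[{p | p ∈ K.D ∧ Γ.cs j p.1 = Γ.ct j p.2}] (a x, b x)) :=
    tendsto_nhdsWithin_iff.2 ⟨ha.prodMk hb, ((ha.prodMk hb).eventually
      (K.isOpen_D.mem_nhds hD)).mono fun y hy => ⟨hy, h y⟩⟩
  exact h1.tendsto.comp h2

lemma tendsto_mul {w : B ⟶ M} (K : OpGerm Γ w j) (b : B) :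
    Tendsto (fun p : N × N => K.μ.val p.1 p.2)
      (𝓝[{p | Γ.cs j p.1 = Γ.ct j p.2}] (K.e b, K.e b)) (𝓝 (K.e b)) := by
  have h1 := (K.mul_smooth.continuousOn (K.e b, K.e b)
    ⟨K.D_unit b, (K.s_e b).trans (K.t_e b).symm⟩).tendsto
  simp only [K.val_e] at h1
  exact h1.mono_left (nhdsWithin_le_of_mem (inter_mem
    (mem_nhdsWithin_of_mem_nhds (K.isOpen_D.mem_nhds (K.D_unit b))) self_mem_nhdsWithin))

variable (K : OpGerm Γ (𝟙 M) j)

lemma exists_triple {S : Mfd} {a₀ b₀ c₀ : S ⟶ N} (h : a₀ ≫ Γ.cs j = b₀ ≫ Γ.ct j)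
    (h' : b₀ ≫ Γ.cs j = c₀ ≫ Γ.ct j) :
    ∃ (T : Γ.triple.obj) (a : T.fst.fst ⟶ uObj j) (b : T.fst.snd ⟶ uObj j) (c : T.snd ⟶ uObj j),
      Γ.stk.Lifts a₀ a ∧ Γ.stk.Lifts b₀ b ∧ Γ.stk.Lifts c₀ c := by
  obtain ⟨z, a, b, ha, hb⟩ := exists_pair h
  have hc := univ_lift j c₀
  have hz : Γ.pair.p.obj z = S := (lift_base ha).1
  obtain ⟨η, hη⟩ := exists_fp (fpSnd Γ.src Γ.tgt ⋙ Γ.src) Γ.tgt (x := z) (y := j.obj (pt c₀)) hz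
    (lift_base hc).1 (by
      rw [atMap_chart Γ.tgt hc, ← h', ← atMap_chart Γ.src hb (lift_base hb).1]
      exact (atMap_same (A := fpSnd Γ.src Γ.tgt) (G := Γ.src) (y := z) (fun w => rfl) hz
        (lift_base hb).1).symm)
  exact ⟨⟨z, _, η, hη⟩, a, b, univ j c₀, ha, hb, hc⟩

lemma eventually_assoc_family {S : Mfd} {a₀ b₀ c₀ : S ⟶ N} (h : a₀ ≫ Γ.cs j = b₀ ≫ Γ.ct j)
    (h' : b₀ ≫ Γ.cs j = c₀ ≫ Γ.ct j) (hab : ∀ s, (a₀ s, b₀ s) ∈ K.D) (hbc : ∀ s, (b₀ s, c₀ s) ∈ K.D)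
    (hl : ∀ s, (K.μ.val (a₀ s) (b₀ s), c₀ s) ∈ K.D) (hr : ∀ s, (a₀ s, K.μ.val (b₀ s) (c₀ s)) ∈ K.D)
    {s : S} {x : M} (ha : a₀ s = K.e x) (hb : b₀ s = K.e x) (hc : c₀ s = K.e x) :
    ∀ᶠ s' in 𝓝 s, K.μ.val (K.μ.val (a₀ s') (b₀ s')) (c₀ s') =
      K.μ.val (a₀ s') (K.μ.val (b₀ s') (c₀ s')) := by
  have hfib := Γ.fibred
  obtain ⟨T, a, b, c, la, lb, lc⟩ := exists_triple h h'
  let Lf : Γ.triple ⥤ᵇ Γ.pair := fpLift (F := Γ.src) (G := Γ.tgt) (fpFst _ _ ⋙ Γ.mul) (fpSnd _ _)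
    (((Γ.src_mul.precomp (fpFst (fpSnd Γ.src Γ.tgt ⋙ Γ.src) Γ.tgt))).trans (fpSame _ _)).hom
  let Rf : Γ.triple ⥤ᵇ Γ.pair := fpLift (F := Γ.src) (G := Γ.tgt) (fpFst _ _ ⋙ fpFst _ _)
    (Γ.lastTwo ⋙ Γ.mul) Γ.mulRight_aux.hom
  have dab : InD₂ K.D a b := ⟨_, _, _, la, lb, hab⟩
  have dbc : InD₂ K.D b c := ⟨_, _, _, lb, lc, hbc⟩
  obtain ⟨p₀, lp⟩ := K.μ.exists_base (z := T.fst) dab la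
  obtain ⟨q₀, lq⟩ := K.μ.exists_base (z := Γ.lastTwo.obj T) dbc lb
  have vp := K.μ.val_eq hfib (z := T.fst) dab la lb lp
  have vq := K.μ.val_eq hfib (z := Γ.lastTwo.obj T) dbc lb lc lq
  have dl : InD₂ K.D (K.μ.m (z := T.fst) a b dab) c := ⟨_, _, _, lp, lc, fun s => by rw [vp]; exact hl s⟩
  have dr : InD₂ K.D a (K.μ.m (z := Γ.lastTwo.obj T) b c dbc) :=
    ⟨_, _, _, la, lq, fun s => by rw [vq]; exact hr s⟩
  obtain ⟨l₀, ll⟩ := K.μ.exists_base (z := Lf.obj T) dl lp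
  obtain ⟨r₀, lr⟩ := K.μ.exists_base (z := Rf.obj T) dr la
  have vl := K.μ.val_eq hfib (z := Lf.obj T) dl lp lc ll
  have vr := K.μ.val_eq hfib (z := Rf.obj T) dr la lq lr
  have hT : Γ.triple.p.obj T = S := (lift_base la).1
  have lr' : Γ.stk.Lifts r₀ (Γ.assoc.hom.app T ≫ K.μ.m (z := Rf.obj T) a
      (K.μ.m (z := Γ.lastTwo.obj T) b c dbc) dr) :=
    lift_id_comp (Γ.assoc.hom.isHomLift hT) lr
  set u : (rep M).obj := pt (pnt x)
  have lε := K.εu_pt_lift (pnt x)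
  have le : ∀ d₀ : S ⟶ N, d₀ s = K.e x → pnt x ≫ K.e = pnt s ≫ d₀ := fun d₀ hd =>
    (pnt_comp _ _).trans ((congrArg pnt hd.symm).trans (pnt_comp _ _).symm)
  obtain ⟨k₁, hk₁, ea⟩ := hfib.exists_lift (pnt s) a₀ _ a ((le a₀ ha) ▸ lε) la
  obtain ⟨k₂, hk₂, eb⟩ := hfib.exists_lift (pnt s) b₀ _ b ((le b₀ hb) ▸ lε) lb
  obtain ⟨k₃, hk₃, ec⟩ := hfib.exists_lift (pnt s) c₀ _ c ((le c₀ hc) ▸ lε) lc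
  let κ : Γ.unit₂.obj u ⟶ T.fst := fpHom (pnt s) k₁ k₂ hk₁ hk₂
  let Κ : Γ.unit₃.obj u ⟶ T := fpHom (F := fpSnd Γ.src Γ.tgt ⋙ Γ.src) (G := Γ.tgt)
    (w := Γ.unit₃.obj u) (pnt s) κ k₃ (fp_lift hk₁) hk₃
  have hΚ : Γ.triple.Lifts (pnt s) Κ := fp_lift (fp_lift hk₁)
  have key := K.chart.eventually_base_eq hfib ll lr' (map_lift Γ.mulLeft hΚ) (by
    have e1 := K.μ.nat (Lf.map Κ) (K.μ.m (z := T.fst) a b dab) c dl (PreWeinstein.inD₂_pre _ dl)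
    have e2 := K.μ.nat (Rf.map Κ) a (K.μ.m (z := Γ.lastTwo.obj T) b c dbc) dr
      (PreWeinstein.inD₂_pre _ dr)
    have e3 : Γ.mul.map κ ≫ K.μ.m (z := T.fst) a b dab = Γ.unitIso.hom.app u ≫ K.εu u :=
      (K.μ.nat κ a b dab (PreWeinstein.inD₂_pre _ dab)).trans
        ((K.μ.m_congr _ ea eb).trans (K.m_εu u))
    have e4 : Γ.mul.map (Γ.lastTwo.map Κ) ≫ K.μ.m (z := Γ.lastTwo.obj T) b c dbc =
        Γ.unitIso.hom.app u ≫ K.εu u :=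
      (K.μ.nat (Γ.lastTwo.map Κ) b c dbc (PreWeinstein.inD₂_pre _ dbc)).trans
        ((K.μ.m_congr _ eb ec).trans (K.m_εu u))
    have e5 := K.m_unit (z := Lf.obj (Γ.unit₃.obj u)) (Γ.unitIso.hom.isHomLift' u)
      (IsHomLift.id (Γ.unit.w_obj u)) (PreWeinstein.inD₂_pre (Lf.map Κ) dl) e3.symm
      ((id_comp _).trans ec.symm)
    have e6 := K.m_unit (z := Rf.obj (Γ.unit₃.obj u)) (IsHomLift.id (Γ.unit.w_obj u))
      (Γ.unitIso.hom.isHomLift' u) (PreWeinstein.inD₂_pre (Rf.map Κ) dr)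
      ((id_comp _).trans ea.symm) e4.symm
    have e7 := ((Γ.assoc_res u) =≫ K.εu u)
    have e8 := Γ.assoc.hom.naturality_assoc Κ
      (K.μ.m (z := Rf.obj T) a (K.μ.m (z := Γ.lastTwo.obj T) b c dbc) dr)
    refine e1.trans (e5.trans (Eq.trans ?_ e8.symm))
    refine Eq.trans ?_ (Γ.assoc.hom.app (Γ.unit₃.obj u) ≫= (e2.trans e6).symm)
    refine ((assoc _ _ _).symm.trans e7.symm).trans ?_
    exact (assoc _ _ _).trans (Γ.assoc.hom.app (Γ.unit₃.obj u) ≫= (assoc _ _ _)))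
  filter_upwards [key] with s' hs'
  rw [vl, vr, vp, vq] at hs'
  exact hs'

lemma eventually_assoc (x : M) : ∀ᶠ p : (N × N) × N in 𝓝 ((K.e x, K.e x), K.e x),
    Γ.cs j p.1.1 = Γ.ct j p.1.2 → Γ.cs j p.1.2 = Γ.ct j p.2 →
    K.μ.val (K.μ.val p.1.1 p.1.2) p.2 = K.μ.val p.1.1 (K.μ.val p.1.2 p.2) := by
  let N₂ := pull (Γ.cs j) (Γ.ct j) K.tgt_subm
  let p₁ : N₂ ⟶ N := pullFst _ _ _
  let p₂ : N₂ ⟶ N := pullSnd _ _ _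
  have hp : p₁ ≫ Γ.cs j = p₂ ≫ Γ.ct j := pull_comm _ _ _
  let N₃ := pull (p₂ ≫ Γ.cs j) (Γ.ct j) K.tgt_subm
  let q : N₃ ⟶ N₂ := pullFst _ _ _
  let c₀ : N₃ ⟶ N := pullSnd _ _ _
  have hq : q ≫ p₂ ≫ Γ.cs j = c₀ ≫ Γ.ct j := pull_comm _ _ _
  have hind : IsInducing fun y : N₃ => ((p₁ (q y), p₂ (q y)), c₀ y) :=
    ((isInducing_pullVal (Γ.cs j) (Γ.ct j) K.tgt_subm).prodMap IsInducing.id).comp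
      (isInducing_pullVal (p₂ ≫ Γ.cs j) (Γ.ct j) K.tgt_subm)
  have hex : Γ.cs j (K.e x) = Γ.ct j (K.e x) := (K.s_e x).trans (K.t_e x).symm
  let y₀ : N₃ := pullMk _ _ K.tgt_subm (pullMk _ _ K.tgt_subm (K.e x) (K.e x) hex) (K.e x) hex
  let Λ : Set N₃ := {y | (p₁ (q y), p₂ (q y)) ∈ K.D ∧ (p₂ (q y), c₀ y) ∈ K.D ∧
    (K.μ.val (p₁ (q y)) (p₂ (q y)), c₀ y) ∈ K.D ∧ (p₁ (q y), K.μ.val (p₂ (q y)) (c₀ y)) ∈ K.D}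
  let O : Opens N₃ := ⟨interior Λ, isOpen_interior⟩
  have hO : ∀ y ∈ O, y ∈ Λ := fun y hy => interior_subset hy
  have hDx := K.isOpen_D.mem_nhds (K.D_unit x)
  have k₁ : ContinuousAt (fun y : N₃ => p₁ (q y)) y₀ := (continuous (q ≫ p₁)).continuousAt
  have k₂ : ContinuousAt (fun y : N₃ => p₂ (q y)) y₀ := (continuous (q ≫ p₂)).continuousAt
  have k₃ : ContinuousAt (fun y : N₃ => c₀ y) y₀ := (continuous c₀).continuousAt
  have hpq : ∀ y, Γ.cs j (p₁ (q y)) = Γ.ct j (p₂ (q y)) := fun y => congr_hom hp (q y)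
  have hqc : ∀ y, Γ.cs j (p₂ (q y)) = Γ.ct j (c₀ y) := fun y => congr_hom hq y
  have k₄ := K.continuousAt_mul k₁ k₂ hpq (K.D_unit x)
  have k₅ := K.continuousAt_mul k₂ k₃ hqc (K.D_unit x)
  have hy₀ : y₀ ∈ O := by
    refine mem_interior_iff_mem_nhds.2 (inter_mem ((k₁.prodMk k₂).eventually hDx)
      (inter_mem ((k₂.prodMk k₃).eventually hDx) (inter_mem
        ((k₄.prodMk k₃).eventually (K.isOpen_D.mem_nhds ?_))
        ((k₁.prodMk k₅).eventually (K.isOpen_D.mem_nhds ?_)))))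
    · change (K.μ.val (K.e x) (K.e x), K.e x) ∈ K.D
      rw [K.val_e]; exact K.D_unit x
    · change (K.e x, K.μ.val (K.e x) (K.e x)) ∈ K.D
      rw [K.val_e]; exact K.D_unit x
  have main := K.eventually_assoc_family (a₀ := N₃.incl O ≫ q ≫ p₁) (b₀ := N₃.incl O ≫ q ≫ p₂)
    (c₀ := N₃.incl O ≫ c₀) (by simp only [assoc, hp]) (by simp only [assoc, hq])
    (fun s => (hO _ s.2).1) (fun s => (hO _ s.2).2.1) (fun s => (hO _ s.2).2.2.1)
    (fun s => (hO _ s.2).2.2.2) (s := opnMk y₀ hy₀) (x := x) rfl rfl rfl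
  have main' : ∀ᶠ y in 𝓝 y₀, K.μ.val (K.μ.val (p₁ (q y)) (p₂ (q y))) (c₀ y) =
      K.μ.val (p₁ (q y)) (K.μ.val (p₂ (q y)) (c₀ y)) := eventually_of_opn hy₀ main
  rw [hind.nhds_eq_comap, Filter.eventually_comap] at main'
  refine main'.mono ?_
  rintro ⟨⟨g, h⟩, k⟩ hP h1 h2
  exact hP (pullMk _ _ K.tgt_subm (pullMk _ _ K.tgt_subm g h h1) k h2) rfl

lemma eventually_inv_inv (x : M) : ∀ᶠ g in 𝓝 (K.e x), K.ι.val (K.ι.val g) = g := by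
  have t0 := K.tendsto_inv x
  have t1 := t0.comp t0
  have hE := K.isOpen_E.mem_nhds (K.E_unit x)
  filter_upwards [((t1.prodMk_nhds t0).prodMk_nhds tendsto_id).eventually
    (K.eventually_assoc x), hE, t0.eventually hE, K.eventually_inv_mul x,
    t0.eventually (K.eventually_inv_mul x), K.eventually_unit_mul x,
    t1.eventually (K.eventually_mul_unit x)] with g h1 h2 h3 h4 h5 h6 h7
  have s1 := K.s_inv h2
  have s2 := K.s_inv h3
  have h8 : K.μ.val (K.μ.val (K.ι.val (K.ι.val g)) (K.ι.val g)) g =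
      K.μ.val (K.ι.val (K.ι.val g)) (K.μ.val (K.ι.val g) g) := h1 s2.1 s1.1
  rw [h4, h5, s1.1, h6] at h8
  simp only [Function.comp] at h7
  rw [s2.1, s1.2] at h7
  rw [← h7, ← h8]

end OpGerm

section

namespace Stk

lemma IsFibredInGroupoids.exists_vlift (hΞ : IsFibredInGroupoids Ξ) {x y z : Ξ.obj} {S T : Mfd}
    {f : S ⟶ T} {φ : z ⟶ x} {ψ : y ⟶ x} (hφ : Ξ.Lifts f φ) (hψ : Ξ.Lifts f ψ) :
    ∃ χ : z ⟶ y, Ξ.Lifts (𝟙 S) χ ∧ χ ≫ ψ = φ :=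
  hΞ.exists_lift (𝟙 S) f φ ψ hφ hψ

end Stk

variable {M B N : Mfd} {Γ : WeinsteinGroupoid.{v, u} M} {w : B ⟶ M} {L : LocalLieGroupoid B N}
  {j : rep N ⥤ᵇ Γ.stk}

lemma PreWeinstein.MulArr.m_ptMap {D : Set (N × N)} (μ : Γ.MulArr j D)
    {ε : Γ.unit.obj (pt w) ⟶ uObj j} {hε : InD₂ D ε ε}
    (h : μ.m (z := Γ.unit₂.obj (pt w)) ε ε hε = Γ.unitIso.hom.app (pt w) ≫ ε) {S : Mfd} (b : S ⟶ B)
    (hb : InD₂ D (ptMap Γ.unit b (rfl : b ≫ w = b ≫ w) ≫ ε) (ptMap Γ.unit b rfl ≫ ε)) :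
    μ.m (z := Γ.unit₂.obj (pt (b ≫ w))) (ptMap Γ.unit b rfl ≫ ε) (ptMap Γ.unit b rfl ≫ ε) hb =
      Γ.unitIso.hom.app (pt (b ≫ w)) ≫ ptMap Γ.unit b rfl ≫ ε := by
  have h1 := μ.nat (Γ.unit₂.map (ptHom (a := b ≫ w) (b := w) b rfl)) ε ε hε hb
  refine h1.symm.trans ((Γ.mul.map _ ≫= h).trans ?_)
  exact Γ.unitIso.hom.naturality_assoc (ptHom (a := b ≫ w) (b := w) b rfl) ε

lemma PreWeinstein.InvArr.i_ptMap {D : Set N} (ι : Γ.InvArr j D)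
    {ε : Γ.unit.obj (pt w) ⟶ uObj j} {hε : InD D ε}
    (h : ι.i ε hε = Γ.invUnitIso.hom.app (pt w) ≫ ε) {S : Mfd} (b : S ⟶ B) :
    ι.i (ptMap Γ.unit b (rfl : b ≫ w = b ≫ w) ≫ ε) (hε.pre _) =
      Γ.invUnitIso.hom.app (pt (b ≫ w)) ≫ ptMap Γ.unit b rfl ≫ ε := by
  have h1 := ι.nat (Γ.unit.map (ptHom (a := b ≫ w) (b := w) b rfl)) ε hε
  refine h1.symm.trans ((Γ.inv.map _ ≫= h).trans ?_)
  exact Γ.invUnitIso.hom.naturality_assoc (ptHom (a := b ≫ w) (b := w) b rfl) ε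

lemma LocalLieGroupoid.exists_presents (hs : Γ.cs j = L.src ≫ w) (ht : Γ.ct j = L.tgt ≫ w)
    {ε : Γ.unit.obj (pt w) ⟶ uObj j} (hε : Γ.stk.Lifts L.unit ε)
    (μ : Γ.MulArr j {p | p.1 ∈ L.dom ∧ p.2 ∈ L.dom})
    (hμ : ∀ g ∈ L.dom, ∀ h ∈ L.dom, L.src g = L.tgt h → μ.val g h = L.mul g h)
    (μ_unit : ∀ h, μ.m (z := Γ.unit₂.obj (pt w)) ε ε h = Γ.unitIso.hom.app (pt w) ≫ ε)
    (ι : Γ.InvArr j Set.univ) (hι : ∀ g, ι.val g = L.inv g)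
    (ι_unit : ∀ h, ι.i ε h = Γ.invUnitIso.hom.app (pt w) ≫ ε) :
    ∃ c : Presents Γ w L j, ∀ {S : Mfd} (b : S ⟶ B),
      c.unit b ≫ ptMap Γ.unit b rfl ≫ ε = univ j (b ≫ L.unit) := by
  have hfib := Γ.fibred
  have src : SameMap (j ⋙ Γ.src) (uMap (L.src ≫ w)) := hs ▸ sameMap_mapOf _
  have tgt : SameMap (j ⋙ Γ.tgt) (uMap (L.tgt ≫ w)) := ht ▸ sameMap_mapOf _
  have hεb : ∀ {S : Mfd} (b : S ⟶ B), Γ.stk.Lifts (b ≫ L.unit)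
      (ptMap Γ.unit b (rfl : b ≫ w = b ≫ w) ≫ ε) := fun b => lift_comp (ptMap_lift Γ.unit _ _) hε
  have hU : ∀ {S : Mfd} (b : S ⟶ B), ∃ χ : j.obj (pt (b ≫ L.unit)) ⟶ Γ.unit.obj (pt (b ≫ w)),
      Γ.stk.Lifts (𝟙 S) χ ∧ χ ≫ ptMap Γ.unit b rfl ≫ ε = univ j (b ≫ L.unit) := fun b =>
    hfib.exists_vlift (univ_lift j _) (hεb b)
  choose unit unit_lift unit_fac using @hU
  have hD : ∀ {S : Mfd} {a b : S ⟶ N} (h : L.Composable a b),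
      InD₂ {p : N × N | p.1 ∈ L.dom ∧ p.2 ∈ L.dom} (univ j a) (univ j b) := fun h =>
    ⟨_, _, _, univ_lift j _, univ_lift j _, fun s => ⟨h.fst_mem s, h.snd_mem s⟩⟩
  have hm : ∀ {S : Mfd} {a b : S ⟶ N} (h : L.Composable a b), Γ.stk.Lifts h.mulMap
      (μ.m (z := Γ.ptPair src tgt a b (by simp only [← Category.assoc, h.eq])) (univ j a) (univ j b)
        (hD h)) := by
    intro S a b h
    obtain ⟨c₀, hc⟩ := μ.exists_base (z := Γ.ptPair src tgt a b (by simp only [← Category.assoc, h.eq]))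
      (hD h) (univ_lift j a)
    have hv := μ.val_eq hfib (z := Γ.ptPair src tgt a b (by simp only [← Category.assoc, h.eq]))
      (hD h) (univ_lift j a) (univ_lift j b) hc
    have e : c₀ = h.mulMap := by
      ext s
      exact (hv s).trans (hμ _ (h.fst_mem s) _ (h.snd_mem s) (congr_hom h.eq s))
    rw [← e]
    exact hc
  have hMul : ∀ {S : Mfd} {a b : S ⟶ N} (h : L.Composable a b),
      ∃ χ : Γ.mul.obj (Γ.ptPair src tgt a b (by simp only [← Category.assoc, h.eq])) ⟶
        j.obj (pt h.mulMap), Γ.stk.Lifts (𝟙 S) χ ∧ χ ≫ univ j h.mulMap =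
        μ.m (z := Γ.ptPair src tgt a b (by simp only [← Category.assoc, h.eq])) (univ j a) (univ j b)
        (hD h) := fun h => hfib.exists_vlift (hm h) (univ_lift j _)
  choose mul mul_lift mul_fac using @hMul
  have hE : ∀ {S : Mfd} (a : S ⟶ N), InD Set.univ (univ j a) := fun a =>
    ⟨_, _, univ_lift j _, fun s => trivial⟩
  have hi : ∀ {S : Mfd} (a : S ⟶ N), Γ.stk.Lifts (a ≫ L.inv) (ι.i (univ j a) (hE a)) := by
    intro S a
    obtain ⟨c₀, hc⟩ := ι.exists_base (hE a) (univ_lift j a)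
    have e : c₀ = a ≫ L.inv := by
      ext s
      exact (ι.val_eq hfib (hE a) (univ_lift j a) hc s).trans (hι _)
    rw [← e]
    exact hc
  have hInv : ∀ {S : Mfd} (a : S ⟶ N), ∃ χ : Γ.inv.obj (j.obj (pt a)) ⟶ j.obj (pt (a ≫ L.inv)),
      Γ.stk.Lifts (𝟙 S) χ ∧ χ ≫ univ j (a ≫ L.inv) = ι.i (univ j a) (hE a) := fun a =>
    hfib.exists_vlift (hi a) (univ_lift j _)
  choose inv inv_lift inv_fac using @hInv
  have dε : InD₂ {p : N × N | p.1 ∈ L.dom ∧ p.2 ∈ L.dom} ε ε :=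
    ⟨_, _, _, hε, hε, fun s => ⟨L.unit_mem s, L.unit_mem s⟩⟩
  have dε' : InD Set.univ ε := ⟨_, _, hε, fun s => trivial⟩
  refine ⟨{ src := src, tgt := tgt, unit := unit, unit_lift := unit_lift
            unit_nat := ?_
            mul := mul
            mul_lift := mul_lift
            mul_nat := ?_
            inv := inv
            inv_lift := inv_lift
            inv_nat := ?_
            mul_unit := ?_
            inv_unit := ?_ }, unit_fac⟩
  · intro S T f b
    refine hfib.hom_ext f (ptMap Γ.unit b (rfl : b ≫ w = b ≫ w) ≫ ε)
      (lift_comp_id (ptMap_lift j f _) (unit_lift b))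
      (lift_id_comp (unit_lift (f ≫ b)) (ptMap_lift Γ.unit f _)) ?_
    refine (Category.assoc _ _ _).trans ((ptMap j f _ ≫= (unit_fac b)).trans ?_)
    refine (ptMap_univ j f _).trans ?_
    refine Eq.trans ?_ (Category.assoc _ _ _).symm
    refine (unit_fac (f ≫ b)).symm.trans ((unit (f ≫ b)) ≫= ?_)
    exact (ptMap_comp_assoc Γ.unit f b _ rfl ε).symm
  · intro S T f a b h
    refine hfib.hom_ext f (univ j h.mulMap) (lift_comp_id (map_lift Γ.mul
      (fp_lift (ptMap_lift j f rfl))) (mul_lift h))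
      (lift_id_comp (mul_lift (h.precomp f)) (ptMap_lift j f _)) ?_
    refine (Category.assoc _ _ _).trans ((Γ.mul.map _ ≫= (mul_fac h)).trans ?_)
    refine (μ.nat _ _ _ _ (PreWeinstein.inD₂_pre _ (hD h))).trans ?_
    refine (μ.m_congr _ (ptMap_univ j f rfl) (ptMap_univ j f rfl)).trans ?_
    refine (mul_fac (h.precomp f)).symm.trans ?_
    refine Eq.trans ?_ (Category.assoc _ _ _).symm
    exact (mul (h.precomp f) ≫= (ptMap_univ j (a := (h.precomp f).mulMap) (b := h.mulMap) f rfl).symm)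
  · intro S T f a
    refine hfib.hom_ext f (univ j (a ≫ L.inv)) (lift_comp_id (map_lift Γ.inv (ptMap_lift j f rfl))
      (inv_lift a)) (lift_id_comp (inv_lift (f ≫ a)) (ptMap_lift j f _)) ?_
    refine (Category.assoc _ _ _).trans ((Γ.inv.map _ ≫= (inv_fac a)).trans ?_)
    refine (ι.nat _ _ _).trans ((ι.i_congr _ (ptMap_univ j f rfl)).trans ?_)
    refine (inv_fac (f ≫ a)).symm.trans ?_
    refine Eq.trans ?_ (Category.assoc _ _ _).symm
    exact ((inv (f ≫ a)) ≫= (ptMap_univ j f _).symm)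
  · intro S b
    have hp := ptMap_lift j (𝟙 S) (a := (L.composable_unit b).mulMap) (b := b ≫ L.unit)
      (by rw [L.mulMap_unit]; simp)
    have hk : Γ.pair.Lifts (𝟙 S) (fpHom (w := Γ.ptPair src tgt (b ≫ L.unit) (b ≫ L.unit)
      (by simp only [← Category.assoc, (L.composable_unit b).eq]))
      (w' := Γ.unit₂.obj (pt (b ≫ w))) (𝟙 S) (unit b) (unit b) (unit_lift b) (unit_lift b)) :=
      fp_lift (unit_lift b)
    refine hfib.hom_ext (𝟙 S) (ptMap Γ.unit b (rfl : b ≫ w = b ≫ w) ≫ ε)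
      (lift_id_comp (mul_lift _) (lift_id_comp hp (unit_lift b)))
      (lift_id_comp (map_lift Γ.mul hk) (app_lift Γ.unitIso.hom (b ≫ w))) ?_
    have e1 : (mul (L.composable_unit b) ≫ ptMap j (𝟙 S) (by rw [L.mulMap_unit]; simp) ≫ unit b) ≫
        ptMap Γ.unit b rfl ≫ ε = μ.m (z := Γ.ptPair src tgt (b ≫ L.unit) (b ≫ L.unit)
          (by simp only [← Category.assoc, (L.composable_unit b).eq])) (univ j _) (univ j _)
          (hD (L.composable_unit b)) := by
      simp only [Category.assoc]
      rw [unit_fac, ptMap_univ, mul_fac]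
    refine e1.trans ?_
    refine Eq.trans ?_ (Category.assoc _ _ _).symm
    have dεb := PreWeinstein.inD₂_pre (z := Γ.unit₂.obj (pt w)) (a := ε) (b := ε)
        (Γ.unit₂.map (ptHom (a := b ≫ w) (b := w) b rfl)) dε
    refine Eq.trans ?_ (Γ.mul.map _ ≫= (μ.m_ptMap (μ_unit dε) b dεb))
    refine Eq.trans ?_ (μ.nat _ _ _ dεb (PreWeinstein.inD₂_pre _ dεb)).symm
    exact μ.m_congr _ (unit_fac b).symm (unit_fac b).symm
  · intro S b
    have hp := ptMap_lift j (𝟙 S) (a := (b ≫ L.unit) ≫ L.inv) (b := b ≫ L.unit)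
      (by rw [L.unit_comp_inv]; simp)
    refine hfib.hom_ext (𝟙 S) (ptMap Γ.unit b (rfl : b ≫ w = b ≫ w) ≫ ε)
      (lift_id_comp (inv_lift _) (lift_id_comp hp (unit_lift b)))
      (lift_id_comp (map_lift Γ.inv (unit_lift b)) (app_lift Γ.invUnitIso.hom (b ≫ w))) ?_
    have e1 : (inv (b ≫ L.unit) ≫ ptMap j (𝟙 S) (by rw [L.unit_comp_inv]; simp) ≫ unit b) ≫
        ptMap Γ.unit b rfl ≫ ε = ι.i (univ j (b ≫ L.unit)) (hE _) := by
      simp only [Category.assoc]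
      rw [unit_fac, ptMap_univ, inv_fac]
    refine e1.trans ?_
    refine Eq.trans ?_ (Category.assoc _ _ _).symm
    refine Eq.trans ?_ (Γ.inv.map (unit b) ≫= (ι.i_ptMap (ι_unit dε') b))
    refine Eq.trans ?_ (ι.nat _ _ _).symm
    exact ι.i_congr _ (unit_fac b).symm

end

namespace Mfd

lemma mdifferentiableAt {S T : Mfd} (f : S ⟶ T) (x : S) : MDifferentiableAt S.I T.I f x :=
  (smooth f x).mdifferentiableAt (by simp)

lemma mfderiv_comp' {S T Z : Mfd} (f : S ⟶ T) (g : T ⟶ Z) (x : S) :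
    mfderiv S.I Z.I (f ≫ g) x = (mfderiv T.I Z.I g (f x)).comp (mfderiv S.I T.I f x) :=
  mfderiv_comp x (mdifferentiableAt g (f x)) (mdifferentiableAt f x)

lemma IsEt.mfderiv_bijective {S T : Mfd} {f : S ⟶ T} (hf : IsEt f) (x : S) :
    Function.Bijective (mfderiv S.I T.I f x) :=
  (hf.mfderivToContinuousLinearEquiv (by simp) x).bijective

lemma IsEt.comp_isSubm {S T Z : Mfd} {f : S ⟶ T} {g : T ⟶ Z} (hf : IsEt f) (hg : IsSubm g) :
    IsSubm (f ≫ g) := fun x => by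
  rw [mfderiv_comp']
  exact (hg (f x)).comp (hf.mfderiv_bijective x).2

lemma IsSubm.of_comp_isEt {S T Z : Mfd} {f : S ⟶ T} {g : T ⟶ Z} (hg : IsEt g)
    (hfg : IsSubm (f ≫ g)) : IsSubm f := fun x v => by
  have h := hfg x
  rw [mfderiv_comp'] at h
  obtain ⟨u, hu⟩ := h (mfderiv T.I Z.I g (f x) v)
  exact ⟨u, (hg.mfderiv_bijective (f x)).1 hu⟩

lemma IsEt.exists_retraction {S T : Mfd} {ψ : S ⟶ T} (hψ : IsEt ψ) (hi : Injective ψ)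
    (hS : Nonempty S) : ∃ ρ : T → S, (∀ x, ρ (ψ x) = x) ∧ ContMDiffOn T.I S.I ∞ ρ (range ψ) := by
  classical
  let V : Opens T := ⟨range ψ, hψ.isOpenMap.isOpen_range⟩
  obtain ⟨g, hg⟩ := hψ.exists_factor hi (T.incl V) fun s => s.2
  have hρ : ∀ y (hy : y ∈ V), ψ (g (opnMk y hy)) = y := fun y hy => congr_hom hg (opnMk y hy)
  refine ⟨fun y => if hy : y ∈ V then g (opnMk y hy) else hS.some, fun x => ?_, fun y hy => ?_⟩
  · have hx : ψ x ∈ V := ⟨x, rfl⟩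
    exact hi ((congrArg ψ (dif_pos hx)).trans (hρ _ hx))
  · refine ContMDiffAt.contMDiffWithinAt (contMDiffAt_of_opn (O := V) hy ?_)
    exact (smooth g _).congr_of_eventuallyEq (Eventually.of_forall fun z => dif_pos z.2)

end Mfd

namespace OpGerm

variable {M N : Mfd} {Γ : WeinsteinGroupoid.{v, u} M} {j : rep N ⥤ᵇ Γ.stk} (K : OpGerm Γ (𝟙 M) j)

lemma exists_law_nhds (x : M) {V : Set N} (hV : V ∈ 𝓝 (K.e x)) : ∃ Q : Set N, IsOpen Q ∧ K.e x ∈ Q ∧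
    (∀ g ∈ Q, K.μ.val (K.e (Γ.ct j g)) g = g ∧ K.μ.val g (K.e (Γ.cs j g)) = g ∧
      K.μ.val (K.ι.val g) g = K.e (Γ.cs j g) ∧ K.μ.val g (K.ι.val g) = K.e (Γ.ct j g) ∧ g ∈ V) ∧
    (∀ g ∈ Q, ∀ h ∈ Q, (g, h) ∈ K.D ∧ (Γ.cs j g = Γ.ct j h → K.μ.val g h ∈ V)) ∧
    ∀ g ∈ Q, ∀ h ∈ Q, ∀ k ∈ Q, Γ.cs j g = Γ.ct j h → Γ.cs j h = Γ.ct j k →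
      K.μ.val (K.μ.val g h) k = K.μ.val g (K.μ.val h k) := by
  have h1 := (K.eventually_unit_mul x).and ((K.eventually_mul_unit x).and
    ((K.eventually_inv_mul x).and ((K.eventually_mul_inv x).and hV)))
  have h2 : ∀ᶠ p : N × N in 𝓝 (K.e x, K.e x), p ∈ K.D ∧
      (Γ.cs j p.1 = Γ.ct j p.2 → K.μ.val p.1 p.2 ∈ V) :=
    Eventually.and (K.isOpen_D.mem_nhds (K.D_unit x))
      (eventually_nhdsWithin_iff.1 ((K.tendsto_mul x).eventually hV))
  have h3 := K.eventually_assoc x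
  rw [nhds_prod_eq, Filter.eventually_prod_self_iff'] at h2
  obtain ⟨t₂, ht₂, h2⟩ := h2
  rw [nhds_prod_eq, nhds_prod_eq, Filter.eventually_prod_iff] at h3
  obtain ⟨pa, hpa, pb, hpb, h3⟩ := h3
  rw [Filter.eventually_prod_self_iff'] at hpa
  obtain ⟨t₃, ht₃, hpa⟩ := hpa
  obtain ⟨Q, hQ, hQo, hxQ⟩ := mem_nhds_iff.1 (inter_mem h1 (inter_mem ht₂
    (inter_mem ht₃ hpb)))
  refine ⟨Q, hQo, hxQ, fun g hg => (hQ hg).1, fun g hg h hh => h2 g (hQ hg).2.1 h (hQ hh).2.1,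
    fun g hg h hh k hk => h3 (hpa g (hQ hg).2.2.1 h (hQ hh).2.2.1) (hQ hk).2.2.2⟩

end OpGerm

section

variable {M N N' : Mfd}

section

variable {Γ : WeinsteinGroupoid.{v, u} M} {j : rep N ⥤ᵇ Γ.stk} {j' : rep N' ⥤ᵇ Γ.stk} {ψ : N' ⟶ N}
  {κ : uObj j' ⟶ uObj j}

lemma WeinsteinGroupoid.cs_of_lift (hκ : Γ.stk.Lifts ψ κ) : Γ.cs j' = ψ ≫ Γ.cs j :=
  (atMap_univ Γ.src j' (obj_univ j')).symm.trans (atMap_chart Γ.src hκ (obj_univ j'))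

lemma WeinsteinGroupoid.ct_of_lift (hκ : Γ.stk.Lifts ψ κ) : Γ.ct j' = ψ ≫ Γ.ct j :=
  (atMap_univ Γ.tgt j' (obj_univ j')).symm.trans (atMap_chart Γ.tgt hκ (obj_univ j'))

lemma Mfd.IsEt.exists_arrow_factor (hψ : IsEt ψ) (hi : Injective ψ)
    (hκ : Γ.stk.Lifts ψ κ) {x : Γ.stk.obj} {S : Mfd} {a₀ : S ⟶ N} {a : x ⟶ uObj j}
    (ha : Γ.stk.Lifts a₀ a) (h : ∀ s, a₀ s ∈ range ψ) :
    ∃ (b₀ : S ⟶ N') (b : x ⟶ uObj j'), b₀ ≫ ψ = a₀ ∧ Γ.stk.Lifts b₀ b ∧ b ≫ κ = a := by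
  obtain ⟨b₀, hb⟩ := hψ.exists_factor hi a₀ h
  obtain ⟨b, hb', e⟩ := Γ.fibred.exists_lift b₀ ψ a κ (hb ▸ ha) hκ
  exact ⟨b₀, b, hb, hb', e⟩

lemma PreWeinstein.MulArr.exists_restrict {D : Set (N × N)}
    (μ : Γ.MulArr j D) (hψ : IsEt ψ) (hi : Injective ψ)
    (hκ : Γ.stk.Lifts ψ κ) {D' : Set (N' × N')}
    (H : ∀ p ∈ D', Γ.cs j (ψ p.1) = Γ.ct j (ψ p.2) →
      (ψ p.1, ψ p.2) ∈ D ∧ μ.val (ψ p.1) (ψ p.2) ∈ range ψ) :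
    ∃ μ' : Γ.MulArr j' D', (∀ {z : Γ.pair.obj} (a : z.fst ⟶ uObj j')
      (b : z.snd ⟶ uObj j') (h) (h'), μ'.m a b h ≫ κ = μ.m (z := z) (a ≫ κ) (b ≫ κ) h') ∧
      ∀ g h, (g, h) ∈ D' → Γ.cs j (ψ g) = Γ.ct j (ψ h) → ψ (μ'.val g h) = μ.val (ψ g) (ψ h) := by
  have hfib := Γ.fibred
  have key : ∀ {z : Γ.pair.obj} (a : z.fst ⟶ uObj j') (b : z.snd ⟶ uObj j'), InD₂ D' a b →
      ∃ c : Γ.mul.obj z ⟶ uObj j', ∃ h' : InD₂ D (a ≫ κ) (b ≫ κ), c ≫ κ = μ.m (a ≫ κ) (b ≫ κ) h' := by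
    rintro z a b ⟨S, a₀, b₀, ha, hb, hm⟩
    have ha' := lift_comp ha hκ
    have hb' := lift_comp hb hκ
    have hc : a₀ ≫ ψ ≫ Γ.cs j = b₀ ≫ ψ ≫ Γ.ct j := by
      simpa only [assoc] using PreWeinstein.pair_comp ha' hb'
    have hc' : ∀ s, Γ.cs j (ψ (a₀ s)) = Γ.ct j (ψ (b₀ s)) := fun s => congr_hom hc s
    have h' : InD₂ D (a ≫ κ) (b ≫ κ) := ⟨_, _, _, ha', hb', fun s => (H _ (hm s) (hc' s)).1⟩
    obtain ⟨c₀, hc₀⟩ := μ.exists_base h' ha'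
    have hv := μ.val_eq hfib h' ha' hb' hc₀
    obtain ⟨-, c, -, -, e⟩ := hψ.exists_arrow_factor hi hκ hc₀ fun s => by
      rw [hv s]
      exact (H _ (hm s) (hc' s)).2
    exact ⟨c, h', e⟩
  choose m hD hm using @key
  refine ⟨⟨fun {z} a b h => m a b h, fun {z z'} k a b h h' => ?_⟩, fun a b h h' => hm a b h, ?_⟩
  · refine hfib.cancel_inj hi hκ ?_
    rw [assoc, hm, hm, μ.nat k _ _ (hD a b h) (PreWeinstein.inD₂_pre k (hD a b h))]
    exact μ.m_congr _ (assoc _ _ _).symm (assoc _ _ _).symm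
  · intro g h hgh hc
    generalize hμ' : (⟨fun {z} a b h => m a b h, _⟩ : Γ.MulArr j' D') = μ'
    have hm' : ∀ {z : Γ.pair.obj} (a : z.fst ⟶ uObj j') (b : z.snd ⟶ uObj j') (h),
        μ'.m a b h ≫ κ = μ.m (z := z) (a ≫ κ) (b ≫ κ) (hD a b h) := by
      subst hμ'
      exact fun a b h => hm a b h
    have e : pnt g ≫ Γ.cs j' = pnt h ≫ Γ.ct j' := by
      rw [pnt_comp, pnt_comp, WeinsteinGroupoid.cs_of_lift hκ, WeinsteinGroupoid.ct_of_lift hκ]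
      exact congrArg pnt hc
    obtain ⟨z, a, b, ha, hb⟩ := OpGerm.exists_pair e
    have hab : InD₂ D' a b := ⟨_, _, _, ha, hb, fun _ => hgh⟩
    obtain ⟨c₀, hc₀⟩ := μ'.exists_base hab ha
    have h1 := μ'.val_eq hfib hab ha hb hc₀ pointElt
    have h2 := lift_comp hc₀ hκ
    rw [hm'] at h2
    have h3 := μ.val_eq hfib _ (lift_comp ha hκ) (lift_comp hb hκ) h2 pointElt
    exact (congrArg ψ h1).symm.trans h3

lemma PreWeinstein.InvArr.exists_restrict {D : Set N} (ι : Γ.InvArr j D)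
    (hψ : IsEt ψ) (hi : Injective ψ) (hκ : Γ.stk.Lifts ψ κ) {D' : Set N'}
    (H : ∀ g ∈ D', ψ g ∈ D ∧ ι.val (ψ g) ∈ range ψ) :
    ∃ ι' : Γ.InvArr j' D', (∀ {x : Γ.stk.obj} (a : x ⟶ uObj j')
      (h) (h'), ι'.i a h ≫ κ = ι.i (a ≫ κ) h') ∧ ∀ g ∈ D', ψ (ι'.val g) = ι.val (ψ g) := by
  have hfib := Γ.fibred
  have key : ∀ {x : Γ.stk.obj} (a : x ⟶ uObj j'), InD D' a →
      ∃ c : Γ.inv.obj x ⟶ uObj j', ∃ h' : InD D (a ≫ κ), c ≫ κ = ι.i (a ≫ κ) h' := by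
    rintro x a ⟨S, a₀, ha, hm⟩
    have ha' := lift_comp ha hκ
    have h' : InD D (a ≫ κ) := ⟨_, _, ha', fun s => (H _ (hm s)).1⟩
    obtain ⟨c₀, hc₀⟩ := ι.exists_base h' ha'
    have hv := ι.val_eq hfib h' ha' hc₀
    obtain ⟨-, c, -, -, e⟩ := hψ.exists_arrow_factor hi hκ hc₀ fun s => by
      rw [hv s]
      exact (H _ (hm s)).2
    exact ⟨c, h', e⟩
  choose i hD hm using @key
  refine ⟨⟨fun {x} a h => i a h, fun {x y} k a h => ?_⟩, fun a h h' => hm a h, ?_⟩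
  · refine hfib.cancel_inj hi hκ ?_
    rw [assoc, hm, hm, ι.nat k _ (hD a h)]
    exact ι.i_congr _ (assoc _ _ _).symm
  · intro g hg
    generalize hι' : (⟨fun {x} a h => i a h, _⟩ : Γ.InvArr j' D') = ι'
    have hm' : ∀ {x : Γ.stk.obj} (a : x ⟶ uObj j') (h), ι'.i a h ≫ κ = ι.i (a ≫ κ) (hD a h) := by
      subst hι'
      exact fun a h => hm a h
    have ha := univ_lift j' (pnt g)
    have hab : InD D' (univ j' (pnt g)) := ⟨_, _, ha, fun _ => hg⟩
    obtain ⟨c₀, hc₀⟩ := ι'.exists_base hab ha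
    have h1 := ι'.val_eq hfib hab ha hc₀ pointElt
    have h2 := lift_comp hc₀ hκ
    rw [hm'] at h2
    have h3 := ι.val_eq hfib _ (lift_comp ha hκ) h2 pointElt
    exact (congrArg ψ h1).symm.trans h3

end

end

section

variable {M N N' B : Mfd} {Γ : WeinsteinGroupoid.{v, u} M} {j : rep N ⥤ᵇ Γ.stk}
  {j' : rep N' ⥤ᵇ Γ.stk}

lemma OpGerm.exists_localLieGroupoid (K : OpGerm Γ (𝟙 M) j) [T2Space B] [ParacompactSpace B]
    {ψ : N' ⟶ N} (hψ : IsEt ψ) (hi : Injective ψ) {κ : uObj j' ⟶ uObj j}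
    (hκ : Γ.stk.Lifts ψ κ) {w : B ⟶ M} (hw : IsEt w) (hwi : Injective w)
    (hE : ∀ g, ψ g ∈ K.E) (hinv : ∀ g, K.ι.val (ψ g) ∈ range ψ)
    (hii : ∀ g, K.ι.val (K.ι.val (ψ g)) = ψ g) (hs : ∀ g, Γ.cs j (ψ g) ∈ range w)
    (ht : ∀ g, Γ.ct j (ψ g) ∈ range w) (he : ∀ b, K.e (w b) ∈ range ψ) {Ω : Set N}
    (hΩ : IsOpen Ω) (heΩ : ∀ b, K.e (w b) ∈ Ω) :
    ∃ (L : LocalLieGroupoid B N') (c : Presents Γ w L j'), (∀ g, w (L.src g) = Γ.cs j (ψ g)) ∧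
      (∀ g, w (L.tgt g) = Γ.ct j (ψ g)) ∧ (∀ b, ψ (L.unit b) = K.e (w b)) ∧
      (∀ g, ψ (L.inv g) = K.ι.val (ψ g)) ∧ (∀ g ∈ L.dom, ∀ h ∈ L.dom, L.src g = L.tgt h →
        ψ (L.mul g h) = K.μ.val (ψ g) (ψ h)) ∧ (∀ g ∈ L.dom, ψ g ∈ Ω) ∧
      ∀ {S : Mfd} (b : S ⟶ B), c.unit b ≫ K.εu (pt (b ≫ w)) = univ j' (b ≫ L.unit) ≫ κ := by
  have hfib := Γ.fibred
  obtain ⟨src, src_w⟩ := hw.exists_factor hwi (ψ ≫ Γ.cs j) hs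
  obtain ⟨tgt, tgt_w⟩ := hw.exists_factor hwi (ψ ≫ Γ.ct j) ht
  have hsrc : ∀ g, w (src g) = Γ.cs j (ψ g) := fun g => congr_hom src_w g
  have htgt : ∀ g, w (tgt g) = Γ.ct j (ψ g) := fun g => congr_hom tgt_w g
  obtain ⟨unit, ε, unit_ψ, hε, ε_κ⟩ := hψ.exists_arrow_factor hi hκ (K.εu_pt_lift w) he
  have hunit : ∀ b, ψ (unit b) = K.e (w b) := fun b => congr_hom unit_ψ b
  obtain ⟨ι, ι_κ, ι_val⟩ := K.ι.exists_restrict hψ hi hκ (D' := Set.univ) fun g _ => ⟨hE g, hinv g⟩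
  obtain ⟨inv₀, hinv₀, -⟩ := K.exists_inv (a₀ := ψ) hE
  obtain ⟨inv, inv_ψ⟩ := hψ.exists_factor hi inv₀ fun s => by rw [hinv₀]; exact hinv s
  have hinv' : ∀ g, ψ (inv g) = K.ι.val (ψ g) := fun g => (congr_hom inv_ψ g).trans (hinv₀ g)
  have src_unit : ∀ b, src (unit b) = b := fun b => hwi (by rw [hsrc, hunit, K.s_e]; rfl)
  have tgt_unit : ∀ b, tgt (unit b) = b := fun b => hwi (by rw [htgt, hunit, K.t_e]; rfl)
  have src_inv : ∀ g, src (inv g) = tgt g := fun g => hwi (by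
    rw [hsrc, hinv', (K.s_inv (hE g)).1, htgt])
  have tgt_inv : ∀ g, tgt (inv g) = src g := fun g => hwi (by
    rw [htgt, hinv', (K.s_inv (hE g)).2, hsrc])
  have inv_inv : ∀ g, inv (inv g) = g := fun g => hi (by rw [hinv', hinv', hii])
  have inv_unit : ∀ b, inv (unit b) = unit b := fun b => hi (by rw [hinv', hunit, K.inv_e])
  have hV : ∀ b, range ψ ∩ Ω ∈ 𝓝 (K.e (w b)) := fun b =>
    (hψ.isOpenMap.isOpen_range.inter hΩ).mem_nhds ⟨he b, heΩ b⟩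
  choose Q hQo hQe hQ₁ hQ₂ hQ₃ using fun b => K.exists_law_nhds (w b) (hV b)
  obtain ⟨D, hDo, hDe, hD⟩ := NearSection.exists_tube (continuous src) (continuous tgt)
    (continuous unit) src_unit tgt_unit (Q := fun b => ψ ⁻¹' Q b)
    (fun b => (hQo b).preimage (continuous ψ)) (fun b => by
      change ψ (unit b) ∈ Q b
      rw [hunit]
      exact hQe b)
  let dom : Opens N' := ⟨D ∩ inv ⁻¹' D, hDo.inter (hDo.preimage (continuous inv))⟩
  have dom_inv : ∀ g ∈ dom, inv g ∈ dom := fun g hg => ⟨hg.2, by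
    change inv (inv g) ∈ D
    rw [inv_inv]
    exact hg.1⟩
  have unit_mem : ∀ b, unit b ∈ dom := fun b => ⟨hDe b, by
    change inv (unit b) ∈ D
    rw [inv_unit]
    exact hDe b⟩
  have triple : ∀ g ∈ dom, ∀ h ∈ dom, ∀ k ∈ dom, src g = tgt h → src h = tgt k →
      ∃ b, ψ g ∈ Q b ∧ ψ h ∈ Q b ∧ ψ k ∈ Q b := fun g hg h hh k hk e e' =>
    hD g hg.1 h hh.1 k hk.1 e e'
  have comp' : ∀ {g h}, src g = tgt h → Γ.cs j (ψ g) = Γ.ct j (ψ h) := fun {g h} e => by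
    rw [← hsrc, ← htgt, e]
  have pair : ∀ g ∈ dom, ∀ h ∈ dom, src g = tgt h →
      (ψ g, ψ h) ∈ K.D ∧ K.μ.val (ψ g) (ψ h) ∈ range ψ := fun g hg h hh e => by
    obtain ⟨b, h1, h2, -⟩ := triple g hg h hh _ (dom_inv h hh) e (tgt_inv h).symm
    exact ⟨(hQ₂ b _ h1 _ h2).1, ((hQ₂ b _ h1 _ h2).2 (comp' e)).1⟩
  have single : ∀ g ∈ dom, ∃ b, ψ g ∈ Q b := fun g hg => by
    obtain ⟨b, h1, -⟩ := triple g hg _ (dom_inv g hg) g hg (tgt_inv g).symm (src_inv g)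
    exact ⟨b, h1⟩
  classical
  let mul : N' → N' → N' := fun g h => if H : K.μ.val (ψ g) (ψ h) ∈ range ψ then H.choose else g
  have hmul : ∀ g ∈ dom, ∀ h ∈ dom, src g = tgt h → ψ (mul g h) = K.μ.val (ψ g) (ψ h) :=
    fun g hg h hh e => by
      have H := (pair g hg h hh e).2
      have e1 : mul g h = H.choose := dif_pos H
      rw [e1]
      exact H.choose_spec
  have src_mul : ∀ g ∈ dom, ∀ h ∈ dom, src g = tgt h → src (mul g h) = src h ∧ tgt (mul g h) = tgt g :=
    fun g hg h hh e => by
      have h1 := K.s_val (pair g hg h hh e).1 (comp' e)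
      rw [← hmul g hg h hh e] at h1
      exact ⟨hwi (by rw [hsrc, h1.1, hsrc]), hwi (by rw [htgt, h1.2, htgt])⟩
  have src_subm : IsSubm src := IsSubm.of_comp_isEt hw (by rw [src_w]; exact hψ.comp_isSubm K.src_subm)
  have tgt_subm : IsSubm tgt := IsSubm.of_comp_isEt hw (by rw [tgt_w]; exact hψ.comp_isSubm K.tgt_subm)
  have mul_smooth : ContMDiffOn (N'.I.prod N'.I) N'.I ∞ (fun p : N' × N' => mul p.1 p.2)
      {p | p.1 ∈ dom ∧ p.2 ∈ dom ∧ src p.1 = tgt p.2} := by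
    intro p hp
    obtain ⟨ρ, hρ, hρs⟩ := hψ.exists_retraction hi ⟨p.1⟩
    have h1 : ContMDiff (N'.I.prod N'.I) (N.I.prod N.I) ∞ (fun p : N' × N' => (ψ p.1, ψ p.2)) :=
      ((smooth ψ).comp contMDiff_fst).prodMk ((smooth ψ).comp contMDiff_snd)
    have h2 := K.mul_smooth.comp (h1.contMDiffOn (s := {p | p.1 ∈ dom ∧ p.2 ∈ dom ∧ src p.1 = tgt p.2}))
      fun p hp => ⟨(pair _ hp.1 _ hp.2.1 hp.2.2).1, comp' hp.2.2⟩
    have h3 := hρs.comp h2 fun p hp => (pair _ hp.1 _ hp.2.1 hp.2.2).2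
    refine (h3 p hp).congr (fun q hq => ?_) ?_
    · exact ((congrArg ρ (hmul _ hq.1 _ hq.2.1 hq.2.2)).symm.trans (hρ _)).symm
    · exact ((congrArg ρ (hmul _ hp.1 _ hp.2.1 hp.2.2)).symm.trans (hρ _)).symm
  let L : LocalLieGroupoid B N' :=
    { src := src, tgt := tgt, unit := unit, inv := inv, dom := dom, mul := mul
      src_subm := src_subm, tgt_subm := tgt_subm, src_unit := src_unit, tgt_unit := tgt_unit
      unit_mem := unit_mem, src_inv := src_inv, tgt_inv := tgt_inv, inv_inv := inv_inv
      inv_unit := inv_unit, inv_mem := dom_inv, mul_smooth := mul_smooth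
      src_mul := fun g hg h hh e => (src_mul g hg h hh e).1
      tgt_mul := fun g hg h hh e => (src_mul g hg h hh e).2
      unit_mul := fun g hg => hi (by
        obtain ⟨b, hb⟩ := single g hg
        rw [hmul _ (unit_mem _) g hg (src_unit _), hunit, htgt]
        exact (hQ₁ b _ hb).1)
      mul_unit := fun g hg => hi (by
        obtain ⟨b, hb⟩ := single g hg
        rw [hmul g hg _ (unit_mem _) (tgt_unit _).symm, hunit, hsrc]
        exact (hQ₁ b _ hb).2.1)
      inv_mul := fun g hg => hi (by
        obtain ⟨b, hb⟩ := single g hg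
        rw [hmul _ (dom_inv g hg) g hg (src_inv g), hunit, hsrc, hinv']
        exact (hQ₁ b _ hb).2.2.1)
      mul_inv := fun g hg => hi (by
        obtain ⟨b, hb⟩ := single g hg
        rw [hmul g hg _ (dom_inv g hg) (tgt_inv g).symm, hunit, htgt, hinv']
        exact (hQ₁ b _ hb).2.2.2.1)
      assoc := fun g hg h hh k hk e e' hgh hhk => hi (by
        obtain ⟨b, h1, h2, h3⟩ := triple g hg h hh k hk e e'
        rw [hmul _ hgh k hk ((src_mul g hg h hh e).1.trans e'), hmul g hg h hh e,
          hmul g hg _ hhk (e.trans (src_mul h hh k hk e').2.symm), hmul h hh k hk e']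
        exact hQ₃ b _ h1 _ h2 _ h3 (comp' e) (comp' e')) }
  obtain ⟨μ, μ_κ, μ_val⟩ := K.μ.exists_restrict hψ hi hκ
    (D' := {p | p.1 ∈ L.dom ∧ p.2 ∈ L.dom}) fun p hp e =>
      pair _ hp.1 _ hp.2 (hwi (by rw [hsrc, htgt, e]))
  obtain ⟨c, hc⟩ := LocalLieGroupoid.exists_presents (L := L) (w := w)
    ((WeinsteinGroupoid.cs_of_lift hκ).trans src_w.symm)
    ((WeinsteinGroupoid.ct_of_lift hκ).trans tgt_w.symm) hε μ
    (fun g hg h hh e => hi ((μ_val g h ⟨hg, hh⟩ (comp' e)).trans (hmul g hg h hh e).symm))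
    (fun h => hfib.cancel_inj hi hκ (by
      have h' : InD₂ K.D (ε ≫ κ) (ε ≫ κ) := by rw [ε_κ]; exact K.inD₂_εu _
      refine (μ_κ (z := Γ.unit₂.obj (pt w)) ε ε h h').trans ?_
      refine (K.μ.m_congr (z := Γ.unit₂.obj (pt w)) h' ε_κ ε_κ).trans ?_
      refine (K.m_εu (pt w)).trans ?_
      exact (Γ.unitIso.hom.app (pt w) ≫= ε_κ).symm.trans (assoc _ _ _).symm))
    ι (fun g => hi ((ι_val g trivial).trans (hinv' g).symm))
    (fun h => hfib.cancel_inj hi hκ (by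
      have h' : InD K.E (ε ≫ κ) := by rw [ε_κ]; exact K.inD_εu _
      refine (ι_κ ε h h').trans ((K.ι.i_congr h' ε_κ).trans ((K.i_εu (pt w)).trans ?_))
      exact (Γ.invUnitIso.hom.app (pt w) ≫= ε_κ).symm.trans (assoc _ _ _).symm))
  refine ⟨L, c, hsrc, htgt, hunit, hinv', hmul, fun g hg => ?_, fun {S} b => ?_⟩
  · obtain ⟨b, hb⟩ := single g hg
    exact (hQ₁ b _ hb).2.2.2.2.2
  · refine Eq.trans ?_ ((hc b) =≫ κ)
    have h1 : ptMap Γ.unit b (rfl : b ≫ w = b ≫ w) ≫ K.εu (pt w) = K.εu (pt (b ≫ w)) := K.map_εu _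
    simp only [assoc]
    rw [ε_κ, h1]

end

section

lemma Mfd.IsEt.exists_transition {N N' Z : Mfd} [Nonempty N] [Nonempty N'] {ψ : N ⟶ Z}
    {ψ' : N' ⟶ Z} (hψ : IsEt ψ) (hi : Injective ψ) (hψ' : IsEt ψ')
    (hi' : Injective ψ') :
    ∃ φ : OpenPartialHomeomorph N N', φ.source = ψ ⁻¹' range ψ' ∧
      φ.target = ψ' ⁻¹' range ψ ∧ (∀ g ∈ φ.source, ψ' (φ g) = ψ g) ∧
      ContMDiffOn N.I N'.I ∞ φ φ.source ∧ ContMDiffOn N'.I N.I ∞ φ.symm φ.target := by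
  have smooth_of : ∀ {A A' : Mfd} {α : A ⟶ Z} {α' : A' ⟶ Z}, IsEt α' → Injective α' →
      ∀ (f : A → A') (O : Set A), IsOpen O → (∀ g ∈ O, α' (f g) = α g) → ContMDiffOn A.I A'.I ∞ f O := by
    intro A A' α α' hα' hi' f O hO h g hg
    let O' : Opens A := ⟨O, hO⟩
    obtain ⟨k, hk⟩ := hα'.exists_factor hi' (A.incl O' ≫ α) fun s => ⟨_, h _ s.2⟩
    refine ContMDiffAt.contMDiffWithinAt (contMDiffAt_of_opn (O := O') hg ?_)
    refine (smooth k _).congr_of_eventuallyEq (Eventually.of_forall fun z => hi' ?_)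
    exact (h _ z.2).trans (congr_hom hk z).symm
  have o := IsOpenEmbedding.of_continuous_injective_isOpenMap (continuous ψ) hi hψ.isOpenMap
  have o' := IsOpenEmbedding.of_continuous_injective_isOpenMap (continuous ψ') hi' hψ'.isOpenMap
  let φ : OpenPartialHomeomorph N N' := (o.toOpenPartialHomeomorph ψ).trans
    (o'.toOpenPartialHomeomorph ψ').symm
  have hs : φ.source = ψ ⁻¹' range ψ' := by ext g; simp [φ]
  have ht : φ.target = ψ' ⁻¹' range ψ := by ext g; simp [φ]
  have h1 : ∀ g ∈ φ.source, ψ' (φ g) = ψ g := fun g hg => by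
    rw [hs] at hg
    exact (o'.toOpenPartialHomeomorph ψ').right_inv (by simpa using hg)
  have h2 : ∀ g ∈ φ.target, ψ (φ.symm g) = ψ' g := fun g hg => by
    have h3 := h1 _ (φ.map_target hg)
    rw [φ.right_inv hg] at h3
    exact h3.symm
  exact ⟨φ, hs, ht, h1, smooth_of hψ' hi' φ _ φ.open_source h1,
    smooth_of hψ hi φ.symm _ φ.open_target h2⟩

variable {M N : Mfd} {Γ : WeinsteinGroupoid.{v, u} M} {j : rep N ⥤ᵇ Γ.stk}

/-- The local Lie groupoid `L` on `N'` is the restriction of the operations `K` on `N` along an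
injective étale map. -/
structure OpGerm.Restr (K : OpGerm Γ (𝟙 M) j) {N' B : Mfd} {j' : rep N' ⥤ᵇ Γ.stk} (ψ : N' ⟶ N)
    {w : B ⟶ M} {L : LocalLieGroupoid B N'} (c : Presents Γ w L j') : Prop where
  et : IsEt ψ
  inj : Injective ψ
  w_inj : Injective w
  src : ∀ g, w (L.src g) = Γ.cs j (ψ g)
  tgt : ∀ g, w (L.tgt g) = Γ.ct j (ψ g)
  unit : ∀ b, ψ (L.unit b) = K.e (w b)
  inv : ∀ g, ψ (L.inv g) = K.ι.val (ψ g)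
  mul : ∀ g ∈ L.dom, ∀ h ∈ L.dom, L.src g = L.tgt h → ψ (L.mul g h) = K.μ.val (ψ g) (ψ h)
  coh : ∃ κ : uObj j' ⟶ uObj j, Γ.stk.Lifts ψ κ ∧
    ∀ {S : Mfd} (b : S ⟶ B), c.unit b ≫ K.εu (pt (b ≫ w)) = univ j' (b ≫ L.unit) ≫ κ

variable {K : OpGerm Γ (𝟙 M) j} {A B A' B' : Mfd} {ja : rep A ⥤ᵇ Γ.stk} {ja' : rep A' ⥤ᵇ Γ.stk}
  {ψ : A ⟶ N} {ψ' : A' ⟶ N} {w : B ⟶ M} {w' : B' ⟶ M} {L : LocalLieGroupoid B A}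
  {L' : LocalLieGroupoid B' A'} {c : Presents Γ w L ja} {c' : Presents Γ w' L' ja'}

lemma OpGerm.Restr.exists_localIso [Nonempty A] [Nonempty A'] (h : K.Restr ψ c)
    (h' : K.Restr ψ' c') : ∃ φ : LocalIso c c', φ.map.source = ψ ⁻¹' range ψ' ∧
      ∀ g ∈ φ.map.source, ψ' (φ.map g) = ψ g := by
  have hfib := Γ.fibred
  obtain ⟨φ, hs, ht, hφ, sm, sm'⟩ := h.et.exists_transition h.inj h'.et h'.inj
  obtain ⟨κ, hκ, hc⟩ := h.coh
  obtain ⟨κ', hκ', hc'⟩ := h'.coh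
  have src : ∀ g ∈ φ.source, w' (L'.src (φ g)) = w (L.src g) := fun g hg => by
    rw [h'.src, hφ g hg, h.src]
  have tgt : ∀ g ∈ φ.source, w' (L'.tgt (φ g)) = w (L.tgt g) := fun g hg => by
    rw [h'.tgt, hφ g hg, h.tgt]
  have unit_mem : ∀ b b', w b = w' b' → L.unit b ∈ φ.source := fun b b' e => by
    rw [hs]
    exact ⟨L'.unit b', by rw [h'.unit, h.unit, e]⟩
  have inv_mem : ∀ g ∈ φ.source, L.inv g ∈ φ.source := fun g hg => by
    rw [hs]
    exact ⟨L'.inv (φ g), by rw [h'.inv, h.inv, hφ g hg]⟩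
  have key : ∀ g ∈ φ.source, ∀ k ∈ φ.source, g ∈ L.dom → k ∈ L.dom → φ g ∈ L'.dom → φ k ∈ L'.dom →
      L.src g = L.tgt k → ψ' (L'.mul (φ g) (φ k)) = ψ (L.mul g k) := fun g hg k hk dg dk dg' dk' e => by
    rw [h.mul g dg k dk e, h'.mul _ dg' _ dk' (h'.w_inj (by rw [src g hg, tgt k hk, e])), hφ g hg,
      hφ k hk]
  have base : ∀ {S : Mfd} (a : S ⟶ A) (ha : ∀ x, a x ∈ φ.source), compOn φ sm a ha ≫ ψ' = a ≫ ψ :=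
    fun a ha => by
      ext x
      exact hφ _ (ha x)
  have hb : ∀ {S : Mfd} (a : S ⟶ A) (ha : ∀ x, a x ∈ φ.source), Γ.stk.Lifts (a ≫ ψ)
      (univ ja' (compOn φ sm a ha) ≫ κ') := fun a ha => by
    rw [← base a ha]
    exact lift_comp (univ_lift ja' _) hκ'
  have hiso : ∀ {S : Mfd} (a : S ⟶ A) (ha : ∀ x, a x ∈ φ.source), ∃ χ : ja.obj (pt a) ⟶
      ja'.obj (pt (compOn φ sm a ha)), Γ.stk.Lifts (𝟙 S) χ ∧
      χ ≫ univ ja' (compOn φ sm a ha) ≫ κ' = univ ja a ≫ κ := fun a ha =>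
    hfib.exists_vlift (lift_comp (univ_lift ja a) hκ) (hb a ha)
  choose iso iso_lift iso_fac using @hiso
  refine ⟨{ map := φ, smooth := sm, smooth_symm := sm', src := src, tgt := tgt, unit_mem := unit_mem
            unit := fun b b' e => h'.inj (by rw [hφ _ (unit_mem b b' e), h.unit, h'.unit, e])
            inv_mem := inv_mem
            inv := fun g hg => h'.inj (by rw [hφ _ (inv_mem g hg), h.inv, h'.inv, hφ g hg])
            mul_mem := fun g hg k hk dg dk dg' dk' e => ?_
            mul := fun g hg k hk dg dk dg' dk' e hm => h'.inj (by
              rw [hφ _ hm, key g hg k hk dg dk dg' dk' e])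
            iso := iso
            iso_lift := iso_lift
            iso_nat := ?_
            iso_unit := ?_ }, hs, hφ⟩
  · have e1 := key g hg k hk dg dk dg' dk' e
    rw [hs, ht]
    exact ⟨fun _ => ⟨_, e1.symm⟩, fun _ => ⟨_, e1⟩⟩
  · intro S T f a ha
    refine hfib.hom_ext f (univ ja' (compOn φ sm a ha) ≫ κ')
      (lift_comp_id (ptMap_lift ja f _) (iso_lift a ha))
      (lift_id_comp (iso_lift (f ≫ a) _) (ptMap_lift ja' f _)) ?_
    rw [assoc, iso_fac, ← assoc, ptMap_univ, ← iso_fac (f ≫ a) (fun x => ha (f x)), assoc]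
    congr 1
    rw [← assoc]
    congr 1
    exact (ptMap_univ ja' f _).symm
  · intro S b b' hbb ha he
    have h1 : ptMap Γ.unit (𝟙 S) (by rw [hbb]; simp) ≫ K.εu (pt (b' ≫ w')) = K.εu (pt (b ≫ w)) :=
      K.map_εu _
    refine hfib.hom_ext (𝟙 S) (K.εu (pt (b' ≫ w')))
      (lift_id_comp (iso_lift _ ha) (lift_id_comp (ptMap_lift ja' (𝟙 S) _) (c'.unit_lift b')))
      (lift_id_comp (c.unit_lift b) (ptMap_lift Γ.unit (𝟙 S) _)) ?_
    simp only [assoc]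
    rw [hc' b', h1, hc b, ← iso_fac _ ha]
    congr 1
    rw [← assoc]
    congr 1
    exact ptMap_univ ja' (𝟙 S) _

lemma OpGerm.exists_isGluing (K : OpGerm Γ (𝟙 M) j) {X : Mfd} {q : rep X ⥤ᵇ Γ.stk} {ι : Type}
    {W : ι → Opens M} (cover : ∀ x, ∃ l, x ∈ W l) {U : ι → Opens X} (hne : ∀ l, Nonempty (X.opn (U l)))
    {Lx : ∀ l, LocalLieGroupoid (M.opn (W l)) (X.opn (U l))}
    {cx : ∀ l, Presents Γ (M.incl (W l)) (Lx l) (uMap (X.incl (U l)) ⋙ q)}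
    {ψx : ∀ l, X.opn (U l) ⟶ N} (hx : ∀ l, K.Restr (ψx l) (cx l))
    {L : LocalLieGroupoid M A} {c : Presents Γ (𝟙 M) L ja} (h : K.Restr ψ c)
    (hsub : ∀ l g, ψx l g ∈ range ψ) (hdom : ∀ l, ∀ g ∈ (Lx l).dom, ψx l g ∈ ψ '' L.dom)
    (hcov : ∀ n : A, ∃ l, ψ n ∈ range (ψx l)) :
    ∃ D : GluingSystem Γ q, Nonempty (IsGluing D c) := by
  choose φ hs hφ using fun k l => (hx k).exists_localIso (hx l)
  have mem : ∀ {k l g}, g ∈ (φ k l).map.source ↔ ψx k g ∈ range (ψx l) := fun {k l g} => by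
    rw [hs]; rfl
  have hA : ∀ l, ∃ m : LocalIso (cx l) c, m.map.source = ψx l ⁻¹' range ψ ∧
      ∀ g ∈ m.map.source, ψ (m.map g) = ψx l g := fun l => by
    obtain ⟨g⟩ := hne l
    obtain ⟨n, -⟩ := hsub l g
    have : Nonempty A := ⟨n⟩
    exact (hx l).exists_localIso h
  choose m hms hm using hA
  have hsrc : ∀ l, (m l).map.source = Set.univ := fun l => by
    rw [hms]
    exact Set.eq_univ_of_forall (hsub l)
  have hm' : ∀ l g, ψ ((m l).map g) = ψx l g := fun l g => hm l g (by rw [hsrc]; trivial)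
  refine ⟨{ ι := ι, W := W, cover := cover, U := U, grpd := Lx, chart := cx, trans := φ
            trans_self_source := fun l => ?_
            trans_self := fun l g => (hx l).inj (hφ l l g (mem.2 ⟨g, rfl⟩))
            trans_symm_mem := fun k l g hg => mem.2 ⟨g, (hφ k l g hg).symm⟩
            trans_symm := fun k l g hg => (hx k).inj ?_
            cocycle_mem := fun k l m g hg hg' => ?_
            cocycle := fun k l m g hg hg' => (hx m).inj ?_ },
          ⟨{ map := m, source := hsrc, dom := fun l g hg => ?_, cover := fun n => ?_
             glue := fun k l g g' => ?_ }⟩⟩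
  · rw [hs]
    exact Set.eq_univ_of_forall fun g => ⟨g, rfl⟩
  · rw [hφ l k _ (mem.2 ⟨g, (hφ k l g hg).symm⟩), hφ k l g hg]
  · rw [mem, ← hφ k l g hg]
    exact mem.1 hg'
  · have hg'' : g ∈ (φ k m).map.source := by
      rw [mem, ← hφ k l g hg]
      exact mem.1 hg'
    rw [hφ l m _ hg', hφ k l g hg, hφ k m g hg'']
  · obtain ⟨n, hn, e⟩ := hdom l g hg
    rw [← hm' l g] at e
    exact h.inj e ▸ hn
  · obtain ⟨l, g, e⟩ := hcov n
    exact ⟨l, g, h.inj ((hm' l g).trans e)⟩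
  · constructor
    · intro e
      have e1 : ψx k g = ψx l g' := by rw [← hm', ← hm', e]
      have hg : g ∈ (φ k l).map.source := mem.2 ⟨g', e1.symm⟩
      exact ⟨hg, (hx l).inj ((hφ k l g hg).trans e1)⟩
    · rintro ⟨hg, e⟩
      refine h.inj ?_
      rw [hm', hm', ← e, hφ k l g hg]

end

section

lemma Mfd.paracompactSpace (B : Mfd) [T2Space B] [SecondCountableTopology B] : ParacompactSpace B := by
  have : LocallyCompactSpace B := Manifold.locallyCompact_of_finiteDimensional B.I
  infer_instance

lemma Mfd.isEt_inclLE {S : Mfd} {U V : Opens S} (h : U ≤ V) : IsEt (S.inclLE h) := by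
  intro x
  have : Nonempty U := ⟨x⟩
  have o : IsOpenEmbedding (Set.inclusion h : U → V) := Opens.isOpenEmbedding_of_le h
  let φ := o.toOpenPartialHomeomorph
  refine ⟨{ toPartialEquiv := φ.toPartialEquiv, open_source := φ.open_source
            open_target := φ.open_target
            contMDiffOn_toFun := (smooth (S.inclLE h)).contMDiffOn
            contMDiffOn_invFun := ?_ }, Set.mem_univ _, fun _ _ => rfl⟩
  rintro _ ⟨z, -, rfl⟩
  refine ContMDiffAt.contMDiffWithinAt ?_
  refine (contMDiffAt_opens_iff (I := S.I) (I' := S.I) (A := V) (U := U)).2 ?_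
  refine ContMDiffAt.congr_of_eventuallyEq (I := S.I) (I' := S.I) (M := V) (smooth (S.incl V) (Set.inclusion h z)) ?_
  have h1 : range (Set.inclusion h) ∈ 𝓝 (Set.inclusion h z) := o.isOpen_range.mem_nhds ⟨z, rfl⟩
  filter_upwards [h1]
  rintro _ ⟨y, rfl⟩
  exact congrArg (fun u : U => (u : S)) (φ.left_inv (Set.mem_univ y))

lemma Mfd.IsEt.comp {S T Z : Mfd} {f : S ⟶ T} {g : T ⟶ Z} (hf : IsEt f) (hg : IsEt g) :
    IsEt (f ≫ g) := fun x => IsLocalDiffeomorphAt.comp (K := Z.I) (P := Z) (hf x) (hg (f x))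

lemma Stk.IsEtChart.restrict {Ξ : BasedCategory.{v₁, u₁} Mfd} (hΞ : IsFibredInGroupoids Ξ) {N : Mfd}
    {j : rep N ⥤ᵇ Ξ} (hj : IsEtChart j) (O : Opens N) : IsEtChart (uMap (N.incl O) ⋙ j) := by
  refine isEtChart_of_local hΞ hj fun n => ⟨O, 𝟙 _, ptMap j (a := N.incl O) (b := 𝟙 _ ≫ N.incl O) (𝟙 _)
    (by simp), fun x => ?_, fun x y h => h, ⟨n, rfl⟩, ptMap_lift j _ _⟩
  exact (Diffeomorph.refl (N.opn O).I (N.opn O) ∞).isLocalDiffeomorph x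

variable {M : Mfd} {Γ : WeinsteinGroupoid.{v, u} M}

lemma isSubm_mapOf_of_local {N X : Mfd} [T2Space M] {q : rep X ⥤ᵇ Γ.stk} (hq : IsAtlas q)
    {j : rep N ⥤ᵇ Γ.stk} {G : Γ.stk ⥤ᵇ rep M} (hG : IsSubmersion G)
    (h : ∀ n : N, ∃ (U : Opens X) (ψ : X.opn U ⟶ N) (κ : q.obj (pt (X.incl U)) ⟶ uObj j),
      IsEt ψ ∧ Injective ψ ∧ n ∈ range ψ ∧ Γ.stk.Lifts ψ κ) :
    IsSubm (mapOf (j ⋙ G)) := by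
  intro n
  obtain ⟨U, ψ, κ, -, -, ⟨x, rfl⟩, hκ⟩ := h n
  have h1 : X.incl U ≫ mapOf (q ⋙ G) = ψ ≫ mapOf (j ⋙ G) := by
    have h2 := mapOf_arrow G hκ
    rwa [id_comp] at h2
  have h3 : IsSubm (ψ ≫ mapOf (j ⋙ G)) := by
    rw [← h1]
    exact (isEt_incl U).comp_isSubm (isSubm_mapOf hG hq)
  have h4 := h3 x
  rw [mfderiv_comp'] at h4
  exact Function.Surjective.of_comp h4

lemma exists_opGerm [T2Space M] [SecondCountableTopology M] {X : Mfd} {q : rep X ⥤ᵇ Γ.stk}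
    (hq : IsEtaleAtlas q) : ∃ (N : Mfd) (j : rep N ⥤ᵇ Γ.stk) (_ : OpGerm Γ (𝟙 M) j), T2Space N ∧
      ∀ n : N, ∃ (U : Opens X) (ψ : X.opn U ⟶ N) (κ : q.obj (pt (X.incl U)) ⟶ uObj j),
      IsEt ψ ∧ Injective ψ ∧ n ∈ range ψ ∧ Γ.stk.Lifts ψ κ := by
  have := M.paracompactSpace
  have := hq.t2
  have sec : mapOf (Γ.unit ⋙ Γ.src) = 𝟙 M := Γ.src_unit (pt (𝟙 M))
  obtain ⟨N, j, t2, hj, ⟨ε⟩, hloc⟩ := exists_chart_of_section Γ.etale.stack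
    (hq.etale.isEtChart Γ.fibred hq) hq.epi sec
  have hs : IsSubm (Γ.cs j) := isSubm_mapOf_of_local hq.toIsAtlas Γ.src_subm hloc
  have ht : IsSubm (Γ.ct j) := isSubm_mapOf_of_local hq.toIsAtlas Γ.tgt_subm hloc
  have hε := bm_lift (obj_univ Γ.unit) (obj_univ j) ε
  obtain ⟨D, μ, hD, hDe, hμ⟩ := Γ.exists_mulArr hj ht hε
  obtain ⟨E, ι, hE, hEe, hι⟩ := Γ.exists_invArr hj hε
  exact ⟨N, j, ⟨hj, hs, ht, _, ε, hε, D, hD, hDe, μ, hμ, E, hE, hEe, ι, hι⟩, t2, hloc⟩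

namespace OpGerm

variable {N : Mfd} {j : rep N ⥤ᵇ Γ.stk} (K : OpGerm Γ (𝟙 M) j)

lemma exists_symmetric : ∃ V : Set N, IsOpen V ∧ (∀ x, K.e x ∈ V) ∧ V ⊆ K.E ∧
    (∀ g ∈ V, K.ι.val g ∈ V) ∧ ∀ g ∈ V, K.ι.val (K.ι.val g) = g := by
  let P : Set N := {g | g ∈ K.E ∧ K.ι.val g ∈ K.E ∧ K.ι.val (K.ι.val g) = g}
  have hPe : ∀ x, K.e x ∈ interior P := fun x => mem_interior_iff_mem_nhds.2 <| by
    have h1 := K.isOpen_E.mem_nhds (K.E_unit x)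
    exact inter_mem h1 (inter_mem ((K.tendsto_inv x).eventually h1)
      (K.eventually_inv_inv x))
  have hc : ContinuousOn K.ι.val (interior P) := K.inv_smooth.continuousOn.mono fun g hg =>
    (interior_subset hg : g ∈ P).1
  refine ⟨interior P ∩ K.ι.val ⁻¹' interior P, hc.isOpen_inter_preimage isOpen_interior
    isOpen_interior, fun x => ⟨hPe x, ?_⟩, fun g hg => (interior_subset hg.1 : g ∈ P).1,
    fun g hg => ⟨hg.2, ?_⟩, fun g hg => (interior_subset hg.1 : g ∈ P).2.2⟩
  · change K.ι.val (K.e x) ∈ interior P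
    rw [K.inv_e]
    exact hPe x
  · change K.ι.val (K.ι.val g) ∈ interior P
    rw [(interior_subset hg.1 : g ∈ P).2.2]
    exact hg.1

lemma exists_symmetric_small {V : Set N} (hV : IsOpen V) (hVe : ∀ x, K.e x ∈ V) (hVE : V ⊆ K.E)
    (hVi : ∀ g ∈ V, K.ι.val g ∈ V) (hVii : ∀ g ∈ V, K.ι.val (K.ι.val g) = g) {R : Set N}
    (hR : IsOpen R) : ∃ (W : Opens M) (O : Opens N), (∀ x, K.e x ∈ R ↔ x ∈ W) ∧ (O : Set N) ⊆ V ∩ R ∧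
      (∀ g ∈ O, K.ι.val g ∈ O) ∧ (∀ g ∈ O, Γ.cs j g ∈ W ∧ Γ.ct j g ∈ W) ∧ ∀ x ∈ W, K.e x ∈ O := by
  let W : Opens M := ⟨K.e ⁻¹' R, hR.preimage (continuous K.e)⟩
  have hc : ContinuousOn K.ι.val V := K.inv_smooth.continuousOn.mono hVE
  let O : Opens N := ⟨(V ∩ K.ι.val ⁻¹' R) ∩ (R ∩ (Γ.cs j ⁻¹' W ∩ Γ.ct j ⁻¹' W)),
    (hc.isOpen_inter_preimage hV hR).inter (hR.inter ((W.isOpen.preimage (continuous _)).inter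
      (W.isOpen.preimage (continuous _))))⟩
  refine ⟨W, O, fun x => Iff.rfl, fun g hg => ⟨hg.1.1, hg.2.1⟩, fun g hg => ?_,
    fun g hg => ⟨hg.2.2.1, hg.2.2.2⟩, fun x hx => ?_⟩
  · have h1 := K.s_inv (hVE hg.1.1)
    refine ⟨⟨hVi g hg.1.1, ?_⟩, hg.1.2, ?_, ?_⟩
    · change K.ι.val (K.ι.val g) ∈ R
      rw [hVii g hg.1.1]
      exact hg.2.1
    · change Γ.cs j (K.ι.val g) ∈ W
      rw [h1.1]
      exact hg.2.2.2
    · change Γ.ct j (K.ι.val g) ∈ W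
      rw [h1.2]
      exact hg.2.2.1
  · refine ⟨⟨hVe x, ?_⟩, hx, ?_, ?_⟩
    · change K.ι.val (K.e x) ∈ R
      rw [K.inv_e]
      exact hx
    · change Γ.cs j (K.e x) ∈ W
      rw [K.s_e]
      exact hx
    · change Γ.ct j (K.e x) ∈ W
      rw [K.t_e]
      exact hx

end OpGerm

lemma Mfd.secondCountable_opn {N : Mfd} {ι : Type} [Countable ι] (O : ι → Opens N) (x : ι → N)
    (h : ∀ l, (O l : Set N) ⊆ (chartAt (𝔼 N.dim) (x l)).source) :
    SecondCountableTopology (N.opn (⨆ l, O l)) := by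
  have hU : ∀ l, SecondCountableTopology {n : N.opn (⨆ l, O l) | N.incl _ n ∈ O l} := fun l => by
    have := (chartAt (𝔼 N.dim) (x l)).secondCountableTopology_source
    let f : {n : N.opn (⨆ l, O l) | N.incl _ n ∈ O l} →
        (chartAt (𝔼 N.dim) (x l)).source := fun n => ⟨N.incl _ n.1, h l n.2⟩
    have hf : IsInducing f := by
      rw [← IsInducing.subtypeVal.of_comp_iff]
      have h1 : IsInducing (N.incl (⨆ l, O l)) := IsInducing.subtypeVal
      exact h1.comp IsInducing.subtypeVal
    exact hf.secondCountableTopology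
  refine secondCountableTopology_of_countable_cover (U := fun l => {n : N.opn (⨆ l, O l) |
    N.incl _ n ∈ O l}) (fun l => (O l).isOpen.preimage (continuous (N.incl _))) ?_
  refine Set.eq_univ_of_forall fun n => ?_
  obtain ⟨l, hl⟩ := Opens.mem_iSup.1 n.2
  exact Set.mem_iUnion.2 ⟨l, hl⟩

lemma WeinsteinGroupoid.exists_gluing [T2Space M] [SecondCountableTopology M] {X : Mfd}
    {q : rep X ⥤ᵇ Γ.stk} (hq : IsEtaleAtlas q) :
    ∃ (D : GluingSystem Γ q) (N : Mfd) (L : LocalLieGroupoid M N) (j : rep N ⥤ᵇ Γ.stk)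
      (c : Presents Γ (𝟙 M) L j),
      T2Space N ∧ SecondCountableTopology N ∧ IsEtale j ∧ Nonempty (IsGluing D c) := by
  have := M.paracompactSpace
  obtain ⟨N₁, j₁, K, t2, hloc⟩ := exists_opGerm (Γ := Γ) hq
  obtain ⟨V, hV, hVe, hVE, hVi, hVii⟩ := K.exists_symmetric
  choose U ψ κ hψ hψi hmem hκ using fun x => hloc (K.e x)
  choose W O hW hOV hOi hOW hWO using fun x => K.exists_symmetric_small hV hVe hVE hVi hVii
    (R := range (ψ x) ∩ (chartAt (𝔼 N₁.dim) (K.e x)).source)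
    ((hψ x).isOpenMap.isOpen_range.inter (chartAt _ _).open_source)
  have hxW : ∀ x, x ∈ W x := fun x => (hW x x).1 ⟨hmem x, mem_chart_source _ _⟩
  obtain ⟨s, hsc, hs⟩ := TopologicalSpace.countable_cover_nhds fun x => (W x).isOpen.mem_nhds (hxW x)
  have : Countable s := hsc.to_subtype
  have cover : ∀ y, ∃ l : s, y ∈ W l := fun y => by
    have hy : y ∈ ⋃ x ∈ s, (W x : Set M) := by rw [hs]; trivial
    obtain ⟨x, hx, hy⟩ := Set.mem_iUnion₂.1 hy
    exact ⟨⟨x, hx⟩, hy⟩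
  let OO : Opens N₁ := ⨆ l : s, O l
  have memOO : ∀ {g}, g ∈ OO ↔ ∃ l : s, g ∈ O l := Opens.mem_iSup
  have sc : SecondCountableTopology (N₁.opn OO) := secondCountable_opn (fun l : s => O l)
    (fun l => K.e l) fun l g hg => (hOV l hg).2.2
  have t2' : T2Space (N₁.opn OO) := inferInstanceAs (T2Space OO)
  have rngOO : ∀ {g}, g ∈ range (N₁.incl OO) ↔ g ∈ OO := fun {g} =>
    ⟨by rintro ⟨n, rfl⟩; exact n.2, fun h => ⟨opnMk g h, rfl⟩⟩
  have eOO : ∀ y, K.e y ∈ OO := fun y => by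
    obtain ⟨l, hl⟩ := cover y
    exact memOO.2 ⟨l, hWO l y hl⟩
  have hOOV : ∀ g ∈ OO, g ∈ V := fun g hg => by
    obtain ⟨l, hl⟩ := memOO.1 hg
    exact (hOV l hl).1
  have idEt : IsEt (𝟙 M) := fun x => (Diffeomorph.refl M.I M ∞).isLocalDiffeomorph x
  obtain ⟨L, c, Lsrc, Ltgt, Lunit, Linv, Lmul, -, Lcoh⟩ :=
    K.exists_localLieGroupoid (j' := uMap (N₁.incl OO) ⋙ j₁) (isEt_incl OO) (incl_injective OO)
    (κ := ptMap j₁ (N₁.incl OO) (by rfl)) (ptMap_lift j₁ _ _) (w := 𝟙 M) idEt (fun _ _ h => h)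
    (fun g => hVE (hOOV _ g.2)) (fun g => rngOO.2 (by
      obtain ⟨l, hl⟩ := memOO.1 g.2
      exact memOO.2 ⟨l, hOi l _ hl⟩)) (fun g => hVii _ (hOOV _ g.2)) (fun g => ⟨_, rfl⟩)
    (fun g => ⟨_, rfl⟩) (fun y => rngOO.2 (eOO y)) isOpen_univ (fun _ => trivial)
  have LR : K.Restr (N₁.incl OO) c := ⟨isEt_incl OO, incl_injective OO, fun _ _ h => h, Lsrc, Ltgt,
    Lunit, Linv, Lmul, _, ptMap_lift j₁ _ _, Lcoh⟩
  have hΩ : IsOpen (N₁.incl OO '' L.dom) := (isEt_incl OO).isOpenMap _ L.dom.isOpen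
  have hL : ∀ x, ∃ (Y : Opens X) (ψ' : X.opn Y ⟶ N₁) (Lx : LocalLieGroupoid (M.opn (W x)) (X.opn Y))
      (cx : Presents Γ (M.incl (W x)) Lx (uMap (X.incl Y) ⋙ q)), K.Restr ψ' cx ∧
      range ψ' = O x ∧ ∀ g ∈ Lx.dom, ψ' g ∈ N₁.incl OO '' L.dom := fun x => by
    have : T2Space (M.opn (W x)) := inferInstanceAs (T2Space (W x))
    have : SecondCountableTopology (M.opn (W x)) := inferInstanceAs (SecondCountableTopology (W x))
    have := (M.opn (W x)).paracompactSpace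
    let Y : Opens X := ⟨X.incl (U x) '' (ψ x ⁻¹' O x),
      (isEt_incl (U x)).isOpenMap _ ((O x).isOpen.preimage (continuous _))⟩
    have hY : Y ≤ U x := by
      rintro _ ⟨y, -, rfl⟩
      exact y.2
    have hYO : ∀ y : X.opn Y, ψ x (X.inclLE hY y) ∈ O x := by
      rintro ⟨_, ⟨y, hy, rfl⟩⟩
      exact hy
    have et : IsEt (X.inclLE hY ≫ ψ x) := by
      intro y
      exact (isEt_inclLE hY).comp (hψ x) y
    have inj : Injective (X.inclLE hY ≫ ψ x) := fun a b h => by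
      have h1 := hψi x h
      exact incl_injective Y (congrArg (X.incl (U x)) h1)
    have rng : range (X.inclLE hY ≫ ψ x) = O x := by
      ext g
      constructor
      · rintro ⟨y, rfl⟩
        exact hYO y
      · intro hg
        obtain ⟨y, rfl⟩ := (hOV x hg).2.1
        exact ⟨opnMk (S := X) (X.incl (U x) y) ⟨y, hg, rfl⟩, rfl⟩
    have rW : ∀ {y}, y ∈ range (M.incl (W x)) ↔ y ∈ W x := fun {g} =>
      ⟨by rintro ⟨n, rfl⟩; exact n.2, fun h => ⟨opnMk g h, rfl⟩⟩
    have lκ : Γ.stk.Lifts (X.inclLE hY ≫ ψ x)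
        (ptMap q (a := 𝟙 _ ≫ X.incl Y) (b := X.incl (U x)) (X.inclLE hY) (by rfl) ≫ κ x) :=
      lift_comp (ptMap_lift q _ _) (hκ x)
    obtain ⟨Lx, cx, h1, h2, h3, h4, h5, h6, h7⟩ :=
      K.exists_localLieGroupoid (j' := uMap (X.incl Y) ⋙ q) et inj lκ (w := M.incl (W x))
      (isEt_incl _) (incl_injective _) (fun g => hVE (hOV x (hYO g)).1) (fun g => by
        rw [rng]; exact hOi x _ (hYO g)) (fun g => hVii _ (hOV x (hYO g)).1)
      (fun g => rW.2 (hOW x _ (hYO g)).1) (fun g => rW.2 (hOW x _ (hYO g)).2)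
      (fun b => by rw [rng]; exact hWO x _ b.2) hΩ (fun b => ⟨L.unit (M.incl (W x) b), L.unit_mem _,
        Lunit _⟩)
    exact ⟨Y, _, Lx, cx, ⟨et, inj, incl_injective _, h1, h2, h3, h4, h5, _, lκ, h7⟩, rng, h6⟩
  choose Y ψ' Lx cx hR hrng hdom using hL
  obtain ⟨D, hD⟩ := K.exists_isGluing (ι := s) (W := fun l => W l) cover (U := fun l => Y l)
    (fun l => ⟨(Lx l).unit (opnMk _ (hxW l))⟩) (Lx := fun l => Lx l) (cx := fun l => cx l)
    (ψx := fun l => ψ' l) (fun l => hR l) LR (fun l g => rngOO.2 (memOO.2 ⟨l, by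
      have h1 : ψ' l g ∈ range (ψ' l) := ⟨g, rfl⟩
      rwa [hrng] at h1⟩)) (fun l g hg => hdom l g hg) (fun n => by
      obtain ⟨l, hl⟩ := memOO.1 n.2
      refine ⟨l, ?_⟩
      rw [hrng]
      exact hl)
  exact ⟨D, _, L, _, c, t2', sc, (K.chart.restrict Γ.fibred OO).isEtale Γ.etale.stack, hD⟩

end

namespace Presents

variable {M B N : Mfd} {Γ : WeinsteinGroupoid.{v, u} M} {w : B ⟶ M} {L : LocalLieGroupoid B N}
  {j : rep N ⥤ᵇ Γ.stk} (c : Presents Γ w L j)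

lemma cs_eq (c : Presents Γ w L j) : Γ.cs j = L.src ≫ w := sameMap_iff.1 c.src

lemma ct_eq (c : Presents Γ w L j) : Γ.ct j = L.tgt ≫ w := sameMap_iff.1 c.tgt

lemma exists_eps : ∃ ε : Γ.unit.obj (pt w) ⟶ uObj j, Γ.stk.Lifts L.unit ε ∧
    ∀ {S : Mfd} (b : S ⟶ B), c.unit b ≫ ptMap Γ.unit b rfl ≫ ε = univ j (b ≫ L.unit) := by
  obtain ⟨ψ, hψ, e, -⟩ := Γ.fibred.lift_inv (c.unit_lift (𝟙 B))
  refine ⟨ptMap Γ.unit (a := w) (b := 𝟙 B ≫ w) (𝟙 B) (by simp) ≫ ψ ≫ univ j (𝟙 B ≫ L.unit),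
    lift_id_comp (ptMap_lift _ _ _) (lift_id_comp hψ (univ_lift j _)), fun {S} b => ?_⟩
  have h : ptMap j (a := b ≫ L.unit) (b := 𝟙 B ≫ L.unit) b rfl ≫ c.unit (𝟙 B) =
      c.unit b ≫ ptMap Γ.unit (a := b ≫ w) (b := 𝟙 B ≫ w) b rfl := c.unit_nat b (𝟙 B)
  have h2 : (c.unit (𝟙 B)) ≫ ψ ≫ univ j (𝟙 B ≫ L.unit) = univ j (𝟙 B ≫ L.unit) :=
    (assoc _ _ _).symm.trans ((e =≫ (univ j (𝟙 B ≫ L.unit))).trans (id_comp _))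
  have h3 : ptMap Γ.unit (a := b ≫ w) (b := w) b rfl ≫ ptMap Γ.unit (a := w) (b := 𝟙 B ≫ w) (𝟙 B)
      (by simp) = ptMap Γ.unit (a := b ≫ w) (b := 𝟙 B ≫ w) b rfl := ptMap_comp Γ.unit _ _ _ _
  refine (c.unit b ≫= ((assoc _ _ _).symm.trans (congrArg
    (· ≫ ψ ≫ univ j (𝟙 B ≫ L.unit)) h3))).trans ?_
  refine (assoc _ _ _).symm.trans ((h.symm =≫ (ψ ≫ univ j (𝟙 B ≫ L.unit))).trans
    ((assoc _ _ _).trans ?_))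
  exact ((ptMap j (a := b ≫ L.unit) (b := 𝟙 B ≫ L.unit) b rfl) ≫= h2).trans
    (ptMap_univ j (a := b ≫ L.unit) (b := 𝟙 B ≫ L.unit) b rfl)

/-- The identities as an arrow into the chart. -/
def eps : Γ.unit.obj (pt w) ⟶ uObj j := c.exists_eps.choose

lemma eps_lift : Γ.stk.Lifts L.unit c.eps := c.exists_eps.choose_spec.1

lemma unit_eps {S : Mfd} (b : S ⟶ B) :
    c.unit b ≫ ptMap Γ.unit b rfl ≫ c.eps = univ j (b ≫ L.unit) := c.exists_eps.choose_spec.2 b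

lemma exists_mulArr (hw : Injective w) : ∃ μ : Γ.MulArr j {p | p.1 ∈ L.dom ∧ p.2 ∈ L.dom},
      (∀ g ∈ L.dom, ∀ h ∈ L.dom, L.src g = L.tgt h → μ.val g h = L.mul g h) ∧
      ∀ h, μ.m (z := Γ.unit₂.obj (pt w)) c.eps c.eps h = Γ.unitIso.hom.app (pt w) ≫ c.eps := by
  have hfib := Γ.fibred
  have hpr : ∀ {S : Mfd} {a b : S ⟶ N} (h : L.Composable a b), a ≫ L.src ≫ w = b ≫ L.tgt ≫ w :=
    fun h => by simp only [← assoc, h.eq]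
  have ex : ∀ {z : Γ.pair.obj} (a : z.fst ⟶ uObj j) (b : z.snd ⟶ uObj j),
      InD₂ {p : N × N | p.1 ∈ L.dom ∧ p.2 ∈ L.dom} a b → ∃ (S : Mfd) (a₀ b₀ : S ⟶ N)
      (h : L.Composable a₀ b₀) (k : z ⟶ Γ.ptPair c.src c.tgt a₀ b₀ (hpr h)),
      Γ.pair.Lifts (𝟙 S) k ∧ FPHom.fst k ≫ univ j a₀ = a ∧ FPHom.snd k ≫ univ j b₀ = b := by
    rintro z a b ⟨S, a₀, b₀, ha, hb, hm⟩
    have hc := PreWeinstein.pair_comp ha hb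
    have h : L.Composable a₀ b₀ := ⟨fun s => (hm s).1, fun s => (hm s).2, by
      ext s
      have h1 := congr_hom hc s
      exact hw (((congr_hom c.cs_eq (a₀ s)).symm.trans h1).trans (congr_hom c.ct_eq (b₀ s)))⟩
    obtain ⟨k, hk, e₁, e₂⟩ := PreWeinstein.exists_pairHom hfib (z := z)
      (z' := Γ.ptPair c.src c.tgt a₀ b₀ (hpr h)) (f := 𝟙 S) (a₀ := a₀) (b₀ := b₀) ha hb
      (univ_lift j a₀) (univ_lift j b₀)
    exact ⟨S, a₀, b₀, h, k, hk, e₁, e₂⟩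
  have key : ∀ {z : Γ.pair.obj} (a : z.fst ⟶ uObj j) (b : z.snd ⟶ uObj j),
      InD₂ {p : N × N | p.1 ∈ L.dom ∧ p.2 ∈ L.dom} a b → ∃ m : Γ.mul.obj z ⟶ uObj j,
      ∀ {S T : Mfd} {a₀ b₀ : S ⟶ N} (h : L.Composable a₀ b₀) (f : T ⟶ S)
        (k : z ⟶ Γ.ptPair c.src c.tgt a₀ b₀ (hpr h)), Γ.pair.Lifts f k →
        FPHom.fst k ≫ univ j a₀ = a → FPHom.snd k ≫ univ j b₀ = b →
        m = Γ.mul.map k ≫ c.mul h ≫ univ j h.mulMap := by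
    intro z a b hD
    obtain ⟨S, a₀, b₀, h, k, hk, e₁, e₂⟩ := ex a b hD
    have ha := e₁ ▸ lift_id_comp (Γ.pair_lift_fst hk) (univ_lift j a₀)
    have hb := e₂ ▸ lift_id_comp (Γ.pair_lift_snd hk) (univ_lift j b₀)
    refine ⟨Γ.mul.map k ≫ c.mul h ≫ univ j h.mulMap, fun {S' T} {a₁ b₁} h' f k' hk' e₁' e₂' => ?_⟩
    have l₁ := Γ.pair_lift_fst hk'
    have l₂ := Γ.pair_lift_snd hk'
    have hT : T = S := (lift_base l₁).1.symm.trans (lift_base ha).1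
    subst hT
    have ea : a₀ = f ≫ a₁ := lift_unique ha (e₁' ▸ lift_comp l₁ (univ_lift j a₁))
    have eb : b₀ = f ≫ b₁ := lift_unique hb (e₂' ▸ lift_comp l₂ (univ_lift j b₁))
    subst ea eb
    have e : k' = k ≫ fpHom (w := Γ.ptPair c.src c.tgt (f ≫ a₁) (f ≫ b₁) (hpr h))
        (w' := Γ.ptPair c.src c.tgt a₁ b₁ (hpr h')) f (ptMap j f rfl) (ptMap j f rfl)
        (ptMap_lift j f rfl) (ptMap_lift j f rfl) := by
      apply FPHom.ext
      · refine hfib.hom_ext f (univ j a₁) l₁ (lift_id_comp (Γ.pair_lift_fst hk) (ptMap_lift j f rfl)) ?_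
        exact e₁'.trans (e₁.symm.trans (Eq.trans (FPHom.fst k ≫= (ptMap_univ j f rfl).symm)
          (assoc _ _ _).symm))
      · refine hfib.hom_ext f (univ j b₁) l₂ (lift_id_comp (Γ.pair_lift_snd hk) (ptMap_lift j f rfl)) ?_
        exact e₂'.trans (e₂.symm.trans (Eq.trans (FPHom.snd k ≫= (ptMap_univ j f rfl).symm)
          (assoc _ _ _).symm))
    rw [e, Γ.mul.map_comp, assoc]
    refine (Γ.mul.map k ≫= ?_)
    have h3 := ((c.mul_nat f h') =≫ univ j h'.mulMap)
    simp only [assoc] at h3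
    refine Eq.trans ?_ h3.symm
    refine (c.mul h ≫= ?_)
    exact (ptMap_univ j (a := h.mulMap) (b := h'.mulMap) f rfl).symm
  choose m hm using @key
  have hD : ∀ {S : Mfd} {a b : S ⟶ N} (h : L.Composable a b),
      InD₂ {p : N × N | p.1 ∈ L.dom ∧ p.2 ∈ L.dom} (univ j a) (univ j b) := fun h =>
    ⟨_, _, _, univ_lift j _, univ_lift j _, fun s => ⟨h.fst_mem s, h.snd_mem s⟩⟩
  let μ : Γ.MulArr j {p | p.1 ∈ L.dom ∧ p.2 ∈ L.dom} :=
    ⟨fun {z} a b h => m a b h, fun {z z'} k a b h h' => by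
      obtain ⟨S, a₀, b₀, hab, k₀, hk₀, e₁, e₂⟩ := ex a b h
      have hk := bm_lift (rfl : Γ.pair.p.obj z' = _) (lift_base hk₀).1 k
      rw [hm a b h hab (𝟙 S) k₀ hk₀ e₁ e₂, hm _ _ h' hab _ (k ≫ k₀) (lift_comp_id hk hk₀)
        ((assoc _ _ _).trans (FPHom.fst k ≫= e₁))
        ((assoc _ _ _).trans (FPHom.snd k ≫= e₂)), Γ.mul.map_comp,
        assoc]⟩
  refine ⟨μ, fun g hg h hh e => ?_, fun h => ?_⟩
  · have hc : L.Composable (pnt g) (pnt h) := ⟨fun _ => hg, fun _ => hh, by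
      rw [pnt_comp, pnt_comp, e]⟩
    have h1 := hm (univ j (pnt g)) (univ j (pnt h)) (hD hc) hc (𝟙 point)
      (𝟙 (Γ.ptPair c.src c.tgt (pnt g) (pnt h) (hpr hc))) (IsHomLift.id (j.w_obj (pt (pnt g))))
      (id_comp _) (id_comp _)
    refine (μ.val_pnt hfib (z := Γ.ptPair c.src c.tgt (pnt g) (pnt h) (hpr hc)) (hD hc)
      (univ_lift j (pnt g)) (univ_lift j (pnt h)) (n := L.mul g h) ?_).symm
    refine (congrArg (fun t => Γ.stk.Lifts (pnt (L.mul g h)) t) h1).mpr ?_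
    rw [Γ.mul.map_id, id_comp]
    exact lift_id_comp (c.mul_lift hc) (univ_lift j hc.mulMap)
  · obtain ⟨k₁, hk₁, e₁⟩ := hfib.exists_lift (𝟙 B) (𝟙 B ≫ L.unit) c.eps (univ j (𝟙 B ≫ L.unit))
      c.eps_lift (univ_lift j _)
    have h4 : ptMap Γ.unit (a := w) (b := 𝟙 B ≫ w) (𝟙 B) rfl ≫
      ptMap Γ.unit (a := 𝟙 B ≫ w) (b := w) (𝟙 B) rfl = 𝟙 _ :=
      (ptMap_comp Γ.unit _ _ _ _).trans (ptMap_id Γ.unit w (id_comp w))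
    have hu : k₁ ≫ c.unit (𝟙 B) = ptMap Γ.unit (a := w) (b := 𝟙 B ≫ w) (𝟙 B) rfl := by
      refine hfib.hom_ext (𝟙 B) (ptMap Γ.unit (a := 𝟙 B ≫ w) (b := w) (𝟙 B) rfl ≫ c.eps)
        (lift_id_comp hk₁ (c.unit_lift _)) (ptMap_lift _ _ _) ?_
      refine (assoc _ _ _).trans ((k₁ ≫= (c.unit_eps (𝟙 B))).trans (e₁.trans ?_))
      exact ((assoc _ _ _).symm.trans ((h4 =≫ c.eps).trans (id_comp _))).symm
    have h1 := hm (z := Γ.unit₂.obj (pt w)) c.eps c.eps h (L.composable_unit (𝟙 B)) (𝟙 B)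
      (fpHom (𝟙 B) k₁ k₁ hk₁ hk₁) (fp_lift hk₁) e₁ e₁
    refine h1.trans ?_
    have h2 := ((c.mul_unit (𝟙 B)) =≫ (ptMap Γ.unit (a := 𝟙 B ≫ w) (b := w) (𝟙 B) rfl ≫ c.eps))
    have h3 : Γ.unit₂.map (ptHom (a := w) (b := 𝟙 B ≫ w) (𝟙 B) rfl) =
        (fpHom (w := Γ.unit₂.obj (pt w)) (𝟙 B) k₁ k₁ hk₁ hk₁ :
          Γ.unit₂.obj (pt w) ⟶ Γ.ptPair c.src c.tgt _ _ (hpr (L.composable_unit (𝟙 B)))) ≫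
        fpHom (w' := Γ.unit₂.obj (pt (𝟙 B ≫ w))) (𝟙 B) (c.unit (𝟙 B)) (c.unit (𝟙 B))
          (c.unit_lift _) (c.unit_lift _) := FPHom.ext hu.symm hu.symm
    have h5 := (c.mul (L.composable_unit (𝟙 B)) ≫= (((assoc _ _ _).trans
      (_ ≫= c.unit_eps (𝟙 B))).trans (ptMap_univ j (𝟙 B) _))).symm.trans
      ((assoc _ _ _).symm.trans (h2.trans (assoc _ _ _)))
    refine (_ ≫= h5).trans ((assoc _ _ _).symm.trans ?_)
    refine (congrArg (fun t => CategoryStruct.comp t _) ((Γ.mul.map_comp _ _).symm.trans (congrArg Γ.mul.map h3.symm))).trans ?_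
    refine (Γ.unitIso.hom.naturality_assoc (ptHom (a := w) (b := 𝟙 B ≫ w) (𝟙 B) rfl) _).trans ?_
    refine (Γ.unitIso.hom.app (pt w) ≫= ?_)
    exact (assoc _ _ _).symm.trans ((h4 =≫ c.eps).trans (id_comp _))

end Presents

section

variable {M B N N' : Mfd} {Γ : WeinsteinGroupoid.{v, u} M} {w : B ⟶ M} {L : LocalLieGroupoid B N}
  {L' : LocalLieGroupoid M N'} {j : rep N ⥤ᵇ Γ.stk} {j' : rep N' ⥤ᵇ Γ.stk}

/-- The identities over an arbitrary base, as an arrow into a chart over `M`. -/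
def Presents.eu (c' : Presents Γ (𝟙 M) L' j') (u : (rep M).obj) : Γ.unit.obj u ⟶ uObj j' :=
  Γ.unit.map (term u) ≫ c'.eps

lemma Presents.map_eu (c' : Presents Γ (𝟙 M) L' j') {u u' : (rep M).obj} (f : u ⟶ u') :
    Γ.unit.map f ≫ c'.eu u' = c'.eu u := by
  rw [eu, ← assoc, ← Γ.unit.map_comp, comp_term, eu]

lemma Presents.eu_lift (c' : Presents Γ (𝟙 M) L' j') {S : Mfd} (b : S ⟶ M) :
    Γ.stk.Lifts (b ≫ L'.unit) (c'.eu (pt b)) := lift_comp (univ_lift Γ.unit b) c'.eps_lift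

/-- A map, defined near the identities of a local Lie groupoid presenting `Γ` over `B`, to one
presenting `Γ` over `M`, with its action on arrows to the chart. -/
structure Germ (c : Presents Γ w L j) (c' : Presents Γ (𝟙 M) L' j') where
  φ : N → N'
  O : Opens N
  mem : ∀ b, L.unit b ∈ O
  tr : ∀ {x : Γ.stk.obj} (a : x ⟶ uObj j), InD (O : Set N) a → (x ⟶ uObj j')
  nat : ∀ {x y : Γ.stk.obj} (k : y ⟶ x) (a : x ⟶ uObj j) (h : InD (O : Set N) a),
    k ≫ tr a h = tr (k ≫ a) (h.pre k)
  tr_eps : ∀ {x : Γ.stk.obj} (l : x ⟶ Γ.unit.obj (pt w)) (h : InD (O : Set N) (l ≫ c.eps)),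
    tr (l ≫ c.eps) h = l ≫ c'.eu (pt w)
  lift : ∀ {x : Γ.stk.obj} {S : Mfd} {a₀ : S ⟶ N} {a : x ⟶ uObj j} (h : InD (O : Set N) a),
    Γ.stk.Lifts a₀ a → ∃ b₀ : S ⟶ N', Γ.stk.Lifts b₀ (tr a h) ∧ ∀ s, b₀ s = φ (a₀ s)

namespace Germ

variable {c : Presents Γ w L j} {c' : Presents Γ (𝟙 M) L' j'}

lemma exists_germ [T2Space B] [ParacompactSpace B] (hj' : IsEtChart j') : Nonempty (Germ c c') := by
  have hfib := Γ.fibred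
  obtain ⟨O, z, r, Φ, mem, hr, coh⟩ := hj'.exists_extension_obj Γ.etale.stack L.unit
    (continuous L.src) L.src_unit c.eps_lift (c'.eu (pt w))
  have hz := (lift_base hr).1
  have hΦ := bm_lift hz (obj_univ j') Φ
  have key : ∀ {x : Γ.stk.obj} (a : x ⟶ uObj j), InD (O : Set N) a → ∃ k : x ⟶ z, k ≫ r = a := by
    rintro x a ⟨S, a₀, ha, hm⟩
    obtain ⟨k, -, e⟩ := hfib.exists_lift (codRestrict a₀ O hm) (N.incl O) a r ha hr
    exact ⟨k, e⟩
  choose k hk using @key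
  refine ⟨⟨fun n => open Classical in bm hz (obj_univ j') Φ
      (if h : n ∈ O then opnMk n h else opnMk _ (mem (L.src n))), O, mem, fun a h => k a h ≫ Φ,
    fun f a h => ?_, fun l h => coh _ _ (hk _ h), fun {x S a₀ a} h ha => ?_⟩⟩
  · rw [← assoc]
    exact ((hfib.cancel_inj (incl_injective O) hr
      ((assoc _ _ _).trans (((f ≫= (hk a h))).trans (hk _ _).symm))) =≫ Φ)
  · have hm := h.mem ha
    have hk' := bm_lift (lift_base ha).1 hz (k a h)
    have e := lift_unique ha ((hk a h) ▸ lift_comp hk' hr)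
    refine ⟨_, lift_comp hk' hΦ, fun s => ?_⟩
    have hs : a₀ s ∈ O := hm s
    simp only [dif_pos hs]
    refine congrArg (bm hz (obj_univ j') Φ) (incl_injective O ?_)
    exact (congr_hom e s).symm

variable (G : Germ c c')

lemma tr_congr {x : Γ.stk.obj} {a a' : x ⟶ uObj j} (h : InD (G.O : Set N) a) (e : a = a') :
    G.tr a h = G.tr a' (e ▸ h) := by subst e; rfl

lemma inD_univ {S : Mfd} {a : S ⟶ N} (h : ∀ s, a s ∈ G.O) : InD (G.O : Set N) (univ j a) :=
  ⟨_, _, univ_lift j a, h⟩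

lemma tr_unit {S : Mfd} (b : S ⟶ B) (h : InD (G.O : Set N) (univ j (b ≫ L.unit))) :
    G.tr (univ j (b ≫ L.unit)) h = c.unit b ≫ c'.eu (pt (b ≫ w)) := by
  have e : (c.unit b ≫ ptMap Γ.unit b rfl) ≫ c.eps = univ j (b ≫ L.unit) :=
    (assoc _ _ _).trans (c.unit_eps b)
  rw [G.tr_congr h e.symm, G.tr_eps, assoc]
  exact (c.unit b ≫= (c'.map_eu (ptHom (a := b ≫ w) (b := w) b rfl)))

lemma φ_unit (b : B) : G.φ (L.unit b) = L'.unit (w b) := by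
  have h : InD (G.O : Set N) (𝟙 _ ≫ c.eps) := ⟨_, _, (id_comp c.eps).symm ▸ c.eps_lift, G.mem⟩
  obtain ⟨b₀, hb, e⟩ := G.lift h ((id_comp c.eps).symm ▸ c.eps_lift)
  rw [← e, lift_unique hb (((G.tr_eps _ h).trans (id_comp _)).symm ▸ c'.eu_lift w)]
  rfl

lemma src_φ {g : N} (hg : g ∈ G.O) : L'.src (G.φ g) = w (L.src g) ∧ L'.tgt (G.φ g) = w (L.tgt g) := by
  have h := G.inD_univ (a := pnt g) fun _ => hg
  obtain ⟨b₀, hb, e⟩ := G.lift h (univ_lift j (pnt g))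
  have hx : Γ.stk.p.obj (j.obj (pt (pnt g))) = point := j.w_obj _
  have h1 := (atMap_chart Γ.src hb hx).symm.trans (atMap_chart Γ.src (univ_lift j (pnt g)) hx)
  have h2 := (atMap_chart Γ.tgt hb hx).symm.trans (atMap_chart Γ.tgt (univ_lift j (pnt g)) hx)
  have k : G.φ g = b₀ pointElt := (e pointElt).symm
  rw [k]
  exact ⟨((congr_hom c'.cs_eq (b₀ pointElt)).symm.trans (congrArg
    (fun f : point ⟶ M => f pointElt) h1)).trans (congr_hom c.cs_eq g),
    ((congr_hom c'.ct_eq (b₀ pointElt)).symm.trans (congrArg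
    (fun f : point ⟶ M => f pointElt) h2)).trans (congr_hom c.ct_eq g)⟩

lemma smoothAt {g : N} (hg : g ∈ G.O) : ContMDiffAt N.I N'.I ∞ G.φ g := by
  obtain ⟨b₀, -, e⟩ := G.lift (G.inD_univ (a := N.incl G.O) fun s => s.2) (univ_lift j (N.incl G.O))
  exact contMDiffAt_of_opn hg ((smooth b₀ _).congr_of_eventuallyEq
    (Eventually.of_forall fun z => (e z).symm))

lemma eventually_localIso {B₂ N₂ : Mfd} {w₂ : B₂ ⟶ M} {L₂ : LocalLieGroupoid B₂ N₂}
    {j₂ : rep N₂ ⥤ᵇ Γ.stk} {c₂ : Presents Γ w₂ L₂ j₂} (G₂ : Germ c₂ c') (hj' : IsEtChart j')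
    (T : LocalIso c c₂) {b : B} {b₂ : B₂} (hb : w b = w₂ b₂) :
    ∀ᶠ g in 𝓝 (L.unit b), G₂.φ (T.map g) = G.φ g := by
  have hfib := Γ.fibred
  let V : Opens N := ⟨(T.map.source ∩ T.map ⁻¹' G₂.O) ∩ G.O,
    (T.map.continuousOn.isOpen_inter_preimage T.map.open_source G₂.O.isOpen).inter G.O.isOpen⟩
  have hV : L.unit b ∈ V := ⟨⟨T.unit_mem b b₂ hb, by
    change T.map (L.unit b) ∈ G₂.O
    rw [T.unit b b₂ hb]; exact G₂.mem b₂⟩, G.mem b⟩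
  have hs : ∀ s : N.opn V, N.incl V s ∈ T.map.source := fun s => s.2.1.1
  have h₁ := G.inD_univ (a := N.incl V) fun s => s.2.2
  have h₂ := G₂.inD_univ (a := compOn T.map T.smooth (N.incl V) hs) fun s => s.2.1.2
  obtain ⟨f₁, l₁, e₁⟩ := G.lift h₁ (univ_lift j _)
  obtain ⟨f₂, l₂, e₂⟩ := G₂.lift h₂ (univ_lift j₂ _)
  let q : j.obj (pt (pnt b ≫ L.unit)) ⟶ j.obj (pt (N.incl V)) :=
    ptMap j (a := pnt b ≫ L.unit) (b := N.incl V) (pnt (opnMk _ hV)) rfl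
  have hw : pnt b ≫ w = pnt b₂ ≫ w₂ := by rw [pnt_comp, pnt_comp, hb]
  have hm : ∀ s, (pnt b ≫ L.unit) s ∈ T.map.source := fun _ => T.unit_mem b b₂ hb
  have he : compOn T.map T.smooth (pnt b ≫ L.unit) hm = pnt b₂ ≫ L₂.unit := by
    ext s
    exact T.unit b b₂ hb
  have key := hj'.eventually_base_eq hfib (s := opnMk _ hV) (lift_id_comp (T.iso_lift _ hs) l₂) l₁
    (ptMap_lift j (a := pnt b ≫ L.unit) (b := N.incl V) (pnt (opnMk _ hV)) rfl) (by
    have r₁ : q ≫ G.tr _ h₁ = c.unit (pnt b) ≫ c'.eu (pt (pnt b ≫ w)) :=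
      ((G.nat q _ h₁).trans (G.tr_congr _ (ptMap_univ j _ _))).trans (G.tr_unit _ _)
    refine Eq.trans ?_ r₁.symm
    refine (assoc _ _ _).symm.trans (((T.iso_nat
      (pnt (opnMk _ hV)) (N.incl V) hs) =≫ G₂.tr _ h₂).trans ((assoc _ _ _).trans ?_))
    refine ((T.iso (pnt b ≫ L.unit) hm) ≫= (G₂.nat _ _ h₂)).trans ?_
    have r₂ : ptMap j₂ (a := compOn T.map T.smooth (pnt b ≫ L.unit) hm) (b := pnt b₂ ≫ L₂.unit) (𝟙 point)
      (by rw [he]; simp) ≫ univ j₂ (pnt b₂ ≫ L₂.unit) = univ j₂ _ := ptMap_univ j₂ _ _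
    have d : InD (G₂.O : Set N₂) (univ j₂ (pnt b₂ ≫ L₂.unit)) := G₂.inD_univ fun _ => G₂.mem b₂
    refine ((T.iso (pnt b ≫ L.unit) hm) ≫= ((G₂.tr_congr _ ((ptMap_univ j₂ _ _).trans
      r₂.symm)).trans ((G₂.nat _ _ d).symm.trans (congrArg (CategoryStruct.comp _)
        (G₂.tr_unit (pnt b₂) d))))).trans ?_
    have r₃ := ((T.iso_unit (pnt b) (pnt b₂) hw hm he) =≫ (c'.eu (pt (pnt b₂ ≫ w₂))))
    simp only [assoc] at r₃
    exact r₃.trans (c.unit (pnt b) ≫= (c'.map_eu _)))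
  refine eventually_of_opn hV (key.mono fun s h => ?_)
  rw [← e₁, ← h, e₂]
  rfl

end Germ

end

lemma Mfd.isLocalDiffeomorphAt_of_inverse {N N' : Mfd} {φ : N → N'} {ψ : N' → N} {n : N}
    (h₁ : ∀ᶠ g in 𝓝 n, ContMDiffAt N.I N'.I ∞ φ g ∧ ψ (φ g) = g)
    (h₂ : ∀ᶠ g in 𝓝 (φ n), ContMDiffAt N'.I N.I ∞ ψ g ∧ φ (ψ g) = g) :
    IsLocalDiffeomorphAt N.I N'.I ∞ φ n := by
  obtain ⟨U, hU, oU, nU⟩ := eventually_nhds_iff.1 h₁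
  obtain ⟨V, hV, oV, nV⟩ := eventually_nhds_iff.1 h₂
  have c₁ : ContMDiffOn N.I N'.I ∞ φ U := fun g hg => (hU g hg).1.contMDiffWithinAt
  have c₂ : ContMDiffOn N'.I N.I ∞ ψ V := fun g hg => (hV g hg).1.contMDiffWithinAt
  refine ⟨{ toFun := φ, invFun := ψ, source := U ∩ φ ⁻¹' V, target := V ∩ ψ ⁻¹' U
            map_source' := fun g hg => ⟨hg.2, by
              change ψ (φ g) ∈ U
              rw [(hU g hg.1).2]; exact hg.1⟩
            map_target' := fun g hg => ⟨hg.2, by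
              change φ (ψ g) ∈ V
              rw [(hV g hg.1).2]; exact hg.1⟩
            left_inv' := fun g hg => (hU g hg.1).2
            right_inv' := fun g hg => (hV g hg.1).2
            open_source := c₁.continuousOn.isOpen_inter_preimage oU oV
            open_target := c₂.continuousOn.isOpen_inter_preimage oV oU
            contMDiffOn_toFun := c₁.mono Set.inter_subset_left
            contMDiffOn_invFun := c₂.mono Set.inter_subset_left }, ⟨nU, nV⟩, fun _ _ => rfl⟩

namespace Germ

variable {M B N N' : Mfd} {Γ : WeinsteinGroupoid.{v, u} M} {w : B ⟶ M} {L : LocalLieGroupoid B N}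
  {L' : LocalLieGroupoid M N'} {j : rep N ⥤ᵇ Γ.stk} {j' : rep N' ⥤ᵇ Γ.stk}
  {c : Presents Γ w L j} {c' : Presents Γ (𝟙 M) L' j'} (G : Germ c c')

lemma isLocalDiffeomorphAt (hj : IsEtChart j) (hj' : IsEtChart j') {n : N} (hn : n ∈ G.O) :
    IsLocalDiffeomorphAt N.I N'.I ∞ G.φ n := by
  have hfib := Γ.fibred
  have d := G.inD_univ (a := pnt n) fun _ => hn
  obtain ⟨b₀, hb, eb⟩ := G.lift d (univ_lift j (pnt n))
  have hc : Γ.stk.Lifts (pnt (G.φ n)) (G.tr (univ j (pnt n)) d) := by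
    convert hb
    ext s
    exact (eb s).symm
  have : T2Space point := inferInstanceAs (T2Space (𝔼 0))
  have : ParacompactSpace point := inferInstanceAs (ParacompactSpace (𝔼 0))
  obtain ⟨D, z, r, α, hD, hr, coh⟩ := hj.exists_extension_obj Γ.etale.stack (pnt (G.φ n))
    (p := fun _ => pointElt) continuous_const (fun _ => Subsingleton.elim _ _) hc (univ j (pnt n))
  have hnD : G.φ n ∈ D := hD pointElt
  have hz := (lift_base hr).1
  obtain ⟨α₀, hα⟩ : ∃ α₀ : N'.opn D ⟶ N, Γ.stk.Lifts α₀ α := ⟨_, bm_lift hz (obj_univ j) α⟩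
  have hψ : ∃ ψ : N' → N, ∀ d : N'.opn D, ψ (N'.incl D d) = α₀ d := ⟨fun x => open Classical in
    if h : x ∈ D then α₀ (opnMk x h) else n, fun d => dif_pos d.2⟩
  obtain ⟨ψ, hψ⟩ := hψ
  have sψ : ∀ x ∈ D, ContMDiffAt N'.I N.I ∞ ψ x := fun x hx => contMDiffAt_of_opn hx
    ((smooth α₀ _).congr_of_eventuallyEq (Eventually.of_forall hψ))
  have oO : ∀ᶠ g in 𝓝 n, g ∈ G.O := G.O.isOpen.mem_nhds hn
  have k₁ : ∀ᶠ g in 𝓝 n, ψ (G.φ g) = g := by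
    have cφ : ContinuousOn G.φ G.O := fun g hg => (G.smoothAt hg).continuousAt.continuousWithinAt
    let V : Opens N := ⟨G.O ∩ G.φ ⁻¹' D, cφ.isOpen_inter_preimage G.O.isOpen D.isOpen⟩
    have hV : n ∈ V := ⟨hn, hnD⟩
    have h₁ := G.inD_univ (a := N.incl V) fun s => s.2.1
    obtain ⟨f, lf, ef⟩ := G.lift h₁ (univ_lift j _)
    have hf : ∀ s, f s ∈ D := fun s => by rw [ef]; exact s.2.2
    obtain ⟨k, hk, ek⟩ := hfib.exists_lift (codRestrict f D hf) (N'.incl D) _ r lf hr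
    have key := hj.eventually_base_eq hfib (s := opnMk n hV) (lift_comp hk hα) (univ_lift j (N.incl V))
      (ptMap_lift j (a := pnt n) (b := N.incl V) (pnt (opnMk n hV)) rfl) (by
      have e : (ptMap j (a := pnt n) (b := N.incl V) (pnt (opnMk n hV)) rfl ≫ k) ≫ r =
          𝟙 _ ≫ G.tr (univ j (pnt n)) d :=
        (assoc _ _ _).trans ((_ ≫= ek).trans
          (((G.nat _ _ h₁).trans (G.tr_congr _ (ptMap_univ j _ _))).trans (id_comp _).symm))
      exact (assoc _ _ _).symm.trans ((coh _ _ e).trans ((id_comp _).trans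
        (ptMap_univ j _ _).symm)))
    refine eventually_of_opn hV (key.mono fun s h => Eq.trans ?_ h)
    rw [← ef]
    exact hψ (codRestrict f D hf s)
  have e₀ : ψ (G.φ n) = n := k₁.self_of_nhds
  have k₂ : ∀ᶠ g in 𝓝 (G.φ n), G.φ (ψ g) = g := by
    let V : Opens (N'.opn D) := ⟨α₀ ⁻¹' G.O, G.O.isOpen.preimage (continuous α₀)⟩
    have hV : opnMk (G.φ n) hnD ∈ V := by
      change α₀ _ ∈ G.O
      rw [← hψ]
      exact e₀.symm ▸ hn
    obtain ⟨y, t, ht⟩ := hfib.exists_pullback hz ((N'.opn D).incl V)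
    have h₁ : InD (G.O : Set N) (t ≫ α) := ⟨_, _, lift_comp ht hα, fun s => s.2⟩
    obtain ⟨f, lf, ef⟩ := G.lift h₁ (lift_comp ht hα)
    obtain ⟨q, hq, eq⟩ := hfib.exists_lift (pnt (opnMk (opnMk (G.φ n) hnD) hV)) _ _ (t ≫ r)
      (show Γ.stk.Lifts (pnt _ ≫ (N'.opn D).incl V ≫ N'.incl D) _ from hc) (lift_comp ht hr)
    have key := hj'.eventually_base_eq hfib (s := opnMk (opnMk (G.φ n) hnD) hV) lf (lift_comp ht hr)
      hq (by
      have e : (q ≫ t) ≫ r = 𝟙 _ ≫ G.tr (univ j (pnt n)) d :=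
        (assoc _ _ _).trans (eq.trans (id_comp _).symm)
      refine Eq.trans ?_ eq.symm
      exact (G.nat _ _ h₁).trans (G.tr_congr _ ((assoc _ _ _).symm.trans
        ((coh _ _ e).trans (id_comp _)))))
    refine eventually_of_opn hnD (eventually_of_opn hV (key.mono fun s h => Eq.trans ?_ h))
    rw [ef]
    exact congrArg G.φ (hψ _)
  exact isLocalDiffeomorphAt_of_inverse ((oO.mono fun g hg => G.smoothAt hg).and k₁)
    (((show ∀ᶠ g in 𝓝 (G.φ n), g ∈ D from D.isOpen.mem_nhds hnD).mono sψ).and k₂)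

lemma eventually_mul (hj' : IsEtChart j') (hw : Injective w) (b : B) :
    ∀ᶠ p : N × N in 𝓝 (L.unit b, L.unit b), L.src p.1 = L.tgt p.2 →
      G.φ (L.mul p.1 p.2) = L'.mul (G.φ p.1) (G.φ p.2) := by
  have hfib := Γ.fibred
  obtain ⟨μ, hμ, μu⟩ := c.exists_mulArr hw
  obtain ⟨μ', hμ', μu'⟩ := c'.exists_mulArr fun _ _ h => h
  let P := pull L.src L.tgt L.tgt_subm
  let p₁ : P ⟶ N := pullFst _ _ _
  let p₂ : P ⟶ N := pullSnd _ _ _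
  have hp : ∀ y, L.src (p₁ y) = L.tgt (p₂ y) := fun y => congr_hom (pull_comm _ _ _) y
  have hb : L.src (L.unit b) = L.tgt (L.unit b) := (L.src_unit b).trans (L.tgt_unit b).symm
  let y₀ : P := pullMk _ _ L.tgt_subm (L.unit b) (L.unit b) hb
  let Q : Set N := {g | g ∈ L.dom ∧ g ∈ G.O ∧ G.φ g ∈ L'.dom}
  have hQ : Q ∈ 𝓝 (L.unit b) := inter_mem (L.dom.isOpen.mem_nhds (L.unit_mem b))
    (inter_mem (G.O.isOpen.mem_nhds (G.mem b)) ((G.smoothAt (G.mem b)).continuousAt.preimage_mem_nhds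
      (L'.dom.isOpen.mem_nhds (by rw [G.φ_unit]; exact L'.unit_mem _))))
  let Λ : Set P := {y | p₁ y ∈ Q ∧ p₂ y ∈ Q ∧ L.mul (p₁ y) (p₂ y) ∈ G.O}
  have cm : ContinuousAt (fun y : P => L.mul (p₁ y) (p₂ y)) y₀ := by
    have h := (L.mul_smooth.continuousOn (L.unit b, L.unit b) ⟨L.unit_mem b, L.unit_mem b, hb⟩)
    have k₁ := (continuous p₁).continuousAt (x := y₀)
    have k₂ := (continuous p₂).continuousAt (x := y₀)
    refine h.tendsto.comp (tendsto_nhdsWithin_iff.2 ⟨k₁.prodMk k₂, ?_⟩)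
    filter_upwards [k₁.preimage_mem_nhds (L.dom.isOpen.mem_nhds (L.unit_mem b)),
      k₂.preimage_mem_nhds (L.dom.isOpen.mem_nhds (L.unit_mem b))] with y h1 h2 using ⟨h1, h2, hp y⟩
  have ue : L.mul (L.unit b) (L.unit b) = L.unit b := by
    simpa [L.tgt_unit] using L.unit_mul (L.unit b) (L.unit_mem b)
  have hy₀ : y₀ ∈ interior Λ := by
    refine mem_interior_iff_mem_nhds.2 ?_
    filter_upwards [(continuous p₁).continuousAt.preimage_mem_nhds (x := y₀) hQ,
      (continuous p₂).continuousAt.preimage_mem_nhds (x := y₀) hQ,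
      cm.preimage_mem_nhds (G.O.isOpen.mem_nhds (ue.symm ▸ G.mem b))] with y h1 h2 h3
    exact ⟨h1, h2, h3⟩
  let V : Opens P := ⟨interior Λ, isOpen_interior⟩
  have hV : ∀ s : P.opn V, P.incl V s ∈ Λ := fun s => interior_subset s.2
  obtain ⟨z, a, e, la, le⟩ := OpGerm.exists_pair (j := j) (a₀ := P.incl V ≫ p₁) (b₀ := P.incl V ≫ p₂)
    (by
      rw [c.cs_eq, c.ct_eq]
      ext s
      exact congrArg w (hp _))
  have dae : InD₂ {p : N × N | p.1 ∈ L.dom ∧ p.2 ∈ L.dom} a e :=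
    ⟨_, _, _, la, le, fun s => ⟨(hV s).1.1, (hV s).2.1.1⟩⟩
  obtain ⟨m₀, lm⟩ := μ.exists_base dae la
  have vm : ∀ s, m₀ s = L.mul (p₁ (P.incl V s)) (p₂ (P.incl V s)) := fun s =>
    (μ.val_eq hfib dae la le lm s).trans (hμ _ (hV s).1.1 _ (hV s).2.1.1 (hp _))
  have da : InD (G.O : Set N) a := ⟨_, _, la, fun s => (hV s).1.2.1⟩
  have de : InD (G.O : Set N) e := ⟨_, _, le, fun s => (hV s).2.1.2.1⟩
  have dm : InD (G.O : Set N) (μ.m a e dae) := ⟨_, _, lm, fun s => by rw [vm]; exact (hV s).2.2⟩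
  obtain ⟨a', la', ea'⟩ := G.lift da la
  obtain ⟨e', le', ee'⟩ := G.lift de le
  obtain ⟨m', lm', em'⟩ := G.lift dm lm
  have dae' : InD₂ {p : N' × N' | p.1 ∈ L'.dom ∧ p.2 ∈ L'.dom} (G.tr a da) (G.tr e de) :=
    ⟨_, _, _, la', le', fun s => ⟨by rw [ea']; exact (hV s).1.2.2, by rw [ee']; exact (hV s).2.1.2.2⟩⟩
  obtain ⟨n', ln⟩ := μ'.exists_base dae' la'
  have vn : ∀ s, n' s = L'.mul (G.φ (p₁ (P.incl V s))) (G.φ (p₂ (P.incl V s))) := fun s => by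
    rw [μ'.val_eq hfib dae' la' le' ln s, ea', ee']
    exact hμ' _ (hV s).1.2.2 _ (hV s).2.1.2.2 (((G.src_φ (hV s).1.2.1).1.trans
      (congrArg w (hp _))).trans (G.src_φ (hV s).2.1.2.1).2.symm)
  let u : (rep M).obj := pt (pnt b ≫ w)
  let ε : Γ.unit.obj u ⟶ uObj j := ptMap Γ.unit (a := pnt b ≫ w) (b := w) (pnt b) rfl ≫ c.eps
  have lε : Γ.stk.Lifts (pnt b ≫ L.unit) ε := lift_comp (ptMap_lift _ _ _) c.eps_lift
  obtain ⟨k₁, hk₁, e₁⟩ := hfib.exists_lift (pnt (opnMk y₀ hy₀)) _ ε a lε la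
  obtain ⟨k₂, hk₂, e₂⟩ := hfib.exists_lift (pnt (opnMk y₀ hy₀)) _ ε e lε le
  let κ : Γ.unit₂.obj u ⟶ z := fpHom (pnt (opnMk y₀ hy₀)) k₁ k₂ hk₁ hk₂
  have tε : ∀ {x : Γ.stk.obj} (l : x ⟶ Γ.unit.obj u) h, G.tr (l ≫ ε) h = l ≫ c'.eu u := fun l h => by
    refine (G.tr_congr h (assoc _ _ _).symm).trans ((G.tr_eps _ _).trans
      ((assoc _ _ _).trans (l ≫= (c'.map_eu _))))
  have te : ∀ h, G.tr ε h = c'.eu u := fun h =>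
    (G.tr_congr h (id_comp ε).symm).trans ((tε _ _).trans (id_comp _))
  have key := hj'.eventually_base_eq hfib (s := opnMk y₀ hy₀) lm' ln (map_lift Γ.mul (fp_lift hk₁ :
    Γ.pair.Lifts _ κ)) (by
    have d₁ : InD₂ {p : N × N | p.1 ∈ L.dom ∧ p.2 ∈ L.dom} c.eps c.eps :=
      ⟨_, _, _, c.eps_lift, c.eps_lift, fun s => ⟨L.unit_mem s, L.unit_mem s⟩⟩
    have d₂ : InD₂ {p : N' × N' | p.1 ∈ L'.dom ∧ p.2 ∈ L'.dom} c'.eps c'.eps :=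
      ⟨_, _, _, c'.eps_lift, c'.eps_lift, fun s => ⟨L'.unit_mem s, L'.unit_mem s⟩⟩
    have d₃ := PreWeinstein.inD₂_pre κ dae
    have d₄ := PreWeinstein.inD₂_pre κ dae'
    have r₁ : Γ.mul.map κ ≫ μ.m a e dae = Γ.unitIso.hom.app u ≫ ε :=
      (μ.nat κ a e dae d₃).trans ((μ.m_congr d₃ e₁ e₂).trans (μ.m_ptMap (μu d₁) (pnt b) _))
    have r₂ : Γ.mul.map κ ≫ μ'.m (G.tr a da) (G.tr e de) dae' = Γ.unitIso.hom.app u ≫ c'.eu u :=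
      (μ'.nat κ _ _ dae' d₄).trans ((μ'.m_congr d₄
        ((G.nat _ _ da).trans ((G.tr_congr _ e₁).trans (te _)))
        ((G.nat _ _ de).trans ((G.tr_congr _ e₂).trans (te _)))).trans
        (μ'.m_ptMap (μu' d₂) (pnt b ≫ w) _))
    exact ((G.nat _ _ dm).trans ((G.tr_congr _ r₁).trans (tε _ _))).trans r₂.symm)
  have main : ∀ᶠ y in 𝓝 y₀, G.φ (L.mul (p₁ y) (p₂ y)) = L'.mul (G.φ (p₁ y)) (G.φ (p₂ y)) :=
    eventually_of_opn hy₀ (key.mono fun s h => by rwa [em', vm, vn] at h)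
  rw [(isInducing_pullVal L.src L.tgt L.tgt_subm).nhds_eq_comap, Filter.eventually_comap] at main
  exact main.mono fun p hP h => hP (pullMk _ _ L.tgt_subm p.1 p.2 h) rfl

end Germ

lemma Mfd.exists_openPartialHomeomorph {N N' : Mfd} {φ : N → N'} {O : Set N} (hO : IsOpen O)
    (inj : Set.InjOn φ O) (h : ∀ g ∈ O, IsLocalDiffeomorphAt N.I N'.I ∞ φ g) (r : N' → N) :
    ∃ Φ : OpenPartialHomeomorph N N', Φ.source = O ∧ Φ.target = φ '' O ∧ (∀ g, Φ g = φ g) ∧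
      ContMDiffOn N.I N'.I ∞ Φ Φ.source ∧ ContMDiffOn N'.I N.I ∞ Φ.symm Φ.target := by
  have ex : ∀ n', ∃ g, n' ∈ φ '' O → g ∈ O ∧ φ g = n' := fun n' => by
    by_cases hn : n' ∈ φ '' O
    · obtain ⟨g, hg⟩ := hn
      exact ⟨g, fun _ => hg⟩
    · exact ⟨r n', fun k => absurd k hn⟩
  choose ψ hψ using ex
  have key : ∀ g ∈ O, φ '' O ∈ 𝓝 (φ g) ∧ ContMDiffAt N'.I N.I ∞ ψ (φ g) := fun g hg => by
    obtain ⟨Φ, hs, hΦ⟩ := h g hg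
    have e : φ g = Φ g := hΦ hs
    have ht : φ g ∈ Φ.target := e ▸ Φ.map_source hs
    have k : Φ.target ∩ Φ.symm ⁻¹' O ∈ 𝓝 (φ g) :=
      ((Φ.contMDiffOn_invFun.continuousOn.isOpen_inter_preimage Φ.open_target hO).mem_nhds ⟨ht, by
        change Φ.symm (φ g) ∈ O
        rw [e]
        exact (Φ.left_inv hs).symm ▸ hg⟩)
    have k' : ∀ n' ∈ Φ.target ∩ Φ.symm ⁻¹' O, φ (Φ.symm n') = n' := fun n' hn =>
      (hΦ (Φ.map_target hn.1)).trans (Φ.right_inv hn.1)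
    refine ⟨Filter.mem_of_superset k fun n' hn => ⟨_, hn.2, k' n' hn⟩, ?_⟩
    refine (Φ.contMDiffOn_invFun.contMDiffAt (Φ.open_target.mem_nhds ht)).congr_of_eventuallyEq ?_
    filter_upwards [k] with n' hn
    have h1 := hψ n' ⟨_, hn.2, k' n' hn⟩
    exact inj h1.1 hn.2 (h1.2.trans (k' n' hn).symm)
  have sm : ContMDiffOn N.I N'.I ∞ φ O := fun g hg => (h g hg).contMDiffAt.contMDiffWithinAt
  have sm' : ContMDiffOn N'.I N.I ∞ ψ (φ '' O) := by
    rintro _ ⟨g, hg, rfl⟩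
    exact (key g hg).2.contMDiffWithinAt
  exact ⟨{ toFun := φ, invFun := ψ, source := O, target := φ '' O
           map_source' := fun g hg => ⟨g, hg, rfl⟩
           map_target' := fun n' hn => (hψ n' hn).1
           left_inv' := fun g hg => inj (hψ _ ⟨g, hg, rfl⟩).1 hg (hψ _ ⟨g, hg, rfl⟩).2
           right_inv' := fun n' hn => (hψ n' hn).2
           open_source := hO
           open_target := isOpen_iff_mem_nhds.2 (by
             rintro _ ⟨g, hg, rfl⟩
             exact (key g hg).1)
           continuousOn_toFun := sm.continuousOn
           continuousOn_invFun := sm'.continuousOn }, rfl, rfl, fun _ => rfl, sm, sm'⟩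

namespace Germ

variable {M N N' : Mfd} {Γ : WeinsteinGroupoid.{v, u} M} {L : LocalLieGroupoid M N}
  {L' : LocalLieGroupoid M N'} {j : rep N ⥤ᵇ Γ.stk} {j' : rep N' ⥤ᵇ Γ.stk}
  {c : Presents Γ (𝟙 M) L j} {c' : Presents Γ (𝟙 M) L' j'} (G : Germ c c')

lemma eventually_inv (hj' : IsEtChart j') (x : M) :
    ∀ᶠ g in 𝓝 (L.unit x), G.φ (L.inv g) = L'.inv (G.φ g) := by
  have hi : Tendsto L.inv (𝓝 (L.unit x)) (𝓝 (L.unit x)) := by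
    have h := (continuous L.inv).tendsto (L.unit x)
    rwa [L.inv_unit] at h
  have hφ : Tendsto G.φ (𝓝 (L.unit x)) (𝓝 (L'.unit x)) := by
    have h := (G.smoothAt (G.mem x)).continuousAt.tendsto
    rwa [G.φ_unit] at h
  have hO := G.O.isOpen.mem_nhds (G.mem x)
  have hd := hφ (L'.dom.isOpen.mem_nhds (L'.unit_mem x))
  filter_upwards [(hi.prodMk_nhds tendsto_id).eventually
    (G.eventually_mul hj' (fun _ _ h => h) x), hO, hi hO, hd, hi hd,
    L.dom.isOpen.mem_nhds (L.unit_mem x)] with g h1 h2 h3 h4 h5 h6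
  have h1 : G.φ (L.mul (L.inv g) g) = L'.mul (G.φ (L.inv g)) (G.φ g) := h1 (L.src_inv g)
  obtain ⟨s, t⟩ : L'.src (G.φ g) = L.src g ∧ L'.tgt (G.φ g) = L.tgt g := G.src_φ h2
  obtain ⟨s', t'⟩ : L'.src (G.φ (L.inv g)) = L.src (L.inv g) ∧ L'.tgt (G.φ (L.inv g)) = L.tgt (L.inv g) :=
    G.src_φ h3
  rw [L.inv_mul g h6, G.φ_unit] at h1
  have e := L'.assoc _ h5 _ h4 _ (L'.inv_mem _ h4) (by rw [s', t, L.src_inv]) (L'.tgt_inv _).symm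
    (h1 ▸ L'.unit_mem _) (by rw [L'.mul_inv _ h4]; exact L'.unit_mem _)
  rw [← h1, L'.mul_inv _ h4, t, ← L.src_inv, ← s', L'.mul_unit _ h5] at e
  rw [← e]
  have e2 := L'.unit_mul _ (L'.inv_mem _ h4)
  rwa [L'.tgt_inv, s] at e2

lemma exists_localIso [T2Space M] [ParacompactSpace M] (hj : IsEtChart j) (hj' : IsEtChart j') :
    Nonempty (LocalIso c c') := by
  have hfib := Γ.fibred
  have cs := continuous L.src
  have ct := continuous L.tgt
  have ci := continuous L.inv
  obtain ⟨G⟩ : Nonempty (Germ c c') := Germ.exists_germ hj'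
  choose U oU mU iU using fun x => (G.isLocalDiffeomorphAt hj hj' (G.mem x)).exists_injOn
  obtain ⟨D₁, oD₁, mD₁, hD₁⟩ := NearSection.exists_tube cs ct (continuous L.unit) L.src_unit
    L.tgt_unit oU mU
  let E : Set N := (D₁ ∩ L.inv ⁻¹' D₁) ∩ G.O
  have oE : IsOpen E := (oD₁.inter (oD₁.preimage ci)).inter G.O.isOpen
  have mE : ∀ x, L.unit x ∈ E := fun x => ⟨⟨mD₁ x, by
    change L.inv (L.unit x) ∈ D₁
    rw [L.inv_unit]; exact mD₁ x⟩, G.mem x⟩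
  have hinj : Set.InjOn G.φ E := fun g hg h hh e => by
    have hs : L.src g = L.src h := by
      have h1 := (G.src_φ hg.2).1
      rw [e, (G.src_φ hh.2).1] at h1
      exact h1.symm
    obtain ⟨x, h1, -, h2⟩ := hD₁ g hg.1.1 _ hh.1.2 h hh.1.1 (hs.trans (L.tgt_inv h).symm) (L.src_inv h)
    exact iU x h1 h2 e
  have hR : ∀ x, ∃ Q : Set N, IsOpen Q ∧ L.unit x ∈ Q ∧ ∀ g ∈ Q, ∀ h ∈ Q, (g ∈ E ∧ g ∈ L.dom ∧
      G.φ (L.inv g) = L'.inv (G.φ g)) ∧ (L.src g = L.tgt h → L.mul g h ∈ E ∧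
      G.φ (L.mul g h) = L'.mul (G.φ g) (G.φ h)) := fun x => by
    have hb : L.src (L.unit x) = L.tgt (L.unit x) := (L.src_unit x).trans (L.tgt_unit x).symm
    have ue : L.mul (L.unit x) (L.unit x) = L.unit x := by
      simpa [L.tgt_unit] using L.unit_mul (L.unit x) (L.unit_mem x)
    have h1 := eventually_nhdsWithin_iff.1 ((L.mul_smooth.continuousOn (L.unit x, L.unit x)
      ⟨L.unit_mem x, L.unit_mem x, hb⟩).eventually (p := (· ∈ E)) (oE.mem_nhds (by
        change L.mul (L.unit x) (L.unit x) ∈ E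
        rw [ue]; exact mE x)))
    have hd : ∀ᶠ g in 𝓝 (L.unit x), g ∈ L.dom := L.dom.isOpen.mem_nhds (L.unit_mem x)
    have h2 : ∀ᶠ g in 𝓝 (L.unit x), g ∈ E := oE.mem_nhds (mE x)
    have h3 := (h1.and (G.eventually_mul hj' (fun _ _ h => h) x)).and
      ((((h2.and hd).and (G.eventually_inv hj' x)).prod_inl_nhds (L.unit x)).and
        (hd.prod_inr_nhds (L.unit x)))
    rw [nhds_prod_eq, Filter.eventually_prod_self_iff'] at h3
    obtain ⟨t, ht, h4⟩ := h3
    obtain ⟨Q, hQ, oQ, mQ⟩ := mem_nhds_iff.1 ht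
    exact ⟨Q, oQ, mQ, fun g hg h hh => by
      obtain ⟨⟨a1, a2⟩, ⟨⟨a3, a4⟩, a5⟩, a6⟩ := h4 g (hQ hg) h (hQ hh)
      exact ⟨⟨a3, a4, a5⟩, fun e => ⟨a1 ⟨a4, a6, e⟩, a2 e⟩⟩⟩
  choose Q oQ mQ hQ using hR
  obtain ⟨D₂, oD₂, mD₂, hD₂⟩ := NearSection.exists_tube cs ct (continuous L.unit) L.src_unit
    L.tgt_unit oQ mQ
  let O : Set N := D₂ ∩ L.inv ⁻¹' D₂
  have mO : ∀ x, L.unit x ∈ O := fun x => ⟨mD₂ x, by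
    change L.inv (L.unit x) ∈ D₂
    rw [L.inv_unit]; exact mD₂ x⟩
  have iO : ∀ g ∈ O, L.inv g ∈ O := fun g hg => ⟨hg.2, by
    change L.inv (L.inv g) ∈ D₂
    rw [L.inv_inv]; exact hg.1⟩
  have p₁ : ∀ g ∈ O, g ∈ E ∧ g ∈ L.dom ∧ G.φ (L.inv g) = L'.inv (G.φ g) := fun g hg => by
    obtain ⟨x, h1, -⟩ := hD₂ g hg.1 _ hg.2 g hg.1 (L.tgt_inv g).symm (L.src_inv g)
    exact (hQ x g h1 g h1).1
  have p₂ : ∀ g ∈ O, ∀ h ∈ O, L.src g = L.tgt h → L.mul g h ∈ E ∧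
      G.φ (L.mul g h) = L'.mul (G.φ g) (G.φ h) := fun g hg h hh e => by
    obtain ⟨x, h1, h2, -⟩ := hD₂ g hg.1 h hh.1 _ hh.2 e (L.tgt_inv h).symm
    exact (hQ x g h1 h h2).2 e
  obtain ⟨Φ, hs, ht, hΦ, sm, sm'⟩ := Mfd.exists_openPartialHomeomorph (oD₂.inter (oD₂.preimage ci))
    (hinj.mono fun g hg => (p₁ g hg).1) (fun g hg => G.isLocalDiffeomorphAt hj hj' (p₁ g hg).1.2)
    fun n' => L.unit (L'.src n')
  have mem : ∀ g, g ∈ Φ.source ↔ g ∈ O := fun g => by rw [hs]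
  have inO : ∀ {S : Mfd} (a : S ⟶ N), (∀ x, a x ∈ Φ.source) → InD (G.O : Set N) (univ j a) :=
    fun a ha => G.inD_univ fun s => (p₁ _ ((mem _).1 (ha s))).1.2
  have hiso : ∀ {S : Mfd} (a : S ⟶ N) (ha : ∀ x, a x ∈ Φ.source), ∃ χ : j.obj (pt a) ⟶
      j'.obj (pt (compOn Φ sm a ha)), Γ.stk.Lifts (𝟙 S) χ ∧
      χ ≫ univ j' (compOn Φ sm a ha) = G.tr (univ j a) (inO a ha) := fun {S} a ha => by
    obtain ⟨b₀, hb, eb⟩ := G.lift (inO a ha) (univ_lift j a)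
    have e : b₀ = compOn Φ sm a ha := by
      ext s
      exact (eb s).trans (hΦ _).symm
    exact hfib.exists_vlift (e ▸ hb) (univ_lift j' _)
  choose iso iso_lift iso_fac using @hiso
  refine ⟨{ map := Φ, smooth := sm, smooth_symm := sm'
            src := fun g hg => by rw [hΦ]; exact (G.src_φ (p₁ g ((mem _).1 hg)).1.2).1
            tgt := fun g hg => by rw [hΦ]; exact (G.src_φ (p₁ g ((mem _).1 hg)).1.2).2
            unit_mem := fun b b' _ => (mem _).2 (mO b)
            unit := fun b b' e => by
              rw [hΦ, G.φ_unit]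
              exact congrArg L'.unit e
            inv_mem := fun g hg => (mem _).2 (iO g ((mem _).1 hg))
            inv := fun g hg => by rw [hΦ, hΦ]; exact (p₁ g ((mem _).1 hg)).2.2
            mul_mem := fun g hg h hh _ _ _ _ e => ?_
            mul := fun g hg h hh _ _ _ _ e _ => by
              rw [hΦ, hΦ, hΦ]; exact (p₂ g ((mem _).1 hg) h ((mem _).1 hh) e).2
            iso := iso
            iso_lift := iso_lift
            iso_nat := ?_
            iso_unit := ?_ }⟩
  · obtain ⟨h1, h2⟩ := p₂ g ((mem _).1 hg) h ((mem _).1 hh) e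
    rw [ht, hΦ, hΦ, ← h2, mem]
    refine ⟨fun k => ⟨_, k, rfl⟩, ?_⟩
    rintro ⟨k, hk, ek⟩
    exact hinj (p₁ k hk).1 h1 ek ▸ hk
  · intro S T f a ha
    refine hfib.hom_ext f (univ j' _) (lift_comp_id (ptMap_lift j f _) (iso_lift a _))
      (lift_id_comp (iso_lift (f ≫ a) _) (ptMap_lift j' f _)) ?_
    refine (assoc _ _ _).trans ((_ ≫= iso_fac a _).trans
      ((G.nat _ _ _).trans ((G.tr_congr _ (ptMap_univ j f _)).trans ?_)))
    exact ((assoc _ _ _).trans ((_ ≫= ptMap_univ j' f _).trans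
      (iso_fac (f ≫ a) _))).symm
  · intro S b b' hb ha he
    refine hfib.hom_ext (𝟙 S) (c'.eu (pt (b' ≫ 𝟙 M)))
      (lift_id_comp (iso_lift _ _) (lift_id_comp (ptMap_lift j' (𝟙 S) _) (c'.unit_lift b')))
      (lift_id_comp (c.unit_lift b) (ptMap_lift Γ.unit (𝟙 S) _)) ?_
    refine ((assoc _ _ _).trans (congrArg (CategoryStruct.comp _) ((assoc _ _ _).trans
      ((_ ≫= c'.unit_eps b').trans (ptMap_univ j' (𝟙 S) _))))).trans ?_
    refine (iso_fac _ _).trans ((G.tr_unit b _).trans ?_)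
    exact ((assoc _ _ _).trans (c.unit b ≫= (c'.map_eu _))).symm

lemma localIso_unique [T2Space M] [ParacompactSpace M] (hj' : IsEtChart j') (φ ψ : LocalIso c c') :
    ∃ O : Opens N, (∀ x, L.unit x ∈ O) ∧ (O : Set N) ⊆ φ.map.source ∩ ψ.map.source ∧
      Set.EqOn φ.map ψ.map O := by
  obtain ⟨G⟩ : Nonempty (Germ c c') := Germ.exists_germ hj'
  obtain ⟨G'⟩ : Nonempty (Germ c' c') := Germ.exists_germ hj'
  refine ⟨⟨interior {g | g ∈ φ.map.source ∩ ψ.map.source ∧ φ.map g = ψ.map g}, isOpen_interior⟩,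
    fun x => mem_interior_iff_mem_nhds.2 ?_, fun g hg => (interior_subset hg).1,
    fun g hg => (interior_subset hg).2⟩
  obtain ⟨U, oU, mU, iU⟩ := (G'.isLocalDiffeomorphAt hj' hj' (G'.mem x)).exists_injOn
  have cts : ∀ T : LocalIso c c', ∀ᶠ g in 𝓝 (L.unit x), g ∈ T.map.source ∧ T.map g ∈ U := fun T => by
    have h1 := T.unit_mem x x rfl
    exact (show ∀ᶠ g in 𝓝 (L.unit x), g ∈ T.map.source from T.map.open_source.mem_nhds h1).and
      ((T.map.continuousAt h1).eventually (oU.mem_nhds (by rw [T.unit x x rfl]; exact mU)))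
  filter_upwards [cts φ, cts ψ, G.eventually_localIso G' hj' φ rfl,
    G.eventually_localIso G' hj' ψ rfl] with g h1 h2 h3 h4
  exact ⟨⟨h1.1, h2.1⟩, iU h1.2 h2.2 (h3.trans h4.symm)⟩

end Germ

section Calculus

variable {E₁ H₁ E₂ H₂ E₃ H₃ : Type*} [NormedAddCommGroup E₁] [NormedSpace ℝ E₁]
  [TopologicalSpace H₁] {I₁ : ModelWithCorners ℝ E₁ H₁} [NormedAddCommGroup E₂] [NormedSpace ℝ E₂]
  [TopologicalSpace H₂] {I₂ : ModelWithCorners ℝ E₂ H₂} [NormedAddCommGroup E₃] [NormedSpace ℝ E₃]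
  [TopologicalSpace H₃] {I₃ : ModelWithCorners ℝ E₃ H₃}
  {S P Q : Type*} [TopologicalSpace S] [ChartedSpace H₁ S]
  [TopologicalSpace P] [ChartedSpace H₂ P]
  [TopologicalSpace Q] [ChartedSpace H₃ Q]

lemma ContMDiffAt.mfderiv_section [IsManifold I₁ ∞ S] [IsManifold I₂ ∞ P] [IsManifold I₃ ∞ Q]
    {f : S → P → Q} {g : S → P} {v : ∀ x, TangentSpace I₂ (g x)} {x₀ : S}
    (hf : ContMDiffAt (I₁.prod I₂) I₃ ∞ (Function.uncurry f) (x₀, g x₀))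
    (hv : ContMDiffAt I₁ I₂.tangent ∞ (fun x => (⟨g x, v x⟩ : TangentBundle I₂ P)) x₀) :
    ContMDiffAt I₁ I₃.tangent ∞
      (fun x => (⟨f x (g x), mfderiv I₂ I₃ (f x) (g x) (v x)⟩ : TangentBundle I₃ Q)) x₀ := by
  have hg : ContMDiffAt I₁ I₂ ∞ g x₀ :=
    ((Bundle.contMDiff_proj (TangentSpace I₂ : P → Type _)).contMDiffAt).comp x₀ hv
  have : IsManifold I₂ 1 P := .of_le (n := ∞) (by simp)
  have : IsManifold I₃ 1 Q := .of_le (n := ∞) (by simp)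
  have h := ContMDiffAt.mfderiv (m := ∞) f g hf hg (by simp)
  exact ContMDiffAt.clm_apply_of_inCoordinates (v := v) h hv
    (hf.comp (f := fun x => (x, g x)) x₀ (contMDiffAt_id.prodMk hg))

lemma tangentBundle_mk_eq {x x' : P} (h : x = x') (y : TangentSpace I₂ x)
    (y' : TangentSpace I₂ x') (hy : (show E₂ from y) = y') :
    (⟨x, y⟩ : TangentBundle I₂ P) = ⟨x', y'⟩ := by
  subst h
  exact congrArg _ hy

lemma mfderiv_apply_congr_point (f : P → Q) {x x' : P} (h : x = x') (y : TangentSpace I₂ x) :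
    (mfderiv I₂ I₃ f x y : E₃) = mfderiv I₂ I₃ f x' y := by
  subst h
  rfl

lemma contMDiffAt_tangentBundle_mk_iff {F : Type*} [NormedAddCommGroup F] [NormedSpace ℝ F]
    {g y : S → F} {x₀ : S} (hg : ContMDiffAt I₁ 𝓘(ℝ, F) ∞ g x₀) :
    ContMDiffAt I₁ 𝓘(ℝ, F).tangent ∞ (fun x => (⟨g x, y x⟩ : TangentBundle 𝓘(ℝ, F) F)) x₀ ↔
      ContMDiffAt I₁ 𝓘(ℝ, F) ∞ y x₀ :=
  ⟨fun h => (contMDiff_snd_tangentBundle_modelSpace F 𝓘(ℝ, F)).contMDiffAt.comp x₀ h,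
    fun h => ContMDiffAt.comp x₀ (g := (tangentBundleModelSpaceHomeomorph 𝓘(ℝ, F)).symm)
      (contMDiff_tangentBundleModelSpaceHomeomorph_symm (n := ∞)).contMDiffAt (hg.prodMk_space h)⟩

end Calculus

lemma mlieBracket_of_related {F : Type*} [NormedAddCommGroup F] [NormedSpace ℝ F] {N : Mfd}
    {f : F → N} {V W : F → F} {X Y : ∀ n : N, TangentSpace N.I n} {x : F}
    (hf : ContMDiffAt 𝓘(ℝ, F) N.I ∞ f x) (hV : DifferentiableAt ℝ V x)
    (hW : DifferentiableAt ℝ W x)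
    (hX : MDifferentiableAt N.I N.I.tangent (fun n => (⟨n, X n⟩ : TangentBundle N.I N)) (f x))
    (hY : MDifferentiableAt N.I N.I.tangent (fun n => (⟨n, Y n⟩ : TangentBundle N.I N)) (f x))
    (hVX : ∀ᶠ v in 𝓝 x, mfderiv 𝓘(ℝ, F) N.I f v (V v) = X (f v))
    (hWY : ∀ᶠ v in 𝓝 x, mfderiv 𝓘(ℝ, F) N.I f v (W v) = Y (f v)) :
    VectorField.mlieBracket N.I X Y (f x) =
      mfderiv 𝓘(ℝ, F) N.I f x (VectorField.lieBracket (E := F) ℝ V W x) := by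
  have : IsManifold N.I 2 N := .of_le (n := ∞) ENat.LEInfty.out
  have : IsManifold N.I 1 N := .of_le (n := ∞) (by simp)
  set κ := extChartAt N.I (f x)
  let Z : (∀ n : N, TangentSpace N.I n) → 𝔼 N.dim → 𝔼 N.dim := fun X =>
    VectorField.mpullbackWithin 𝓘(ℝ, 𝔼 N.dim) N.I κ.symm X (range N.I)
  have hZ : ∀ X : (∀ n : N, TangentSpace N.I n),
      MDifferentiableAt N.I N.I.tangent (fun n => (⟨n, X n⟩ : TangentBundle N.I N)) (f x) →
      DifferentiableAt ℝ (Z X) (κ (f x)) := fun X hX => by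
    refine DifferentiableWithinAt.differentiableAt (MDifferentiableWithinAt.differentiableWithinAt_mpullbackWithin_vectorField
      (s := Set.univ) hX.mdifferentiableWithinAt) ?_
    simp
  have hκ : ∀ᶠ v in 𝓝 x, f v ∈ κ.source :=
    hf.continuousAt.preimage_mem_nhds (extChartAt_source_mem_nhds (f x))
  have hfv : ∀ᶠ v in 𝓝 x, ContMDiffAt 𝓘(ℝ, F) N.I 1 f v :=
    (contMDiffAt_iff_contMDiffAt_nhds (by simp)).1 (hf.of_le (by simp))
  let fc : F → 𝔼 N.dim := fun v => κ (f v)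
  have hfc : ContDiffAt ℝ ∞ fc x := contMDiffAt_iff_contDiffAt.1
    ((contMDiffAt_extChartAt (x := f x)).comp x hf)
  have hd : ∀ᶠ v in 𝓝 x, ∀ y : F, fderiv ℝ fc v y =
      mfderiv N.I 𝓘(ℝ, 𝔼 N.dim) κ (f v) (mfderiv 𝓘(ℝ, F) N.I f v y) := by
    filter_upwards [hκ, hfv] with v hv hv' y
    rw [← mfderiv_eq_fderiv]
    have := mfderiv_comp v (mdifferentiableAt_extChartAt (x := f x)
      (by simpa [κ, extChartAt_source] using hv)) (hv'.mdifferentiableAt one_ne_zero)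
    exact congrArg (fun T => T y) this
  have hr : ∀ (V : F → F) (X : ∀ n : N, TangentSpace N.I n),
      (∀ᶠ v in 𝓝 x, mfderiv 𝓘(ℝ, F) N.I f v (V v) = X (f v)) →
      (fun v => fderiv ℝ fc v (V v)) =ᶠ[𝓝 x] fun v => Z X (fc v) := fun V X h => by
    filter_upwards [hκ, hd, h] with v hv hdv hXv
    rw [hdv, hXv]
    have h1 : κ.symm (κ (f v)) = f v := κ.left_inv hv
    have h2 : (show 𝔼 N.dim from X (κ.symm (κ (f v)))) = X (f v) := by rw [h1]
    refine ((isInvertible_mfderivWithin_extChartAt_symm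
      (κ.map_source hv)).inverse_apply_eq.2 (h2.trans ?_)).symm
    exact (congrArg (fun T => T (X (f v)))
      (mfderivWithin_extChartAt_symm_comp_mfderiv_extChartAt' hv)).symm
  have hX' := (hr V X hVX).fderiv_eq (𝕜 := ℝ)
  have hY' := (hr W Y hWY).fderiv_eq (𝕜 := ℝ)
  have hl := VectorField.fderiv_apply_lieBracket hfc (minSmoothness_of_isRCLikeNormedField.trans_le ENat.LEInfty.out) hW hV
  have hfd : DifferentiableAt ℝ fc x := hfc.differentiableAt (by simp)
  have hcX : fderiv ℝ (fun v => Z X (fc v)) x = (fderiv ℝ (Z X) (fc x)).comp (fderiv ℝ fc x) :=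
    (HasFDerivAt.comp (g := Z X) x (hZ X hX).hasFDerivAt hfd.hasFDerivAt).fderiv
  have hcY : fderiv ℝ (fun v => Z Y (fc v)) x = (fderiv ℝ (Z Y) (fc x)).comp (fderiv ℝ fc x) :=
    (HasFDerivAt.comp (g := Z Y) x (hZ Y hY).hasFDerivAt hfd.hasFDerivAt).fderiv
  have hl' : fderiv ℝ fc x (VectorField.lieBracket ℝ V W x) =
      VectorField.lieBracket ℝ (Z X) (Z Y) (fc x) := by
    rw [hl, hX', hY', hcX, hcY, VectorField.lieBracket_eq]
    simp only [ContinuousLinearMap.comp_apply]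
    exact congrArg₂ (fun a b => fderiv ℝ (Z Y) (fc x) a - fderiv ℝ (Z X) (fc x) b)
      (hr V X hVX).self_of_nhds (hr W Y hWY).self_of_nhds
  rw [← VectorField.mlieBracketWithin_univ, VectorField.mlieBracketWithin_apply]
  have hi : (mfderiv N.I 𝓘(ℝ, 𝔼 N.dim) κ (f x)).IsInvertible :=
    isInvertible_mfderiv_extChartAt (mem_extChartAt_source (f x))
  refine hi.injective ?_
  refine (hi.self_apply_inverse _).trans (.trans ?_ (hl'.symm.trans (hd.self_of_nhds _)))
  change VectorField.lieBracketWithin ℝ (Z X) (Z Y) (κ.symm ⁻¹' Set.univ ∩ range N.I) (fc x) = _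
  rw [ModelWithCorners.range_eq_univ, Set.preimage_univ, Set.univ_inter,
    VectorField.lieBracketWithin_univ]

namespace LocalLieGroupoid

variable {B N : Mfd} (L : LocalLieGroupoid B N)

/-- The model of the source fibres. -/
abbrev Fib (_ : LocalLieGroupoid B N) : Type := 𝔼 (N.dim - B.dim)

/-- A family of charts, centred at the identities, of the source fibres over points near `b₀`. -/
structure FibreChart (b₀ : B) where
  σ : B → L.Fib → N
  h : N → L.Fib
  W : Opens (B × L.Fib)
  mem : (b₀, 0) ∈ W
  smooth : ∀ p ∈ W, ContMDiffAt (B.I.prod 𝓘(ℝ, L.Fib)) N.I ∞ (Function.uncurry σ) p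
  h_smooth : ∀ p ∈ W, ContMDiffAt N.I 𝓘(ℝ, L.Fib) ∞ h (σ p.1 p.2)
  σ_zero : ∀ b, (b, 0) ∈ W → σ b 0 = L.unit b
  src_σ : ∀ p ∈ W, L.src (σ p.1 p.2) = p.1
  h_σ : ∀ p ∈ W, h (σ p.1 p.2) = p.2
  σ_h : ∀ p ∈ W, ∀ᶠ n in 𝓝 (σ p.1 p.2), σ (L.src n) (h n) = n

lemma exists_fibreChart (b₀ : B) : Nonempty (L.FibreChart b₀) := by
  obtain ⟨Φ, h₀, hΦ, hs, hs'⟩ := exists_submersion_chart L.src L.src_subm (L.unit b₀)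
  have hu : ∀ b, L.unit b ∈ Φ.source → ContMDiffAt B.I (B.I.prod 𝓘(ℝ, L.Fib)) ∞
      (fun b => Φ (L.unit b)) b := fun b hb =>
    (hs.contMDiffAt (Φ.open_source.mem_nhds hb)).comp b (smooth L.unit).contMDiffAt
  let τ : B × L.Fib → B × L.Fib := fun p => (p.1, (Φ (L.unit p.1)).2 + p.2)
  have hτ : ∀ p : B × L.Fib, L.unit p.1 ∈ Φ.source →
      ContMDiffAt (B.I.prod 𝓘(ℝ, L.Fib)) (B.I.prod 𝓘(ℝ, L.Fib)) ∞ τ p := fun p hp =>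
    contMDiffAt_fst.prodMk (((hu p.1 hp).comp p contMDiffAt_fst).snd.add contMDiffAt_snd)
  have hunit : ∀ b, L.unit b ∈ Φ.source → Φ (L.unit b) = τ (b, 0) := fun b hb =>
    Prod.ext ((hΦ _ hb).trans (L.src_unit b)) (add_zero _).symm
  have ho : IsOpen {p : B × L.Fib | L.unit p.1 ∈ Φ.source ∧ τ p ∈ Φ.target} :=
    isOpen_iff_mem_nhds.2 fun p hp => inter_mem
      (((continuous L.unit).comp continuous_fst).continuousAt.preimage_mem_nhds
        (Φ.open_source.mem_nhds hp.1))
      ((hτ p hp.1).continuousAt.preimage_mem_nhds (Φ.open_target.mem_nhds hp.2))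
  have hsrc : ∀ p : B × L.Fib, τ p ∈ Φ.target → L.src (Φ.symm (τ p)) = p.1 := fun p hp => by
    rw [← hΦ _ (Φ.map_target hp), Φ.right_inv hp]
  refine ⟨⟨fun b v => Φ.symm (τ (b, v)), fun n => (Φ n).2 - (Φ (L.unit (L.src n))).2, ⟨_, ho⟩,
    ⟨h₀, hunit b₀ h₀ ▸ Φ.map_source h₀⟩, fun p hp => ?_, fun p hp => ?_, fun b hb => ?_,
    fun p hp => hsrc p hp.2, fun p hp => ?_, fun p hp => ?_⟩⟩
  · exact (hs'.contMDiffAt (Φ.open_target.mem_nhds hp.2)).comp p (hτ p hp.1)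
  · have := (hu _ ((hsrc p hp.2).symm ▸ hp.1)).comp _ (smooth L.src).contMDiffAt
    exact (hs.contMDiffAt (Φ.open_source.mem_nhds (Φ.map_target hp.2))).snd.sub this.snd
  · rw [← hunit b hb.1, Φ.left_inv hb.1]
  · have := hsrc p hp.2
    change (Φ (Φ.symm (τ p))).2 - (Φ (L.unit (L.src (Φ.symm (τ p))))).2 = p.2
    rw [this, Φ.right_inv hp.2]
    exact add_sub_cancel_left _ _
  · filter_upwards [Φ.open_source.mem_nhds (Φ.map_target hp.2)] with n hn
    have : τ (L.src n, (Φ n).2 - (Φ (L.unit (L.src n))).2) = Φ n :=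
      Prod.ext (hΦ n hn).symm (add_sub_cancel _ _)
    change Φ.symm (τ _) = n
    rw [this, Φ.left_inv hn]

namespace FibreChart

variable {L} {b₀ : B} (C : L.FibreChart b₀)

/-- The base of a family of charts. -/
def O : Opens B := ⟨{b | (b, 0) ∈ C.W}, C.W.2.preimage (by fun_prop)⟩

lemma eventually_mem {b : B} (hb : b ∈ C.O) : ∀ᶠ v in 𝓝 (0 : L.Fib), (b, v) ∈ C.W :=
  (C.W.2.preimage (f := fun v : L.Fib => (b, v)) (by fun_prop)).mem_nhds hb

lemma σ_smooth {p : B × L.Fib} (hp : p ∈ C.W) : ContMDiffAt 𝓘(ℝ, L.Fib) N.I ∞ (C.σ p.1) p.2 :=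
  (C.smooth p hp).comp (f := fun v : L.Fib => (p.1, v)) p.2 (contMDiffAt_const.prodMk contMDiffAt_id)

lemma tendsto_σ {b : B} (hb : b ∈ C.O) : Tendsto (C.σ b) (𝓝 0) (𝓝 (L.unit b)) :=
  C.σ_zero b hb ▸ (C.σ_smooth (p := (b, 0)) hb).continuousAt

lemma mfderiv_h_σ {p : B × L.Fib} (hp : p ∈ C.W) (y : L.Fib) :
    mfderiv N.I 𝓘(ℝ, L.Fib) C.h (C.σ p.1 p.2) (mfderiv 𝓘(ℝ, L.Fib) N.I (C.σ p.1) p.2 y) = y := by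
  have h := mfderiv_comp p.2 ((C.h_smooth p hp).mdifferentiableAt (by simp))
    ((C.σ_smooth hp).mdifferentiableAt (by simp))
  have h' : C.h ∘ C.σ p.1 =ᶠ[𝓝 p.2] _root_.id := by
    filter_upwards [(C.W.2.preimage (f := fun v : L.Fib => (p.1, v)) (by fun_prop)).mem_nhds hp]
      with v hv using C.h_σ _ hv
  rw [h'.mfderiv_eq, mfderiv_id] at h
  exact (congrArg (fun T => T y) h).symm

lemma mfderiv_src_σ {p : B × L.Fib} (hp : p ∈ C.W) (y : L.Fib) :
    mfderiv N.I B.I L.src (C.σ p.1 p.2) (mfderiv 𝓘(ℝ, L.Fib) N.I (C.σ p.1) p.2 y) = 0 := by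
  have h := mfderiv_comp p.2 (mdifferentiableAt L.src _)
    ((C.σ_smooth hp).mdifferentiableAt (by simp))
  have h' : L.src ∘ C.σ p.1 =ᶠ[𝓝 p.2] fun _ => p.1 := by
    filter_upwards [(C.W.2.preimage (f := fun v : L.Fib => (p.1, v)) (by fun_prop)).mem_nhds hp]
      with v hv using C.src_σ _ hv
  rw [h'.mfderiv_eq, mfderiv_const] at h
  exact (congrArg (fun T => T y) h).symm

lemma mfderiv_σ_h {p : B × L.Fib} (hp : p ∈ C.W) {u : TangentSpace N.I (C.σ p.1 p.2)}
    (hu : mfderiv N.I B.I L.src (C.σ p.1 p.2) u = 0) :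
    mfderiv 𝓘(ℝ, L.Fib) N.I (C.σ p.1) p.2 (mfderiv N.I 𝓘(ℝ, L.Fib) C.h (C.σ p.1 p.2) u) = u := by
  have hh := (C.h_smooth p hp).mdifferentiableAt (by simp)
  have hpair : (fun n => (L.src n, C.h n)) (C.σ p.1 p.2) = p := Prod.ext (C.src_σ p hp) (C.h_σ p hp)
  have hσ := (C.smooth p hp).mdifferentiableAt (by simp)
  have h := mfderiv_comp_of_eq (x := C.σ p.1 p.2) hσ
    ((mdifferentiableAt L.src _).prodMk hh) hpair
  have h' : Function.uncurry C.σ ∘ (fun n => (L.src n, C.h n)) =ᶠ[𝓝 (C.σ p.1 p.2)] _root_.id :=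
    C.σ_h p hp
  rw [h'.mfderiv_eq, mfderiv_id, mfderiv_prodMk (mdifferentiableAt L.src _) hh] at h
  have h2 := mfderiv_comp (f := fun v : L.Fib => (p.1, v)) p.2 hσ
    (mdifferentiableAt_const.prodMk mdifferentiableAt_id)
  rw [mfderiv_prod_right] at h2
  refine (congrArg (fun T => T (mfderiv N.I 𝓘(ℝ, L.Fib) C.h (C.σ p.1 p.2) u)) h2).trans
    (.trans ?_ (congrArg (fun T => T u) h).symm)
  let z : 𝔼 B.dim × L.Fib :=
    (mfderiv N.I B.I L.src (C.σ p.1 p.2) u, mfderiv N.I 𝓘(ℝ, L.Fib) C.h (C.σ p.1 p.2) u)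
  have hz : (0, z.2) = z := Prod.ext hu.symm rfl
  exact (congrArg (mfderiv (B.I.prod 𝓘(ℝ, L.Fib)) N.I (Function.uncurry C.σ) p) hz).trans
    (mfderiv_apply_congr_point _ hpair z).symm

end FibreChart
end LocalLieGroupoid

namespace LocalLieGroupoid

variable {B N : Mfd} (L : LocalLieGroupoid B N)

lemma mfderiv_mul_right {F : Type*} [NormedAddCommGroup F] [NormedSpace ℝ F] {k : F → N} {x : F}
    {g : N} (hk : MDifferentiableAt 𝓘(ℝ, F) N.I k x) (hg : g ∈ L.dom)
    (h : ∀ᶠ v in 𝓝 x, k v ∈ L.dom ∧ L.src (k v) = L.tgt g) (y : F) :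
    mfderiv 𝓘(ℝ, F) N.I (fun v => L.mul (k v) g) x y =
      mfderivWithin N.I N.I (fun h => L.mul h g) {h | h ∈ L.dom ∧ L.src h = L.tgt g} (k x)
        (mfderiv 𝓘(ℝ, F) N.I k x y) := by
  have hm : MDifferentiableWithinAt N.I N.I (fun h => L.mul h g)
      {h | h ∈ L.dom ∧ L.src h = L.tgt g} (k x) := by
    have := (L.mul_smooth (k x, g) ⟨h.self_of_nhds.1, hg, h.self_of_nhds.2⟩).comp
      (s := {h | h ∈ L.dom ∧ L.src h = L.tgt g}) (f := fun h => (h, g)) (k x)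
      (contMDiffAt_id.prodMk contMDiffAt_const).contMDiffWithinAt
      (fun a ha => ⟨ha.1, hg, ha.2⟩)
    exact this.mdifferentiableWithinAt (by simp)
  have := (hm.hasMFDerivWithinAt.comp x (hk.hasMFDerivAt.hasMFDerivWithinAt
    (s := {v | k v ∈ L.dom ∧ L.src (k v) = L.tgt g})) (fun _ hv => hv)).hasMFDerivAt h
  exact congrArg (fun T => T y) this.mfderiv

/-- The right invariant vector field given by tangent vectors at the identities. -/
def ri (e : ∀ b, TangentSpace N.I (L.unit b)) (g : N) : TangentSpace N.I g :=
  mfderivWithin N.I N.I (fun h => L.mul h g) {h | h ∈ L.dom ∧ L.src h = L.tgt g}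
    (L.unit (L.tgt g)) (e (L.tgt g))

/-- Smooth sections of the bundle of vectors at the identities tangent to the source fibres. -/
structure IsSec (e : ∀ b, TangentSpace N.I (L.unit b)) : Prop where
  smooth : ContMDiff B.I N.I.tangent ∞ (fun b => (⟨L.unit b, e b⟩ : TangentBundle N.I N))
  ker : ∀ b, mfderiv N.I B.I L.src (L.unit b) (e b) = 0

variable {L}

namespace FibreChart

variable {b₀ : B} (C : L.FibreChart b₀)

lemma eventually_right {g : N} {b : B} (hb : L.tgt g = b) (hO : b ∈ C.O) :
    ∀ᶠ v in 𝓝 (0 : L.Fib), C.σ b v ∈ L.dom ∧ L.src (C.σ b v) = L.tgt g := by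
  filter_upwards [C.tendsto_σ hO (L.dom.2.mem_nhds (L.unit_mem b)), C.eventually_mem hO] with v h h'
  exact ⟨h, (C.src_σ _ h').trans hb.symm⟩

lemma mul_σ_zero {g : N} {b : B} (hb : L.tgt g = b) (hO : b ∈ C.O) (hg : g ∈ L.dom) :
    L.mul (C.σ b 0) g = g := by
  subst hb
  rw [C.σ_zero _ hO, L.unit_mul g hg]

lemma mfderiv_σ_unit {b : B} (hO : b ∈ C.O) {u : TangentSpace N.I (L.unit b)}
    (hu : mfderiv N.I B.I L.src (L.unit b) u = 0) :
    mfderiv 𝓘(ℝ, L.Fib) N.I (C.σ b) 0 (mfderiv N.I 𝓘(ℝ, L.Fib) C.h (L.unit b) u) = u := by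
  have h := C.σ_zero b hO
  exact (congrArg _ (mfderiv_apply_congr_point _ h.symm u)).trans
    (C.mfderiv_σ_h (p := (b, 0)) hO ((mfderiv_apply_congr_point _ h u).trans hu))

lemma ri_eq {g : N} {b : B} (hb : L.tgt g = b) (hO : b ∈ C.O) (hg : g ∈ L.dom)
    {e : ∀ b, TangentSpace N.I (L.unit b)} (he : mfderiv N.I B.I L.src (L.unit b) (e b) = 0) :
    L.ri e g = mfderiv 𝓘(ℝ, L.Fib) N.I (fun v => L.mul (C.σ b v) g) 0
      (mfderiv N.I 𝓘(ℝ, L.Fib) C.h (L.unit b) (e b)) := by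
  subst hb
  refine .symm ((L.mfderiv_mul_right ((C.σ_smooth (p := (_, 0)) hO).mdifferentiableAt (by simp)) hg
    (C.eventually_right rfl hO) _).trans ?_)
  rw [C.mfderiv_σ_unit hO he]
  change mfderivWithin N.I N.I (fun h => L.mul h g) _ (C.σ (L.tgt g) 0) _ = _
  rw [C.σ_zero _ hO]
  rfl

lemma smooth_mul {g : N} (hg : g ∈ L.dom) {v : L.Fib} (hv : (L.tgt g, v) ∈ C.W)
    (hd : C.σ (L.tgt g) v ∈ L.dom) : ContMDiffAt (N.I.prod 𝓘(ℝ, L.Fib)) N.I ∞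
      (Function.uncurry fun g v => L.mul (C.σ (L.tgt g) v) g) (g, v) := by
  have hc : ContMDiffAt (N.I.prod 𝓘(ℝ, L.Fib)) (N.I.prod N.I) ∞
      (fun p : N × L.Fib => (C.σ (L.tgt p.1) p.2, p.1)) (g, v) :=
    ContMDiffAt.prodMk (ContMDiffAt.comp (g, v) (f := fun p : N × L.Fib => (L.tgt p.1, p.2))
      (C.smooth (L.tgt g, v) hv) ((((Mfd.smooth L.tgt).comp contMDiff_fst).prodMk
        contMDiff_snd).contMDiffAt)) contMDiffAt_fst
  have hn : (fun p : N × L.Fib => (C.σ (L.tgt p.1) p.2, p.1)) ⁻¹'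
      {p | p.1 ∈ L.dom ∧ p.2 ∈ L.dom ∧ L.src p.1 = L.tgt p.2} ∈ 𝓝 (g, v) := by
    filter_upwards [hc.continuousAt.fst (L.dom.2.mem_nhds hd), continuousAt_fst (L.dom.2.mem_nhds hg),
      (C.W.2.preimage (f := fun p : N × L.Fib => (L.tgt p.1, p.2))
        (((continuous L.tgt).comp continuous_fst).prodMk continuous_snd)).mem_nhds hv]
      with p h h' h''
    exact ⟨h, h', C.src_σ _ h''⟩
  exact ((L.mul_smooth (_, _) ⟨hd, hg, C.src_σ _ hv⟩).comp (g, v) hc.contMDiffWithinAt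
    (Set.mapsTo_preimage _ _)).contMDiffAt hn

lemma smooth_mul_right {g : N} {b : B} (hb : L.tgt g = b) (hO : b ∈ C.O) (hg : g ∈ L.dom) :
    ContMDiffAt 𝓘(ℝ, L.Fib) N.I ∞ (fun v => L.mul (C.σ b v) g) 0 := by
  subst hb
  exact ContMDiffAt.comp 0 (C.smooth_mul hg hO ((C.eventually_right rfl hO).self_of_nhds.1))
    (f := fun v => (g, v)) (contMDiffAt_const.prodMk contMDiffAt_id)

end FibreChart

lemma mfderiv_src_ri {e : ∀ b, TangentSpace N.I (L.unit b)} (he : L.IsSec e) {g : N}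
    (hg : g ∈ L.dom) : mfderiv N.I B.I L.src g (L.ri e g) = 0 := by
  obtain ⟨C⟩ := L.exists_fibreChart (L.tgt g)
  rw [C.ri_eq rfl C.mem hg (he.ker _)]
  have h := mfderiv_comp (0 : L.Fib) (mdifferentiableAt L.src _)
    ((C.smooth_mul_right rfl C.mem hg).mdifferentiableAt (by simp))
  have h' : L.src ∘ (fun v => L.mul (C.σ (L.tgt g) v) g) =ᶠ[𝓝 0] fun _ => L.src g := by
    filter_upwards [C.eventually_right rfl C.mem] with v hv
    exact L.src_mul _ hv.1 g hg hv.2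
  rw [h'.mfderiv_eq, mfderiv_const] at h
  refine (mfderiv_apply_congr_point _ (C.mul_σ_zero rfl C.mem hg).symm _).trans
    (congrArg (fun T => T (mfderiv N.I 𝓘(ℝ, L.Fib) C.h (L.unit (L.tgt g)) (e (L.tgt g)))) h).symm

lemma contMDiffAt_ri {e : ∀ b, TangentSpace N.I (L.unit b)} (he : L.IsSec e) {g : N}
    (hg : g ∈ L.dom) :
    ContMDiffAt N.I N.I.tangent ∞ (fun g => (⟨g, L.ri e g⟩ : TangentBundle N.I N)) g := by
  obtain ⟨C⟩ := L.exists_fibreChart (L.tgt g)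
  have hy : ContMDiffAt N.I 𝓘(ℝ, L.Fib) ∞
      (fun g => mfderiv N.I 𝓘(ℝ, L.Fib) C.h (L.unit (L.tgt g)) (e (L.tgt g))) g := by
    have hh : ContMDiffAt N.I 𝓘(ℝ, L.Fib) ∞ C.h (L.unit (L.tgt g)) :=
      C.σ_zero _ C.mem ▸ C.h_smooth (L.tgt g, 0) C.mem
    have h := ContMDiffAt.mfderiv_section (S := N) (f := fun _ => C.h)
      (hh.comp (g, _) contMDiffAt_snd) (he.smooth.comp (smooth L.tgt)).contMDiffAt
    exact (contMDiffAt_tangentBundle_mk_iff (hh.comp g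
      ((smooth L.unit).comp (smooth L.tgt)).contMDiffAt)).1 h
  have h := ContMDiffAt.mfderiv_section (f := fun g v => L.mul (C.σ (L.tgt g) v) g)
    (g := fun _ => 0) (C.smooth_mul hg C.mem (C.eventually_right rfl C.mem).self_of_nhds.1)
    ((contMDiffAt_tangentBundle_mk_iff contMDiffAt_const).2 hy)
  refine h.congr_of_eventuallyEq ?_
  filter_upwards [L.dom.2.mem_nhds hg,
    (C.O.2.preimage (continuous L.tgt)).mem_nhds (show L.tgt g ∈ C.O from C.mem)] with g' hg' h'
  exact tangentBundle_mk_eq (C.mul_σ_zero rfl h' hg').symm _ _ (C.ri_eq rfl h' hg' (he.ker _))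

lemma ri_unit {e : ∀ b, TangentSpace N.I (L.unit b)} (he : L.IsSec e) (b : B) :
    L.ri e (L.unit b) = e b := by
  obtain ⟨C⟩ := L.exists_fibreChart b
  rw [C.ri_eq (L.tgt_unit b) C.mem (L.unit_mem b) (he.ker _)]
  have h' : (fun v => L.mul (C.σ b v) (L.unit b)) =ᶠ[𝓝 0] C.σ b := by
    filter_upwards [C.eventually_right (L.tgt_unit b) C.mem] with v hv
    have := L.mul_unit _ hv.1
    rwa [hv.2, L.tgt_unit] at this
  rw [h'.mfderiv_eq]
  exact C.mfderiv_σ_unit C.mem (he.ker b)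

end LocalLieGroupoid

namespace LocalLieGroupoid

variable {B N : Mfd} {L : LocalLieGroupoid B N} {e e' : ∀ b, TangentSpace N.I (L.unit b)}

lemma ri_mul (he : L.IsSec e) {n g : N} (hn : n ∈ L.dom) (hg : g ∈ L.dom)
    (h : L.src n = L.tgt g) (hm : L.mul n g ∈ L.dom) :
    L.ri e (L.mul n g) = mfderivWithin N.I N.I (fun h => L.mul h g)
      {h | h ∈ L.dom ∧ L.src h = L.tgt g} n (L.ri e n) := by
  obtain ⟨C⟩ := L.exists_fibreChart (L.tgt n)
  have ht := L.tgt_mul n hn g hg h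
  have h0 := C.mul_σ_zero rfl C.mem hn
  have hs := C.smooth_mul_right rfl C.mem hn
  have hd : ∀ᶠ v in 𝓝 (0 : L.Fib), L.mul (C.σ (L.tgt n) v) n ∈ L.dom :=
    hs.continuousAt.preimage_mem_nhds (L.dom.2.mem_nhds (h0.symm ▸ hn))
  have hr : ∀ᶠ v in 𝓝 (0 : L.Fib), L.mul (C.σ (L.tgt n) v) n ∈ L.dom ∧
      L.src (L.mul (C.σ (L.tgt n) v) n) = L.tgt g := by
    filter_upwards [C.eventually_right rfl C.mem, hd] with v hv hv'
    exact ⟨hv', (L.src_mul _ hv.1 n hn hv.2).trans h⟩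
  rw [C.ri_eq ht C.mem hm (he.ker _), C.ri_eq rfl C.mem hn (he.ker _)]
  have ha : (fun v => L.mul (C.σ (L.tgt n) v) (L.mul n g)) =ᶠ[𝓝 0]
      fun v => L.mul (L.mul (C.σ (L.tgt n) v) n) g := by
    filter_upwards [C.eventually_right rfl C.mem, hd] with v hv hv'
    exact (L.assoc _ hv.1 n hn g hg hv.2 h hv' hm).symm
  rw [ha.mfderiv_eq]
  refine (L.mfderiv_mul_right (hs.mdifferentiableAt (by simp)) hg hr _).trans ?_
  rw [h0]

/-- The bracket of the right invariant vector fields given by `e` and `e'`, at the identities. -/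
def br (L : LocalLieGroupoid B N) (e e' : ∀ b, TangentSpace N.I (L.unit b)) (b : B) :
    TangentSpace N.I (L.unit b) :=
  VectorField.mlieBracket N.I (L.ri e) (L.ri e') (L.unit b)

namespace FibreChart

variable {b₀ : B} (C : L.FibreChart b₀)

/-- The right invariant vector field, in the chart of a source fibre. -/
def ξ (e : ∀ b, TangentSpace N.I (L.unit b)) (b : B) (v : L.Fib) : L.Fib :=
  mfderiv N.I 𝓘(ℝ, L.Fib) C.h (C.σ b v) (L.ri e (C.σ b v))

lemma eventually_dom {b : B} (hO : b ∈ C.O) :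
    ∀ᶠ v in 𝓝 (0 : L.Fib), C.σ b v ∈ L.dom ∧ (b, v) ∈ C.W := by
  filter_upwards [C.eventually_right (L.tgt_unit b) hO, C.eventually_mem hO] with v h h'
  exact ⟨h.1, h'⟩

lemma differentiableAt_ξ (he : L.IsSec e) {b : B} (hO : b ∈ C.O) :
    DifferentiableAt ℝ (C.ξ e b) 0 := by
  have hd := (C.eventually_dom hO).self_of_nhds
  have h := ContMDiffAt.mfderiv_section (S := L.Fib) (I₁ := 𝓘(ℝ, L.Fib)) (f := fun _ => C.h)
    ((C.h_smooth (b, 0) hO).comp (0, C.σ b 0) contMDiffAt_snd)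
    (ContMDiffAt.comp 0 (contMDiffAt_ri he hd.1) (C.σ_smooth (p := (b, 0)) hO))
  exact ((contMDiffAt_tangentBundle_mk_iff ((C.h_smooth (b, 0) hO).comp (0 : L.Fib)
    (C.σ_smooth (p := (b, 0)) hO))).1 h).contDiffAt.differentiableAt (by simp)

lemma mfderiv_σ_ξ (he : L.IsSec e) {b : B} {v : L.Fib} (hd : C.σ b v ∈ L.dom) (hW : (b, v) ∈ C.W) :
    mfderiv 𝓘(ℝ, L.Fib) N.I (C.σ b) v (C.ξ e b v) = L.ri e (C.σ b v) :=
  C.mfderiv_σ_h (p := (b, v)) hW (mfderiv_src_ri he hd)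

lemma br_eq (he : L.IsSec e) (he' : L.IsSec e') {b : B} (hO : b ∈ C.O) :
    L.br e e' b = mfderiv 𝓘(ℝ, L.Fib) N.I (C.σ b) 0
      (VectorField.lieBracket ℝ (C.ξ e b) (C.ξ e' b) 0 : L.Fib) := by
  have hd := (C.eventually_dom hO).self_of_nhds
  have h := mlieBracket_of_related (C.σ_smooth (p := (b, 0)) hO) (C.differentiableAt_ξ he hO)
    (C.differentiableAt_ξ he' hO) ((contMDiffAt_ri he hd.1).mdifferentiableAt (by simp))
    ((contMDiffAt_ri he' hd.1).mdifferentiableAt (by simp))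
    ((C.eventually_dom hO).mono fun v hv => C.mfderiv_σ_ξ he hv.1 hv.2)
    ((C.eventually_dom hO).mono fun v hv => C.mfderiv_σ_ξ he' hv.1 hv.2)
  refine .trans ?_ h
  exact congrArg (fun n => (VectorField.mlieBracket N.I (L.ri e) (L.ri e') n :
    𝔼 N.dim)) (C.σ_zero b hO).symm

end FibreChart

lemma isSec_br (he : L.IsSec e) (he' : L.IsSec e') : L.IsSec (L.br e e') := by
  refine ⟨fun b => ?_, fun b => ?_⟩
  · have : IsManifold N.I ((⊤ : ℕ∞) + 1) N := inferInstanceAs (IsManifold N.I ∞ N)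
    have : IsManifold N.I (minSmoothness ℝ 2) N :=
      .of_le (n := ∞) (minSmoothness_of_isRCLikeNormedField.trans_le ENat.LEInfty.out)
    exact ContMDiffAt.comp b (ContMDiffAt.mlieBracket_vectorField (m := ⊤) (n := ⊤)
      (contMDiffAt_ri he (L.unit_mem b)) (contMDiffAt_ri he' (L.unit_mem b))
      (minSmoothness_of_isRCLikeNormedField.trans_le le_rfl)) (smooth L.unit).contMDiffAt
  · obtain ⟨C⟩ := L.exists_fibreChart b
    rw [C.br_eq he he' C.mem]
    exact (mfderiv_apply_congr_point _ (C.σ_zero b C.mem).symm _).trans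
      (C.mfderiv_src_σ (p := (b, 0)) C.mem _)

lemma ri_br (he : L.IsSec e) (he' : L.IsSec e') {g : N} (hg : g ∈ L.dom) :
    L.ri (L.br e e') g = VectorField.mlieBracket N.I (L.ri e) (L.ri e') g := by
  obtain ⟨C⟩ := L.exists_fibreChart (L.tgt g)
  have h0 := C.mul_σ_zero rfl C.mem hg
  have hs := C.smooth_mul_right rfl C.mem hg
  have hd : ∀ᶠ v in 𝓝 (0 : L.Fib), L.mul (C.σ (L.tgt g) v) g ∈ L.dom :=
    hs.continuousAt.preimage_mem_nhds (L.dom.2.mem_nhds (h0.symm ▸ hg))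
  have hrel : ∀ {e}, L.IsSec e → ∀ᶠ v in 𝓝 (0 : L.Fib),
      mfderiv 𝓘(ℝ, L.Fib) N.I (fun v => L.mul (C.σ (L.tgt g) v) g) v (C.ξ e (L.tgt g) v) =
        L.ri e (L.mul (C.σ (L.tgt g) v) g) := fun {e} he => by
    filter_upwards [(C.eventually_right rfl C.mem).eventually_nhds, hd, C.eventually_dom C.mem]
      with v hv hv' hv''
    rw [ri_mul he hv.self_of_nhds.1 hg hv.self_of_nhds.2 hv', ← C.mfderiv_σ_ξ he hv''.1 hv''.2]
    exact L.mfderiv_mul_right ((C.σ_smooth hv''.2).mdifferentiableAt (by simp)) hg hv _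
  have h := mlieBracket_of_related hs (C.differentiableAt_ξ he C.mem)
    (C.differentiableAt_ξ he' C.mem)
    ((contMDiffAt_ri he (h0.symm ▸ hg)).mdifferentiableAt (by simp))
    ((contMDiffAt_ri he' (h0.symm ▸ hg)).mdifferentiableAt (by simp)) (hrel he) (hrel he')
  have h' : (VectorField.mlieBracket N.I (L.ri e) (L.ri e') g : 𝔼 N.dim) =
      VectorField.mlieBracket N.I (L.ri e) (L.ri e') (L.mul (C.σ (L.tgt g) 0) g) := by rw [h0]
  rw [C.ri_eq rfl C.mem hg ((isSec_br he he').ker _)]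
  refine .trans (congrArg _ ?_) (h'.trans h).symm
  rw [C.br_eq he he' C.mem]
  exact (mfderiv_apply_congr_point _ (C.σ_zero _ C.mem).symm _).trans
    (C.mfderiv_h_σ (p := (_, 0)) C.mem _)

end LocalLieGroupoid

namespace LocalLieGroupoid

variable {B N B' N' : Mfd} {L : LocalLieGroupoid B N} {L' : LocalLieGroupoid B' N'} {w : B ⟶ B'}
  {φ : N → N'}

/-- `φ` is, near the identities, an étale morphism of local groupoids over `w`. -/
structure IsGermHom (L : LocalLieGroupoid B N) (L' : LocalLieGroupoid B' N') (w : B ⟶ B')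
    (φ : N → N') : Prop where
  et : IsEt w
  diffeo : ∀ b, ∀ᶠ g in 𝓝 (L.unit b), IsLocalDiffeomorphAt N.I N'.I ∞ φ g
  unit : ∀ b, φ (L.unit b) = L'.unit (w b)
  base : ∀ b, ∀ᶠ g in 𝓝 (L.unit b), L'.src (φ g) = w (L.src g) ∧ L'.tgt (φ g) = w (L.tgt g)
  mul : ∀ b, ∀ᶠ p : N × N in 𝓝 (L.unit b, L.unit b), L.src p.1 = L.tgt p.2 →
    φ (L.mul p.1 p.2) = L'.mul (φ p.1) (φ p.2)

namespace IsGermHom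

variable (H : IsGermHom L L' w φ)
include H

lemma mfderiv_bijective (b : B) : Function.Bijective (mfderiv N.I N'.I φ (L.unit b)) :=
  ((H.diffeo b).self_of_nhds.mfderivToContinuousLinearEquiv (by simp)).bijective

lemma mfderiv_src_eq_zero_iff (b : B) (u : TangentSpace N.I (L.unit b)) :
    mfderiv N'.I B'.I L'.src (L'.unit (w b)) (mfderiv N.I N'.I φ (L.unit b) u) = 0 ↔
      mfderiv N.I B.I L.src (L.unit b) u = 0 := by
  have h := mfderiv_comp (L.unit b) (mdifferentiableAt L'.src _)
    ((H.diffeo b).self_of_nhds.mdifferentiableAt (by simp))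
  have h' : L'.src ∘ φ =ᶠ[𝓝 (L.unit b)] w ∘ L.src := (H.base b).mono fun g hg => hg.1
  rw [h'.mfderiv_eq, mfderiv_comp _ (mdifferentiableAt w _) (mdifferentiableAt L.src _)] at h
  have h2 : mfderiv N'.I B'.I L'.src (L'.unit (w b)) (mfderiv N.I N'.I φ (L.unit b) u) =
      mfderiv B.I B'.I w (L.src (L.unit b)) (mfderiv N.I B.I L.src (L.unit b) u) :=
    (mfderiv_apply_congr_point _ (H.unit b).symm _).trans (congrArg (fun T => T u) h).symm
  rw [h2]
  exact map_eq_zero_iff (mfderiv B.I B'.I w (L.src (L.unit b))) (IsEt.mfderiv_bijective H.et _).1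

lemma mfderiv_tgt {M : Mfd} (f : B' ⟶ M) (b : B) (u : TangentSpace N.I (L.unit b)) :
    mfderiv N'.I M.I (L'.tgt ≫ f) (L'.unit (w b)) (mfderiv N.I N'.I φ (L.unit b) u) =
      mfderiv N.I M.I (L.tgt ≫ w ≫ f) (L.unit b) u := by
  have h := mfderiv_comp (L.unit b) (mdifferentiableAt (L'.tgt ≫ f) _)
    ((H.diffeo b).self_of_nhds.mdifferentiableAt (by simp))
  have h' : (L'.tgt ≫ f) ∘ φ =ᶠ[𝓝 (L.unit b)] (L.tgt ≫ w ≫ f) :=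
    (H.base b).mono fun g hg => congrArg f hg.2
  rw [h'.mfderiv_eq] at h
  exact (mfderiv_apply_congr_point _ (H.unit b).symm _).trans (congrArg (fun T => T u) h).symm

lemma smooth_iff {e : ∀ b, TangentSpace N.I (L.unit b)} {e' : ∀ b, TangentSpace N'.I (L'.unit b)}
    (he : ∀ b, e' (w b) = mfderiv N.I N'.I φ (L.unit b) (e b)) (b : B) :
    ContMDiffAt B'.I N'.I.tangent ∞ (fun b => (⟨L'.unit b, e' b⟩ : TangentBundle N'.I N')) (w b) ↔
      ContMDiffAt B.I N.I.tangent ∞ (fun b => (⟨L.unit b, e b⟩ : TangentBundle N.I N)) b := by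
  have hc : (fun b => (⟨L'.unit b, e' b⟩ : TangentBundle N'.I N')) ∘ w =
      fun b => ⟨φ (L.unit b), mfderiv N.I N'.I φ (L.unit b) (e b)⟩ :=
    funext fun b => tangentBundle_mk_eq (H.unit b).symm _ _ (he b)
  refine ⟨fun h => ?_, fun h => ?_⟩
  · have hφ := (H.diffeo b).self_of_nhds
    have h1 := h.comp b (smooth w).contMDiffAt
    rw [hc] at h1
    have h2 := ContMDiffAt.mfderiv_section (S := B) (f := fun _ => hφ.localInverse)
      (hφ.localInverse_contMDiffAt.comp (b, φ (L.unit b)) contMDiffAt_snd) h1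
    refine h2.congr_of_eventuallyEq ?_
    filter_upwards [(continuous L.unit).continuousAt.eventually
      (hφ.localInverse_eventuallyEq_left.eventuallyEq_nhds.and (H.diffeo b)),
      (continuous L.unit).continuousAt.preimage_mem_nhds
        (hφ.contMDiffAt.continuousAt.preimage_mem_nhds
        (hφ.localInverse_open_source.mem_nhds hφ.localInverse_mem_source))] with b' hb' hs
    have h3 := mfderiv_comp (L.unit b') ((hφ.localInverse_contMDiffOn.contMDiffAt
      (hφ.localInverse_open_source.mem_nhds hs)).mdifferentiableAt (by simp))
      (hb'.2.mdifferentiableAt (by simp))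
    rw [hb'.1.mfderiv_eq, mfderiv_id] at h3
    exact tangentBundle_mk_eq hb'.1.self_of_nhds.symm _ _ (congrArg (fun T => T (e b')) h3)
  · have h1 := ContMDiffAt.mfderiv_section (S := B) (f := fun _ => φ)
      ((H.diffeo b).self_of_nhds.contMDiffAt.comp (b, L.unit b) contMDiffAt_snd) h
    rw [← hc] at h1
    have hw := H.et b
    refine ((ContMDiffAt.comp_of_eq h1 hw.localInverse_contMDiffAt
      (hw.localInverse_left_inv hw.localInverse_mem_target))).congr_of_eventuallyEq ?_
    filter_upwards [hw.localInverse_eventuallyEq_right] with x hx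
    exact congrArg (fun x => (⟨L'.unit x, e' x⟩ : TangentBundle N'.I N')) hx.symm

lemma eventually_ri {e : ∀ b, TangentSpace N.I (L.unit b)}
    {e' : ∀ b, TangentSpace N'.I (L'.unit b)} (hs : L.IsSec e)
    (he : ∀ b, e' (w b) = mfderiv N.I N'.I φ (L.unit b) (e b)) (b : B) :
    ∀ᶠ g in 𝓝 (L.unit b), L'.ri e' (φ g) = mfderiv N.I N'.I φ g (L.ri e g) := by
  obtain ⟨C⟩ := L.exists_fibreChart b
  have hut : Tendsto (fun g => L.unit (L.tgt g)) (𝓝 (L.unit b)) (𝓝 (L.unit b)) := by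
    have := ((continuous L.unit).comp (continuous L.tgt)).tendsto (L.unit b)
    rwa [Function.comp_apply, L.tgt_unit] at this
  have ht : Tendsto L.tgt (𝓝 (L.unit b)) (𝓝 b) := by
    have := (continuous L.tgt).tendsto (L.unit b)
    rwa [L.tgt_unit] at this
  have hdom : ∀ᶠ g in 𝓝 (L.unit b), φ g ∈ L'.dom :=
    (H.diffeo b).self_of_nhds.contMDiffAt.continuousAt.preimage_mem_nhds
      (L'.dom.2.mem_nhds (H.unit b ▸ L'.unit_mem (w b)))
  filter_upwards [L.dom.2.mem_nhds (L.unit_mem b), hdom, ht (C.O.2.mem_nhds C.mem), H.diffeo b,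
    hut.eventually (H.diffeo b), hut.eventually (hdom.and (H.base b)).eventually_nhds, H.base b,
    (hut.prodMk_nhds tendsto_id).eventually (H.mul b).eventually_nhds]
    with g hg hg' hO hφ hφu hb hbg hm
  have hσ := C.σ_smooth (p := (L.tgt g, 0)) hO
  have h0 := C.σ_zero _ hO
  have hg0 := C.mul_σ_zero rfl hO hg
  have hk : MDifferentiableAt 𝓘(ℝ, L.Fib) N'.I (φ ∘ C.σ (L.tgt g)) 0 :=
    MDifferentiableAt.comp (0 : L.Fib) (h0.symm ▸ hφu.mdifferentiableAt (by simp))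
      (hσ.mdifferentiableAt (by simp))
  have hr : ∀ᶠ v in 𝓝 (0 : L.Fib), φ (C.σ (L.tgt g) v) ∈ L'.dom ∧
      L'.src (φ (C.σ (L.tgt g) v)) = L'.tgt (φ g) := by
    filter_upwards [C.tendsto_σ hO hb, C.eventually_mem hO] with v hv hv'
    exact ⟨hv.1, hv.2.1.trans ((congrArg w (C.src_σ _ hv')).trans hbg.2.symm)⟩
  have hmul : φ ∘ (fun v => L.mul (C.σ (L.tgt g) v) g) =ᶠ[𝓝 0]
      fun v => L'.mul (φ (C.σ (L.tgt g) v)) (φ g) := by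
    filter_upwards [((C.tendsto_σ hO).prodMk_nhds tendsto_const_nhds) hm, C.eventually_mem hO]
      with v hv hv'
    exact hv (C.src_σ _ hv')
  set y := mfderiv N.I 𝓘(ℝ, L.Fib) C.h (L.unit (L.tgt g)) (e (L.tgt g))
  have h1 := mfderiv_comp (0 : L.Fib) (hg0.symm ▸ hφ.mdifferentiableAt (by simp))
    ((C.smooth_mul_right rfl hO hg).mdifferentiableAt (by simp))
  rw [hmul.mfderiv_eq] at h1
  have h2 := L'.mfderiv_mul_right hk hg' hr y
  have h3 : mfderiv 𝓘(ℝ, L.Fib) N'.I (φ ∘ C.σ (L.tgt g)) 0 y = e' (w (L.tgt g)) := by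
    rw [mfderiv_comp (0 : L.Fib) (h0.symm ▸ hφu.mdifferentiableAt (by simp))
      (hσ.mdifferentiableAt (by simp)), he, ← C.mfderiv_σ_unit hO (hs.ker (L.tgt g))]
    exact mfderiv_apply_congr_point _ h0 _
  rw [C.ri_eq rfl hO hg (hs.ker _)]
  refine .trans ?_ (mfderiv_apply_congr_point φ hg0 _)
  refine .trans ?_ (h2.symm.trans (congrArg (fun T => T y) h1))
  rw [h3]
  have h4 : (φ ∘ C.σ (L.tgt g)) 0 = L'.unit (w (L.tgt g)) := (congrArg φ h0).trans (H.unit _)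
  rw [h4, ri, hbg.2]

lemma br_eq {e₁ e₂ : ∀ b, TangentSpace N.I (L.unit b)}
    {e₁' e₂' : ∀ b, TangentSpace N'.I (L'.unit b)} (hs₁ : L.IsSec e₁) (hs₂ : L.IsSec e₂)
    (hs₁' : L'.IsSec e₁') (hs₂' : L'.IsSec e₂')
    (he₁ : ∀ b, e₁' (w b) = mfderiv N.I N'.I φ (L.unit b) (e₁ b))
    (he₂ : ∀ b, e₂' (w b) = mfderiv N.I N'.I φ (L.unit b) (e₂ b)) (b : B) :
    L'.br e₁' e₂' (w b) = mfderiv N.I N'.I φ (L.unit b) (L.br e₁ e₂ b) := by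
  obtain ⟨C⟩ := L.exists_fibreChart b
  have h0 := C.σ_zero b C.mem
  have hσ := C.σ_smooth (p := (b, 0)) C.mem
  have hφ := (H.diffeo b).self_of_nhds
  have h4 : φ (C.σ b 0) = L'.unit (w b) := (congrArg φ h0).trans (H.unit _)
  have hrel : ∀ {e : ∀ b, TangentSpace N.I (L.unit b)} {e' : ∀ b, TangentSpace N'.I (L'.unit b)},
      L.IsSec e → (∀ b, e' (w b) = mfderiv N.I N'.I φ (L.unit b) (e b)) → ∀ᶠ v in 𝓝 (0 : L.Fib),
      mfderiv 𝓘(ℝ, L.Fib) N'.I (φ ∘ C.σ b) v (C.ξ e b v) = L'.ri e' (φ (C.σ b v)) := by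
    intro e e' hs he
    filter_upwards [C.tendsto_σ C.mem (H.eventually_ri hs he b), C.tendsto_σ C.mem (H.diffeo b),
      C.eventually_dom C.mem] with v hv hv' hd
    rw [mfderiv_comp v (hv'.mdifferentiableAt (by simp))
      ((C.σ_smooth hd.2).mdifferentiableAt (by simp))]
    exact (congrArg _ (C.mfderiv_σ_ξ hs hd.1 hd.2)).trans hv.symm
  have hX : ∀ {e'}, L'.IsSec e' → MDifferentiableAt N'.I N'.I.tangent
      (fun n => (⟨n, L'.ri e' n⟩ : TangentBundle N'.I N')) ((φ ∘ C.σ b) 0) := fun h =>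
    (contMDiffAt_ri h (show φ (C.σ b 0) ∈ L'.dom from h4 ▸ L'.unit_mem (w b))).mdifferentiableAt (by simp)
  have h := mlieBracket_of_related (f := φ ∘ C.σ b)
    (ContMDiffAt.comp (0 : L.Fib) (h0.symm ▸ hφ.contMDiffAt) hσ)
    (C.differentiableAt_ξ hs₁ C.mem) (C.differentiableAt_ξ hs₂ C.mem) (hX hs₁') (hX hs₂')
    (hrel hs₁ he₁) (hrel hs₂ he₂)
  rw [mfderiv_comp (0 : L.Fib) (h0.symm ▸ hφ.mdifferentiableAt (by simp))
    (hσ.mdifferentiableAt (by simp))] at h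
  rw [C.br_eq hs₁ hs₂ C.mem]
  have h5 : (L'.br e₁' e₂' (w b) : 𝔼 N'.dim) =
    VectorField.mlieBracket N'.I (L'.ri e₁') (L'.ri e₂') ((φ ∘ C.σ b) 0) :=
    congrArg (fun n => (VectorField.mlieBracket N'.I (L'.ri e₁') (L'.ri e₂') n : 𝔼 N'.dim)) h4.symm
  exact h5.trans (h.trans (mfderiv_apply_congr_point φ h0 _))

end IsGermHom
end LocalLieGroupoid

section

namespace LieAlgebroid

variable {M B N N' : Mfd} {A : LieAlgebroid M} {w : B ⟶ M} {L : LocalLieGroupoid B N}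
  {L' : LocalLieGroupoid M N'} {φ : N → N'}
  {θ : ∀ b : B, A.A (w b) →ₗ[ℝ] TangentSpace N.I (L.unit b)}
  {θ' : ∀ x : M, A.A x →ₗ[ℝ] TangentSpace N'.I (L'.unit x)}

/-- The conditions at `b` on an identification of `A` with the Lie algebroid of `L`, except for the
compatibility with the brackets. -/
structure RealizesAt (A : LieAlgebroid M) (w : B ⟶ M) (L : LocalLieGroupoid B N)
    (θ : ∀ b : B, A.A (w b) →ₗ[ℝ] TangentSpace N.I (L.unit b)) (b : B) : Prop where
  injective : Injective (θ b)
  range : ∀ v : TangentSpace N.I (L.unit b),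
    v ∈ range (θ b) ↔ mfderiv N.I B.I L.src (L.unit b) v = 0
  smooth : ∀ a : A.Sec, ContMDiffAt B.I N.I.tangent ∞
    (fun b => (⟨L.unit b, θ b (a (w b))⟩ : TangentBundle N.I N)) b
  anchor : ∀ v, mfderiv N.I M.I (L.tgt ≫ w) (L.unit b) (θ b v) = A.anchor (w b) v

lemma Realizes.realizesAt (R : A.Realizes w L) (b : B) : RealizesAt A w L R.θ b :=
  ⟨R.injective b, R.range b, fun a => R.smooth a b, R.anchor b⟩

lemma RealizesAt.isSec (h : ∀ b, RealizesAt A w L θ b) (a : A.Sec) :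
    L.IsSec fun b => θ b (a (w b)) :=
  ⟨fun b => (h b).smooth a, fun b => ((h b).range _).1 ⟨_, rfl⟩⟩

/-- An identification of Lie algebroids from its conditions at points. -/
def Realizes.of (h : ∀ b, RealizesAt A w L θ b) (hb : ∀ (a a' : A.Sec) (b : B),
    θ b (A.bracket a a' (w b)) =
      L.br (fun b => θ b (a (w b))) (fun b => θ b (a' (w b))) b) : A.Realizes w L :=
  ⟨θ, fun b => (h b).injective, fun b => (h b).range, fun a b => (h b).smooth a,
    fun b => (h b).anchor, hb⟩

variable (H : LocalLieGroupoid.IsGermHom L L' w φ)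
  (hθ : ∀ b v, θ' (w b) v = mfderiv N.I N'.I φ (L.unit b) (θ b v))
include H hθ

lemma realizesAt_iff (b : B) : RealizesAt A (𝟙 M) L' θ' (w b) ↔ RealizesAt A w L θ b := by
  have hi := H.mfderiv_bijective b
  have h1 : Injective (θ' (w b)) ↔ Injective (θ b) := by
    rw [show (θ' (w b) : A.A (w b) → _) = mfderiv N.I N'.I φ (L.unit b) ∘ θ b from funext (hθ b)]
    exact hi.1.of_comp_iff (θ b)
  have h2 : (∀ v, v ∈ range (θ' (w b)) ↔ mfderiv N'.I M.I L'.src (L'.unit (w b)) v = 0) ↔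
      ∀ v, v ∈ range (θ b) ↔ mfderiv N.I B.I L.src (L.unit b) v = 0 := by
    have hr : ∀ u, mfderiv N.I N'.I φ (L.unit b) u ∈ range (θ' (w b)) ↔ u ∈ range (θ b) :=
      fun u => exists_congr fun v => by
        rw [hθ]
        exact hi.1.eq_iff
    refine ⟨fun h u => ?_, fun h v => ?_⟩
    · rw [← hr, ← H.mfderiv_src_eq_zero_iff b u]
      exact h _
    · obtain ⟨u, rfl⟩ := hi.2 v
      exact (hr u).trans ((h u).trans (H.mfderiv_src_eq_zero_iff b u).symm)
  have h3 := fun a : A.Sec => H.smooth_iff (e := fun b => θ b (a (w b))) (e' := fun x => θ' x (a x))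
    (fun b => hθ b _) b
  have h4 : ∀ v, mfderiv N'.I M.I (L'.tgt ≫ 𝟙 M) (L'.unit (w b)) (θ' (w b) v) =
      mfderiv N.I M.I (L.tgt ≫ w) (L.unit b) (θ b v) := fun v => by
    rw [hθ]
    exact H.mfderiv_tgt (𝟙 M) b (θ b v)
  exact ⟨fun h => ⟨h1.1 h.1, h2.1 h.2, fun a => (h3 a).1 (h.3 a), fun v => (h4 v).symm.trans (h.4 v)⟩,
    fun h => ⟨h1.2 h.1, h2.2 h.2, fun a => (h3 a).2 (h.3 a), fun v => (h4 v).trans (h.4 v)⟩⟩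

lemma bracket_iff (h : ∀ b, RealizesAt A w L θ b) (h' : ∀ x, RealizesAt A (𝟙 M) L' θ' x)
    (a a' : A.Sec) (b : B) :
    θ' (w b) (A.bracket a a' (w b)) = L'.br (fun x => θ' x (a x)) (fun x => θ' x (a' x)) (w b) ↔
      θ b (A.bracket a a' (w b)) = L.br (fun b => θ b (a (w b))) (fun b => θ b (a' (w b))) b := by
  have hb := H.br_eq (RealizesAt.isSec h a) (RealizesAt.isSec h a') (RealizesAt.isSec h' a)
    (RealizesAt.isSec h' a') (fun b => hθ b _) (fun b => hθ b _) b
  refine Iff.trans ?_ (H.mfderiv_bijective b).1.eq_iff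
  exact ⟨fun h => (hθ b _).symm.trans (h.trans hb), fun h => (hθ b _).trans (h.trans hb.symm)⟩

end LieAlgebroid

variable {M B N N' X : Mfd} {Γ : WeinsteinGroupoid.{v, u} M} {w : B ⟶ M} {L : LocalLieGroupoid B N}
  {j : rep N ⥤ᵇ Γ.stk} {c : Presents Γ w L j} {L' : LocalLieGroupoid M N'}
  {j' : rep N' ⥤ᵇ Γ.stk} {c' : Presents Γ (𝟙 M) L' j'}

lemma Germ.isGermHom (G : Germ c c') (hj : IsEtChart j) (hj' : IsEtChart j') (hw : IsEt w)
    (hi : Injective w) : LocalLieGroupoid.IsGermHom L L' w G.φ where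
  et := hw
  diffeo b := Filter.mem_of_superset (G.O.2.mem_nhds (G.mem b)) fun _ h => G.isLocalDiffeomorphAt hj hj' h
  unit := G.φ_unit
  base b := Filter.mem_of_superset (G.O.2.mem_nhds (G.mem b)) fun _ h => G.src_φ h
  mul := G.eventually_mul hj' hi

lemma GluingSystem.exists_germ [T2Space M] [SecondCountableTopology M] {q : rep X ⥤ᵇ Γ.stk}
    (D : GluingSystem Γ q) (hq : IsEtaleAtlas q) (hj' : IsEtChart j') :
    ∃ G : ∀ l, Germ (D.chart l) c', ∀ l,
      LocalLieGroupoid.IsGermHom (D.grpd l) L' (M.incl (D.W l)) (G l).φ := by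
  have hG : ∀ l, Nonempty (Germ (D.chart l) c') := fun l => by
    have : T2Space (M.opn (D.W l)) := inferInstanceAs (T2Space (D.W l))
    have : SecondCountableTopology (M.opn (D.W l)) :=
      inferInstanceAs (SecondCountableTopology (D.W l))
    have := Mfd.paracompactSpace (M.opn (D.W l))
    exact Germ.exists_germ hj'
  exact ⟨fun l => (hG l).some, fun l => (hG l).some.isGermHom
    (IsEtChart.restrict Γ.fibred (hq.etale.isEtChart Γ.fibred hq) (D.U l)) hj' (isEt_incl _) (incl_injective _)⟩

lemma GluingSystem.mfderiv_trans {q : rep X ⥤ᵇ Γ.stk} (D : GluingSystem Γ q)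
    (hj' : IsEtChart j') (G : ∀ l, Germ (D.chart l) c')
    (hG : ∀ l, LocalLieGroupoid.IsGermHom (D.grpd l) L' (M.incl (D.W l)) (G l).φ) (k l : D.ι) {x : M}
    (hk : x ∈ D.W k) (hl : x ∈ D.W l)
    (u : TangentSpace (X.opn (D.U k)).I ((D.grpd k).unit ⟨x, hk⟩)) :
    mfderiv (X.opn (D.U l)).I N'.I (G l).φ ((D.grpd l).unit ⟨x, hl⟩)
        (mfderiv (X.opn (D.U k)).I (X.opn (D.U l)).I (D.trans k l).map ((D.grpd k).unit ⟨x, hk⟩) u) =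
      mfderiv (X.opn (D.U k)).I N'.I (G k).φ ((D.grpd k).unit ⟨x, hk⟩) u := by
  have hT := (D.trans k l).unit ⟨x, hk⟩ ⟨x, hl⟩ rfl
  have hs : (D.grpd k).unit ⟨x, hk⟩ ∈ (D.trans k l).map.source :=
    (D.trans k l).unit_mem ⟨x, hk⟩ ⟨x, hl⟩ rfl
  have h := (G k).eventually_localIso (G l) hj' (D.trans k l) (b := ⟨x, hk⟩) (b₂ := ⟨x, hl⟩) rfl
  have hd := ((hG l).diffeo ⟨x, hl⟩).self_of_nhds.mdifferentiableAt (by simp)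
  have h' := mfderiv_comp ((D.grpd k).unit ⟨x, hk⟩) (hT ▸ hd) (((D.trans k l).smooth.contMDiffAt
      ((D.trans k l).map.open_source.mem_nhds hs)).mdifferentiableAt (by simp))
  have h2 : (G l).φ ∘ (D.trans k l).map =ᶠ[𝓝 ((D.grpd k).unit ⟨x, hk⟩)] (G k).φ := h
  rw [h2.mfderiv_eq] at h'
  exact (mfderiv_apply_congr_point (G l).φ hT.symm _).trans (congrArg (fun T => T u) h').symm

lemma LocalLieGroupoid.hasLieAlgebroid_iff [T2Space M] [SecondCountableTopology M]
    (c' : Presents Γ (𝟙 M) L' j') (hj' : IsEtale j') (A : LieAlgebroid M) :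
    L'.HasLieAlgebroid A ↔ Γ.HasLieAlgebroid A := by
  obtain ⟨X₀, q₀, hq₀⟩ := Γ.etale.atlas
  have hj' := hj'.isEtChart Γ.fibred hq₀
  refine ⟨fun ⟨R⟩ => ?_, fun ⟨X, q, hq, D, R, hR⟩ => ?_⟩
  · obtain ⟨D, -⟩ := WeinsteinGroupoid.exists_gluing hq₀
    obtain ⟨G, hG⟩ := D.exists_germ (c' := c') hq₀ hj'
    let θ : ∀ l (b : M.opn (D.W l)), A.A (M.incl (D.W l) b) →ₗ[ℝ]
        TangentSpace (X₀.opn (D.U l)).I ((D.grpd l).unit b) := fun l b =>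
      (((hG l).diffeo b).self_of_nhds.mfderivToContinuousLinearEquiv
        (by simp)).symm.toLinearEquiv.toLinearMap ∘ₗ (R.θ (M.incl (D.W l) b))
    have hθ : ∀ l b v, R.θ (M.incl (D.W l) b) v =
        mfderiv (X₀.opn (D.U l)).I N'.I (G l).φ ((D.grpd l).unit b) (θ l b v) := fun l b v =>
      ((((hG l).diffeo b).self_of_nhds.mfderivToContinuousLinearEquiv (by simp)).apply_symm_apply
        _).symm
    have hr := fun l b => (LieAlgebroid.realizesAt_iff (hG l) (hθ l) b).1 (R.realizesAt _)
    refine ⟨X₀, q₀, hq₀, D, fun l => .of (θ := θ l) (hr l) fun a a' b =>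
      (LieAlgebroid.bracket_iff (hG l) (hθ l) (hr l) R.realizesAt a a' b).1 (R.bracket a a' _),
      fun k l x hk hl v => ((hG l).mfderiv_bijective _).1 ?_⟩
    exact (D.mfderiv_trans hj' G hG k l hk hl _).trans ((hθ k ⟨x, hk⟩ v).symm.trans (hθ l ⟨x, hl⟩ v))
  · obtain ⟨G, hG⟩ := D.exists_germ (c' := c') hq hj'
    choose l hl using D.cover
    let θ' : ∀ x : M, A.A x →ₗ[ℝ] TangentSpace N'.I (L'.unit x) := fun x =>
      (mfderiv (X.opn (D.U (l x))).I N'.I (G (l x)).φ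
        ((D.grpd (l x)).unit ⟨x, hl x⟩)).toLinearMap ∘ₗ (R (l x)).θ ⟨x, hl x⟩
    have hθ : ∀ k b v, θ' (M.incl (D.W k) b) v =
        mfderiv (X.opn (D.U k)).I N'.I (G k).φ ((D.grpd k).unit b) ((R k).θ b v) := by
      rintro k ⟨x, hk⟩ v
      refine .trans ?_ (D.mfderiv_trans hj' G hG k (l x) hk (hl x) ((R k).θ ⟨x, hk⟩ v))
      rw [hR k (l x) x hk (hl x) v]
      rfl
    have hr : ∀ x, LieAlgebroid.RealizesAt A (𝟙 M) L' θ' x := fun x =>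
      (LieAlgebroid.realizesAt_iff (hG (l x)) (hθ (l x)) ⟨x, hl x⟩).2 ((R (l x)).realizesAt _)
    exact ⟨.of hr fun a a' x => (LieAlgebroid.bracket_iff (hG (l x)) (hθ (l x))
      (R (l x)).realizesAt hr a a' ⟨x, hl x⟩).2 ((R (l x)).bracket a a' _)⟩

end

namespace LocalLieGroupoid

variable {B N : Mfd} {L : LocalLieGroupoid B N} {e e' e'' : ∀ b, TangentSpace N.I (L.unit b)}

lemma br_swap (e e' : ∀ b, TangentSpace N.I (L.unit b)) (b : B) : L.br e e' b = -L.br e' e b :=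
  VectorField.mlieBracket_swap_apply

lemma IsSec.mdifferentiableAt (he : L.IsSec e) (b : B) : MDifferentiableAt N.I N.I.tangent
    (fun g => (⟨g, L.ri e g⟩ : TangentBundle N.I N)) (L.unit b) :=
  (contMDiffAt_ri he (L.unit_mem b)).mdifferentiableAt (by simp)

lemma br_add (e : ∀ b, TangentSpace N.I (L.unit b)) (he' : L.IsSec e') (he'' : L.IsSec e'')
    (b : B) : L.br e (fun b => e' b + e'' b) b = L.br e e' b + L.br e e'' b := by
  have : IsManifold N.I 2 N := .of_le (n := ∞) ENat.LEInfty.out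
  have h : L.ri (fun b => e' b + e'' b) = L.ri e' + L.ri e'' := funext fun g => map_add _ _ _
  unfold br
  rw [h]
  exact VectorField.mlieBracket_add_right (he'.mdifferentiableAt b) (he''.mdifferentiableAt b)

lemma br_jacobi (he : L.IsSec e) (he' : L.IsSec e') (he'' : L.IsSec e'') (b : B) :
    L.br e (L.br e' e'') b = L.br (L.br e e') e'' b + L.br e' (L.br e e'') b := by
  have : IsManifold N.I 3 N := .of_le (n := ∞) ENat.LEInfty.out
  have : IsManifold N.I (minSmoothness ℝ 3) N :=
    .of_le (n := ∞) (minSmoothness_of_isRCLikeNormedField.trans_le ENat.LEInfty.out)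
  have h : ∀ {e e'}, L.IsSec e → L.IsSec e' →
      L.ri (L.br e e') =ᶠ[𝓝 (L.unit b)] VectorField.mlieBracket N.I (L.ri e) (L.ri e') :=
    fun he he' => Filter.mem_of_superset (L.dom.2.mem_nhds (L.unit_mem b))
      fun g hg => ri_br he he' hg
  have hs : ∀ {e}, L.IsSec e → ContMDiffAt N.I N.I.tangent (minSmoothness ℝ 2)
      (fun g => (⟨g, L.ri e g⟩ : TangentBundle N.I N)) (L.unit b) := fun he =>
    (contMDiffAt_ri he (L.unit_mem b)).of_le
      (minSmoothness_of_isRCLikeNormedField.trans_le ENat.LEInfty.out)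
  exact (Filter.EventuallyEq.mlieBracket_vectorField_eq .rfl (h he' he'')).trans
    ((VectorField.leibniz_identity_mlieBracket_apply (hs he) (hs he') (hs he'')).trans
    (congrArg₂ _ (Filter.EventuallyEq.mlieBracket_vectorField_eq (h he he') .rfl).symm
      (Filter.EventuallyEq.mlieBracket_vectorField_eq .rfl (h he he'')).symm))

lemma br_smul (f : C^∞⟮B.I, B; 𝓘(ℝ, ℝ), ℝ⟯) (he : L.IsSec e) (he' : L.IsSec e') (b : B) :
    L.br e (fun b => f b • e' b) b = f b • L.br e e' b +
      Mfd.dirDeriv f b (mfderiv N.I B.I L.tgt (L.unit b) (e b)) • e' b := by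
  have : IsManifold N.I 2 N := .of_le (n := ∞) ENat.LEInfty.out
  have h : L.ri (fun b => f b • e' b) = (f ∘ L.tgt) • L.ri e' := funext fun g => map_smul _ _ _
  have hf : MDifferentiableAt B.I 𝓘(ℝ, ℝ) f (L.tgt (L.unit b)) :=
    f.contMDiff.mdifferentiableAt (by simp)
  have ht := mdifferentiableAt L.tgt (L.unit b)
  have h' := VectorField.mlieBracket_smul_right (V := L.ri e) (hf.comp _ ht)
    (he'.mdifferentiableAt b)
  rw [← h] at h'
  refine h'.trans ((add_comm _ _).trans (congrArg₂ _ ?_ ?_))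
  · rw [Function.comp_apply, L.tgt_unit]
    rfl
  · rw [ri_unit he', ri_unit he]
    refine congrArg (· • e' b) ?_
    refine (congrArg (fun T => T (e b)) (mfderiv_comp (L.unit b) hf ht)).trans ?_
    exact mfderiv_apply_congr_point f (L.tgt_unit b) _

namespace FibreChart

variable {b₀ : B} (C : L.FibreChart b₀)

/-- The derivative of the charts of the source fibres at the identities. -/
def P (b : B) : 𝔼 N.dim →L[ℝ] L.Fib := mfderiv N.I 𝓘(ℝ, L.Fib) C.h (L.unit b)

/-- The derivative of the inverses of the charts of the source fibres at the identities. -/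
def Q (b : B) : L.Fib →L[ℝ] 𝔼 N.dim := mfderiv 𝓘(ℝ, L.Fib) N.I (C.σ b) 0

variable {C} {b : B} (hb : b ∈ C.O)
include hb

lemma P_Q (y : L.Fib) : C.P b (C.Q b y) = y :=
  (mfderiv_apply_congr_point C.h (C.σ_zero b hb).symm _).trans (C.mfderiv_h_σ (p := (b, 0)) hb y)

lemma src_Q (y : L.Fib) : mfderiv N.I B.I L.src (L.unit b) (C.Q b y) = 0 :=
  (mfderiv_apply_congr_point L.src (C.σ_zero b hb).symm _).trans
    (C.mfderiv_src_σ (p := (b, 0)) hb y)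

lemma Q_P {u : TangentSpace N.I (L.unit b)} (hu : mfderiv N.I B.I L.src (L.unit b) u = 0) :
    C.Q b (C.P b u) = u :=
  C.mfderiv_σ_unit hb hu

lemma h_smooth_unit : ContMDiffAt N.I 𝓘(ℝ, L.Fib) ∞ C.h (L.unit b) :=
  C.σ_zero _ hb ▸ C.h_smooth (b, 0) hb

lemma contMDiffAt_P {e : ∀ b, TangentSpace N.I (L.unit b)} (he : ContMDiffAt B.I N.I.tangent ∞
      (fun b => (⟨L.unit b, e b⟩ : TangentBundle N.I N)) b) :
    ContMDiffAt B.I 𝓘(ℝ, L.Fib) ∞ (fun b => C.P b (e b)) b :=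
  (contMDiffAt_tangentBundle_mk_iff ((h_smooth_unit hb).comp b (Mfd.smooth L.unit).contMDiffAt)).1
    (ContMDiffAt.mfderiv_section (S := B) (f := fun _ => C.h)
      ((h_smooth_unit hb).comp (b, _) contMDiffAt_snd) he)

lemma contMDiffAt_P_Q {b₁ : B} {C' : L.FibreChart b₁} (hb' : b ∈ C'.O) :
    ContMDiffAt B.I 𝓘(ℝ, L.Fib →L[ℝ] L.Fib) ∞ (fun b => C'.P b ∘L C.Q b) b := by
  have hh : ContMDiffAt N.I 𝓘(ℝ, L.Fib) ∞ C'.h (C.σ b 0) := (C.σ_zero b hb).symm ▸ h_smooth_unit hb'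
  have h := ContMDiffAt.mfderiv (m := ∞) (n := ∞) (x₀ := b) (fun b v => C'.h (C.σ b v)) (fun _ => 0)
    (hh.comp (b, 0) (C.smooth (b, 0) hb)) contMDiffAt_const (by simp)
  have hm := inTangentCoordinates_model_space (I := 𝓘(ℝ, L.Fib)) (I' := 𝓘(ℝ, L.Fib))
    (fun _ : B => 0) (fun b => C'.h (C.σ b 0))
    (fun b => mfderiv 𝓘(ℝ, L.Fib) 𝓘(ℝ, L.Fib) (fun v => C'.h (C.σ b v)) 0) b
  have h := Eq.mp (congrArg (ContMDiffAt B.I 𝓘(ℝ, L.Fib →L[ℝ] L.Fib) ∞ · b) hm) h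
  refine h.congr_of_eventuallyEq ?_
  filter_upwards [C.O.2.mem_nhds hb, C'.O.2.mem_nhds hb'] with b hb hb'
  have hh : ContMDiffAt N.I 𝓘(ℝ, L.Fib) ∞ C'.h (C.σ b 0) := (C.σ_zero b hb).symm ▸ h_smooth_unit hb'
  refine .trans ?_ (mfderiv_comp (0 : L.Fib) (hh.mdifferentiableAt (by simp))
    ((C.σ_smooth (p := (b, 0)) hb).mdifferentiableAt (by simp))).symm
  exact ContinuousLinearMap.ext fun y => mfderiv_apply_congr_point C'.h (C.σ_zero b hb).symm _

end FibreChart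
end LocalLieGroupoid

namespace LocalLieGroupoid

open FibreChart

variable {M N : Mfd} (L : LocalLieGroupoid M N)

/-- A chart of the source fibres near each point. -/
def fibreChartAt (x : M) : L.FibreChart x := (L.exists_fibreChart x).some

/-- The bundle of vectors at the identities tangent to the source fibres. -/
def core : VectorBundleCore ℝ M L.Fib M where
  baseSet i := (L.fibreChartAt i).O
  isOpen_baseSet i := (L.fibreChartAt i).O.2
  indexAt x := x
  mem_baseSet_at x := (L.fibreChartAt x).mem
  coordChange i j x := (L.fibreChartAt j).P x ∘L (L.fibreChartAt i).Q x
  coordChange_self _ _ hx v := P_Q hx v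
  continuousOn_coordChange _ _ _ hx := (contMDiffAt_P_Q hx.1 hx.2).continuousAt.continuousWithinAt
  coordChange_comp _ _ _ _ hx v := congrArg _ (Q_P hx.1.2 (src_Q hx.1.1 v))

instance : L.core.IsContMDiff M.I ∞ :=
  ⟨fun _ _ _ hx => (contMDiffAt_P_Q hx.1 hx.2).contMDiffWithinAt⟩

/-- The inclusion of the Lie algebroid into the tangent bundle. -/
def θ (x : M) : L.core.Fiber x →ₗ[ℝ] TangentSpace N.I (L.unit x) :=
  ((L.fibreChartAt x).Q x).toLinearMap

lemma θ_injective (x : M) : Injective (L.θ x) :=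
  Function.LeftInverse.injective (P_Q (L.fibreChartAt x).mem)

lemma src_θ (x : M) (v : L.core.Fiber x) : mfderiv N.I M.I L.src (L.unit x) (L.θ x v) = 0 :=
  src_Q (L.fibreChartAt x).mem v

lemma contMDiff_θ : ContMDiff (M.I.prod 𝓘(ℝ, L.Fib)) N.I.tangent ∞
    (fun a : Bundle.TotalSpace L.Fib L.core.Fiber =>
      (⟨L.unit a.proj, L.θ a.proj a.2⟩ : TangentBundle N.I N)) := fun a => by
  let C := L.fibreChartAt a.proj
  have hy := (Bundle.contMDiffAt_totalSpace.1 (contMDiffAt_id (I := M.I.prod 𝓘(ℝ, L.Fib)) (n := ∞)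
    (x := a))).2
  have h := ContMDiffAt.mfderiv_section (x₀ := a) (f := fun a v => C.σ a.proj v) (g := fun _ => 0)
    (ContMDiffAt.comp (a, 0) (f := fun p : Bundle.TotalSpace L.Fib L.core.Fiber × L.Fib =>
        (p.1.proj, p.2)) (C.smooth (a.proj, 0) C.mem)
      (((Bundle.contMDiffAt_proj L.core.Fiber).comp (a, 0) contMDiffAt_fst).prodMk contMDiffAt_snd))
    ((contMDiffAt_tangentBundle_mk_iff contMDiffAt_const).2 hy)
  refine h.congr_of_eventuallyEq ?_
  filter_upwards [(Bundle.contMDiffAt_proj L.core.Fiber (IB := M.I) (n := ∞) (p :=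
    a)).continuousAt.preimage_mem_nhds (C.O.2.mem_nhds C.mem)] with a' ha'
  exact tangentBundle_mk_eq (C.σ_zero _ ha').symm _ _ (Q_P ha' (L.src_θ a'.proj a'.2)).symm

variable {L}

lemma isSec_θ (a : Cₛ^∞⟮M.I; L.Fib, L.core.Fiber⟯) : L.IsSec fun x => L.θ x (a x) :=
  ⟨L.contMDiff_θ.comp a.contMDiff, fun x => L.src_θ x _⟩

lemma exists_θ_eq {e : ∀ b, TangentSpace N.I (L.unit b)} (he : L.IsSec e) :
    ∃ a : Cₛ^∞⟮M.I; L.Fib, L.core.Fiber⟯, ∀ x, L.θ x (a x) = e x := by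
  refine ⟨⟨fun x => (L.fibreChartAt x).P x (e x), fun x => ?_⟩, fun x =>
    Q_P (L.fibreChartAt x).mem (he.ker x)⟩
  refine (Bundle.contMDiffAt_section x).2
    ((contMDiffAt_P (L.fibreChartAt x).mem (he.smooth x)).congr_of_eventuallyEq ?_)
  filter_upwards [(L.fibreChartAt x).O.2.mem_nhds (L.fibreChartAt x).mem] with x' hx'
  exact congrArg _ (Q_P (L.fibreChartAt x').mem (he.ker x'))

lemma sec_ext {a a' : Cₛ^∞⟮M.I; L.Fib, L.core.Fiber⟯} (h : ∀ x, L.θ x (a x) = L.θ x (a' x)) :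
    a = a' := ContMDiffSection.ext fun x => L.θ_injective x (h x)

lemma exists_lieAlgebroid (L : LocalLieGroupoid M N) : ∃ A : LieAlgebroid M, L.HasLieAlgebroid A := by
  choose β hβ using fun a a' : Cₛ^∞⟮M.I; L.Fib, L.core.Fiber⟯ =>
    exists_θ_eq (isSec_br (isSec_θ a) (isSec_θ a'))
  have hθβ : ∀ a a', (fun x => L.θ x (β a a' x)) =
    L.br (fun x => L.θ x (a x)) (fun x => L.θ x (a' x)) := fun a a' => funext (hβ a a')
  have hadd : ∀ a b : Cₛ^∞⟮M.I; L.Fib, L.core.Fiber⟯, (fun x => L.θ x ((a + b) x)) =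
    fun x => L.θ x (a x) + L.θ x (b x) := fun a b => funext fun x => map_add (L.θ x) (a x) (b x)
  have add_br : ∀ a b c, β a (b + c) = β a b + β a c := fun a b c => sec_ext fun x => by
    rw [hβ, hadd, br_add _ (isSec_θ b) (isSec_θ c), ← hβ, ← hβ]
    exact (map_add (L.θ x) _ _).symm
  have swap : ∀ a b, β a b = -β b a := fun a b => sec_ext fun x => by
    rw [hβ, br_swap, ← hβ]
    exact (map_neg (L.θ x) _).symm
  let A : LieAlgebroid M := {
      rank := N.dim - M.dim, A := L.core.Fiber
      anchor := fun x => (mfderiv N.I M.I L.tgt (L.unit x)).toLinearMap ∘ₗ L.θ x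
      anchor_smooth := by
        refine (((smooth L.tgt).contMDiff_tangentMap (m := ∞) (by simp)).comp
          L.contMDiff_θ).congr fun a => ?_
        exact tangentBundle_mk_eq (L.tgt_unit a.proj).symm _ _ rfl
      bracket := β
      bracket_add := add_br
      add_bracket := fun a b c => by rw [swap, add_br, neg_add, ← swap, ← swap]
      bracket_self := fun a => sec_ext fun x => by
        rw [hβ, br, VectorField.mlieBracket_self]
        exact (map_zero (L.θ x)).symm
      jacobi := fun a b c => sec_ext fun x => by
        rw [hβ, hθβ, br_jacobi (isSec_θ a) (isSec_θ b) (isSec_θ c), ← hθβ a b, ← hθβ a c, ← hβ, ← hβ]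
        exact (map_add (L.θ x) _ _).symm
      leibniz := fun f a b fb hfb x => L.θ_injective x <| by
        have : (fun x => L.θ x (fb x)) = fun x => f x • L.θ x (b x) := funext fun x => by
          rw [hfb, map_smul]
        rw [hβ, this, br_smul f (isSec_θ a) (isSec_θ b), ← hβ, map_add, map_smul, map_smul]
        rfl }
  exact ⟨A, ⟨⟨L.θ, L.θ_injective, fun x v => ⟨fun ⟨a, ha⟩ => ha ▸ L.src_θ x a, fun hv =>
    ⟨_, Q_P (L.fibreChartAt x).mem hv⟩⟩, fun a => (isSec_θ a).smooth, fun x v => rfl,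
    fun a a' x => hβ a a' x⟩⟩⟩

end LocalLieGroupoid

namespace LieAlgebroid

open LocalLieGroupoid.FibreChart

variable {M N : Mfd} {A A' : LieAlgebroid M} {L : LocalLieGroupoid M N}

lemma exists_sec [T2Space M] (x₀ : M) (y : 𝔼 A.rank) : ∃ a : A.Sec, ∀ᶠ x in 𝓝 x₀,
      a x = (trivializationAt (𝔼 A.rank) A.A x₀).symm x y := by
  set t := trivializationAt (𝔼 A.rank) A.A x₀
  obtain ⟨f, hf, -⟩ := (SmoothBumpFunction.nhds_basis_support (I := M.I)
    (t.open_baseSet.mem_nhds (FiberBundle.mem_baseSet_trivializationAt' x₀))).mem_iff.1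
    Filter.univ_mem
  have hs : ContMDiffOn M.I (M.I.prod 𝓘(ℝ, 𝔼 A.rank)) ∞
      (fun x => Bundle.TotalSpace.mk' (𝔼 A.rank) x (t.symm x y)) t.baseSet :=
    (t.contMDiffOn_section_baseSet_iff (IB := M.I)).2
      ((contMDiffOn_const (c := y)).congr fun x hx => by rw [t.apply_mk_symm hx])
  refine ⟨⟨fun x => f x • t.symm x y, ContMDiffOn.smul_section_of_tsupport
    f.contMDiff.contMDiffOn t.open_baseSet hf hs⟩, ?_⟩
  filter_upwards [f.eventuallyEq_one] with x hx
  change f x • t.symm x y = t.symm x y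
  rw [hx, Pi.one_apply, one_smul]

lemma Realizes.contMDiff [T2Space M] (R : A.Realizes (𝟙 M) L) {σ : ∀ x, A.A x}
    (hσ : ContMDiff M.I N.I.tangent ∞ fun x => (⟨L.unit x, R.θ x (σ x)⟩ : TangentBundle N.I N)) :
    ContMDiff M.I (M.I.prod 𝓘(ℝ, 𝔼 A.rank)) ∞
      fun x => Bundle.TotalSpace.mk' (𝔼 A.rank) x (σ x) := fun x₀ => by
  refine (Bundle.contMDiffAt_section x₀).2 ?_
  set t := trivializationAt (𝔼 A.rank) A.A x₀
  obtain ⟨C⟩ := L.exists_fibreChart x₀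
  let T : M → 𝔼 A.rank →L[ℝ] L.Fib := fun x => LinearMap.toContinuousLinearMap
    ((C.P x).toLinearMap ∘ₗ (R.θ x ∘ₗ t.symmₗ ℝ x))
  have hx₀ : x₀ ∈ t.baseSet := FiberBundle.mem_baseSet_trivializationAt' x₀
  have hT : ∀ x ∈ t.baseSet, ∀ y, T x y = C.P x (R.θ x (t.symm x y)) := fun x hx y => by
    change C.P x (R.θ x (t.symmₗ ℝ x y)) = _
    rw [t.coe_symmₗ hx]
  have hker : ∀ x v, mfderiv N.I M.I L.src (L.unit x) (R.θ x v) = 0 := fun x v =>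
    (R.range x _).1 ⟨v, rfl⟩
  have hinv : ∀ x ∈ t.baseSet, x ∈ C.O → (T x).IsInvertible := fun x hx hC => by
    have hb : Function.Bijective (T x) := by
      refine ⟨fun y y' h => ?_, fun y => ?_⟩
      · rw [hT x hx, hT x hx] at h
        have h' := R.injective x ((Q_P hC (hker x _)).symm.trans
          ((congrArg (C.Q x) h).trans (Q_P hC (hker x _))))
        have h2 := congrArg (fun v => (t ⟨x, v⟩).2) h'
        rwa [t.apply_mk_symm hx, t.apply_mk_symm hx] at h2
      · obtain ⟨v, hv⟩ := (R.range x _).2 (src_Q hC y)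
        refine ⟨(t ⟨x, v⟩).2, ?_⟩
        rw [hT x hx, t.symm_apply_apply_mk hx v, hv, P_Q hC]
    exact ⟨(LinearEquiv.ofBijective (T x).toLinearMap hb).toContinuousLinearEquiv, rfl⟩
  have hTs : ContMDiffAt M.I 𝓘(ℝ, 𝔼 A.rank →L[ℝ] L.Fib) ∞ T x₀ := by
    have h1 : ∀ y, ContMDiffAt M.I 𝓘(ℝ, L.Fib) ∞ (fun x => T x y) x₀ := fun y => by
      obtain ⟨a, ha⟩ := A.exists_sec x₀ y
      refine (contMDiffAt_P C.mem (R.smooth a x₀)).congr_of_eventuallyEq ?_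
      filter_upwards [ha, t.open_baseSet.mem_nhds hx₀] with x hx hx'
      rw [hT x hx', ← hx]
      rfl
    have h2 : ∀ x, T x = ∑ i, (EuclideanSpace.proj i : 𝔼 A.rank →L[ℝ] ℝ).smulRight
        (T x (EuclideanSpace.single i 1)) := fun x => by
      refine ContinuousLinearMap.coe_injective
        ((EuclideanSpace.basisFun (Fin A.rank) ℝ).toBasis.ext fun i => ?_)
      simp [Finset.sum_apply]
    refine ContMDiffAt.congr_of_eventuallyEq ?_ (Eventually.of_forall h2)
    refine contMDiffAt_finsetSum fun i _ => ?_
    exact (ContinuousLinearMap.smulRightL ℝ (𝔼 A.rank) L.Fib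
      (EuclideanSpace.proj i)).contMDiff.contMDiffAt.comp x₀ (h1 _)
  obtain ⟨T₀, hT₀⟩ := hinv x₀ hx₀ C.mem
  have hi : ContMDiffAt M.I 𝓘(ℝ, L.Fib →L[ℝ] 𝔼 A.rank) ∞ (fun x => (T x).inverse) x₀ :=
    ContMDiffAt.comp x₀ (hT₀ ▸ (contDiffAt_map_inverse T₀).contMDiffAt) hTs
  refine (hi.clm_apply (contMDiffAt_P C.mem (hσ x₀))).congr_of_eventuallyEq ?_
  filter_upwards [t.open_baseSet.mem_nhds hx₀, C.O.2.mem_nhds C.mem] with x hx hC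
  refine .symm ((hinv x hx hC).inverse_apply_eq.2 ?_)
  rw [hT x hx, t.symm_apply_apply_mk hx]

lemma Realizes.nonempty_iso [T2Space M] (R : A.Realizes (𝟙 M) L) (R' : A'.Realizes (𝟙 M) L) :
    Nonempty (A.Iso A') := by
  have hr : ∀ x, LinearMap.range (R.θ x) = LinearMap.range (R'.θ x) := fun x =>
    Submodule.ext fun v => (R.range x v).trans (R'.range x v).symm
  let f : ∀ x, A.A x ≃ₗ[ℝ] A'.A x := fun x => (LinearEquiv.ofInjective (R.θ x) (R.injective x)).trans
    ((LinearEquiv.ofEq _ _ (hr x)).trans (LinearEquiv.ofInjective (R'.θ x) (R'.injective x)).symm)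
  have hf : ∀ x v, R'.θ x (f x v) = R.θ x v := fun x v =>
    congrArg Subtype.val ((LinearEquiv.ofInjective (R'.θ x) (R'.injective x)).apply_symm_apply
      (LinearEquiv.ofEq _ _ (hr x) (LinearEquiv.ofInjective (R.θ x) (R.injective x) v)))
  have hf' : ∀ x v, R.θ x ((f x).symm v) = R'.θ x v := fun x v => by
    rw [← hf, LinearEquiv.apply_symm_apply]
  have hs : ∀ a : A.Sec, ContMDiff M.I N.I.tangent ∞ fun x =>
      (⟨L.unit x, R'.θ x (f x (a x))⟩ : TangentBundle N.I N) := fun a => by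
    simp only [hf]
    exact R.smooth a
  have hs' : ∀ a : A'.Sec, ContMDiff M.I N.I.tangent ∞ fun x =>
      (⟨L.unit x, R.θ x ((f x).symm (a x))⟩ : TangentBundle N.I N) := fun a => by
    simp only [hf']
    exact R'.smooth a
  let S : A.Sec ≃ A'.Sec := ⟨fun a => ⟨fun x => f x (a x), R'.contMDiff (hs a)⟩,
      fun a => ⟨fun x => (f x).symm (a x), R.contMDiff (hs' a)⟩,
      fun a => ContMDiffSection.ext fun x => (f x).symm_apply_apply (a x),
      fun a => ContMDiffSection.ext fun x => (f x).apply_symm_apply (a x)⟩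
  have hS : ∀ a, (fun x => R'.θ x (S a x)) = fun x => R.θ x (a x) := fun a => funext fun x => hf x _
  refine ⟨⟨f, S, fun a x => rfl, fun x v => ?_, fun a b => ContMDiffSection.ext fun x =>
    R'.injective x ?_⟩⟩
  · refine (R'.anchor x (f x v)).symm.trans (.trans ?_ (R.anchor x v))
    exact congrArg _ (hf x v)
  · refine .trans (hf x _) ((R.bracket a b x).trans (.trans ?_ (R'.bracket (S a) (S b) x).symm))
    change L.br (fun x => R.θ x (a x)) (fun x => R.θ x (b x)) x =
      L.br (fun x => R'.θ x (S a x)) (fun x => R'.θ x (S b x)) x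
    rw [hS, hS]

end LieAlgebroid

end

theorem mainTheorem4 (M : Mfd) [T2Space M] [SecondCountableTopology M]
    (𝒢 : WeinsteinGroupoid.{v, u} M) :
    -- for every étale atlas, there are local Lie groupoids in the atlas, over an open covering of
    -- `M`, which present `𝒢` and glue to a local Lie groupoid over `M` which presents `𝒢`
    (∀ (X : Mfd) (q : rep X ⥤ᵇ 𝒢.stk), IsEtaleAtlas q →
      ∃ (D : GluingSystem 𝒢 q) (N : Mfd) (L : LocalLieGroupoid M N) (j : rep N ⥤ᵇ 𝒢.stk)
        (c : Presents 𝒢 (𝟙 M) L j),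
        T2Space N ∧ SecondCountableTopology N ∧ IsEtale j ∧ Nonempty (IsGluing D c)) ∧
    -- any two local Lie groupoids associated with `𝒢` are isomorphic near the identity section, and
    -- the germ of the isomorphism is unique
    (∀ (N N' : Mfd) (L : LocalLieGroupoid M N) (L' : LocalLieGroupoid M N')
      (j : rep N ⥤ᵇ 𝒢.stk) (j' : rep N' ⥤ᵇ 𝒢.stk) (c : Presents 𝒢 (𝟙 M) L j)
      (c' : Presents 𝒢 (𝟙 M) L' j'), IsEtale j → IsEtale j' →
      Nonempty (LocalIso c c') ∧
        ∀ φ ψ : LocalIso c c', ∃ O : Opens N, (∀ x, L.unit x ∈ O) ∧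
          (O : Set N) ⊆ φ.map.source ∩ ψ.map.source ∧ Set.EqOn φ.map ψ.map O) ∧
    -- `𝒢` has a Lie algebroid, unique up to isomorphism, and it is the one of every local Lie
    -- groupoid associated with `𝒢`
    (∃ A : LieAlgebroid M, 𝒢.HasLieAlgebroid A) ∧
    (∀ A A' : LieAlgebroid M, 𝒢.HasLieAlgebroid A → 𝒢.HasLieAlgebroid A' →
      Nonempty (A.Iso A')) ∧
    (∀ (N : Mfd) (L : LocalLieGroupoid M N) (j : rep N ⥤ᵇ 𝒢.stk), Presents 𝒢 (𝟙 M) L j →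
      IsEtale j → ∀ A : LieAlgebroid M, L.HasLieAlgebroid A ↔ 𝒢.HasLieAlgebroid A) := by
  obtain ⟨X, q, hq⟩ := 𝒢.etale.atlas
  have := Mfd.paracompactSpace M
  obtain ⟨-, N₀, L₀, j₀, c₀, -, -, hj₀, -⟩ := 𝒢.exists_gluing hq
  refine ⟨fun X q hq => 𝒢.exists_gluing hq, fun N N' L L' j j' c c' hj hj' => ?_, ?_,
    fun A A' hA hA' => ?_, fun N L j c hj A => L.hasLieAlgebroid_iff c hj A⟩
  · have hj' := hj'.isEtChart 𝒢.fibred hq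
    exact ⟨Germ.exists_localIso (hj.isEtChart 𝒢.fibred hq) hj', Germ.localIso_unique hj'⟩
  · exact L₀.exists_lieAlgebroid.imp fun A => (L₀.hasLieAlgebroid_iff c₀ hj₀ A).1
  · obtain ⟨R⟩ := (L₀.hasLieAlgebroid_iff c₀ hj₀ A).2 hA
    obtain ⟨R'⟩ := (L₀.hasLieAlgebroid_iff c₀ hj₀ A').2 hA'
    exact R.nonempty_iso R'
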